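/- **Setting.** Let $(R,\mathfrak m,k)$ be a commutative noetherian local ring which is $\mathfrak m$-adically complete, $Q$ a finite quiver, $\mathscr I\lhd RQ$ an ideal generated by paths of length $2$, and $\vartheta\colon RQ\to\Lambda$ a surjective $R$-algebra homomorphism with $\mathscr I\subseteq\ker\vartheta$ and $\vartheta(\gamma)\ne0$ for every path $\gamma\notin\mathscr I$ (we write $\gamma$ for $\vartheta(\gamma)$). Paths compose right to left: $xy$ is first $y$, then $x$. Let $\mathbf A$ be the set of arrows and $\mathbf P$ the set of non-trivial paths $\gamma\notin\mathscr I$; such a $\gamma$ has a head $h(\gamma)$, a tail $t(\gamma)$, a first arrow $\mathrm f(\gamma)$ (rightmost) and a last arrow $\mathrm l(\gamma)$ (leftmost). Assume that $\Lambda$ is a *complete gentle algebra*: (1) every vertex is the head of at most two arrows and the tail of at most two arrows; (2) for each arrow $y$ there is at most one arrow $x$ with $t(x)=h(y)$ and $xy\in\mathbf P$, and at most one arrow $z$ with $h(z)=t(y)$ and $yz\in\mathbf P$; (3) for each arrow $y$ there is at most one arrow $x$ with $t(x)=h(y)$ and $xy\notin\mathbf P$, and at most one arrow $z$ with $h(z)=t(y)$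 and $yz\notin\mathbf P$; (4) for each vertex $v$, $\Lambda e_v$ has the unique maximal submodule $\sum_{t(x)=v}\Lambda x$, and $e_v\Lambda$ has the unique maximal submodule $\sum_{h(x)=v}x\Lambda$; (5) $\Lambda x$ and $x\Lambda$ are finitely generated $R$-modules for every arrow $x$; (6) $\Lambda x\cap\Lambda y=0=x\Lambda\cap y\Lambda$ for distinct arrows $x,y$. **Words.** Letters are $x$ (direct) and $x^{-1}$ (inverse), $x\in\mathbf A$, with $h(x^{-1})=t(x)$ and $t(x^{-1})=h(x)$. Fix signs $s(l)\in\{\pm1\}$ of the letters such that distinct letters $l,l'$ with equal heads and equal signs satisfy $\{l,l'\}=\{x^{-1},y\}$ with $xy\in\mathscr I$. Let $I$ be $\{0,\dots,m\}$, $\mathbb N$, $-\mathbb N$ or $\mathbb Z$. For $I=\{0\}$ the $I$-words are the trivial words $1_{v,\pm1}$. Otherwise an $I$-word is a sequence of letters $C_i$ ($i-1,i\in I$) such that $t(C_i)=h(C_{i+1})$ and $C_i^{-1}\neq C_{i+1}$, and such that every path $\gamma$ for which $\gamma$ or $\gamma^{-1}$ occurs as a run of consecutive letters lies in $\mathbf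 P$. The associated vertices are $v_C(i)=t(C_i)=h(C_{i+1})$. Inverses reverse the sequence and invert the letters, and $(1_{v,\delta})^{-1}=1_{v,-\delta}$; for $I=\mathbb Z$, $(C^{-1})_i=C_{1-i}^{-1}$. The shift is $C[n]_i=C_{i+n}$ for $I=\mathbb Z$, and $C[n]=C$ otherwise. A word with $I\subseteq\mathbb N$ has the head and sign of its first letter; $1_{v,\delta}$ has head $v$ and sign $\delta$. The composition $CD$ is concatenation (of a finite or $-\mathbb N$-word with a finite or $\mathbb N$-word; if both are infinite, $CD=C\mid D$, so that $D$ starts at position $1$); if $C$ or $D$ is trivial, $CD$ is defined when $h(C^{-1})=h(D)$ and $s(C^{-1})=-s(D)$. A word is direct (inverse) if all its letters are. A *peak* of $C$ is an $i\in I$ such that ($C_i$ is direct or $i-1\notin I$) and ($C_{i+1}$ is inverse or $i+1\notin I$). A *string word* is a word $C=B^{-1}(AD)$ with $B$, $D$ trivial or inverse and with $A$ trivial or $A=\gamma_1^{-1}\sigma_1\cdots\gamma_n^{-1}\sigma_n$ ($n\ge1$, $\gamma_i,\sigma_i\in\mathbf P$). Let $\pi(0)<\dots<\pi(d)$ be its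 peaks (so $d=n$, or $d=0$ if $A$ is trivial), $N(C)=\bigoplus_{i=0}^d\Lambda g_{C,i}$ with $g_{C,i}=e_{v_C(\pi(i))}$, and $M(C)=N(C)/(L_-(C)+L_0(C)+L_+(C))$, where $L_0(C)=\sum_{i=0}^{d-1}\Lambda(\gamma_{i+1}g_{C,i}-\sigma_{i+1}g_{C,i+1})$, $L_-(C)=\Lambda bB^{-1}g_{C,0}$ if there is an arrow $b$ such that $Bb^{-1}$ is a word and $L_-(C)=0$ otherwise, and $L_+(C)=\Lambda dD^{-1}g_{C,d}$ if there is an arrow $d$ such that $Dd^{-1}$ is a word and $L_+(C)=0$ otherwise. **Generalised words.** Generalised letters are $\langle\gamma\rangle$ (direct) and $\langle\gamma\rangle^{-1}$ (inverse), $\gamma\in\mathbf P$, with $h(\langle\gamma\rangle)=t(\gamma)=t(\langle\gamma\rangle^{-1})$, $t(\langle\gamma\rangle)=h(\gamma)=h(\langle\gamma\rangle^{-1})$, $s(\langle\gamma\rangle)=s(\mathrm f(\gamma)^{-1})$ and $s(\langle\gamma\rangle^{-1})=-s(\mathrm l(\gamma))$. Generalised $I$-words are the trivial ones $\langle1_{v,\pm1}\rangle$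 for $I=\{0\}$, and otherwise the sequences of generalised letters in which any two consecutive letters have the form $\langle\gamma\rangle\langle\sigma\rangle^{-1}$ with $h(\gamma)=h(\sigma)$, $\mathrm l(\gamma)\ne\mathrm l(\sigma)$; $\langle\gamma\rangle^{-1}\langle\sigma\rangle^{-1}$ with $t(\gamma)=h(\sigma)$, $\mathrm f(\gamma)\mathrm l(\sigma)=0$; $\langle\gamma\rangle^{-1}\langle\sigma\rangle$ with $t(\gamma)=t(\sigma)$, $\mathrm f(\gamma)\neq\mathrm f(\sigma)$; or $\langle\gamma\rangle\langle\sigma\rangle$ with $h(\gamma)=t(\sigma)$, $\mathrm f(\sigma)\mathrm l(\gamma)=0$. Inverses, shifts, compositions and $v_{\mathcal C}(i)=t(\mathcal C_i)=h(\mathcal C_{i+1})$ are as for words. Let $\mathscr H(\langle\gamma\rangle)=-1$, $\mathscr H(\langle\gamma\rangle^{-1})=1$, and $\mathscr H_{\mathcal C}(i)=\sum_{j=1}^i\mathscr H(\mathcal C_j)$ for $i\ge0$, $\mathscr H_{\mathcal C}(i)=-\sum_{j=i+1}^0\mathscr H(\mathcal C_j)$ for $i<0$. The *string complex* $P(\mathcal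 C)$ has $P^n(\mathcal C)=\bigoplus_{\mathscr H_{\mathcal C}(i)=n}\Lambda g_{\mathcal C,i}$ with $g_{\mathcal C,i}=e_{v_{\mathcal C}(i)}$, and differential $g_{\mathcal C,i}\mapsto g^-_{\mathcal C,i}+g^+_{\mathcal C,i}$, where $g^+_{\mathcal C,i}=\mu g_{\mathcal C,i+1}$ if $\mathcal C_{i+1}=\langle\mu\rangle^{-1}$, $g^-_{\mathcal C,i}=\eta g_{\mathcal C,i-1}$ if $\mathcal C_i=\langle\eta\rangle$, and these are $0$ otherwise. A *string-resolution* is a generalised word $\mathcal C=\mathcal B^{-1}(\mathcal A\mathcal D)$ where $\mathcal A$ is trivial or $\mathcal A=\langle\mu_1\rangle\langle\eta_1\rangle^{-1}\cdots\langle\mu_n\rangle\langle\eta_n\rangle^{-1}$ ($n\geq 1$), and each $\mathcal X\in\{\mathcal B,\mathcal D\}$ is either trivial, or is direct with $\mathcal X_i=\langle a_i\rangle$, $a_i\in\mathbf A$, for all $i>1$, and such that $\mathcal X\langle a\rangle$ is not a generalised word for any arrow $a$. Its *interval* $[\iota(-),\iota(+)]$ consists of the positions in $\mathcal C$ at which $\mathcal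 A$ begins and ends: $\mathcal B=(\mathcal C_{\le\iota(-)})^{-1}$, $\mathcal A=(\mathcal C_{>\iota(-)})_{\le\iota(+)-\iota(-)}$ and $\mathcal D=\mathcal C_{>\iota(+)}$. **The two maps.** *Resolution.* For a finite generalised word $\mathcal E$, let $\mathcal E(\nearrow)=\mathcal E\mathcal N$, where $\mathcal N$ is trivial or $\mathcal N=\langle a_1\rangle\langle a_2\rangle\cdots$ (finite or infinite) with arrows $a_i$, $\mathcal E\mathcal N$ is a generalised word, and $\mathcal E\mathcal N\langle a\rangle$ is not a generalised word for any arrow $a$. Dually $\mathcal E(\nwarrow)=\mathcal L^{-1}\mathcal E$, with $\mathcal L$ of the same form, and $\mathcal E(\nwarrow\nearrow)=\mathcal L^{-1}(\mathcal E\mathcal N)$. For a string word $C=B^{-1}(AD)$ let $\mathcal A=\langle1_{v,\epsilon}\rangle$ if $A=1_{v,\epsilon}$, and $\mathcal A=\langle\gamma_1\rangle\langle\sigma_1\rangle^{-1}\cdots\langle\gamma_n\rangle\langle\sigma_n\rangle^{-1}$ if $A=\gamma_1^{-1}\sigma_1\cdots\gamma_n^{-1}\sigma_n$. Let $b$, $d$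 be the arrows, if they exist, such that $Bb^{-1}$, respectively $Dd^{-1}$, is a word. Then $\mathcal R_C$ is $\big((\langle bB^{-1}\rangle^{-1}\mathcal A\langle dD^{-1}\rangle)(\nwarrow\nearrow)\big)[1]$ if $b$ and $d$ exist, $(\mathcal A\langle dD^{-1}\rangle)(\nearrow)$ if only $d$ exists, $(\langle bB^{-1}\rangle^{-1}\mathcal A)(\nwarrow)$ if only $b$ exists, and $\mathcal A$ if neither exists. *Homology.* For a finite word $E$, let $E(\searrow)=ED$ with $D$ trivial or inverse (finite or infinite) such that $ED$ is a word and $EDx^{-1}$ is not a word for any arrow $x$. Dually $E(\swarrow)=B^{-1}E$ with $B$ trivial or inverse such that $B^{-1}E$ is a word and $xB^{-1}E$ is not a word for any arrow $x$, and $E(\swarrow\searrow)=B^{-1}(ED)$. For a string-resolution $\mathcal C=\mathcal B^{-1}(\mathcal A\mathcal D)$ let $A=1_{v,\epsilon}$ if $\mathcal A=\langle1_{v,\epsilon}\rangle$, and $A=\mu_1^{-1}\eta_1\cdots\mu_n^{-1}\eta_n$ if $\mathcal A=\langle\mu_1\rangle\langle\eta_1\rangle^{-1}\cdots\langle\mu_n\rangle\langle\eta_n\rangle^{-1}$.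 If $\mathcal B$ (respectively $\mathcal D$) is non-trivial write $\mathcal B_1=\langle b\sigma\rangle$ (respectively $\mathcal D_1=\langle d\mu\rangle$) with $b,d\in\mathbf A$ and possibly trivial paths $\sigma,\mu$. Then $H(\mathcal C)$ is $A(\swarrow\searrow)$ if $\mathcal B$ and $\mathcal D$ are trivial, $(A\mu^{-1})(\swarrow)$ if only $\mathcal B$ is trivial, $(\sigma A)(\searrow)$ if only $\mathcal D$ is trivial, and $\sigma A\mu^{-1}$ if neither is trivial. **Corollary 5.9.** The assignments $C\mapsto\mathcal R_C$ and $\mathcal C\mapsto H(\mathcal C)$ are well defined and are mutually inverse bijections between the set of string words and the set of string-resolutions. Moreover, if $C$ and $\mathcal C$ correspond and $[\iota(-),\iota(+)]$ is the (unique) interval of $\mathcal C$, then $\mathscr H_{\mathcal C}(\iota(-))=\mathscr H_{\mathcal C}(\iota(+))=:t$ and $P=P(\mathcal C)[t]$ (so $P^n=P^{n+t}(\mathcal C)$) is a projective resolution of $M(C)$: each $P^n$ is a projective $\Lambda$-module, $P^n=0$ for $n>0$, $H^n(P)=0$ for $n\neq0$, and $H^0(P)\cong M(C)$. -/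

import Mathlib

open CategoryTheory

/-! ## Quivers with quadratic zero relations, path algebras, complete gentle algebras -/

/-- A quiver with vertices `V` and arrows `A`, together with a set of paths of length two.
The pair `(x, y)` stands for the path `xy` (first `y`, then `x`), so `t(x) = h(y)`. -/
structure BoundQuiver (V A : Type*) where
  hd : A → V
  tl : A → V
  rel : Set (A × A)
  rel_comp : ∀ p ∈ rel, tl p.1 = hd p.2

section PathAlg

variable {V A : Type*} [Fintype V] (R : Type*) [CommRing R] (Q : BoundQuiver V A)

/-- The defining relations of the path algebra `RQ` on the generators `e_v` and `x`. -/
inductive PathRel : FreeAlgebra R (V ⊕ A) → FreeAlgebra R (V ⊕ A) → Prop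
  | idem (v : V) : PathRel
      (FreeAlgebra.ι R (Sum.inl v) * FreeAlgebra.ι R (Sum.inl v)) (FreeAlgebra.ι R (Sum.inl v))
  | orth (v w : V) (h : v ≠ w) : PathRel
      (FreeAlgebra.ι R (Sum.inl v) * FreeAlgebra.ι R (Sum.inl w)) 0
  | one : PathRel (∑ v : V, FreeAlgebra.ι R (Sum.inl v)) 1
  | head (x : A) : PathRel
      (FreeAlgebra.ι R (Sum.inl (Q.hd x)) * FreeAlgebra.ι R (Sum.inr x)) (FreeAlgebra.ι R (Sum.inr x))
  | tail (x : A) : PathRel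
      (FreeAlgebra.ι R (Sum.inr x) * FreeAlgebra.ι R (Sum.inl (Q.tl x))) (FreeAlgebra.ι R (Sum.inr x))

/-- The path algebra `RQ`, presented by its trivial paths and its arrows. -/
abbrev PathAlgebra : Type _ := RingQuot (PathRel R Q)

/-- The trivial path at `v`, as an element of `RQ`. -/
noncomputable def trivPath (v : V) : PathAlgebra R Q :=
  RingQuot.mkAlgHom R (PathRel R Q) (FreeAlgebra.ι R (Sum.inl v))

/-- An arrow, as an element of `RQ`. -/
noncomputable def arrowElt (x : A) : PathAlgebra R Q :=
  RingQuot.mkAlgHom R (PathRel R Q) (FreeAlgebra.ι R (Sum.inr x))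

/-- A non-trivial path `x_n ⋯ x_1`, written as the list `[x_n, …, x_1]`. -/
def BoundQuiver.IsPath (p : List A) : Prop :=
  p ≠ [] ∧ p.IsChain (fun x y => Q.tl x = Q.hd y)

/-- The element of `RQ` given by a path. -/
noncomputable def pathElt (p : List A) : PathAlgebra R Q := (p.map (arrowElt R Q)).prod

/-- The ideal of `RQ` generated by the chosen paths of length two. -/
noncomputable def relIdeal : TwoSidedIdeal (PathAlgebra R Q) :=
  TwoSidedIdeal.span {z | ∃ p ∈ Q.rel, z = pathElt R Q [p.1, p.2]}

/-- The set `P` of non-trivial paths outside the ideal. -/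
def GPath : Type _ := {p : List A // Q.IsPath p ∧ pathElt R Q p ∉ relIdeal R Q}

variable {R Q}

/-- The last arrow `l(γ)` (the leftmost one). -/
def GPath.last (γ : GPath R Q) : A := γ.1.head γ.2.1.1

/-- The first arrow `f(γ)` (the rightmost one). -/
def GPath.first (γ : GPath R Q) : A := γ.1.getLast γ.2.1.1

/-- The head `h(γ)`. -/
def GPath.hd (γ : GPath R Q) : V := Q.hd γ.last

/-- The tail `t(γ)`. -/
def GPath.tl (γ : GPath R Q) : V := Q.tl γ.first

variable {Λ : Type*} [Ring Λ] [Algebra R Λ]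

/-- `Λ` is a complete gentle `R`-algebra by means of `ϑ : RQ → Λ` and the ideal of relations.
Left ideals are `Λ`-submodules of `Λ`, right ideals are `Λᵐᵒᵖ`-submodules of `Λ`, and `N ⋖ M` says
that `N` is a maximal submodule of `M`. -/
structure IsCompleteGentle (ϑ : PathAlgebra R Q →ₐ[R] Λ) : Prop where
  surj : Function.Surjective ϑ
  map_ideal : ∀ z ∈ relIdeal R Q, ϑ z = 0
  map_triv : ∀ v : V, trivPath R Q v ∉ relIdeal R Q → ϑ (trivPath R Q v) ≠ 0
  map_path : ∀ p : List A, Q.IsPath p → pathElt R Q p ∉ relIdeal R Q → ϑ (pathElt R Q p) ≠ 0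
  out_le : ∀ v : V, {x : A | Q.tl x = v}.encard ≤ 2
  in_le : ∀ v : V, {x : A | Q.hd x = v}.encard ≤ 2
  cont_left : ∀ y : A,
    {x : A | Q.tl x = Q.hd y ∧ pathElt R Q [x, y] ∉ relIdeal R Q}.encard ≤ 1
  cont_right : ∀ y : A,
    {z : A | Q.hd z = Q.tl y ∧ pathElt R Q [y, z] ∉ relIdeal R Q}.encard ≤ 1
  stop_left : ∀ y : A,
    {x : A | Q.tl x = Q.hd y ∧ pathElt R Q [x, y] ∈ relIdeal R Q}.encard ≤ 1
  stop_right : ∀ y : A,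
    {z : A | Q.hd z = Q.tl y ∧ pathElt R Q [y, z] ∈ relIdeal R Q}.encard ≤ 1
  rad_left : ∀ (v : V) (N : Submodule Λ Λ),
    N ⋖ Submodule.span Λ {ϑ (trivPath R Q v)} ↔
      N = Submodule.span Λ {z | ∃ x : A, Q.tl x = v ∧ z = ϑ (arrowElt R Q x)}
  rad_right : ∀ (v : V) (N : Submodule Λᵐᵒᵖ Λ),
    N ⋖ Submodule.span Λᵐᵒᵖ {ϑ (trivPath R Q v)} ↔
      N = Submodule.span Λᵐᵒᵖ {z | ∃ x : A, Q.hd x = v ∧ z = ϑ (arrowElt R Q x)}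
  fg_left : ∀ x : A, (LinearMap.range (LinearMap.mulRight R (ϑ (arrowElt R Q x)))).FG
  fg_right : ∀ x : A, (LinearMap.range (LinearMap.mulLeft R (ϑ (arrowElt R Q x)))).FG
  inter_left : ∀ x y : A, x ≠ y →
    Disjoint (Submodule.span Λ {ϑ (arrowElt R Q x)}) (Submodule.span Λ {ϑ (arrowElt R Q y)})
  inter_right : ∀ x y : A, x ≠ y →
    Disjoint (Submodule.span Λᵐᵒᵖ {ϑ (arrowElt R Q x)}) (Submodule.span Λᵐᵒᵖ {ϑ (arrowElt R Q y)})

end PathAlg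

/-! ## Sequences of letters

The same combinatorial framework serves for words (letters over the arrows) and for generalised
words (letters over the paths in `P`). -/

/-- Direct and inverse letters over an alphabet `α`. -/
inductive Letter (α : Type*) where
  | dir (a : α) : Letter α
  | inv (a : α) : Letter α

/-- The inverse of a letter. -/
def Letter.flip {α : Type*} : Letter α → Letter α
  | .dir a => .inv a
  | .inv a => .dir a

/-- Sequences of letters indexed by `{0,…,m}`, `ℕ`, `-ℕ` or `ℤ`:
* `triv v ε` is the trivial sequence `1_{v,ε}`;
* `fin [C_1, …, C_m]` is `C_1 ⋯ C_m` (only used for `m > 0`);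
* `right s` is the `ℕ`-sequence `C_1 C_2 ⋯` with `s n = C_{n+1}`;
* `left s` is the `-ℕ`-sequence `⋯ C_{-1} C_0` with `s n = C_{-n}`;
* `bi f` is the `ℤ`-sequence `⋯ C_0 ∣ C_1 ⋯` with `f i = C_i`. -/
inductive Seqn (V L : Type*) where
  | triv (v : V) (ε : ℤˣ) : Seqn V L
  | fin (l : List L) : Seqn V L
  | right (s : Stream' L) : Seqn V L
  | left (s : Stream' L) : Seqn V L
  | bi (f : ℤ → L) : Seqn V L

namespace Seqn

variable {V α : Type*}

instance : Nonempty (Seqn V (Letter α)) := ⟨.fin []⟩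

/-- The index set `I`. -/
def idx : Seqn V (Letter α) → Set ℤ
  | .triv _ _ => {0}
  | .fin l => Set.Icc 0 l.length
  | .right _ => Set.Ici 0
  | .left _ => Set.Iic 0
  | .bi _ => Set.univ

/-- The letter `C_i` (present iff `i - 1` and `i` lie in `I`). -/
def letter : Seqn V (Letter α) → ℤ → Option (Letter α)
  | .triv _ _, _ => none
  | .fin l, i => if 1 ≤ i then l[(i - 1).toNat]? else none
  | .right s, i => if 1 ≤ i then some (s.get (i - 1).toNat) else none
  | .left s, i => if i ≤ 0 then some (s.get (-i).toNat) else none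
  | .bi f, i => some (f i)

/-- The inverse `C⁻¹`. -/
def inv : Seqn V (Letter α) → Seqn V (Letter α)
  | .triv v ε => .triv v (-ε)
  | .fin l => .fin (l.reverse.map Letter.flip)
  | .right s => .left (s.map Letter.flip)
  | .left s => .right (s.map Letter.flip)
  | .bi f => .bi (fun i => (f (1 - i)).flip)

/-- The shift `C[n]`. -/
def shift : Seqn V (Letter α) → ℤ → Seqn V (Letter α)
  | .bi f, n => .bi (fun i => f (i + n))
  | C, _ => C

def IsTriv (C : Seqn V (Letter α)) : Prop := ∃ v ε, C = .triv v ε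

/-- All letters are direct (trivial sequences included). -/
def IsDirect (C : Seqn V (Letter α)) : Prop := ∀ i l, C.letter i = some l → ∃ a, l = .dir a

/-- All letters are inverse (trivial sequences included). -/
def IsInverse (C : Seqn V (Letter α)) : Prop := ∀ i l, C.letter i = some l → ∃ a, l = .inv a

/-- The head and the sign of a sequence with `I ⊆ ℕ`. -/
def start (hd : Letter α → V) (s : Letter α → ℤˣ) : Seqn V (Letter α) → Option (V × ℤˣ)
  | .triv v ε => some (v, ε)
  | .fin l => l.head?.map (fun a => (hd a, s a))
  | .right t => some (hd (t.get 0), s (t.get 0))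
  | .left _ => none
  | .bi _ => none

/-- `Comp hd s C D E` says that `E` is the composition `CD`, where `C` is finite or a
`-ℕ`-sequence and `D` is finite or an `ℕ`-sequence. When one factor is trivial, the heads of `C⁻¹`
and `D` must agree and their signs must be opposite; when both factors are non-trivial, `E` is
their concatenation, and it has to be checked separately that `E` is a (generalised) word. -/
inductive Comp (hd : Letter α → V) (s : Letter α → ℤˣ) :
    Seqn V (Letter α) → Seqn V (Letter α) → Seqn V (Letter α) → Prop
  | triv_left (v : V) (ε : ℤˣ) (D : Seqn V (Letter α)) (h : D.start hd s = some (v, ε)) :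
      Comp hd s (.triv v ε) D D
  | triv_right (v : V) (ε : ℤˣ) (C : Seqn V (Letter α)) (h : C.inv.start hd s = some (v, -ε)) :
      Comp hd s C (.triv v ε) C
  | fin_fin (l l' : List (Letter α)) : Comp hd s (.fin l) (.fin l') (.fin (l ++ l'))
  | fin_right (l : List (Letter α)) (t : Stream' (Letter α)) :
      Comp hd s (.fin l) (.right t) (.right (Stream'.appendStream' l t))
  | left_fin (t : Stream' (Letter α)) (l : List (Letter α)) :
      Comp hd s (.left t) (.fin l) (.left (Stream'.appendStream' l.reverse t))
  | left_right (t t' : Stream' (Letter α)) :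
      Comp hd s (.left t) (.right t')
        (.bi (fun i => if i ≤ 0 then t.get (-i).toNat else t'.get (i - 1).toNat))

/-- The trivial sequence at the right-hand end of `C`. -/
def endTriv (hd : Letter α → V) (s : Letter α → ℤˣ) (C : Seqn V (Letter α)) :
    Seqn V (Letter α) :=
  match C.inv.start hd s with
  | some (v, ε) => .triv v (-ε)
  | none => .fin []

/-- `C_{>i}`, for `i ∈ I`. -/
def gt (hd : Letter α → V) (s : Letter α → ℤˣ) : Seqn V (Letter α) → ℤ → Seqn V (Letter α)
  | .triv v ε, _ => .triv v ε
  | .fin l, i => if (l.length : ℤ) ≤ i then endTriv hd s (.fin l) else .fin (l.drop i.toNat)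
  | .right t, i => .right (t.drop i.toNat)
  | .left t, i => if 0 ≤ i then endTriv hd s (.left t) else .fin (t.take (-i).toNat).reverse
  | .bi f, i => .right (fun n => f (i + 1 + n))

/-- `C_{≤i}`, for `i ∈ I`: the inverse of the part of `C⁻¹` behind the position that
corresponds to `i`. -/
def le (hd : Letter α → V) (s : Letter α → ℤˣ) (C : Seqn V (Letter α)) (i : ℤ) :
    Seqn V (Letter α) :=
  match C with
  | .fin l => (gt hd s (Seqn.fin l).inv (l.length - i)).inv
  | C => (gt hd s C.inv (-i)).inv

/-- The vertex `v_C(i)`: the tail of `C_i`, which is the head of `C_{i+1}`. -/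
def vtx (hd : Letter α → V) (C : Seqn V (Letter α)) (i : ℤ) : Option V :=
  match C with
  | .triv v _ => some v
  | C => match C.letter i with
    | some l => some (hd l.flip)
    | none => (C.letter (i + 1)).map hd

/-- `i` is a `C`-peak. -/
def IsPeak (C : Seqn V (Letter α)) (i : ℤ) : Prop :=
  i ∈ C.idx ∧ ((∃ a, C.letter i = some (.dir a)) ∨ i - 1 ∉ C.idx) ∧
    ((∃ a, C.letter (i + 1) = some (.inv a)) ∨ i + 1 ∉ C.idx)

/-- The finite set of `C`-peaks (empty if there are infinitely many). -/
noncomputable def peaks (C : Seqn V (Letter α)) : Finset ℤ :=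
  open Classical in if h : {i : ℤ | C.IsPeak i}.Finite then h.toFinset else ∅

/-- The peaks in increasing order, `π(0) < π(1) < ⋯`. -/
noncomputable def peak (C : Seqn V (Letter α)) (i : Fin C.peaks.card) : ℤ :=
  C.peaks.orderEmbOfFin rfl i

/-- The consecutive letters of the list `l` occur in `C`. -/
def Occurs (C : Seqn V (Letter α)) (l : List (Letter α)) : Prop :=
  ∃ i : ℤ, ∀ (k : ℕ) (h : k < l.length), C.letter (i + k) = some l[k]

end Seqn

/-! ## Words and string words -/

section Words

variable {V A : Type*} [Fintype V] (R : Type*) [CommRing R] (Q : BoundQuiver V A)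

/-- The head of a letter; its tail is the head of the inverse letter. -/
def BoundQuiver.lhead : Letter A → V
  | .dir x => Q.hd x
  | .inv x => Q.tl x

/-- A path, as a list of direct letters. -/
def dirList (p : List A) : List (Letter A) := p.map Letter.dir

/-- The inverse of a path, as a list of inverse letters. -/
def invList (p : List A) : List (Letter A) := p.reverse.map Letter.inv

/-- `C` is a word. -/
structure IsWord (C : Seqn V (Letter A)) : Prop where
  ne_nil : C ≠ .fin []
  adj : ∀ i a b, C.letter i = some a → C.letter (i + 1) = some b →
    Q.lhead a.flip = Q.lhead b ∧ a.flip ≠ b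
  mem : ∀ p : List A, Q.IsPath p → (C.Occurs (dirList p) ∨ C.Occurs (invList p)) →
    pathElt R Q p ∉ relIdeal R Q

/-- A choice of signs for the letters. -/
def IsSign (s : Letter A → ℤˣ) : Prop :=
  ∀ l l' : Letter A, l ≠ l' → Q.lhead l = Q.lhead l' → s l = s l' →
    ∃ x y : A, ((l = .inv x ∧ l' = .dir y) ∨ (l = .dir y ∧ l' = .inv x)) ∧
      Q.tl x = Q.hd y ∧ pathElt R Q [x, y] ∈ relIdeal R Q

variable {R Q}

/-- The letters of `γ_1⁻¹ σ_1 ⋯ γ_n⁻¹ σ_n`. -/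
def altList (ps : List (GPath R Q × GPath R Q)) : List (Letter A) :=
  ps.flatMap (fun p => invList p.1.1 ++ dirList p.2.1)

variable (R Q)

/-- `(B, A, D)` is a decomposition of the word `C = B⁻¹(AD)`. -/
structure IsDecomp (s : Letter A → ℤˣ) (C B A' D : Seqn V (Letter A)) : Prop where
  word_B : IsWord R Q B
  word_A : IsWord R Q A'
  word_D : IsWord R Q D
  alt : A'.IsTriv ∨ ∃ ps : List (GPath R Q × GPath R Q), ps ≠ [] ∧ A' = .fin (altList ps)
  inverse_B : B.IsInverse
  inverse_D : D.IsInverse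
  comp : ∃ E, Seqn.Comp Q.lhead s A' D E ∧ IsWord R Q E ∧ Seqn.Comp Q.lhead s B.inv E C

/-- `C` is a string word. -/
def IsStringWord (s : Letter A → ℤˣ) (C : Seqn V (Letter A)) : Prop :=
  IsWord R Q C ∧ ∃ B A' D, IsDecomp R Q s C B A' D

/-- `B` is trivial or the inverse `p⁻¹` of a (possibly trivial) path `p`, the letter `b⁻¹` can be
appended to `B`, and `β` is the path `b B⁻¹ = b p`. -/
def IsCap (s : Letter A → ℤˣ) (B : Seqn V (Letter A)) (β : GPath R Q) : Prop :=
  ∃ (b : A) (p : List A), β.1 = b :: p ∧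
    ((p = [] ∧ B.IsTriv) ∨ (p ≠ [] ∧ B = .fin (invList p))) ∧
    ∃ W, Seqn.Comp Q.lhead s B (.fin [.inv b]) W ∧ IsWord R Q W

end Words

/-! ## String modules -/

section StringModule

open DirectSum

variable {V A : Type*} [Fintype V] {R : Type*} [CommRing R] {Q : BoundQuiver V A}
  {Λ : Type*} [Ring Λ] [Algebra R Λ] (ϑ : PathAlgebra R Q →ₐ[R] Λ)

/-- The idempotent `e_v` of `Λ` (and `0` if no vertex is given). -/
noncomputable def idemp : Option V → Λ
  | some v => ϑ (trivPath R Q v)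
  | none => 0

/-- The left `Λ`-module `Λ e_v`. -/
noncomputable abbrev projMod (v : Option V) : Submodule Λ Λ := Submodule.span Λ {idemp ϑ v}

/-- A path, as an element of `Λ`. -/
noncomputable def pathVal (p : List A) : Λ := ϑ (pathElt R Q p)

/-- `N(C) = ⨁_i Λ g_{C,i}` where `g_{C,i}` is the idempotent at the `i`-th peak. -/
abbrev StringN (C : Seqn V (Letter A)) : Type _ :=
  ⨁ i : Fin C.peaks.card, projMod ϑ (C.vtx Q.lhead (C.peak i))

/-- The generator `g_{C,i}` of `N(C)`. -/
noncomputable def stringGen (C : Seqn V (Letter A)) (i : Fin C.peaks.card) : StringN ϑ C :=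
  DirectSum.lof Λ (Fin C.peaks.card) (fun i => projMod ϑ (C.vtx Q.lhead (C.peak i))) i
    ⟨idemp ϑ (C.vtx Q.lhead (C.peak i)), Submodule.mem_span_singleton_self _⟩

/-- `L_-(C)`, generated by `(w B⁻¹) g_{C,0}` if there is an arrow `w` such that `w B⁻¹` is a
word. -/
noncomputable def stringLMinus (s : Letter A → ℤˣ) (C : Seqn V (Letter A)) :
    Submodule Λ (StringN ϑ C) :=
  Submodule.span Λ {z | ∃ B A' D, IsDecomp R Q s C B A' D ∧ ∃ β, IsCap R Q s B β ∧
    ∃ i : Fin C.peaks.card, i.val = 0 ∧ z = pathVal ϑ β.1 • stringGen ϑ C i}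

/-- `L_0(C)`, generated by the elements `γ_{i+1} g_{C,i} - σ_{i+1} g_{C,i+1}`. -/
noncomputable def stringLZero (s : Letter A → ℤˣ) (C : Seqn V (Letter A)) :
    Submodule Λ (StringN ϑ C) :=
  Submodule.span Λ {z | ∃ B A' D, IsDecomp R Q s C B A' D ∧
    ∃ ps : List (GPath R Q × GPath R Q), A' = .fin (altList ps) ∧
    ∃ i j : Fin C.peaks.card, j.val = i.val + 1 ∧ ∃ γ σ, ps[i.val]? = some (γ, σ) ∧
      z = pathVal ϑ γ.1 • stringGen ϑ C i - pathVal ϑ σ.1 • stringGen ϑ C j}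

/-- `L_+(C)`, generated by `(z D⁻¹) g_{C,d}`, for the last peak, if there is an arrow `z` such
that `D z⁻¹` is a word. -/
noncomputable def stringLPlus (s : Letter A → ℤˣ) (C : Seqn V (Letter A)) :
    Submodule Λ (StringN ϑ C) :=
  Submodule.span Λ {z | ∃ B A' D, IsDecomp R Q s C B A' D ∧ ∃ δ, IsCap R Q s D δ ∧
    ∃ i : Fin C.peaks.card, i.val + 1 = C.peaks.card ∧ z = pathVal ϑ δ.1 • stringGen ϑ C i}

/-- The string module `M(C) = N(C) / (L_-(C) + L_0(C) + L_+(C))`. -/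
abbrev StringModule (s : Letter A → ℤˣ) (C : Seqn V (Letter A)) : Type _ :=
  StringN ϑ C ⧸ (stringLMinus ϑ s C ⊔ stringLZero ϑ s C ⊔ stringLPlus ϑ s C)

end StringModule

/-! ## Generalised words and string resolutions -/

section GenWords

variable {V A : Type*} [Fintype V] {R : Type*} [CommRing R] {Q : BoundQuiver V A}

/-- The head of a generalised letter: `h(⟨γ⟩) = t(γ)` and `h(⟨γ⟩⁻¹) = h(γ)`. -/
def ghead : Letter (GPath R Q) → V
  | .dir γ => γ.tl
  | .inv γ => γ.hd

/-- The sign of a generalised letter: `s(⟨γ⟩) = s(f(γ)⁻¹)` and `s(⟨γ⟩⁻¹) = -s(l(γ))`. -/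
def gsign (s : Letter A → ℤˣ) : Letter (GPath R Q) → ℤˣ
  | .dir γ => s (.inv γ.first)
  | .inv γ => -s (.dir γ.last)

/-- The pairs of consecutive letters allowed in a generalised word. -/
def GAdj : Letter (GPath R Q) → Letter (GPath R Q) → Prop
  | .dir γ, .inv σ => γ.hd = σ.hd ∧ γ.last ≠ σ.last
  | .inv γ, .inv σ => γ.tl = σ.hd ∧ pathElt R Q [γ.first, σ.last] ∈ relIdeal R Q
  | .inv γ, .dir σ => γ.tl = σ.tl ∧ γ.first ≠ σ.first
  | .dir γ, .dir σ => γ.hd = σ.tl ∧ pathElt R Q [σ.first, γ.last] ∈ relIdeal R Q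

/-- `C` is a generalised word. -/
structure IsGenWord (C : Seqn V (Letter (GPath R Q))) : Prop where
  ne_nil : C ≠ .fin []
  adj : ∀ i a b, C.letter i = some a → C.letter (i + 1) = some b → GAdj a b

/-- The letters of `⟨μ_1⟩ ⟨η_1⟩⁻¹ ⋯ ⟨μ_n⟩ ⟨η_n⟩⁻¹`. -/
def galtList (ps : List (GPath R Q × GPath R Q)) : List (Letter (GPath R Q)) :=
  ps.flatMap (fun p => [.dir p.1, .inv p.2])

/-- The path `γ` is an arrow. -/
def GPath.IsArrow (γ : GPath R Q) : Prop := ∃ a : A, γ.1 = [a]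

/-- `C⟨a⟩` is a generalised word for some arrow `a`. -/
def ExtendsRight (s : Letter A → ℤˣ) (C : Seqn V (Letter (GPath R Q))) : Prop :=
  ∃ a : GPath R Q, a.IsArrow ∧
    ∃ E, Seqn.Comp ghead (gsign s) C (.fin [.dir a]) E ∧ IsGenWord E

/-- `⟨a⟩⁻¹C` is a generalised word for some arrow `a`. -/
def ExtendsLeft (s : Letter A → ℤˣ) (C : Seqn V (Letter (GPath R Q))) : Prop :=
  ∃ a : GPath R Q, a.IsArrow ∧
    ∃ E, Seqn.Comp ghead (gsign s) (.fin [.inv a]) C E ∧ IsGenWord E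

/-- `(B, A, D)` is a decomposition of the string resolution `C = B⁻¹(AD)`. -/
structure IsGenDecomp (s : Letter A → ℤˣ) (C B A' D : Seqn V (Letter (GPath R Q))) : Prop where
  word_B : IsGenWord B
  word_A : IsGenWord A'
  word_D : IsGenWord D
  alt : A'.IsTriv ∨ ∃ ps : List (GPath R Q × GPath R Q), ps ≠ [] ∧ A' = .fin (galtList ps)
  cond_B : ¬ B.IsTriv → B.IsDirect ∧
    (∀ n : ℤ, 1 < n → ∀ l, B.letter n = some l → ∃ a : GPath R Q, a.IsArrow ∧ l = .dir a) ∧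
    ¬ ExtendsRight s B
  cond_D : ¬ D.IsTriv → D.IsDirect ∧
    (∀ n : ℤ, 1 < n → ∀ l, D.letter n = some l → ∃ a : GPath R Q, a.IsArrow ∧ l = .dir a) ∧
    ¬ ExtendsRight s D
  comp : ∃ E, Seqn.Comp ghead (gsign s) A' D E ∧ IsGenWord E ∧
    Seqn.Comp ghead (gsign s) B.inv E C

/-- `C` is a string resolution. -/
def IsStringRes (s : Letter A → ℤˣ) (C : Seqn V (Letter (GPath R Q))) : Prop :=
  IsGenWord C ∧ ∃ B A' D, IsGenDecomp s C B A' D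

/-- `[a, b]` is the interval of the string resolution `C`. -/
def IsInterval (s : Letter A → ℤˣ) (C : Seqn V (Letter (GPath R Q))) (a b : ℤ) : Prop :=
  ∃ B A' D, IsGenDecomp s C B A' D ∧ a ∈ C.idx ∧ b ∈ C.idx ∧ a ≤ b ∧
    B = (C.le ghead (gsign s) a).inv ∧
    A' = (C.gt ghead (gsign s) a).le ghead (gsign s) (b - a) ∧
    D = C.gt ghead (gsign s) b

/-! ### The resolution of a string word -/

/-- `A'` and `A''` are trivial words `1_{v,ε}` and `⟨1_{v,ε}⟩`, or alternating words
`γ_1⁻¹ σ_1 ⋯ γ_n⁻¹ σ_n` and `⟨γ_1⟩ ⟨σ_1⟩⁻¹ ⋯ ⟨γ_n⟩ ⟨σ_n⟩⁻¹`. -/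
def IsAltMatch (A' : Seqn V (Letter A)) (A'' : Seqn V (Letter (GPath R Q))) : Prop :=
  (∃ v ε, A' = .triv v ε ∧ A'' = .triv v ε) ∨
    ∃ ps : List (GPath R Q × GPath R Q), ps ≠ [] ∧ A' = .fin (altList ps) ∧
      A'' = .fin (galtList ps)

/-- `F = E(↗)`: the word `F = EN` where `N` is trivial or `N = ⟨a_1⟩⟨a_2⟩⋯` with arrows `a_i`
(finitely or infinitely many), and `N` is maximal: there is no arrow `a` such that `EN⟨a⟩` is a
generalised word. -/
def IsUpRight (s : Letter A → ℤˣ) (E F : Seqn V (Letter (GPath R Q))) : Prop :=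
  ∃ N, IsGenWord N ∧
    (∀ i l, N.letter i = some l → ∃ a : GPath R Q, a.IsArrow ∧ l = .dir a) ∧
    Seqn.Comp ghead (gsign s) E N F ∧ IsGenWord F ∧ ¬ ExtendsRight s F

/-- `F = E(↖)`: the word `F = L⁻¹E` where `L` is trivial or `L = ⟨a_1⟩⟨a_2⟩⋯` with arrows `a_i`
(finitely or infinitely many), and `L` is maximal: there is no arrow `a` such that `⟨a⟩⁻¹L⁻¹E`
is a generalised word. -/
def IsUpLeft (s : Letter A → ℤˣ) (E F : Seqn V (Letter (GPath R Q))) : Prop :=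
  ∃ L, IsGenWord L ∧
    (∀ i l, L.letter i = some l → ∃ a : GPath R Q, a.IsArrow ∧ l = .dir a) ∧
    Seqn.Comp ghead (gsign s) L.inv E F ∧ IsGenWord F ∧ ¬ ExtendsLeft s F

/-- `F = E(↖↗) = L⁻¹(EN)`. -/
def IsUpBoth (s : Letter A → ℤˣ) (E F : Seqn V (Letter (GPath R Q))) : Prop :=
  ∃ X, IsUpRight s E X ∧ IsUpLeft s X F

/-- `Cres` is the resolution `R_C` of the string word `C`. -/
def IsResolutionWord (s : Letter A → ℤˣ) (C : Seqn V (Letter A))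
    (Cres : Seqn V (Letter (GPath R Q))) : Prop :=
  ∃ B A' D, IsDecomp R Q s C B A' D ∧ ∃ A'', IsAltMatch A' A'' ∧
    ((∃ β δ, IsCap R Q s B β ∧ IsCap R Q s D δ ∧
        ∃ X E F, Seqn.Comp ghead (gsign s) A'' (.fin [.dir δ]) X ∧
          Seqn.Comp ghead (gsign s) (.fin [.inv β]) X E ∧ IsUpBoth s E F ∧ Cres = F.shift 1) ∨
      ((¬ ∃ β, IsCap R Q s B β) ∧ ∃ δ, IsCap R Q s D δ ∧
        ∃ E, Seqn.Comp ghead (gsign s) A'' (.fin [.dir δ]) E ∧ IsUpRight s E Cres) ∨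
      ((¬ ∃ δ, IsCap R Q s D δ) ∧ ∃ β, IsCap R Q s B β ∧
        ∃ E, Seqn.Comp ghead (gsign s) (.fin [.inv β]) A'' E ∧ IsUpLeft s E Cres) ∨
      ((¬ ∃ β, IsCap R Q s B β) ∧ (¬ ∃ δ, IsCap R Q s D δ) ∧ Cres = A''))

/-- The map `C ↦ R_C`. -/
noncomputable def resolutionWord (R : Type*) [CommRing R] (Q : BoundQuiver V A)
    (s : Letter A → ℤˣ) (C : Seqn V (Letter A)) : Seqn V (Letter (GPath R Q)) :=
  Classical.epsilon (IsResolutionWord s C)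

/-! ### The homology word of a string resolution -/

/-- `F = E(↘)`: the word `F = ED` where `D` is trivial or inverse, and `D` is maximal: there is
no arrow `x` such that `EDx⁻¹` is a word. -/
def IsDownRight (R : Type*) [CommRing R] (Q : BoundQuiver V A) (s : Letter A → ℤˣ)
    (E F : Seqn V (Letter A)) : Prop :=
  ∃ D, IsWord R Q D ∧ D.IsInverse ∧ Seqn.Comp Q.lhead s E D F ∧ IsWord R Q F ∧
    ¬ ∃ (x : A) (G : _), Seqn.Comp Q.lhead s F (.fin [.inv x]) G ∧ IsWord R Q G

/-- `F = E(↙)`: the word `F = B⁻¹E` where `B` is trivial or inverse, and `B` is maximal: there is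
no arrow `x` such that `xB⁻¹E` is a word. -/
def IsDownLeft (R : Type*) [CommRing R] (Q : BoundQuiver V A) (s : Letter A → ℤˣ)
    (E F : Seqn V (Letter A)) : Prop :=
  ∃ B, IsWord R Q B ∧ B.IsInverse ∧ Seqn.Comp Q.lhead s B.inv E F ∧ IsWord R Q F ∧
    ¬ ∃ (x : A) (G : _), Seqn.Comp Q.lhead s (.fin [.dir x]) F G ∧ IsWord R Q G

/-- `F = E(↙↘) = B⁻¹(ED)`. -/
def IsDownBoth (R : Type*) [CommRing R] (Q : BoundQuiver V A) (s : Letter A → ℤˣ)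
    (E F : Seqn V (Letter A)) : Prop :=
  ∃ X, IsDownRight R Q s E X ∧ IsDownLeft R Q s X F

/-- `X = E μ⁻¹` for a possibly trivial path `μ`. -/
def IsMulInv (Q : BoundQuiver V A) (s : Letter A → ℤˣ) (E : Seqn V (Letter A)) (μ : List A)
    (X : Seqn V (Letter A)) : Prop :=
  (μ = [] ∧ X = E) ∨ (μ ≠ [] ∧ Seqn.Comp Q.lhead s E (.fin (invList μ)) X)

/-- `X = σ E` for a possibly trivial path `σ`. -/
def IsMulLeft (Q : BoundQuiver V A) (s : Letter A → ℤˣ) (σ : List A) (E : Seqn V (Letter A))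
    (X : Seqn V (Letter A)) : Prop :=
  (σ = [] ∧ X = E) ∨ (σ ≠ [] ∧ Seqn.Comp Q.lhead s (.fin (dirList σ)) E X)

/-- The first letter of `D` is `⟨dμ⟩` where `d` is an arrow and `μ` is a possibly trivial path. -/
def StartsWith (D : Seqn V (Letter (GPath R Q))) (μ : List A) : Prop :=
  ∃ (γ : GPath R Q) (d : A), D.letter 1 = some (.dir γ) ∧ γ.1 = d :: μ

/-- `C` is the homology word `H(Cres)` of the string resolution `Cres`. -/
def IsHomologyWord (s : Letter A → ℤˣ) (Cres : Seqn V (Letter (GPath R Q)))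
    (C : Seqn V (Letter A)) : Prop :=
  ∃ B A'' D, IsGenDecomp s Cres B A'' D ∧ ∃ A', IsAltMatch A' A'' ∧
    ((B.IsTriv ∧ D.IsTriv ∧ IsDownBoth R Q s A' C) ∨
      (B.IsTriv ∧ ∃ μ, StartsWith D μ ∧ ∃ X, IsMulInv Q s A' μ X ∧ IsDownLeft R Q s X C) ∨
      (D.IsTriv ∧ ∃ σ, StartsWith B σ ∧ ∃ X, IsMulLeft Q s σ A' X ∧ IsDownRight R Q s X C) ∨
      (∃ σ μ, StartsWith B σ ∧ StartsWith D μ ∧ ∃ X, IsMulInv Q s A' μ X ∧ IsMulLeft Q s σ X C))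

/-- The map `Cres ↦ H(Cres)`. -/
noncomputable def homologyWord (s : Letter A → ℤˣ) (Cres : Seqn V (Letter (GPath R Q))) :
    Seqn V (Letter A) :=
  Classical.epsilon (IsHomologyWord s Cres)

/-! ## String complexes -/

/-- `ℋ(⟨γ⟩) = -1` and `ℋ(⟨γ⟩⁻¹) = 1`. -/
def letterHeight : Option (Letter (GPath R Q)) → ℤ
  | some (.dir _) => -1
  | some (.inv _) => 1
  | none => 0

/-- The function `ℋ_C`, which gives the homogeneous degrees. -/
noncomputable def height (C : Seqn V (Letter (GPath R Q))) (i : ℤ) : ℤ :=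
  if 0 ≤ i then ∑ j ∈ Finset.Ioc 0 i, letterHeight (C.letter j)
  else -∑ j ∈ Finset.Ioc i 0, letterHeight (C.letter j)

open DirectSum

variable {Λ : Type*} [Ring Λ] [Algebra R Λ] (ϑ : PathAlgebra R Q →ₐ[R] Λ)

/-- `P^n(C) = ⨁ Λ e_{v_C(i)}` over the `i ∈ I` of degree `n`. -/
abbrev StringP (C : Seqn V (Letter (GPath R Q))) (n : ℤ) : Type _ :=
  ⨁ i : {i : ℤ // i ∈ C.idx ∧ height C i = n}, projMod ϑ (C.vtx ghead i.1)

/-- The generator `g_{C,i}` in degree `n`, for `i ∈ I` of degree `n` (and `0` otherwise). -/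
noncomputable def pGen (C : Seqn V (Letter (GPath R Q))) (n i : ℤ) : StringP ϑ C n :=
  open Classical in
  if h : i ∈ C.idx ∧ height C i = n then
    DirectSum.lof Λ {i : ℤ // i ∈ C.idx ∧ height C i = n}
      (fun i => projMod ϑ (C.vtx ghead i.1)) ⟨i, h⟩
      ⟨idemp ϑ (C.vtx ghead i), Submodule.mem_span_singleton_self _⟩
  else 0

/-- `g_{C,i}^+`, for `i` of degree `n`. -/
noncomputable def pPlus (C : Seqn V (Letter (GPath R Q))) (n i : ℤ) : StringP ϑ C (n + 1) :=
  match C.letter (i + 1) with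
  | some (.inv μ) => pathVal ϑ μ.1 • pGen ϑ C (n + 1) (i + 1)
  | _ => 0

/-- `g_{C,i}^-`, for `i` of degree `n`. -/
noncomputable def pMinus (C : Seqn V (Letter (GPath R Q))) (n i : ℤ) : StringP ϑ C (n + 1) :=
  match C.letter i with
  | some (.dir η) => pathVal ϑ η.1 • pGen ϑ C (n + 1) (i - 1)
  | _ => 0

/-- The differential: the `Λ`-linear map with `λ g_{C,i} ↦ λ (g_{C,i}^- + g_{C,i}^+)`. -/
noncomputable def pDiff (C : Seqn V (Letter (GPath R Q))) (n : ℤ) :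
    StringP ϑ C n →ₗ[Λ] StringP ϑ C (n + 1) :=
  open Classical in
  DirectSum.toModule Λ {i : ℤ // i ∈ C.idx ∧ height C i = n} (StringP ϑ C (n + 1))
    (fun i => (LinearMap.toSpanSingleton Λ (StringP ϑ C (n + 1))
      (pMinus ϑ C n i.1 + pPlus ϑ C n i.1)).comp (projMod ϑ (C.vtx ghead i.1)).subtype)

variable {ϑ}

lemma pathElt_mul_trivPath (p : List A) (hp : p ≠ []) :
    pathElt R Q p * trivPath R Q (Q.tl (p.getLast hp)) = pathElt R Q p := by
  induction p with
  | nil => exact absurd rfl hp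
  | cons x p ih =>
    rcases p with _ | ⟨y, p⟩
    · simp only [pathElt, List.map_cons, List.map_nil, List.prod_cons, List.prod_nil, mul_one,
        List.getLast_singleton, arrowElt, trivPath]
      rw [← map_mul]
      exact RingQuot.mkAlgHom_rel R (PathRel.tail x)
    · have := ih (by simp)
      rw [List.getLast_cons (by simp)]
      have e : pathElt R Q (x :: y :: p) = arrowElt R Q x * pathElt R Q (y :: p) := by
        simp [pathElt]
      rw [e, mul_assoc, this]

lemma pathElt_append (p q : List A) :
    pathElt R Q (p ++ q) = pathElt R Q p * pathElt R Q q := by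
  simp [pathElt]

lemma pathVal_mul_eq_zero (hϑ : IsCompleteGentle ϑ) (γ σ : GPath R Q)
    (h : pathElt R Q [γ.first, σ.last] ∈ relIdeal R Q) :
    pathVal ϑ γ.1 * pathVal ϑ σ.1 = 0 := by
  have h0 := hϑ.map_ideal _ h
  have e1 : γ.1 = γ.1.dropLast ++ [γ.first] := (List.dropLast_append_getLast γ.2.1.1).symm
  have e2 : σ.1 = [σ.last] ++ σ.1.tail := by simp [GPath.last]
  rw [e1, e2]
  unfold pathVal
  rw [← map_mul, pathElt_append, pathElt_append, mul_assoc,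
    ← mul_assoc (pathElt R Q [γ.first]), ← pathElt_append]
  simp only [List.singleton_append]
  rw [map_mul, map_mul, h0, zero_mul, mul_zero]

lemma pathVal_mul_idemp (γ : GPath R Q) :
    pathVal ϑ γ.1 * idemp ϑ (some γ.tl) = pathVal ϑ γ.1 := by
  unfold pathVal idemp
  rw [← map_mul]
  congr 1
  exact pathElt_mul_trivPath γ.1 γ.2.1.1

lemma vtx_of_letter (C : Seqn V (Letter (GPath R Q))) (i : ℤ) (l : Letter (GPath R Q))
    (h : C.letter i = some l) : C.vtx ghead i = some (ghead l.flip) := by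
  cases C <;> simp_all [Seqn.vtx, Seqn.letter]

lemma vtx_of_letter_succ (C : Seqn V (Letter (GPath R Q))) (hC : IsGenWord C) (i : ℤ)
    (l : Letter (GPath R Q)) (h : C.letter (i + 1) = some l) :
    C.vtx ghead i = some (ghead l) := by
  have key : ∀ l', C.letter i = some l' → ghead l'.flip = ghead l := by
    intro l' h'
    have := hC.adj i l' l h' h
    rcases l' with γ | γ <;> rcases l with σ | σ <;> exact this.1
  rcases hl : C.letter i with _ | l'
  · cases C with
    | triv v ε => simp [Seqn.letter] at h
    | _ => simp only [Seqn.vtx, hl, h, Option.map_some]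
  · rw [vtx_of_letter C i l' hl, key l' hl]

lemma pDiff_pPlus (hϑ : IsCompleteGentle ϑ) (C : Seqn V (Letter (GPath R Q)))
    (hC : IsGenWord C) (n i : ℤ) : pDiff ϑ C (n + 1) (pPlus ϑ C n i) = 0 := by
  unfold pPlus
  rcases h : C.letter (i + 1) with _ | μ | μ
  · simp
  · simp
  · simp only [map_smul]
    by_cases h0 : i + 1 ∈ C.idx ∧ height C (i + 1) = n + 1
    · have hd : pDiff ϑ C (n + 1) (pGen ϑ C (n + 1) (i + 1)) =
          idemp ϑ (C.vtx ghead (i + 1)) •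
            (pMinus ϑ C (n + 1) (i + 1) + pPlus ϑ C (n + 1) (i + 1)) := by
        classical
        unfold pGen
        rw [dif_pos h0, pDiff]
        erw [DirectSum.toModule_lof]
        simp
      rw [hd, vtx_of_letter C _ _ h, smul_smul]
      have e : ghead (Letter.inv μ).flip = μ.tl := rfl
      rw [e, pathVal_mul_idemp]
      have e1 : pMinus ϑ C (n + 1) (i + 1) = 0 := by simp [pMinus, h]
      rw [e1, zero_add]
      unfold pPlus
      rcases h2 : C.letter (i + 1 + 1) with _ | η | η
      · simp
      · simp
      · have := hC.adj _ _ _ h h2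
        simp only [smul_smul]
        rw [pathVal_mul_eq_zero hϑ μ η this.2, zero_smul]
    · have : pGen ϑ C (n + 1) (i + 1) = 0 := by
        unfold pGen
        rw [dif_neg h0]
      rw [this]
      simp

lemma pDiff_pMinus (hϑ : IsCompleteGentle ϑ) (C : Seqn V (Letter (GPath R Q)))
    (hC : IsGenWord C) (n i : ℤ) : pDiff ϑ C (n + 1) (pMinus ϑ C n i) = 0 := by
  unfold pMinus
  rcases h : C.letter i with _ | μ | μ
  · simp
  · simp only [map_smul]
    have h' : C.letter (i - 1 + 1) = some (Letter.dir μ) := by rw [sub_add_cancel, h]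
    by_cases h0 : i - 1 ∈ C.idx ∧ height C (i - 1) = n + 1
    · have hd : pDiff ϑ C (n + 1) (pGen ϑ C (n + 1) (i - 1)) =
          idemp ϑ (C.vtx ghead (i - 1)) •
            (pMinus ϑ C (n + 1) (i - 1) + pPlus ϑ C (n + 1) (i - 1)) := by
        classical
        unfold pGen
        rw [dif_pos h0, pDiff]
        erw [DirectSum.toModule_lof]
        simp
      rw [hd, vtx_of_letter_succ C hC _ _ h', smul_smul]
      have e : ghead (Letter.dir μ) = μ.tl := rfl
      rw [e, pathVal_mul_idemp]
      have e1 : pPlus ϑ C (n + 1) (i - 1) = 0 := by simp [pPlus, h]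
      rw [e1, add_zero]
      unfold pMinus
      rcases h2 : C.letter (i - 1) with _ | η | η
      · simp
      · have := hC.adj _ _ _ h2 h'
        simp only [smul_smul]
        rw [pathVal_mul_eq_zero hϑ μ η this.2, zero_smul]
      · simp
    · have : pGen ϑ C (n + 1) (i - 1) = 0 := by
        unfold pGen
        rw [dif_neg h0]
      rw [this]
      simp
  · simp

lemma pDiff_comp_pDiff (hϑ : IsCompleteGentle ϑ) (C : Seqn V (Letter (GPath R Q)))
    (hC : IsGenWord C) (n : ℤ) : (pDiff ϑ C (n + 1)).comp (pDiff ϑ C n) = 0 := by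
  classical
  refine DirectSum.linearMap_ext Λ fun i => LinearMap.ext fun a => ?_
  simp only [LinearMap.comp_apply, LinearMap.zero_apply]
  have : pDiff ϑ C n (DirectSum.lof Λ _ _ i a) =
      (a : Λ) • (pMinus ϑ C n i.1 + pPlus ϑ C n i.1) := by
    rw [pDiff]
    erw [DirectSum.toModule_lof]
    simp
  erw [this]
  rw [map_smul, map_add, pDiff_pPlus hϑ C hC, pDiff_pMinus hϑ C hC, add_zero, smul_zero]

/-- The string complex `P(C)` of a generalised word. -/
noncomputable def stringComplex (hϑ : IsCompleteGentle ϑ) (C : Seqn V (Letter (GPath R Q)))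
    (hC : IsGenWord C) : CochainComplex (ModuleCat Λ) ℤ :=
  CochainComplex.of (fun n => ModuleCat.of Λ (StringP ϑ C n)) (fun n => ModuleCat.ofHom (pDiff ϑ C n))
    (fun n => by
      rw [← ModuleCat.ofHom_comp, pDiff_comp_pDiff hϑ C hC n]
      rfl)

end GenWords

/-! ## Resolutions -/

/-- `P` is a complex of projective modules which is a resolution in degree `d`. -/
def IsResolutionInDegree {Λ : Type*} [Ring Λ] (P : CochainComplex (ModuleCat Λ) ℤ) (d : ℤ) :
    Prop :=
  (∀ n, Module.Projective Λ (P.X n)) ∧ (∀ l, d < l → Limits.IsZero (P.X l)) ∧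
    ∀ m, m ≠ d → Limits.IsZero (P.homology m)

/-- `P` is a (projective) resolution of the module `M`. -/
def IsResolutionOf {Λ : Type*} [Ring Λ] (P : CochainComplex (ModuleCat Λ) ℤ)
    (M : ModuleCat Λ) : Prop :=
  IsResolutionInDegree P 0 ∧ Nonempty (P.homology 0 ≅ M)

/-! The combinatorial half rests on a common normal form. A string word is `B⁻¹(AD)` and a string
resolution is `ℬ⁻¹(𝒜𝒟)`, where `A` and `𝒜` are two readings of the same data: a trivial word, or a
list of pairs of paths. This datum is a `Core`. The tails `B`, `D` consist of inverse letters and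
`ℬ`, `𝒟` of direct generalised letters, whereas a non-trivial core begins with a letter of the class
found in the tails and ends with the inverse of such a letter. Hence the decomposition is unique
(`Core.word_injective`, `Core.genWord_injective`), and it remains to match tails with a given head
and sign.

A tail of a word that cannot be prolonged corresponds to the trivial tail. Any other tail `D` is
finite and has exactly one prolongation `x⁻¹`; the path `β = xD⁻¹` then starts a maximal chain
`⟨β⟩⟨a₁⟩⟨a₂⟩⋯` in which each arrow annihilates the preceding path from the left. Gentleness makes
this chain unique, and `D` is recovered by removing the last arrow of `β`. The trivial tail comes
from the unique maximal inverse continuation. This is `existsUnique_tailRes` and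
`existsUnique_wTail`. The lemmas `Core.isResolutionWord_iff` and `Core.isHomologyWord_iff` identify
both constructions with this correspondence of tails.

For exactness, the height alternates between two values on the core and decreases along both tails.
In a cycle every coefficient is annihilated by the adjacent paths that act on it, because left
ideals of distinct arrows meet in zero. At a position inside the core that is not of maximal height,
two paths with different last arrows annihilate the coefficient, so it vanishes. In the tails the
annihilator of a path is zero or generated by the arrow that stops it, which is the next letter; so
the coefficient is a boundary. These are `eq_zero_of_annihilates_two`, `annihilator_path` and
`mem_range_pDiff`.

The annihilator statement needs `c x γ = 0` to imply `c x = 0` when `xγ` lies in `P`. Otherwise `c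
x` would be a left multiple of arbitrarily long paths ending on the right in `x`. Since `Λx` is
finitely generated over a noetherian local ring, it would lie in `𝔪^k Λx` for all `k`, contrary to
Krull's intersection theorem.

In the top degree the homology is a cokernel. Its generators sit at the positions of maximal height,
which correspond to the peaks of the word, and the boundaries are the defining relations of `M(C)`
up to replacing `g_i` by `(-1)^i g_i` (`Core.exists_equiv_map_eq_range`). -/

set_option linter.unusedSectionVars false

/-! ### Paths outside a quadratic monomial ideal -/

section PathIdeal

variable {V A : Type*} [Fintype V] {R : Type*} [CommRing R] {Q : BoundQuiver V A}

/-- The vertex at position `i` of a path. -/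
def pathVertex (Q : BoundQuiver V A) (p : List A) (hp : p ≠ []) (i : ℕ) : V :=
  if h : i < p.length then Q.hd p[i] else Q.tl (p.getLast hp)

open Classical in
/-- The free algebra acting on functions on the positions of a path. -/
noncomputable def pathRepFree (R : Type*) [CommRing R] (Q : BoundQuiver V A) (p : List A)
    (hp : p ≠ []) : FreeAlgebra R (V ⊕ A) →ₐ[R] Module.End R (ℕ → R) :=
  FreeAlgebra.lift R (Sum.elim
    (fun v => { toFun := fun f i => if pathVertex Q p hp i = v then f i else 0
                map_add' := fun f g => by ext i; simp only [Pi.add_apply]; split_ifs <;> simp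
                map_smul' := fun r f => by ext i; simp })
    -- Lists of arrows run from the last arrow to the first: position `i` is the head of the `i`-th
    -- entry and `i + 1` its tail, so an arrow carries the value at `i + 1` to `i`.
    (fun x => { toFun := fun f i => if p[i]? = some x then f (i + 1) else 0
                map_add' := fun f g => by ext i; simp only [Pi.add_apply]; split_ifs <;> simp
                map_smul' := fun r f => by ext i; simp }))

lemma pathRepFree_inl (p : List A) (hp : p ≠ []) (v : V) (f : ℕ → R) (i : ℕ)
    [Decidable (pathVertex Q p hp i = v)] :
    pathRepFree R Q p hp (FreeAlgebra.ι R (Sum.inl v)) f i =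
      if pathVertex Q p hp i = v then f i else 0 := by
  simp only [pathRepFree, FreeAlgebra.lift_ι_apply, Sum.elim_inl, LinearMap.coe_mk, AddHom.coe_mk]
  congr

lemma pathRepFree_inr (p : List A) (hp : p ≠ []) (x : A) (f : ℕ → R) (i : ℕ)
    [Decidable (p[i]? = some x)] :
    pathRepFree R Q p hp (FreeAlgebra.ι R (Sum.inr x)) f i =
      if p[i]? = some x then f (i + 1) else 0 := by
  simp only [pathRepFree, FreeAlgebra.lift_ι_apply, Sum.elim_inr, LinearMap.coe_mk, AddHom.coe_mk]
  congr

lemma pathVertex_succ (p : List A) (hp : Q.IsPath p) (i : ℕ) (h : i < p.length) :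
    pathVertex Q p hp.1 (i + 1) = Q.tl p[i] := by
  unfold pathVertex
  split_ifs with h1
  · exact (List.isChain_iff_getElem.1 hp.2 i h1).symm
  · congr 1
    rw [List.getLast_eq_getElem]
    congr 1
    omega

lemma pathRepFree_rel (p : List A) (hp : Q.IsPath p) ⦃a b : FreeAlgebra R (V ⊕ A)⦄
    (h : PathRel R Q a b) : pathRepFree R Q p hp.1 a = pathRepFree R Q p hp.1 b := by
  classical
  refine LinearMap.ext fun f => funext fun i => ?_
  cases h with
  | idem v =>
    simp only [map_mul, Module.End.mul_apply, pathRepFree_inl]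
    split_ifs <;> rfl
  | orth v w hvw =>
    simp only [map_mul, Module.End.mul_apply, pathRepFree_inl, map_zero, LinearMap.zero_apply,
      Pi.zero_apply]
    split_ifs with h1 h2
    · exact absurd (h1.symm.trans h2) hvw
    · rfl
    · rfl
  | one =>
    simp [map_sum, LinearMap.sum_apply, Finset.sum_apply, pathRepFree_inl]
  | head x =>
    simp only [map_mul, Module.End.mul_apply, pathRepFree_inl, pathRepFree_inr]
    by_cases h : p[i]? = some x
    · obtain ⟨hi, rfl⟩ := List.getElem?_eq_some_iff.1 h
      simp [pathVertex, hi]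
    · simp [h]
  | tail x =>
    simp only [map_mul, Module.End.mul_apply, pathRepFree_inl, pathRepFree_inr]
    by_cases h : p[i]? = some x
    · obtain ⟨hi, rfl⟩ := List.getElem?_eq_some_iff.1 h
      simp [pathVertex_succ p hp i hi]
    · simp [h]

/-- The path algebra acting on functions on the positions of a path. -/
noncomputable def pathRep (R : Type*) [CommRing R] (p : List A) (hp : Q.IsPath p) :
    PathAlgebra R Q →ₐ[R] Module.End R (ℕ → R) :=
  RingQuot.liftAlgHom R ⟨pathRepFree R Q p hp.1, pathRepFree_rel p hp⟩

lemma pathRep_arrow (p : List A) (hp : Q.IsPath p) (x : A) (f : ℕ → R) (i : ℕ)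
    [Decidable (p[i]? = some x)] :
    pathRep R p hp (arrowElt R Q x) f i = if p[i]? = some x then f (i + 1) else 0 := by
  rw [pathRep, arrowElt, RingQuot.liftAlgHom_mkAlgHom_apply, pathRepFree_inr]

/-- Each arrow of the suffix reads the entry one position further on, so the action telescopes to
the value at the tail of `p`. For `l = []` this shows that `p` itself acts non-trivially. -/
lemma pathRep_suffix (p : List A) (hp : Q.IsPath p) (l q : List A) (h : p = l ++ q) (f : ℕ → R) :
    pathRep R p hp (pathElt R Q q) f l.length = f p.length := by
  classical
  induction q generalizing l with
  | nil => simp [pathElt, h]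
  | cons x q ih =>
    have := ih (l ++ [x]) (by simp [h])
    have e : pathElt R Q (x :: q) = arrowElt R Q x * pathElt R Q q := by simp [pathElt]
    rw [e, map_mul, Module.End.mul_apply, pathRep_arrow, if_pos (by simp [h])]
    simpa using this

lemma pathElt_mem_relIdeal_of_mem_rel {x y : A} (h : (x, y) ∈ Q.rel) :
    pathElt R Q [x, y] ∈ relIdeal R Q :=
  TwoSidedIdeal.subset_span ⟨(x, y), h, rfl⟩

/-- In the representation on the positions of `p`, a product of two arrows acts non-trivially only
if these arrows are consecutive in `p`. So the generators of the ideal act by zero, while `p` sends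
the constant function `1` to a function with value `1` at position `0`. -/
lemma pathElt_notMem_relIdeal [Nontrivial R] (p : List A) (hp : Q.IsPath p)
    (h : p.IsChain (fun x y => pathElt R Q [x, y] ∉ relIdeal R Q)) :
    pathElt R Q p ∉ relIdeal R Q := by
  classical
  intro hmem
  have hle : relIdeal R Q ≤ TwoSidedIdeal.ker (pathRep R p hp) := by
    refine TwoSidedIdeal.span_le.2 ?_
    rintro z ⟨⟨x, y⟩, hxy, rfl⟩
    rw [SetLike.mem_coe, TwoSidedIdeal.mem_ker]
    refine LinearMap.ext fun f => funext fun i => ?_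
    have e : pathElt R Q [x, y] = arrowElt R Q x * arrowElt R Q y := by simp [pathElt]
    simp only [e, map_mul, Module.End.mul_apply, pathRep_arrow, LinearMap.zero_apply, Pi.zero_apply]
    split_ifs with h1 h2
    · exfalso
      obtain ⟨hi, rfl⟩ := List.getElem?_eq_some_iff.1 h1
      obtain ⟨hi', rfl⟩ := List.getElem?_eq_some_iff.1 h2
      exact List.isChain_iff_getElem.1 h i hi' (pathElt_mem_relIdeal_of_mem_rel hxy)
    · rfl
    · rfl
  have h0 := (TwoSidedIdeal.mem_ker _).1 (hle hmem)
  have h1 := pathRep_suffix (R := R) p hp [] p rfl (fun _ => 1)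
  rw [h0] at h1
  simp at h1

lemma pathElt_mem_of_infix (l p q : List A) (h : pathElt R Q p ∈ relIdeal R Q) :
    pathElt R Q (l ++ p ++ q) ∈ relIdeal R Q := by
  rw [pathElt_append, pathElt_append]
  exact TwoSidedIdeal.mul_mem_right _ _ _ (TwoSidedIdeal.mul_mem_left _ _ _ h)

lemma isChain_of_pathElt_notMem (p : List A) (h : pathElt R Q p ∉ relIdeal R Q) :
    p.IsChain (fun x y => pathElt R Q [x, y] ∉ relIdeal R Q) := by
  rw [List.isChain_iff_forall_rel_of_append_cons_cons]
  rintro x y l l' rfl h'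
  apply h
  have := pathElt_mem_of_infix l [x, y] l' h'
  simpa using this

/-- The condition that `x y` is a path outside the ideal. -/
def Follows (R : Type*) [CommRing R] (Q : BoundQuiver V A) (x y : A) : Prop :=
  Q.tl x = Q.hd y ∧ pathElt R Q [x, y] ∉ relIdeal R Q

/-- The ideal is generated by paths of length two, so membership is detected on consecutive arrows.
From here on, `P` is the set of non-empty chains for `Follows`. -/
lemma isPath_notMem_iff [Nontrivial R] (p : List A) :
    (Q.IsPath p ∧ pathElt R Q p ∉ relIdeal R Q) ↔ p ≠ [] ∧ p.IsChain (Follows R Q) := by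
  constructor
  · rintro ⟨h1, h2⟩
    refine ⟨h1.1, ?_⟩
    have := isChain_of_pathElt_notMem p h2
    have h3 := h1.2
    rw [List.isChain_iff_getElem] at this h3 ⊢
    exact fun i hi => ⟨h3 i hi, this i hi⟩
  · rintro ⟨h1, h2⟩
    have h3 : Q.IsPath p := ⟨h1, h2.imp fun _ _ h => h.1⟩
    exact ⟨h3, pathElt_notMem_relIdeal p h3 (h2.imp fun _ _ h => h.2)⟩

/-- The path with the given arrows. -/
def GPath.mk [Nontrivial R] (p : List A) (hp : p ≠ []) (h : p.IsChain (Follows R Q)) : GPath R Q :=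
  ⟨p, (isPath_notMem_iff p).2 ⟨hp, h⟩⟩

lemma GPath.isChain [Nontrivial R] (γ : GPath R Q) : γ.1.IsChain (Follows R Q) :=
  ((isPath_notMem_iff γ.1).1 γ.2).2

lemma GPath.ne_nil (γ : GPath R Q) : γ.1 ≠ [] := γ.2.1.1

end PathIdeal

/-! ### Left annihilators of paths in a complete gentle algebra -/

section Annihilator

/-- A quotient of a noetherian local ring by a power of the maximal ideal is artinian. -/
lemma isArtinianRing_quotient_maximalIdeal_pow (R : Type*) [CommRing R] [IsNoetherianRing R]
    [IsLocalRing R] (k : ℕ) : IsArtinianRing (R ⧸ IsLocalRing.maximalIdeal R ^ k) :=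
  have : Ring.KrullDimLE 0 (R ⧸ IsLocalRing.maximalIdeal R ^ k) :=
    Ring.krullDimLE_zero_iff.mpr fun J prime ↦
      Ideal.isMaximal_of_isIntegral_of_isMaximal_comap _ <| by
        -- A prime of the quotient contracts to a prime containing a power of the maximal ideal,
        -- hence to the maximal ideal itself.
        have hp := prime.comap (Ideal.Quotient.mk (IsLocalRing.maximalIdeal R ^ k))
        have h1 : IsLocalRing.maximalIdeal R ^ k ≤
            J.comap (Ideal.Quotient.mk (IsLocalRing.maximalIdeal R ^ k)) :=
          .trans (by simp) (Ideal.ker_le_comap _)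
        have h2 := le_antisymm (IsLocalRing.le_maximalIdeal hp.ne_top) (hp.le_of_pow_le h1)
        change (J.comap (Ideal.Quotient.mk (IsLocalRing.maximalIdeal R ^ k))).IsMaximal
        rw [h2]
        exact IsLocalRing.maximalIdeal.isMaximal R
  IsNoetherianRing.isArtinianRing_of_krullDimLE_zero

/-- A descending chain of submodules of a finitely generated module over a noetherian local ring
becomes stationary modulo any power of the maximal ideal. -/
lemma exists_stationary_mod_pow {R : Type*} [CommRing R] [IsNoetherianRing R] [IsLocalRing R]
    {M : Type*} [AddCommGroup M] [Module R M] (N : Submodule R M) (hN : N.FG)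
    (F : ℕ → Submodule R M) (hF : ∀ n, F (n + 1) ≤ F n) (hFN : ∀ n, F n ≤ N) (k : ℕ) :
    ∃ n, ∀ z ∈ F n, ∃ z' ∈ F (n + 1), z - z' ∈ IsLocalRing.maximalIdeal R ^ k • N := by
  have := isArtinianRing_quotient_maximalIdeal_pow R k
  set I := IsLocalRing.maximalIdeal R ^ k
  have hfin : Module.Finite R N := Module.Finite.iff_fg.2 hN
  have hfin' : Module.Finite (R ⧸ I) (N ⧸ I • (⊤ : Submodule R N)) :=
    Module.Finite.of_restrictScalars_finite R _ _
  have hart : IsArtinian R (N ⧸ I • (⊤ : Submodule R N)) :=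
    isArtinian_of_surjective_algebraMap (R := R ⧸ I) (S := R) Ideal.Quotient.mk_surjective
  let G : ℕ →o (Submodule R (N ⧸ I • (⊤ : Submodule R N)))ᵒᵈ :=
    ⟨fun n => OrderDual.toDual (((F n).comap N.subtype).map (Submodule.mkQ _)),
      monotone_nat_of_le_succ fun n => OrderDual.toDual_le_toDual.2
        (Submodule.map_mono (Submodule.comap_mono (hF n)))⟩
  obtain ⟨n, hn⟩ := IsArtinian.monotone_stabilizes G
  refine ⟨n, fun z hz => ?_⟩
  have h1 : ((F n).comap N.subtype).map (Submodule.mkQ (I • (⊤ : Submodule R N))) =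
      ((F (n + 1)).comap N.subtype).map (Submodule.mkQ (I • (⊤ : Submodule R N))) :=
    hn (n + 1) (Nat.le_succ n)
  have h2 : Submodule.mkQ (I • (⊤ : Submodule R N)) ⟨z, hFN n hz⟩ ∈
      ((F (n + 1)).comap N.subtype).map (Submodule.mkQ (I • (⊤ : Submodule R N))) := by
    rw [← h1]
    exact Submodule.mem_map_of_mem hz
  obtain ⟨z', hz', e⟩ := h2
  refine ⟨z', hz', ?_⟩
  have h3 : (⟨z, hFN n hz⟩ : N) - z' ∈ I • (⊤ : Submodule R N) :=
    (Submodule.Quotient.eq _).1 e.symm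
  exact (Submodule.mem_smul_top_iff I N _).1 h3

lemma mem_smul_mul_left {R : Type*} [CommRing R] {Λ : Type*} [Ring Λ] [Algebra R Λ] (I : Ideal R)
    (N : Submodule R Λ) (hN : ∀ a : Λ, ∀ z ∈ N, a * z ∈ N) (a z : Λ) (hz : z ∈ I • N) :
    a * z ∈ I • N := by
  refine Submodule.smul_induction_on hz (fun r hr n hn => ?_) (fun x y hx hy => ?_)
  · rw [mul_smul_comm]
    exact Submodule.smul_mem_smul hr (hN a n hn)
  · rw [mul_add]
    exact add_mem hx hy

/-- Krull's intersection theorem for the finitely generated module `N`, phrased for elements of the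
ambient module. -/
lemma eq_zero_of_forall_mem_pow_smul {R : Type*} [CommRing R] [IsNoetherianRing R] [IsLocalRing R]
    {M : Type*} [AddCommGroup M] [Module R M] (N : Submodule R M) (hN : N.FG) (z : M) (hz : z ∈ N)
    (h : ∀ k, z ∈ IsLocalRing.maximalIdeal R ^ k • N) : z = 0 := by
  have hfin : Module.Finite R N := Module.Finite.iff_fg.2 hN
  have h1 := Ideal.iInf_pow_smul_eq_bot_of_isLocalRing (M := N) (IsLocalRing.maximalIdeal R)
    (IsLocalRing.maximalIdeal.isMaximal R).ne_top
  have h2 : (⟨z, hz⟩ : N) ∈ (⨅ i : ℕ, IsLocalRing.maximalIdeal R ^ i • ⊤ : Submodule R N) := by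
    rw [Submodule.mem_iInf]
    exact fun i => (Submodule.mem_smul_top_iff _ N _).2 (h i)
  rw [h1] at h2
  exact congrArg Subtype.val ((Submodule.mem_bot R).1 h2)

variable {V A : Type*} [Fintype V] {R : Type*} [CommRing R] {Q : BoundQuiver V A}
  {Λ : Type*} [Ring Λ] [Algebra R Λ] {ϑ : PathAlgebra R Q →ₐ[R] Λ}

lemma idemp_mul_idemp (v : V) : idemp ϑ (some v) * idemp ϑ (some v) = idemp ϑ (some v) := by
  simp only [idemp, ← map_mul]
  congr 1
  rw [trivPath, ← map_mul]
  exact RingQuot.mkAlgHom_rel R (PathRel.idem v)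

lemma idemp_mul_arrow (x : A) :
    idemp ϑ (some (Q.hd x)) * ϑ (arrowElt R Q x) = ϑ (arrowElt R Q x) := by
  simp only [idemp, ← map_mul]
  congr 1
  rw [trivPath, arrowElt, ← map_mul]
  exact RingQuot.mkAlgHom_rel R (PathRel.head x)

lemma pathVal_cons (x : A) (p : List A) :
    pathVal ϑ (x :: p) = ϑ (arrowElt R Q x) * pathVal ϑ p := by
  simp [pathVal, pathElt]

lemma pathVal_append (p q : List A) : pathVal ϑ (p ++ q) = pathVal ϑ p * pathVal ϑ q := by
  simp [pathVal, pathElt]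

lemma pathVal_singleton (x : A) : pathVal ϑ [x] = ϑ (arrowElt R Q x) := by
  simp [pathVal, pathElt]

lemma idemp_mul_pathVal (p : List A) (hp : p ≠ []) :
    idemp ϑ (some (Q.hd (p.head hp))) * pathVal ϑ p = pathVal ϑ p := by
  obtain ⟨x, p, rfl⟩ := List.exists_cons_of_ne_nil hp
  rw [pathVal_cons, ← mul_assoc, List.head_cons, idemp_mul_arrow]

lemma mem_projMod_iff (v : V) (a : Λ) : a ∈ projMod ϑ (some v) ↔ a * idemp ϑ (some v) = a := by
  rw [Submodule.mem_span_singleton]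
  constructor
  · rintro ⟨b, rfl⟩
    rw [smul_eq_mul, mul_assoc, idemp_mul_idemp]
  · exact fun h => ⟨a, h⟩

/-- The radical of `Λ e_v`. -/
noncomputable def radProj (ϑ : PathAlgebra R Q →ₐ[R] Λ) (v : V) : Submodule Λ Λ :=
  Submodule.span Λ {z | ∃ x : A, Q.tl x = v ∧ z = ϑ (arrowElt R Q x)}

lemma radProj_covBy (hϑ : IsCompleteGentle ϑ) (v : V) : radProj ϑ v ⋖ projMod ϑ (some v) :=
  (hϑ.rad_left v _).2 rfl

/-- An element of `Λ e_v` outside the radical generates `Λ e_v`. -/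
lemma exists_mul_eq_idemp (hϑ : IsCompleteGentle ϑ) (v : V) (a : Λ)
    (ha : a ∈ projMod ϑ (some v)) (hr : a ∉ radProj ϑ v) : ∃ b, b * a = idemp ϑ (some v) := by
  by_contra hne
  have hle : Submodule.span Λ {a} ≤ projMod ϑ (some v) :=
    (Submodule.span_singleton_le_iff_mem _ _).2 ha
  -- The module `Λe_v` is cyclic, so a proper submodule lies in a maximal one; the radical is the
  -- only candidate.
  have hco : IsCoatomic (Set.Iic (projMod ϑ (some v))) :=
    CompleteLattice.Iic_coatomic_of_compact_element (Submodule.singleton_span_isCompactElement _)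
  rcases hco.eq_top_or_exists_le_coatom ⟨_, hle⟩ with h | ⟨N, hN, hle'⟩
  · have h1 : Submodule.span Λ {a} = projMod ϑ (some v) := congrArg Subtype.val h
    have h2 : idemp ϑ (some v) ∈ Submodule.span Λ {a} :=
      h1 ▸ Submodule.mem_span_singleton_self _
    exact hne (Submodule.mem_span_singleton.1 h2)
  · have h1 := Set.Iic.isCoatom_iff.1 hN
    have h2 : (N : Submodule Λ Λ) = radProj ϑ v := (hϑ.rad_left v _).1 h1
    exact hr (h2 ▸ hle' (Submodule.mem_span_singleton_self a))

lemma idemp_notMem_radProj (hϑ : IsCompleteGentle ϑ) (v : V) : idemp ϑ (some v) ∉ radProj ϑ v := by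
  intro h
  exact (radProj_covBy hϑ v).lt.not_ge ((Submodule.span_singleton_le_iff_mem _ _).2 h)

lemma pathVal_ne_zero (hϑ : IsCompleteGentle ϑ) (γ : GPath R Q) : pathVal ϑ γ.1 ≠ 0 :=
  hϑ.map_path γ.1 γ.2.1 γ.2.2

/-- The elements of the radical of `Λ e_v`, where `v` is the head of the arrow `y`. -/
lemma mem_radProj_decomp (hϑ : IsCompleteGentle ϑ) (y : A) (a : Λ)
    (ha : a ∈ radProj ϑ (Q.hd y)) :
    ∃ a₁ a₂ : Λ, a = a₁ + a₂ ∧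
      (a₁ = 0 ∨ ∃ (x : A) (c : Λ), Follows R Q x y ∧ c ∈ projMod ϑ (some (Q.hd x)) ∧
        a₁ = c * ϑ (arrowElt R Q x)) ∧
      (a₂ = 0 ∨ ∃ (x : A) (c : Λ), Q.tl x = Q.hd y ∧ pathElt R Q [x, y] ∈ relIdeal R Q ∧
        c ∈ projMod ϑ (some (Q.hd x)) ∧ a₂ = c * ϑ (arrowElt R Q x)) := by
  have hc : ∀ (c : Λ) (x : A), c * idemp ϑ (some (Q.hd x)) * ϑ (arrowElt R Q x) =
      c * ϑ (arrowElt R Q x) := fun c x => by rw [mul_assoc, idemp_mul_arrow]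
  have hc' : ∀ (c : Λ) (x : A), c * idemp ϑ (some (Q.hd x)) ∈ projMod ϑ (some (Q.hd x)) :=
    fun c x => by rw [mem_projMod_iff, mul_assoc, idemp_mul_idemp]
  refine Submodule.span_induction (p := fun a _ => ∃ a₁ a₂ : Λ, a = a₁ + a₂ ∧
      (a₁ = 0 ∨ ∃ (x : A) (c : Λ), Follows R Q x y ∧ c ∈ projMod ϑ (some (Q.hd x)) ∧
        a₁ = c * ϑ (arrowElt R Q x)) ∧
      (a₂ = 0 ∨ ∃ (x : A) (c : Λ), Q.tl x = Q.hd y ∧ pathElt R Q [x, y] ∈ relIdeal R Q ∧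
        c ∈ projMod ϑ (some (Q.hd x)) ∧ a₂ = c * ϑ (arrowElt R Q x))) ?_ ?_ ?_ ?_ ha
  · rintro z ⟨x, hx, rfl⟩
    by_cases h : pathElt R Q [x, y] ∈ relIdeal R Q
    · exact ⟨0, _, (zero_add _).symm, Or.inl rfl, Or.inr ⟨x, _, hx, h, hc' 1 x, by rw [hc, one_mul]⟩⟩
    · exact ⟨_, 0, (add_zero _).symm, Or.inr ⟨x, _, ⟨hx, h⟩, hc' 1 x, by rw [hc, one_mul]⟩, Or.inl rfl⟩
  · exact ⟨0, 0, by simp, Or.inl rfl, Or.inl rfl⟩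
  · rintro a b - - ⟨a₁, a₂, rfl, ha₁, ha₂⟩ ⟨b₁, b₂, rfl, hb₁, hb₂⟩
    -- At most one arrow continues `y` inside `P` and at most one stops it, so two summands of the
    -- same kind involve the same arrow and their coefficients add.
    refine ⟨a₁ + b₁, a₂ + b₂, by abel, ?_, ?_⟩
    · rcases ha₁ with rfl | ⟨x, c, hx, hcx, rfl⟩
      · rwa [zero_add]
      · rcases hb₁ with rfl | ⟨x', c', hx', hcx', rfl⟩
        · rw [add_zero]
          exact Or.inr ⟨x, c, hx, hcx, rfl⟩
        · obtain rfl : x = x' := Set.encard_le_one_iff.1 (hϑ.cont_left y) x x' hx hx'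
          exact Or.inr ⟨x, c + c', hx, add_mem hcx hcx', by rw [add_mul]⟩
    · rcases ha₂ with rfl | ⟨x, c, hx, hx2, hcx, rfl⟩
      · rwa [zero_add]
      · rcases hb₂ with rfl | ⟨x', c', hx', hx2', hcx', rfl⟩
        · rw [add_zero]
          exact Or.inr ⟨x, c, hx, hx2, hcx, rfl⟩
        · obtain rfl : x = x' :=
            Set.encard_le_one_iff.1 (hϑ.stop_left y) x x' ⟨hx, hx2⟩ ⟨hx', hx2'⟩
          exact Or.inr ⟨x, c + c', hx, hx2, add_mem hcx hcx', by rw [add_mul]⟩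
  · rintro r a - ⟨a₁, a₂, rfl, ha₁, ha₂⟩
    refine ⟨r * a₁, r * a₂, by rw [smul_eq_mul, mul_add], ?_, ?_⟩
    · rcases ha₁ with rfl | ⟨x, c, hx, hcx, rfl⟩
      · exact Or.inl (mul_zero _)
      · exact Or.inr ⟨x, r * c, hx, Submodule.smul_mem _ r hcx, by rw [mul_assoc]⟩
    · rcases ha₂ with rfl | ⟨x, c, hx, hx2, hcx, rfl⟩
      · exact Or.inl (mul_zero _)
      · exact Or.inr ⟨x, r * c, hx, hx2, Submodule.smul_mem _ r hcx, by rw [mul_assoc]⟩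

/-- Elements that are divisible by arbitrarily long paths vanish. -/
lemma eq_zero_of_forall_mem_range [IsNoetherianRing R] [IsLocalRing R] (hϑ : IsCompleteGentle ϑ)
    (x : A) (y : ℕ → A) (q : ℕ → List A) (h0 : q 0 = [x]) (hq : ∀ n, q (n + 1) = y n :: q n)
    (hpath : ∀ n, Q.IsPath (q n)) (u : Λ) (hu : ∀ n, ∃ c, u = c * pathVal ϑ (q n)) : u = 0 := by
  set N := LinearMap.range (LinearMap.mulRight R (ϑ (arrowElt R Q x))) with hNdef
  have hN : N.FG := hϑ.fg_left x
  have hNl : ∀ a : Λ, ∀ z ∈ N, a * z ∈ N := by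
    rintro a _ ⟨c, rfl⟩
    exact ⟨a * c, by simp [mul_assoc]⟩
  let F : ℕ → Submodule R Λ := fun n => LinearMap.range (LinearMap.mulRight R (pathVal ϑ (q n)))
  have hF : ∀ n, F (n + 1) ≤ F n := by
    rintro n _ ⟨c, rfl⟩
    exact ⟨c * ϑ (arrowElt R Q (y n)), by simp [hq, pathVal_cons, mul_assoc]⟩
  have hF0 : F 0 = N := by simp only [F, h0, pathVal_singleton, hNdef]
  have hFN : ∀ n, F n ≤ N := by
    intro n
    induction n with
    | zero => exact hF0.le
    | succ n ih => exact (hF n).trans ih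
  have huN : u ∈ N := by
    obtain ⟨c, hc⟩ := hu 0
    exact hF0 ▸ ⟨c, hc.symm⟩
  refine eq_zero_of_forall_mem_pow_smul N hN u huN fun k => ?_
  -- Stationarity, applied to the path `q n` itself, gives `q n ≡ c (y n) (q n)` modulo `𝔪^k N`. The
  -- element `τ` below is `e_v` minus an element of the radical; it has a left inverse relative to
  -- `e_v`, so `q n`, and with it `u`, lies in `𝔪^k N`.
  obtain ⟨n, hn⟩ := exists_stationary_mod_pow N hN F hF hFN k
  obtain ⟨_, ⟨c, rfl⟩, hz⟩ := hn (pathVal ϑ (q n)) ⟨1, by simp⟩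
  simp only [LinearMap.mulRight_apply, hq, pathVal_cons] at hz
  set v := Q.hd ((q n).head (hpath n).1) with hv
  have hyn : Q.tl (y n) = v := by
    have h1 := (hpath (n + 1)).2
    rw [hq] at h1
    obtain ⟨a, l, e⟩ := List.exists_cons_of_ne_nil (hpath n).1
    simp only [hv, e, List.head_cons]
    rw [e] at h1
    exact (List.isChain_cons_cons.1 h1).1
  have hr : idemp ϑ (some v) * (c * ϑ (arrowElt R Q (y n))) ∈ radProj ϑ v := by
    rw [← mul_assoc]
    exact Submodule.smul_mem _ _ (Submodule.subset_span ⟨y n, hyn, rfl⟩)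
  set τ := idemp ϑ (some v) - idemp ϑ (some v) * (c * ϑ (arrowElt R Q (y n))) with hτ
  have hτm : τ ∈ projMod ϑ (some v) :=
    sub_mem (Submodule.mem_span_singleton_self _) ((radProj_covBy hϑ v).le hr)
  have hτr : τ ∉ radProj ϑ v := fun h => idemp_notMem_radProj hϑ v (by
    have := add_mem h hr
    rwa [hτ, sub_add_cancel] at this)
  obtain ⟨b, hb⟩ := exists_mul_eq_idemp hϑ v τ hτm hτr
  have hmem : pathVal ϑ (q n) ∈ IsLocalRing.maximalIdeal R ^ k • N := by
    have h1 : pathVal ϑ (q n) = b * (idemp ϑ (some v) * (pathVal ϑ (q n) -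
        c * (ϑ (arrowElt R Q (y n)) * pathVal ϑ (q n)))) := by
      have h2 : idemp ϑ (some v) * (pathVal ϑ (q n) -
        c * (ϑ (arrowElt R Q (y n)) * pathVal ϑ (q n))) = τ * pathVal ϑ (q n) := by
        rw [hτ]; noncomm_ring
      rw [h2, ← mul_assoc, hb, idemp_mul_pathVal]
    rw [h1]
    exact mem_smul_mul_left _ N hNl _ _ (mem_smul_mul_left _ N hNl _ _ hz)
  obtain ⟨d, rfl⟩ := hu n
  exact mem_smul_mul_left _ N hNl _ _ hmem

/-- If `c x γ = 0` for an arrow `x` such that `x γ` is a path outside the ideal, then `c x = 0`. -/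
lemma mul_arrow_eq_zero [IsNoetherianRing R] [IsLocalRing R] (hϑ : IsCompleteGentle ϑ)
    (γ : GPath R Q) (x : A) (hx : Follows R Q x γ.last) (c : Λ)
    (hc : c ∈ projMod ϑ (some (Q.hd x)))
    (h : c * ϑ (arrowElt R Q x) * pathVal ϑ γ.1 = 0) : c * ϑ (arrowElt R Q x) = 0 := by
  by_contra hu
  set u := c * ϑ (arrowElt R Q x) with hudef
  -- The paths `p` through which `u` factors and which can be composed with `γ` inside `P`. As long
  -- as `u ≠ 0`, such a path can be prolonged on the left.
  let S : List A → Prop := fun p => p ≠ [] ∧ (p ++ γ.1).IsChain (Follows R Q) ∧ ∃ d : Λ,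
    (∃ hp : p ≠ [], d ∈ projMod ϑ (some (Q.hd (p.head hp)))) ∧ u = d * pathVal ϑ p
  have hS0 : S [x] := by
    refine ⟨by simp, ?_, c, ⟨by simp, by simpa using hc⟩, by rw [pathVal_singleton]⟩
    obtain ⟨a, l, e⟩ := List.exists_cons_of_ne_nil γ.ne_nil
    have h1 : γ.last = a := by simp [GPath.last, e]
    have h2 := γ.isChain
    rw [e] at h2 ⊢
    exact List.isChain_cons_cons.2 ⟨h1 ▸ hx, h2⟩
  have hstep : ∀ p, S p → ∃ z, S (z :: p) := by
    rintro p ⟨hp, hch, d, ⟨_, hd⟩, hud⟩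
    have hγ : idemp ϑ (some (Q.hd (p.head hp))) * (pathVal ϑ p * pathVal ϑ γ.1) ≠ 0 := by
      rw [← mul_assoc, idemp_mul_pathVal, ← pathVal_append]
      exact pathVal_ne_zero hϑ (GPath.mk (p ++ γ.1) (by simp [hp]) hch)
    -- Outside the radical `d` could be cancelled from `d p γ = u γ = 0`, which contradicts `p γ ≠
    -- 0`.
    have hrad : d ∈ radProj ϑ (Q.hd (p.head hp)) := by
      by_contra hr
      obtain ⟨b, hb⟩ := exists_mul_eq_idemp hϑ _ d hd hr
      apply hγ
      rw [← hb, mul_assoc, ← mul_assoc d, ← hud, h, mul_zero]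
    obtain ⟨a₁, a₂, e, h1, h2⟩ := mem_radProj_decomp hϑ _ _ hrad
    -- This summand ends in the arrow that stops the last arrow of `p`, so only the summand that
    -- continues `p` contributes to `u`.
    have ha₂ : a₂ * pathVal ϑ p = 0 := by
      rcases h2 with rfl | ⟨z, d', -, hrel, -, rfl⟩
      · exact zero_mul _
      · obtain ⟨a, l, rfl⟩ := List.exists_cons_of_ne_nil hp
        have := hϑ.map_ideal _ hrel
        simp only [List.head_cons, pathElt, List.map_cons, List.map_nil, List.prod_cons,
          List.prod_nil, mul_one, map_mul] at this
        rw [pathVal_cons, mul_assoc, ← mul_assoc (ϑ (arrowElt R Q z)), this, zero_mul, mul_zero]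
    have hud' : u = a₁ * pathVal ϑ p := by rw [hud, e, add_mul, ha₂, add_zero]
    rcases h1 with rfl | ⟨z, d', hz, hd', rfl⟩
    · exact absurd (hud'.trans (zero_mul _)) hu
    · refine ⟨z, by simp, ?_, d', ⟨by simp, by simpa using hd'⟩, ?_⟩
      · obtain ⟨a, l, rfl⟩ := List.exists_cons_of_ne_nil hp
        exact List.isChain_cons_cons.2 ⟨hz, hch⟩
      · rw [pathVal_cons, hud', mul_assoc]
  have : Nonempty A := ⟨x⟩
  choose! z hz using hstep
  let q : ℕ → List A := fun n => Nat.rec [x] (fun _ p => z p :: p) n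
  have hq : ∀ n, S (q n) := by
    intro n
    induction n with
    | zero => exact hS0
    | succ n ih => exact hz _ ih
  refine hu (eq_zero_of_forall_mem_range hϑ x (fun n => z (q n)) q rfl (fun n => rfl)
    (fun n => ⟨(hq n).1, ?_⟩) u (fun n => ?_))
  · exact ((List.isChain_append.1 (hq n).2.1).1).imp fun _ _ h => h.1
  · obtain ⟨d, -, hd⟩ := (hq n).2.2
    exact ⟨d, hd⟩

/-- The left annihilator of a path `γ` is `0` or generated by the arrow `y` with `y γ = 0`. -/
lemma annihilator_path [IsNoetherianRing R] [IsLocalRing R] (hϑ : IsCompleteGentle ϑ)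
    (γ : GPath R Q) (a : Λ) (ha : a ∈ projMod ϑ (some γ.hd)) (h : a * pathVal ϑ γ.1 = 0) :
    a = 0 ∨ ∃ (y : A) (c : Λ), Q.tl y = γ.hd ∧ pathElt R Q [y, γ.last] ∈ relIdeal R Q ∧
      c ∈ projMod ϑ (some (Q.hd y)) ∧ a = c * ϑ (arrowElt R Q y) := by
  have hrad : a ∈ radProj ϑ γ.hd := by
    by_contra hr
    obtain ⟨b, hb⟩ := exists_mul_eq_idemp hϑ _ a ha hr
    apply pathVal_ne_zero hϑ γ
    have h1 := idemp_mul_pathVal (ϑ := ϑ) γ.1 γ.ne_nil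
    have h2 : idemp ϑ (some (Q.hd (γ.1.head γ.ne_nil))) = b * a := hb.symm
    rw [← h1, h2, mul_assoc, h, mul_zero]
  obtain ⟨a₁, a₂, rfl, h1, h2⟩ := mem_radProj_decomp hϑ _ _ hrad
  have ha₂ : a₂ * pathVal ϑ γ.1 = 0 := by
    rcases h2 with rfl | ⟨z, d', -, hrel, -, rfl⟩
    · exact zero_mul _
    · have e : γ.1 = γ.last :: γ.1.tail := by simp [GPath.last]
      have := hϑ.map_ideal _ hrel
      simp only [pathElt, List.map_cons, List.map_nil, List.prod_cons,
        List.prod_nil, mul_one, map_mul] at this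
      rw [e, pathVal_cons, mul_assoc, ← mul_assoc (ϑ (arrowElt R Q z)), this, zero_mul, mul_zero]
  have ha₁ : a₁ = 0 := by
    rw [add_mul, ha₂, add_zero] at h
    rcases h1 with rfl | ⟨z, d', hz, hd', rfl⟩
    · rfl
    · exact mul_arrow_eq_zero hϑ γ z hz d' hd' h
  rw [ha₁, zero_add]
  rcases h2 with h2 | ⟨y, c, hy, hrel, hc, e⟩
  · exact Or.inl h2
  · exact Or.inr ⟨y, c, hy, hrel, hc, e⟩

lemma mul_pathVal_mem_span (γ : GPath R Q) (a : Λ) :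
    a * pathVal ϑ γ.1 ∈ Submodule.span Λ {ϑ (arrowElt R Q γ.first)} := by
  have e1 : γ.1 = γ.1.dropLast ++ [γ.first] := (List.dropLast_append_getLast γ.2.1.1).symm
  rw [e1, pathVal_append, pathVal_singleton, ← mul_assoc]
  exact Submodule.smul_mem _ _ (Submodule.mem_span_singleton_self _)

/-- Paths with different first arrows generate independent left ideals. -/
lemma mul_pathVal_eq_zero_of_add (hϑ : IsCompleteGentle ϑ) (γ σ : GPath R Q)
    (hne : γ.first ≠ σ.first) (a b : Λ) (h : a * pathVal ϑ γ.1 + b * pathVal ϑ σ.1 = 0) :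
    a * pathVal ϑ γ.1 = 0 ∧ b * pathVal ϑ σ.1 = 0 := by
  have h1 : a * pathVal ϑ γ.1 = 0 := by
    refine Submodule.disjoint_def.1 (hϑ.inter_left _ _ hne) _ (mul_pathVal_mem_span γ a) ?_
    rw [eq_neg_of_add_eq_zero_left h]
    exact neg_mem (mul_pathVal_mem_span σ b)
  exact ⟨h1, by rwa [h1, zero_add] at h⟩

/-- No non-zero element annihilates two paths with the same head and different last arrows. -/
lemma eq_zero_of_annihilates_two [IsNoetherianRing R] [IsLocalRing R] (hϑ : IsCompleteGentle ϑ)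
    (γ σ : GPath R Q) (hhd : γ.hd = σ.hd) (hne : γ.last ≠ σ.last) (a : Λ)
    (ha : a ∈ projMod ϑ (some γ.hd)) (h1 : a * pathVal ϑ γ.1 = 0) (h2 : a * pathVal ϑ σ.1 = 0) :
    a = 0 := by
  rcases annihilator_path hϑ γ a ha h1 with h | ⟨y, c, hy, hrel, -, e⟩
  · exact h
  rcases annihilator_path hϑ σ a (hhd ▸ ha) h2 with h | ⟨y', c', hy', hrel', -, e'⟩
  · exact h
  -- A single arrow stops at most one arrow on its right. The two annihilators are therefore
  -- generated by different arrows, whose left ideals meet in zero.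
  have hyy : y ≠ y' := by
    rintro rfl
    exact hne (Set.encard_le_one_iff.1 (hϑ.stop_right y) _ _ ⟨hy.symm, hrel⟩ ⟨hy'.symm, hrel'⟩)
  refine Submodule.disjoint_def.1 (hϑ.inter_left _ _ hyy) _ ?_ ?_
  · rw [e]
    exact Submodule.smul_mem _ _ (Submodule.mem_span_singleton_self _)
  · rw [e']
    exact Submodule.smul_mem _ _ (Submodule.mem_span_singleton_self _)

end Annihilator

/-! ### One-sided sequences and their maximal continuations -/

/-- Finite or infinite one-sided sequences. -/
inductive Tail (α : Type*) where
  | fin (l : List α) : Tail α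
  | inf (s : Stream' α) : Tail α

namespace Tail

variable {α β : Type*}

/-- The entry at position `n`. -/
def get? : Tail α → ℕ → Option α
  | .fin l, n => l[n]?
  | .inf s, n => some (s.get n)

def map (f : α → β) : Tail α → Tail β
  | .fin l => .fin (l.map f)
  | .inf s => .inf (s.map f)

/-- Prepend a list. -/
def app (l : List α) : Tail α → Tail α
  | .fin l' => .fin (l ++ l')
  | .inf s => .inf (Stream'.appendStream' l s)

@[simp] lemma get?_fin (l : List α) (n : ℕ) : (Tail.fin l).get? n = l[n]? := rfl

@[simp] lemma get?_inf (s : Stream' α) (n : ℕ) : (Tail.inf s).get? n = some (s.get n) := rfl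

@[simp] lemma map_fin (f : α → β) (l : List α) : (Tail.fin l).map f = .fin (l.map f) := rfl

@[simp] lemma map_inf (f : α → β) (s : Stream' α) : (Tail.inf s).map f = .inf (s.map f) := rfl

@[simp] lemma app_fin (l l' : List α) : app l (.fin l') = .fin (l ++ l') := rfl

@[simp] lemma app_nil (t : Tail α) : app [] t = t := by
  cases t <;> simp [app, Stream'.appendStream']

lemma app_app (l l' : List α) (t : Tail α) : app l (app l' t) = app (l ++ l') t := by
  cases t with
  | fin k => simp [app]
  | inf s => simp [app, Stream'.append_append_stream]

@[simp] lemma get?_map (f : α → β) (t : Tail α) (n : ℕ) : (t.map f).get? n = (t.get? n).map f := by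
  cases t <;> simp [map, Stream'.get_map]

lemma get?_app (l : List α) (t : Tail α) (n : ℕ) :
    (app l t).get? n = if n < l.length then l[n]? else t.get? (n - l.length) := by
  cases t with
  | fin l' => simp [app, List.getElem?_append]
  | inf s =>
    simp only [app, get?_inf]
    split_ifs with h
    · rw [Stream'.get_append_left _ _ _ h, List.getElem?_eq_getElem h]
    · obtain ⟨k, rfl⟩ := Nat.exists_eq_add_of_le (not_lt.1 h)
      rw [Stream'.get_append_right, Nat.add_sub_cancel_left]

lemma map_app (f : α → β) (l : List α) (t : Tail α) : (app l t).map f = app (l.map f) (t.map f) := by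
  cases t <;> simp [app, map, Stream'.map_append_stream]

lemma ext {t t' : Tail α} (h : ∀ n, t.get? n = t'.get? n) : t = t' := by
  cases t with
  | fin l =>
    cases t' with
    | fin l' => exact congrArg _ (List.ext_getElem? h)
    | inf s => have := h l.length; simp at this
  | inf s =>
    cases t' with
    | fin l' => have := h l'.length; simp at this
    | inf s' => exact congrArg _ (Stream'.ext fun n => by simpa using h n)

lemma get?_succ_eq_none {t : Tail α} {n : ℕ} (h : t.get? n = none) : t.get? (n + 1) = none := by
  cases t with
  | fin l => simp only [get?_fin, List.getElem?_eq_none_iff] at h ⊢; omega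
  | inf s => simp at h

lemma get?_eq_none_of_le {t : Tail α} {n m : ℕ} (h : t.get? n = none) (hnm : n ≤ m) :
    t.get? m = none := by
  induction hnm with
  | refl => exact h
  | step _ ih => exact get?_succ_eq_none ih

lemma eq_nil_of_get?_zero {t : Tail α} (h : t.get? 0 = none) : t = .fin [] :=
  ext fun n => by rw [get?_eq_none_of_le h (Nat.zero_le n)]; simp

lemma exists_get?_zero {t : Tail α} (h : t ≠ .fin []) : ∃ a, t.get? 0 = some a :=
  Option.ne_none_iff_exists'.1 fun h' => h (eq_nil_of_get?_zero h')

lemma exists_eq_app_singleton {t : Tail α} {a : α} (h : t.get? 0 = some a) :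
    ∃ t', t = app [a] t' := by
  cases t with
  | fin l =>
    cases l with
    | nil => simp at h
    | cons b l => exact ⟨.fin l, by simp at h; simp [h]⟩
  | inf s =>
    refine ⟨.inf s.tail, ext fun n => ?_⟩
    cases n with
    | zero => simpa [get?_app] using h
    | succ n => simp [get?_app, Stream'.get_tail]

lemma map_injective {f : α → β} (hf : Function.Injective f) : Function.Injective (map f) := by
  intro t t' h
  refine ext fun n => Option.map_injective hf ?_
  rw [← get?_map, ← get?_map, h]

lemma map_eq_nil {f : α → β} {t : Tail α} : t.map f = .fin [] ↔ t = .fin [] := by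
  cases t <;> simp [map]

lemma app_ne_nil {l : List α} (hl : l ≠ []) (t : Tail α) : app l t ≠ .fin [] := by
  cases t <;> simp [app, hl]

lemma app_eq_nil {l : List α} {t : Tail α} : app l t = .fin [] ↔ l = [] ∧ t = .fin [] := by
  cases t <;> simp [app]

lemma get?_zero_app_of_ne_nil {l : List α} (hl : l ≠ []) (t : Tail α) :
    (app l t).get? 0 = l[0]? := by
  rw [get?_app, if_pos (List.length_pos_of_ne_nil hl)]

/-- A tail with prescribed entries. -/
lemma exists_get?_eq (f : ℕ → Option α) (hf : ∀ n, f n = none → f (n + 1) = none) :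
    ∃ t : Tail α, ∀ n, t.get? n = f n := by
  classical
  by_cases h : ∃ n, f n = none
  · have key : ∀ m, Nat.find h ≤ m → f m = none := by
      intro m hm
      induction hm with
      | refl => exact Nat.find_spec h
      | step _ ih => exact hf _ ih
    have key' : ∀ m, m < Nat.find h → ∃ a, f m = some a := fun m hm =>
      Option.ne_none_iff_exists'.1 (Nat.find_min h hm)
    refine ⟨.fin (List.ofFn fun i : Fin (Nat.find h) => (key' i i.2).choose), fun m => ?_⟩
    rw [get?_fin, List.getElem?_ofFn]
    split_ifs with hm
    · exact (key' m hm).choose_spec.symm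
    · exact (key m (not_lt.1 hm)).symm
  · push Not at h
    choose s hs using fun n => Option.ne_none_iff_exists'.1 (h n)
    exact ⟨.inf s, fun n => (hs n).symm⟩

/-- Consecutive entries are related. -/
def Chain (r : α → α → Prop) (t : Tail α) : Prop :=
  ∀ n a b, t.get? n = some a → t.get? (n + 1) = some b → r a b

/-- A chain whose first entry satisfies `S`. -/
def Good (S : α → Prop) (r : α → α → Prop) (t : Tail α) : Prop :=
  (∀ a, t.get? 0 = some a → S a) ∧ t.Chain r

/-- A chain that cannot be extended. -/
def IsMax (S : α → Prop) (r : α → α → Prop) (t : Tail α) : Prop :=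
  ¬ ∃ k x, t = .fin k ∧ Good S r (.fin (k ++ [x]))

lemma chain_nil (r : α → α → Prop) : Chain r (.fin []) := by
  intro n a b h; simp at h

lemma good_nil (S : α → Prop) (r : α → α → Prop) : Good S r (.fin []) :=
  ⟨by simp, chain_nil r⟩

lemma chain_fin {r : α → α → Prop} {l : List α} : Chain r (.fin l) ↔ l.IsChain r := by
  rw [List.isChain_iff_getElem]
  constructor
  · intro h i hi
    exact h i _ _ (List.getElem?_eq_getElem _) (List.getElem?_eq_getElem hi)
  · intro h n a b ha hb
    obtain ⟨h1, rfl⟩ := List.getElem?_eq_some_iff.1 ha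
    obtain ⟨h2, rfl⟩ := List.getElem?_eq_some_iff.1 hb
    exact h n h2

lemma chain_map {r : β → β → Prop} {f : α → β} {t : Tail α} :
    Chain r (t.map f) ↔ Chain (fun a b => r (f a) (f b)) t := by
  constructor
  · intro h n a b ha hb
    exact h n _ _ (by simp [ha]) (by simp [hb])
  · intro h n a b ha hb
    simp only [get?_map, Option.map_eq_some_iff] at ha hb
    obtain ⟨a, ha, rfl⟩ := ha
    obtain ⟨b, hb, rfl⟩ := hb
    exact h n a b ha hb

lemma chain_app {r : α → α → Prop} {l : List α} {t : Tail α} :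
    Chain r (app l t) ↔ l.IsChain r ∧ Chain r t ∧
      ∀ a b, l.getLast? = some a → t.get? 0 = some b → r a b := by
  rw [← chain_fin]
  constructor
  · intro h
    refine ⟨fun n a b ha hb => h n a b ?_ ?_, fun n a b ha hb => h (n + l.length) a b ?_ ?_, ?_⟩
    · obtain ⟨h1, -⟩ := List.getElem?_eq_some_iff.1 ha
      rw [get?_app, if_pos h1]; exact ha
    · obtain ⟨h1, -⟩ := List.getElem?_eq_some_iff.1 hb
      rw [get?_app, if_pos h1]; exact hb
    · rw [get?_app, if_neg (by omega), Nat.add_sub_cancel]; exact ha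
    · rw [get?_app, if_neg (by omega), show n + l.length + 1 - l.length = n + 1 by omega]; exact hb
    · intro a b ha hb
      have hl : l ≠ [] := by rintro rfl; simp at ha
      have hl' := List.length_pos_of_ne_nil hl
      refine h (l.length - 1) a b ?_ ?_
      · rw [get?_app, if_pos (by omega), ← List.getLast?_eq_getElem?, ha]
      · rw [get?_app, if_neg (by omega), show l.length - 1 + 1 - l.length = 0 by omega, hb]
  · rintro ⟨h1, h2, h3⟩ n a b ha hb
    rw [get?_app] at ha hb
    split_ifs at ha with hn
    · split_ifs at hb with hn'
      · exact h1 n a b ha hb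
      · refine h3 a b ?_ ?_
        · rw [List.getLast?_eq_getElem?, show l.length - 1 = n by omega, ha]
        · rw [← hb]; congr 1; omega
    · rw [if_neg (by omega)] at hb
      exact h2 (n - l.length) a b ha (by rw [← hb]; congr 1; omega)

lemma Chain.imp {r r' : α → α → Prop} (h : ∀ a b, r a b → r' a b) {t : Tail α} (ht : Chain r t) :
    Chain r' t := fun n a b ha hb => h a b (ht n a b ha hb)

lemma isMax_of_forall {S : α → Prop} {r : α → α → Prop} {t : Tail α}
    (h0 : t.get? 0 = none → ∀ x, ¬ S x)
    (h : ∀ n a, t.get? n = some a → t.get? (n + 1) = none → ∀ b, ¬ r a b) : IsMax S r t := by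
  rintro ⟨k, x, rfl, h1, h2⟩
  rcases List.eq_nil_or_concat k with rfl | ⟨k, a, rfl⟩
  · exact h0 (by simp) x (h1 x (by simp))
  · refine h k.length a (by simp) (by simp) x (h2 k.length a x ?_ ?_)
    · simp
    · simp

lemma IsMax.not_of_zero {S : α → Prop} {r : α → α → Prop} {t : Tail α} (h : IsMax S r t)
    (h0 : t.get? 0 = none) (x : α) : ¬ S x := by
  intro hx
  refine h ⟨[], x, eq_nil_of_get?_zero h0, by simpa using hx, ?_⟩
  rw [chain_fin]; simp

lemma exists_eq_fin_concat {t : Tail α} {n : ℕ} {a : α} (h : t.get? n = some a)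
    (h1 : t.get? (n + 1) = none) : ∃ k : List α, k.length = n ∧ t = .fin (k ++ [a]) := by
  cases t with
  | inf s => simp at h1
  | fin l =>
    simp only [get?_fin, List.getElem?_eq_none_iff] at h h1
    obtain ⟨h2, e⟩ := List.getElem?_eq_some_iff.1 h
    refine ⟨l.take n, by simp; omega, ?_⟩
    rw [← e, List.take_append_getElem, List.take_of_length_le h1]

lemma good_concat {S : α → Prop} {r : α → α → Prop} {k : List α} {a b : α}
    (h : Good S r (.fin (k ++ [a]))) (hab : r a b) : Good S r (.fin (k ++ [a] ++ [b])) := by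
  refine ⟨fun x hx => h.1 x ?_, ?_⟩
  · rw [← hx]
    cases k <;> simp
  · have h2 := chain_fin.1 h.2
    rw [chain_fin, List.isChain_append]
    refine ⟨h2, by simp, ?_⟩
    simp only [List.getLast?_append, List.getLast?_singleton, Option.some_or, List.head?_cons]
    rintro x hx y hy
    cases hx; cases hy; exact hab

lemma IsMax.not_of_succ {S : α → Prop} {r : α → α → Prop} {t : Tail α} (h : IsMax S r t)
    (ht : Good S r t) {n : ℕ} {a : α} (h0 : t.get? n = some a) (h1 : t.get? (n + 1) = none)
    (x : α) : ¬ r a x := by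
  intro hx
  obtain ⟨k, -, rfl⟩ := exists_eq_fin_concat h0 h1
  exact h ⟨_, x, rfl, good_concat ht hx⟩

/-- Determinism forces the entries to agree one after the other, and maximality forbids one chain to
stop where the other one goes on. -/
lemma eq_of_isMax {S : α → Prop} {r : α → α → Prop} (hS : ∀ x y, S x → S y → x = y)
    (hr : ∀ a x y, r a x → r a y → x = y) {t t' : Tail α} (h1 : Good S r t) (h2 : IsMax S r t)
    (h1' : Good S r t') (h2' : IsMax S r t') : t = t' := by
  refine ext fun n => ?_
  induction n with
  | zero =>
    rcases ha : t.get? 0 with _ | a <;> rcases hb : t'.get? 0 with _ | b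
    · rfl
    · exact absurd (h1'.1 b hb) (h2.not_of_zero ha b)
    · exact absurd (h1.1 a ha) (h2'.not_of_zero hb a)
    · rw [hS a b (h1.1 a ha) (h1'.1 b hb)]
  | succ n ih =>
    rcases hc : t.get? n with _ | c
    · rw [get?_succ_eq_none hc, get?_succ_eq_none (ih ▸ hc)]
    · have hc' : t'.get? n = some c := ih ▸ hc
      rcases ha : t.get? (n + 1) with _ | a <;> rcases hb : t'.get? (n + 1) with _ | b
      · rfl
      · exact absurd (h1'.2 n c b hc' hb) (h2.not_of_succ h1 hc ha b)
      · exact absurd (h1.2 n c a hc ha) (h2'.not_of_succ h1' hc' hb a)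
      · rw [hr c a b (h1.2 n c a hc ha) (h1'.2 n c b hc' hb)]

/-- Deterministic chains have a unique maximal continuation. -/
theorem existsUnique_isMax {S : α → Prop} {r : α → α → Prop} (hS : ∀ x y, S x → S y → x = y)
    (hr : ∀ a x y, r a x → r a y → x = y) : ∃! t : Tail α, Good S r t ∧ IsMax S r t := by
  classical
  -- The chain follows the successors as long as there are any; `f` is constantly `none` after the
  -- first gap. An infinite chain is maximal for trivial reasons.
  let next : α → Option α := fun a => if h : ∃ b, r a b then some h.choose else none
  let f : ℕ → Option α := fun n => Nat.rec (if h : ∃ b, S b then some h.choose else none)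
    (fun _ o => o.bind next) n
  have hf1 : ∀ n, f (n + 1) = (f n).bind next := fun n => rfl
  have hnext : ∀ a b, next a = some b → r a b := by
    intro a b h
    simp only [next] at h
    split_ifs at h with h'
    cases h
    exact h'.choose_spec
  have hnext' : ∀ a, next a = none → ∀ b, ¬ r a b := by
    intro a h b hb
    simp only [next] at h
    rw [dif_pos ⟨b, hb⟩] at h
    cases h
  obtain ⟨t, ht⟩ := exists_get?_eq f (fun n hn => by rw [hf1, hn]; rfl)
  have ht1 : Good S r t := by
    refine ⟨fun a ha => ?_, fun n a b ha hb => ?_⟩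
    · rw [ht] at ha
      change (if h : ∃ b, S b then some h.choose else none) = some a at ha
      split_ifs at ha with h
      cases ha
      exact h.choose_spec
    · rw [ht] at ha
      rw [ht, hf1, ha] at hb
      exact hnext a b hb
  have ht2 : IsMax S r t := by
    refine isMax_of_forall ?_ ?_
    · intro h0 x hx
      rw [ht] at h0
      change (if h : ∃ b, S b then some h.choose else none) = none at h0
      rw [dif_pos ⟨x, hx⟩] at h0
      cases h0
    · intro n a ha h1 b
      rw [ht] at ha
      rw [ht, hf1, ha] at h1
      exact hnext' a h1 b
  exact ⟨t, ⟨ht1, ht2⟩, fun t' h' => eq_of_isMax hS hr h'.1 h'.2 ht1 ht2⟩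

end Tail

/-! ### Letters, and sequences glued from two one-sided tails -/

lemma Letter.flip_flip {α : Type*} (a : Letter α) : a.flip.flip = a := by cases a <;> rfl

lemma Letter.flip_injective {α : Type*} : Function.Injective (Letter.flip (α := α)) :=
  Function.LeftInverse.injective Letter.flip_flip

namespace Seqn

variable {V α : Type*}

/-- The sequence with index set in `ℕ` and the given letters, `1_{v,ε}` if there are none. -/
def ofTail (v : V) (ε : ℤˣ) : Tail (Letter α) → Seqn V (Letter α)
  | .fin [] => .triv v ε
  | .fin (a :: l) => .fin (a :: l)
  | .inf s => .right s

/-- The sequence `B⁻¹E`, or `1_{v,ε}` if `B` and `E` have no letters. -/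
def glue (v : V) (ε : ℤˣ) : Tail (Letter α) → Tail (Letter α) → Seqn V (Letter α)
  | .fin b, e => ofTail v ε (.app (b.reverse.map Letter.flip) e)
  | .inf b, .fin e => .left (Stream'.appendStream' e.reverse (b.map Letter.flip))
  | .inf b, .inf e =>
    .bi (fun i => if i ≤ 0 then (b.map Letter.flip).get (-i).toNat else e.get (i - 1).toNat)

/-- The position in `B⁻¹E` at which `E` starts. -/
def origin : Tail (Letter α) → Tail (Letter α) → ℤ
  | .fin b, _ => b.length
  | .inf _, .fin e => -e.length
  | .inf _, .inf _ => 0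

lemma origin_fin (b : List (Letter α)) (e : Tail (Letter α)) : origin (.fin b) e = b.length := rfl

lemma origin_inf_fin (b : Stream' (Letter α)) (e : List (Letter α)) :
    origin (.inf b) (.fin e) = -e.length := rfl

lemma origin_inf_inf (b : Stream' (Letter α)) (e : Stream' (Letter α)) :
    origin (.inf b) (.inf e) = 0 := rfl

lemma ofTail_fin_of_ne_nil (v : V) (ε : ℤˣ) {l : List (Letter α)} (hl : l ≠ []) :
    ofTail v ε (.fin l) = .fin l := by
  cases l with
  | nil => exact absurd rfl hl
  | cons a l => rfl

/-- The vertex and the sign only label the trivial sequence, so they may be changed at will as soon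
as a letter is present. -/
lemma ofTail_congr {v w : V} {ε δ : ℤˣ} {t : Tail (Letter α)} (h : t ≠ .fin []) :
    ofTail v ε t = ofTail w δ t := by
  rcases t with (_ | ⟨a, l⟩) | s
  · exact absurd rfl h
  · rfl
  · rfl

lemma ofTail_ne_fin_nil (v : V) (ε : ℤˣ) (t : Tail (Letter α)) : ofTail v ε t ≠ .fin [] := by
  rcases t with (_ | ⟨a, l⟩) | s <;> simp [ofTail]

lemma isTriv_ofTail {v : V} {ε : ℤˣ} {t : Tail (Letter α)} : (ofTail v ε t).IsTriv ↔ t = .fin [] := by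
  rcases t with (_ | ⟨a, l⟩) | s <;> simp [ofTail, IsTriv]

lemma letter_ofTail (v : V) (ε : ℤˣ) (t : Tail (Letter α)) (i : ℤ) :
    (ofTail v ε t).letter i = if 1 ≤ i then t.get? (i - 1).toNat else none := by
  rcases t with (_ | ⟨a, l⟩) | s <;> simp [ofTail, letter]

lemma idx_ofTail (v : V) (ε : ℤˣ) (t : Tail (Letter α)) (i : ℤ) :
    i ∈ (ofTail v ε t).idx ↔ i = 0 ∨ 0 < i ∧ (t.get? (i - 1).toNat) ≠ none := by
  rcases t with (_ | ⟨a, l⟩) | s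
  · simp [ofTail, idx]
  · simp only [ofTail, idx, Set.mem_Icc, Tail.get?_fin, ne_eq, List.getElem?_eq_none_iff]
    omega
  · simp only [ofTail, idx, Set.mem_Ici, Tail.get?_inf]
    simp
    omega

lemma ofTail_injective {v w : V} {ε δ : ℤˣ} {t t' : Tail (Letter α)}
    (h : ofTail v ε t = ofTail w δ t') : t = t' := by
  refine Tail.ext fun n => ?_
  have := congrArg (fun C => C.letter (n + 1)) h
  simpa [letter_ofTail] using this

lemma ofTail_nil_inj {v w : V} {ε δ : ℤˣ}
    (h : ofTail (α := α) v ε (.fin []) = ofTail w δ (.fin [])) : v = w ∧ ε = δ := by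
  simpa [ofTail] using h

lemma glue_nil (v : V) (ε : ℤˣ) (e : Tail (Letter α)) : glue v ε (.fin []) e = ofTail v ε e := by
  simp [glue]

lemma glue_ne_fin_nil (v : V) (ε : ℤˣ) (B E : Tail (Letter α)) : glue v ε B E ≠ .fin [] := by
  cases B with
  | fin b => exact ofTail_ne_fin_nil _ _ _
  | inf b => cases E <;> simp [glue]

lemma get?_reverse_flip (b : List (Letter α)) (n : ℕ) (h : n < b.length) :
    (b.reverse.map Letter.flip)[n]? = (b[b.length - 1 - n]?).map Letter.flip := by
  rw [List.getElem?_map, List.getElem?_reverse h]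

/-- A description that is uniform in the four shapes of index sets: to the right of the origin one
reads `E`, and up to the origin one reads `B` backwards with inverted letters. Together with
`idx_glue` it replaces case distinctions on the index set in most later arguments. -/
lemma letter_glue (v : V) (ε : ℤˣ) (B E : Tail (Letter α)) (i : ℤ) :
    (glue v ε B E).letter i =
      if origin B E < i then E.get? (i - origin B E - 1).toNat
      else (B.get? (origin B E - i).toNat).map Letter.flip := by
  cases B with
  | fin b =>
    have ho := origin_fin b E
    generalize origin (.fin b) E = o at ho ⊢
    subst ho
    simp only [glue, letter_ofTail, Tail.get?_app, List.length_map, List.length_reverse,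
      Tail.get?_fin]
    by_cases h1 : 1 ≤ i
    · rw [if_pos h1]
      by_cases h2 : (b.length : ℤ) < i
      · rw [if_pos h2, if_neg (by omega)]
        congr 1
        omega
      · rw [if_neg h2, if_pos (by omega), get?_reverse_flip _ _ (by omega)]
        congr 2
        omega
    · rw [if_neg h1, if_neg (by omega), List.getElem?_eq_none (by omega)]
      rfl
  | inf b =>
    cases E with
    | fin e =>
      have ho := origin_inf_fin b e
      generalize origin (.inf b) (.fin e) = o at ho ⊢
      subst ho
      simp only [glue, letter, Tail.get?_fin, Tail.get?_inf]
      by_cases h : -(e.length : ℤ) < i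
      · rw [if_pos h]
        by_cases h0 : i ≤ 0
        · rw [if_pos h0, Stream'.get_append_left _ _ _ (by simp; omega),
            List.getElem_reverse, List.getElem?_eq_getElem (by omega)]
          congr 2
          omega
        · rw [if_neg h0, List.getElem?_eq_none (by omega)]
      · have h2 : (-i).toNat = e.reverse.length + (-(e.length : ℤ) - i).toNat := by
          rw [List.length_reverse]; omega
        rw [if_neg h, if_pos (by omega), h2, Stream'.get_append_right, Stream'.get_map]
        rfl
    | inf e =>
      have ho := origin_inf_inf b e
      generalize origin (.inf b) (.inf e) = o at ho ⊢
      subst ho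
      simp only [glue, letter, Tail.get?_inf, Stream'.get_map, Option.map_some]
      by_cases h : i ≤ 0
      · rw [if_pos h, if_neg (by omega)]
        congr 3
        omega
      · rw [if_neg h, if_pos (by omega)]
        congr 3
        omega

lemma idx_glue (v : V) (ε : ℤˣ) (B E : Tail (Letter α)) (i : ℤ) :
    i ∈ (glue v ε B E).idx ↔ i = origin B E ∨
      (origin B E < i ∧ E.get? (i - origin B E - 1).toNat ≠ none) ∨
      (i < origin B E ∧ B.get? (origin B E - i - 1).toNat ≠ none) := by
  cases B with
  | fin b =>
    simp only [glue, idx_ofTail, origin_fin, Tail.get?_app, List.length_map, List.length_reverse,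
      Tail.get?_fin, ne_eq, List.getElem?_eq_none_iff, not_le]
    by_cases h : (i - 1).toNat < b.length
    · rw [if_pos h, List.getElem?_eq_getElem (by simpa using h)]
      simp only [reduceCtorEq, not_false_eq_true, and_true]
      constructor
      · rintro (h1 | h1)
        · by_cases h2 : b.length = 0
          · left; omega
          · right; right; omega
        · by_cases h2 : i = b.length
          · left; exact h2
          · right; right; omega
      · omega
    · rw [if_neg h]
      by_cases h2 : (b.length : ℤ) < i
      · have e1 : (i - 1).toNat - b.length = (i - b.length - 1).toNat := by omega
        rw [e1]
        constructor
        · rintro (h1 | h1)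
          · omega
          · exact Or.inr (Or.inl ⟨h2, h1.2⟩)
        · rintro (h1 | h1 | h1)
          · omega
          · exact Or.inr ⟨by omega, h1.2⟩
          · omega
      · have h3 : b.length = 0 ∧ i ≤ 0 := by omega
        constructor
        · rintro (h1 | h1) <;> omega
        · rintro (h1 | h1 | h1) <;> omega
  | inf b =>
    cases E with
    | fin e =>
      simp only [glue, idx, origin_inf_fin, Tail.get?_fin, Tail.get?_inf, Set.mem_Iic, ne_eq,
        List.getElem?_eq_none_iff, reduceCtorEq, not_false_eq_true, and_true]
      omega
    | inf e =>
      simp only [glue, idx, origin_inf_inf, Tail.get?_inf, Set.mem_univ, ne_eq, reduceCtorEq,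
        not_false_eq_true, and_true, true_iff]
      omega

/-- Consecutive letters are related, and the sequence is not the empty list of letters. -/
def Related (r : Letter α → Letter α → Prop) (C : Seqn V (Letter α)) : Prop :=
  C ≠ .fin [] ∧ ∀ i a b, C.letter i = some a → C.letter (i + 1) = some b → r a b

lemma related_ofTail {r : Letter α → Letter α → Prop} {v : V} {ε : ℤˣ} {t : Tail (Letter α)} :
    Related r (ofTail v ε t) ↔ t.Chain r := by
  simp only [Related, ofTail_ne_fin_nil, ne_eq, not_false_eq_true, true_and, letter_ofTail]
  constructor
  · intro h n a b ha hb
    refine h (n + 1) a b ?_ ?_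
    · rw [if_pos (by omega), ← ha]
      congr 1; omega
    · rw [if_pos (by omega), ← hb]
      congr 1; omega
  · intro h i a b ha hb
    by_cases h1 : 1 ≤ i
    · rw [if_pos h1] at ha
      rw [if_pos (by omega)] at hb
      refine h (i - 1).toNat a b ha ?_
      rw [← hb]
      congr 1; omega
    · rw [if_neg h1] at ha
      cases ha

/-- Invariance of `r` under inversion turns adjacency inside `B⁻¹` into adjacency inside `B`; what
remains is the pair of letters that meet at the origin. -/
lemma related_glue {r : Letter α → Letter α → Prop} (hr : ∀ a b, r a b ↔ r b.flip a.flip)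
    {v : V} {ε : ℤˣ} {B E : Tail (Letter α)} :
    Related r (glue v ε B E) ↔ B.Chain r ∧ E.Chain r ∧
      ∀ a b, B.get? 0 = some a → E.get? 0 = some b → r a.flip b := by
  simp only [Related, glue_ne_fin_nil, ne_eq, not_false_eq_true, true_and, letter_glue]
  generalize origin B E = o
  constructor
  · intro h
    refine ⟨fun n a b ha hb => ?_, fun n a b ha hb => ?_, fun a b ha hb => ?_⟩
    · rw [hr]
      refine h (o - n - 1) _ _ ?_ ?_
      · rw [if_neg (by omega), show (o - (o - n - 1)).toNat = n + 1 by omega, hb]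
        rfl
      · rw [if_neg (by omega), show (o - (o - n - 1 + 1)).toNat = n by omega, ha]
        rfl
    · refine h (o + n + 1) _ _ ?_ ?_
      · rw [if_pos (by omega), show (o + n + 1 - o - 1).toNat = n by omega, ha]
      · rw [if_pos (by omega), show (o + n + 1 + 1 - o - 1).toNat = n + 1 by omega, hb]
    · refine h o _ _ ?_ ?_
      · rw [if_neg (by omega), sub_self, Int.toNat_zero, ha]
        rfl
      · rw [if_pos (by omega), show (o + 1 - o - 1).toNat = 0 by omega, hb]
  · rintro ⟨h1, h2, h3⟩ i a b ha hb
    rcases lt_trichotomy i o with h | h | h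
    · rw [if_neg (by omega)] at ha hb
      simp only [Option.map_eq_some_iff] at ha hb
      obtain ⟨a, ha, rfl⟩ := ha
      obtain ⟨b, hb, rfl⟩ := hb
      rw [← hr]
      refine h1 _ b a hb ?_
      rw [← ha]
      congr 1; omega
    · subst h
      rw [if_neg (by omega), sub_self, Int.toNat_zero] at ha
      rw [if_pos (by omega), show (i + 1 - i - 1).toNat = 0 by omega] at hb
      simp only [Option.map_eq_some_iff] at ha
      obtain ⟨a, ha, rfl⟩ := ha
      exact h3 a b ha hb
    · rw [if_pos (by omega)] at ha hb
      refine h2 _ a b ha ?_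
      rw [← hb]
      congr 1; omega

/-- If `p` holds for the inverses of the letters of `B` and fails for the first letter of `E`, then
`B⁻¹E` determines `B` and `E`. -/
lemma glue_injective {p : Letter α → Prop} {v v' : V} {ε ε' : ℤˣ} {B B' E E' : Tail (Letter α)}
    (hB : ∀ n a, B.get? n = some a → p a.flip) (hB' : ∀ n a, B'.get? n = some a → p a.flip)
    (hE : ∀ a, E.get? 0 = some a → ¬ p a) (hE' : ∀ a, E'.get? 0 = some a → ¬ p a)
    (h : glue v ε B E = glue v' ε' B' E') : B = B' ∧ E = E' := by
  -- If the first origin were strictly to the left of the second, the first letter of `E` would also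
  -- be the inverse of a letter of `B'`, so `p` would both fail and hold for it.
  have key : ∀ {v v' : V} {ε ε' : ℤˣ} {B B' E E' : Tail (Letter α)},
      (∀ n a, B'.get? n = some a → p a.flip) → (∀ a, E.get? 0 = some a → ¬ p a) →
      glue v ε B E = glue v' ε' B' E' → ¬ origin B E < origin B' E' := by
    intro v v' ε ε' B B' E E' hB' hE h hlt
    have hmem : origin B' E' ∈ (glue v ε B E).idx := by
      rw [h, idx_glue]; exact Or.inl rfl
    rw [idx_glue] at hmem
    have h0 : E.get? 0 ≠ none := by
      intro h0
      rcases hmem with h1 | ⟨h1, h2⟩ | ⟨h1, h2⟩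
      · omega
      · exact h2 (Tail.get?_eq_none_of_le h0 (Nat.zero_le _))
      · omega
    obtain ⟨a, ha⟩ := Option.ne_none_iff_exists'.1 h0
    have h1 := congrArg (fun C => C.letter (origin B E + 1)) h
    simp only [letter_glue] at h1
    rw [if_pos (by omega), if_neg (by omega), show (origin B E + 1 - origin B E - 1).toNat = 0 by
      omega, ha] at h1
    obtain ⟨c, hc, e⟩ := Option.map_eq_some_iff.1 h1.symm
    exact hE a ha (e ▸ hB' _ c hc)
  have ho : origin B E = origin B' E' :=
    le_antisymm (not_lt.1 (key hB hE' h.symm)) (not_lt.1 (key hB' hE h))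
  constructor
  · refine Tail.ext fun n => Option.map_injective Letter.flip_injective ?_
    have h1 := congrArg (fun C => C.letter (origin B E - n)) h
    simp only [letter_glue, ← ho] at h1
    rwa [if_neg (by omega), if_neg (by omega), show (origin B E - (origin B E - n)).toNat = n by
      omega] at h1
  · refine Tail.ext fun n => ?_
    have h1 := congrArg (fun C => C.letter (origin B E + n + 1)) h
    simp only [letter_glue, ← ho] at h1
    rwa [if_pos (by omega), if_pos (by omega),
      show (origin B E + n + 1 - origin B E - 1).toNat = n by omega] at h1

lemma glue_nil_inj {v v' : V} {ε ε' : ℤˣ}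
    (h : glue (α := α) v ε (.fin []) (.fin []) = glue v' ε' (.fin []) (.fin [])) :
    v = v' ∧ ε = ε' := by
  simpa [glue, ofTail] using h

/-- The analogue of `glue_injective` for a list followed by a tail. -/
lemma app_injective {p : Letter α → Prop} {l l' : List (Letter α)} {t t' : Tail (Letter α)}
    (hl : ∀ a, l.getLast? = some a → ¬ p a) (hl' : ∀ a, l'.getLast? = some a → ¬ p a)
    (ht : ∀ n a, t.get? n = some a → p a) (ht' : ∀ n a, t'.get? n = some a → p a)
    (h : Tail.app l t = Tail.app l' t') : l = l' ∧ t = t' := by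
  have key : ∀ {l l' : List (Letter α)} {t t' : Tail (Letter α)},
      (∀ a, l'.getLast? = some a → ¬ p a) → (∀ n a, t.get? n = some a → p a) →
      Tail.app l t = Tail.app l' t' → ¬ l.length < l'.length := by
    intro l l' t t' hl' ht h hlt
    have hne : l' ≠ [] := by rintro rfl; simp at hlt
    have h1 := congrArg (fun C => Tail.get? C (l'.length - 1)) h
    simp only [Tail.get?_app] at h1
    rw [if_neg (by omega), if_pos (by omega), ← List.getLast?_eq_getElem?,
      List.getLast?_eq_some_getLast hne] at h1
    exact hl' _ (List.getLast?_eq_some_getLast hne) (ht _ _ h1)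
  have hlen : l.length = l'.length :=
    le_antisymm (not_lt.1 (key hl ht' h.symm)) (not_lt.1 (key hl' ht h))
  constructor
  · refine List.ext_getElem? fun n => ?_
    by_cases hn : n < l.length
    · have h1 := congrArg (fun C => Tail.get? C n) h
      simp only [Tail.get?_app] at h1
      rwa [if_pos hn, if_pos (by omega)] at h1
    · rw [List.getElem?_eq_none (by omega), List.getElem?_eq_none (by omega)]
  · refine Tail.ext fun n => ?_
    have h1 := congrArg (fun C => Tail.get? C (l.length + n)) h
    simp only [Tail.get?_app] at h1
    rwa [if_neg (by omega), if_neg (by omega), Nat.add_sub_cancel_left, hlen,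
      Nat.add_sub_cancel_left] at h1

/-! ### Compositions in terms of tails -/

section Comp

variable (hd : Letter α → V) (sg : Letter α → ℤˣ)

/-- The first letter of `t`, if there is one, has head `v` and sign `ε`. -/
def Matches (v : V) (ε : ℤˣ) (t : Tail (Letter α)) : Prop :=
  ∀ a, t.get? 0 = some a → hd a = v ∧ sg a = ε

variable {hd sg}

lemma start_ofTail {v : V} {ε : ℤˣ} {t : Tail (Letter α)} (h : Matches hd sg v ε t) :
    (ofTail v ε t).start hd sg = some (v, ε) := by
  rcases t with (_ | ⟨a, l⟩) | s
  · rfl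
  · obtain ⟨h1, h2⟩ := h a (by simp)
    simp [ofTail, start, h1, h2]
  · obtain ⟨h1, h2⟩ := h (s.get 0) (by simp)
    simp [ofTail, start, h1, h2]

lemma matches_of_start {v w : V} {ε δ : ℤˣ} {t : Tail (Letter α)}
    (h : (ofTail w δ t).start hd sg = some (v, ε)) : Matches hd sg v ε t := by
  intro a ha
  rcases t with (_ | ⟨b, l⟩) | s
  · simp at ha
  · simp at ha; subst ha
    simpa [ofTail, start] using h
  · simp at ha; subst ha
    simpa [ofTail, start] using h

variable (hd sg) in
/-- The list `l` starts with head `v` and sign `ε`, and ends in such a way that a sequence that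
continues it has head `w` and sign `δ`. -/
structure HasEnds (l : List (Letter α)) (v : V) (ε : ℤˣ) (w : V) (δ : ℤˣ) : Prop where
  nil : l = [] → v = w ∧ ε = δ
  head : ∀ a, l.head? = some a → hd a = v ∧ sg a = ε
  last : ∀ a, l.getLast? = some a → hd a.flip = w ∧ sg a.flip = -δ

lemma HasEnds.matches_app {l : List (Letter α)} {v w : V} {ε δ : ℤˣ} (h : HasEnds hd sg l v ε w δ)
    {t : Tail (Letter α)} (ht : l = [] → Matches hd sg w δ t) :
    Matches hd sg v ε (.app l t) := by
  intro a ha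
  by_cases hl : l = []
  · subst hl
    obtain ⟨rfl, rfl⟩ := h.nil rfl
    exact ht rfl a (by simpa using ha)
  · rw [Tail.get?_zero_app_of_ne_nil hl] at ha
    exact h.head a (by rw [List.head?_eq_getElem?, ha])

lemma inv_fin_start (l : List (Letter α)) :
    (Seqn.inv (V := V) (.fin l)).start hd sg =
      l.getLast?.map (fun a => (hd a.flip, sg a.flip)) := by
  simp only [inv, start, List.head?_map, List.head?_reverse, Option.map_map]
  rfl

/-- All cases of `Comp` with a finite left factor amount to prepending `l`. The condition on head
and sign is visible only where a factor is trivial: a trivial `D` has to be `1_{w,δ}`, and for `l =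
[]` the first letter of `D` has to match. Two non-trivial factors are concatenated without any test.
-/
lemma comp_ofTail {l : List (Letter α)} {v w : V} {ε δ : ℤˣ} (h : HasEnds hd sg l v ε w δ)
    {D E : Seqn V (Letter α)} (hD : D ≠ .fin []) :
    Comp hd sg (ofTail v ε (.fin l)) D E ↔ ∃ d : Tail (Letter α), D = ofTail w δ d ∧
      E = ofTail v ε (.app l d) ∧ (l = [] → Matches hd sg w δ d) := by
  constructor
  · intro hc
    by_cases hl : l = []
    · subst hl
      obtain ⟨rfl, rfl⟩ := h.nil rfl
      have key : ∀ D : Seqn V (Letter α), D ≠ .fin [] → D.start hd sg = some (v, ε) →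
          ∃ d : Tail (Letter α), D = ofTail v ε d := by
        rintro (⟨w, δ⟩ | l | s | s | f) hD hs
        · simp only [start, Option.some.injEq, Prod.mk.injEq] at hs
          exact ⟨.fin [], by rw [hs.1, hs.2]; rfl⟩
        · exact ⟨.fin l, by rw [ofTail_fin_of_ne_nil]; rintro rfl; exact hD rfl⟩
        · exact ⟨.inf s, rfl⟩
        · simp [start] at hs
        · simp [start] at hs
      generalize hC : ofTail v ε (.fin []) = C at hc
      cases hc with
      | triv_left w δ D hs =>
        simp only [ofTail, triv.injEq] at hC
        obtain ⟨rfl, rfl⟩ := hC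
        obtain ⟨d, rfl⟩ := key _ hD hs
        exact ⟨d, rfl, by simp, fun _ => matches_of_start hs⟩
      | triv_right w δ C hs =>
        subst hC
        simp only [ofTail, inv, start, Option.some.injEq, Prod.mk.injEq, neg_inj] at hs
        obtain ⟨rfl, rfl⟩ := hs
        exact ⟨.fin [], rfl, by simp, fun _ a ha => by simp at ha⟩
      | fin_fin l l' => simp [ofTail] at hC
      | fin_right l t => simp [ofTail] at hC
      | left_fin t l => simp [ofTail] at hC
      | left_right t t' => simp [ofTail] at hC
    · have e : ∀ t, ofTail v ε (.app l t) = (match t with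
          | .fin d => .fin (l ++ d)
          | .inf s => .right (Stream'.appendStream' l s)) := by
        rintro (d | s)
        · exact ofTail_fin_of_ne_nil v ε (by simp [hl])
        · rfl
      rw [ofTail_fin_of_ne_nil v ε hl] at hc
      generalize hC : (Seqn.fin l : Seqn V (Letter α)) = C at hc
      cases hc with
      | triv_left w δ D hs => cases hC
      | triv_right w' δ' C hs =>
        subst hC
        rw [inv_fin_start] at hs
        obtain ⟨a, ha, hs⟩ := Option.map_eq_some_iff.1 hs
        have := h.last a ha
        simp only [Prod.mk.injEq] at hs
        obtain rfl : w = w' := this.1.symm.trans hs.1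
        obtain rfl : δ = δ' := neg_injective (this.2.symm.trans hs.2)
        exact ⟨.fin [], rfl, by rw [e]; simp, fun h => absurd h hl⟩
      | fin_fin k l' =>
        cases hC
        have hl' : l' ≠ [] := by rintro rfl; exact hD rfl
        exact ⟨.fin l', by rw [ofTail_fin_of_ne_nil _ _ hl'], by rw [e], fun h => absurd h hl⟩
      | fin_right k t =>
        cases hC
        exact ⟨.inf t, rfl, by rw [e], fun h => absurd h hl⟩
      | left_fin t l => cases hC
      | left_right t t' => cases hC
  · rintro ⟨d, rfl, rfl, hm⟩
    by_cases hl : l = []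
    · subst hl
      obtain ⟨rfl, rfl⟩ := h.nil rfl
      rw [Tail.app_nil]
      exact Comp.triv_left v ε _ (start_ofTail (hm rfl))
    · rw [ofTail_fin_of_ne_nil v ε hl]
      rcases d with d | s
      · rw [Tail.app_fin, ofTail_fin_of_ne_nil v ε (by simp [hl])]
        by_cases hd' : d = []
        · subst hd'
          rw [List.append_nil]
          refine Comp.triv_right _ _ _ ?_
          rw [inv_fin_start, List.getLast?_eq_some_getLast hl]
          have := h.last _ (List.getLast?_eq_some_getLast hl)
          simp [this.1, this.2]
        · rw [ofTail_fin_of_ne_nil _ _ hd']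
          exact Comp.fin_fin _ _
      · exact Comp.fin_right _ _

lemma inv_inv (C : Seqn V (Letter α)) : C.inv.inv = C := by
  have hs : ∀ s : Stream' (Letter α), (s.map Letter.flip).map Letter.flip = s := fun s =>
    Stream'.ext fun n => by simp [Stream'.get_map, Letter.flip_flip]
  cases C with
  | triv v ε => simp [inv]
  | fin l =>
    simp only [inv, ← List.map_reverse, List.reverse_reverse, List.map_map]
    congr 1
    conv_rhs => rw [← List.map_id l]
    exact List.map_congr_left fun a _ => Letter.flip_flip a
  | right s => simp only [inv, hs]
  | left s => simp only [inv, hs]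
  | bi f => simp [inv, Letter.flip_flip]

lemma inv_ofTail_neg_eq_glue (v : V) (ε : ℤˣ) (b : Tail (Letter α)) :
    (ofTail v (-ε) b).inv = glue v ε b (.fin []) := by
  rcases b with (_ | ⟨a, l⟩) | s
  · simp [ofTail, inv, glue]
  · have h1 : glue v ε (.fin (a :: l)) (.fin []) =
        ofTail v ε (.fin ((a :: l).reverse.map Letter.flip ++ [])) := rfl
    rw [h1, List.append_nil, ofTail_fin_of_ne_nil v ε (l := (a :: l).reverse.map Letter.flip)
      (by simp)]
    rfl
  · simp [ofTail, inv, glue]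

lemma exists_ofTail_of_start {D : Seqn V (Letter α)} (hD : D ≠ .fin []) {v : V} {ε : ℤˣ}
    (hs : D.start hd sg = some (v, ε)) :
    ∃ d : Tail (Letter α), D = ofTail v ε d ∧ Matches hd sg v ε d := by
  have : ∃ d : Tail (Letter α), D = ofTail v ε d := by
    rcases D with ⟨w, δ⟩ | l | s | s | f
    · simp only [start, Option.some.injEq, Prod.mk.injEq] at hs
      exact ⟨.fin [], by rw [hs.1, hs.2]; rfl⟩
    · exact ⟨.fin l, by rw [ofTail_fin_of_ne_nil]; rintro rfl; exact hD rfl⟩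
    · exact ⟨.inf s, rfl⟩
    · simp [start] at hs
    · simp [start] at hs
  obtain ⟨d, rfl⟩ := this
  exact ⟨d, rfl, matches_of_start hs⟩

lemma inv_eq_iff {C D : Seqn V (Letter α)} : C.inv = D ↔ C = D.inv :=
  ⟨fun h => by rw [← h, inv_inv], fun h => by rw [h, inv_inv]⟩

/-- The counterpart on the left. The sign of `B` is `-ε`, because composition requires `B` and the
right factor to have opposite signs; as before, this is a condition on the letters of `B` only if
the right factor is trivial. -/
lemma comp_inv_ofTail {v : V} {ε : ℤˣ} {e : Tail (Letter α)} (he : Matches hd sg v ε e)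
    {B C : Seqn V (Letter α)} (hB : B ≠ .fin []) :
    Comp hd sg B.inv (ofTail v ε e) C ↔ ∃ b : Tail (Letter α), B = ofTail v (-ε) b ∧
      C = glue v ε b e ∧ (e = .fin [] → Matches hd sg v (-ε) b) := by
  constructor
  · intro hc
    generalize hX : B.inv = X at hc
    generalize hY : ofTail v ε e = Y at hc
    rw [inv_eq_iff] at hX
    cases hc with
    | triv_left w δ D hs =>
      subst hY
      rw [start_ofTail he] at hs
      simp only [Option.some.injEq, Prod.mk.injEq] at hs
      obtain ⟨rfl, rfl⟩ := hs
      exact ⟨.fin [], hX, by simp [glue_nil], fun _ a ha => by simp at ha⟩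
    | triv_right w δ C hs =>
      have he0 : e = .fin [] := isTriv_ofTail.1 ⟨w, δ, hY⟩
      subst he0
      simp only [ofTail, triv.injEq] at hY
      obtain ⟨rfl, rfl⟩ := hY
      rw [← hX] at hs
      obtain ⟨b, rfl, hb⟩ := exists_ofTail_of_start hB hs
      refine ⟨b, rfl, ?_, fun _ => hb⟩
      rw [← inv_ofTail_neg_eq_glue, hX, inv_inv]
    | fin_fin l l' =>
      rcases e with (_ | ⟨a, k⟩) | s
      · simp [ofTail] at hY
      · have hl : l ≠ [] := by rintro rfl; exact hB hX
        simp only [ofTail, fin.injEq] at hY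
        subst hY
        refine ⟨.fin (l.reverse.map Letter.flip), ?_, ?_, by simp⟩
        · rw [hX, ofTail_fin_of_ne_nil _ _ (by simpa using hl)]
          rfl
        · simp only [glue, Tail.app_fin, ← List.map_reverse, List.reverse_reverse, List.map_map]
          rw [ofTail_fin_of_ne_nil _ _ (by simp)]
          congr 2
          conv_lhs => rw [← List.map_id l]
          exact List.map_congr_left fun a _ => (Letter.flip_flip a).symm
      · simp [ofTail] at hY
    | fin_right l t =>
      rcases e with (_ | ⟨a, k⟩) | s
      · simp [ofTail] at hY
      · simp [ofTail] at hY
      · have hl : l ≠ [] := by rintro rfl; exact hB hX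
        simp only [ofTail, right.injEq] at hY
        subst hY
        refine ⟨.fin (l.reverse.map Letter.flip), ?_, ?_, by simp⟩
        · rw [hX, ofTail_fin_of_ne_nil _ _ (by simpa using hl)]
          rfl
        · simp only [glue, ← List.map_reverse, List.reverse_reverse, List.map_map, Tail.app, ofTail]
          congr 2
          conv_lhs => rw [← List.map_id l]
          exact List.map_congr_left fun a _ => (Letter.flip_flip a).symm
    | left_fin t l =>
      rcases e with (_ | ⟨a, k⟩) | s
      · simp [ofTail] at hY
      · simp only [ofTail, fin.injEq] at hY
        subst hY
        refine ⟨.inf (t.map Letter.flip), hX, ?_, by simp⟩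
        simp only [glue]
        congr 2
        exact Stream'.ext fun n => by simp [Stream'.get_map, Letter.flip_flip]
      · simp [ofTail] at hY
    | left_right t t' =>
      rcases e with (_ | ⟨a, k⟩) | s
      · simp [ofTail] at hY
      · simp [ofTail] at hY
      · simp only [ofTail, right.injEq] at hY
        subst hY
        refine ⟨.inf (t.map Letter.flip), hX, ?_, by simp⟩
        simp only [glue]
        congr 1
        funext i
        simp [Stream'.get_map, Letter.flip_flip]
  · rintro ⟨b, rfl, rfl, hb⟩
    by_cases he0 : e = .fin []
    · subst he0
      rw [← inv_ofTail_neg_eq_glue]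
      refine Comp.triv_right _ _ _ ?_
      rw [inv_inv]
      exact start_ofTail (hb rfl)
    rcases b with (_ | ⟨a, l⟩) | s
    · rw [glue_nil]
      simp only [ofTail, inv, neg_neg]
      exact Comp.triv_left _ _ _ (start_ofTail he)
    · have h1 : (ofTail v (-ε) (.fin (a :: l))).inv = .fin ((a :: l).reverse.map Letter.flip) := rfl
      rw [h1]
      rcases e with (_ | ⟨a', k⟩) | s
      · exact absurd rfl he0
      · have h2 : glue v ε (.fin (a :: l)) (.fin (a' :: k)) =
            ofTail v ε (.fin ((a :: l).reverse.map Letter.flip ++ (a' :: k))) := rfl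
        rw [h2, ofTail_fin_of_ne_nil v ε (l := (a :: l).reverse.map Letter.flip ++ (a' :: k))
          (by simp)]
        exact Comp.fin_fin _ _
      · exact Comp.fin_right _ _
    · rcases e with (_ | ⟨a', k⟩) | s'
      · exact absurd rfl he0
      · exact Comp.left_fin _ _
      · exact Comp.left_right _ _

lemma glue_cons_left {v : V} {ε : ℤˣ} {b : List (Letter α)} {e : Tail (Letter α)} (a : Letter α) :
    ofTail v ε (.app [a] (.app (b.reverse.map Letter.flip) e)) =
      glue v ε (.fin (b ++ [a.flip])) e := by
  simp [glue, Tail.app_app, Letter.flip_flip]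

/-- Extension of `B⁻¹E` by one letter on the left. -/
lemma comp_singleton_glue {v : V} {ε : ℤˣ} {b e : Tail (Letter α)} (a : Letter α)
    (he : Matches hd sg v ε e) (G : Seqn V (Letter α)) :
    Comp hd sg (.fin [a]) (glue v ε b e) G ↔ ∃ k, b = .fin k ∧
      G = glue v ε (.fin (k ++ [a.flip])) e ∧
      (e = .fin [] → k = [] → hd a.flip = v ∧ sg a.flip = -ε) := by
  constructor
  · intro hc
    generalize hX : (Seqn.fin [a] : Seqn V (Letter α)) = X at hc
    generalize hY : glue v ε b e = Y at hc
    cases hc with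
    | triv_left w δ D hs => cases hX
    | triv_right w δ C hs =>
      subst hX
      rw [inv_fin_start] at hs
      simp only [List.getLast?_singleton, Option.map_some, Option.some.injEq, Prod.mk.injEq] at hs
      rcases b with k | s
      · have h0 : Tail.app (k.reverse.map Letter.flip) e = .fin [] :=
          isTriv_ofTail.1 ⟨w, δ, hY⟩
        rw [Tail.app_eq_nil] at h0
        obtain ⟨h0, rfl⟩ := h0
        obtain rfl : k = [] := by simpa using h0
        simp only [glue, List.reverse_nil, List.map_nil, Tail.app_nil, ofTail, triv.injEq] at hY
        obtain ⟨rfl, rfl⟩ := hY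
        exact ⟨[], rfl, by simp [glue, ofTail, Letter.flip_flip], fun _ _ => hs⟩
      · cases e <;> simp [glue] at hY
    | fin_fin l l' =>
      obtain rfl : [a] = l := by simpa using hX
      rcases b with k | s
      · refine ⟨k, rfl, ?_, ?_⟩
        · rw [← glue_cons_left]
          simp only [glue] at hY
          generalize Tail.app (k.reverse.map Letter.flip) e = t at hY
          rcases t with (_ | ⟨c, m⟩) | s
          · simp [ofTail] at hY
          · simp only [ofTail, fin.injEq] at hY
            subst hY
            rfl
          · simp [ofTail] at hY
        · rintro rfl rfl
          simp [glue, ofTail] at hY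
      · cases e <;> simp [glue] at hY
    | fin_right l t' =>
      obtain rfl : [a] = l := by simpa using hX
      rcases b with k | s
      · refine ⟨k, rfl, ?_, ?_⟩
        · rw [← glue_cons_left]
          simp only [glue] at hY
          generalize Tail.app (k.reverse.map Letter.flip) e = t at hY
          rcases t with (_ | ⟨c, m⟩) | s
          · simp [ofTail] at hY
          · simp [ofTail] at hY
          · simp only [ofTail, right.injEq] at hY
            subst hY
            rfl
        · rintro rfl rfl
          simp [glue, ofTail] at hY
      · cases e <;> simp [glue] at hY
    | left_fin t l => cases hX
    | left_right t t' => cases hX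
  · rintro ⟨k, rfl, rfl, h⟩
    rw [← glue_cons_left]
    simp only [glue]
    rcases ht : Tail.app (k.reverse.map Letter.flip) e with (_ | ⟨c, m⟩) | s
    · rw [Tail.app_eq_nil] at ht
      have := h ht.2 (by simpa using ht.1)
      refine Comp.triv_right _ _ _ ?_
      rw [inv_fin_start]
      simp [this.1, this.2]
    · exact Comp.fin_fin _ _
    · exact Comp.fin_right _ _

end Comp

/-- A letter at the junction may be counted with either tail. For a `ℤ`-sequence this moves the
origin by one position, and for other sequences nothing changes; this is the source of the shift by
`1` in the definition of `R_C`. -/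
lemma shift_glue (v w : V) (ε δ : ℤˣ) (a : Letter α) (b e : Tail (Letter α)) :
    (glue v ε b (.app [a.flip] e)).shift 1 = glue w δ (.app [a] b) e := by
  rcases b with b | b
  · have h1 : ∀ t : Tail (Letter α), (ofTail v ε t).shift 1 = ofTail v ε t := by
      rintro ((_ | ⟨a, l⟩) | s) <;> rfl
    simp only [glue, h1, Tail.app_app, Tail.app_fin]
    rw [ofTail_congr (w := w) (δ := δ)]
    · congr 2
      simp
    · exact Tail.app_ne_nil (by simp) _
  · have hs : Stream'.map Letter.flip ([a] ++ₛ b) = [a.flip] ++ₛ b.map Letter.flip := by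
      rw [Stream'.map_append_stream]; rfl
    rcases e with e | e
    · simp only [glue, Tail.app, shift, hs]
      rw [← Stream'.append_append_stream]
      simp
    · simp only [glue, Tail.app, shift, hs]
      congr 1
      funext i
      rcases lt_trichotomy i 0 with h | rfl | h
      · rw [if_pos (by omega), if_pos (by omega), show (-i).toNat = [a.flip].length +
          (-(i + 1)).toNat by simp; omega, Stream'.get_append_right]
      · rfl
      · rw [if_neg (by omega), if_neg (by omega), show (i + 1 - 1).toNat = [a.flip].length +
          (i - 1).toNat by simp; omega, Stream'.get_append_right]

end Seqn

/-! ### A common setting for the tails of words and of generalised words -/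

namespace Seqn

variable {V α : Type*}

/-- An adjacency relation `r` together with a class `c` of letters that occur in the tails: the
letters `(c x)⁻¹` and `c y` may be consecutive iff they have the same head and opposite signs. -/
structure Polarised (hd : Letter α → V) (sg : Letter α → ℤˣ) (r : Letter α → Letter α → Prop)
    (c : α → Letter α) : Prop where
  flip_iff : ∀ a b, r a b ↔ r b.flip a.flip
  junction : ∀ x y, r (c x).flip (c y) ↔ hd (c x) = hd (c y) ∧ sg (c y) = -sg (c x)
  inj : Function.Injective c
  flip_ne : ∀ x y, (c x).flip ≠ c y

/-- A list of letters to both ends of which tails can be attached. -/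
structure IsCoreList (hd : Letter α → V) (sg : Letter α → ℤˣ) (r : Letter α → Letter α → Prop)
    (c : α → Letter α) (l : List (Letter α)) (v : V) (ε : ℤˣ) (w : V) (δ : ℤˣ) : Prop
    extends HasEnds hd sg l v ε w δ where
  chain : l.IsChain r
  head_eq : ∀ a, l.head? = some a → ∃ x, a = c x
  last_eq : ∀ a, l.getLast? = some a → ∃ x, a = (c x).flip

/-- The tail `d` is admissible for the head `w` and the sign `δ`. -/
def TailGood (hd : Letter α → V) (sg : Letter α → ℤˣ) (r : Letter α → Letter α → Prop)
    (c : α → Letter α) (w : V) (δ : ℤˣ) (d : Tail α) : Prop :=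
  Tail.Good (fun x => hd (c x) = w ∧ sg (c x) = δ) (fun x y => r (c x) (c y)) d

lemma exists_map_eq {c : α → Letter α} {t : Tail (Letter α)}
    (h : ∀ n a, t.get? n = some a → ∃ x, a = c x) : ∃ d : Tail α, t = d.map c := by
  classical
  obtain ⟨d, hd⟩ := Tail.exists_get?_eq
    (fun n => if h : ∃ x, t.get? n = some (c x) then some h.choose else none) (by
      intro n hn
      split_ifs at hn with h1
      rw [dif_neg]
      rintro ⟨x, hx⟩
      rcases ht : t.get? n with _ | a
      · rw [Tail.get?_succ_eq_none ht] at hx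
        cases hx
      · obtain ⟨y, rfl⟩ := h n a ht
        exact h1 ⟨y, ht⟩)
  refine ⟨d, Tail.ext fun n => ?_⟩
  rw [Tail.get?_map, hd]
  split_ifs with h1
  · exact h1.choose_spec
  · rcases ht : t.get? n with _ | a
    · rfl
    · obtain ⟨y, rfl⟩ := h n a ht
      exact absurd ⟨y, ht⟩ h1

section

variable {hd : Letter α → V} {sg : Letter α → ℤˣ} {r : Letter α → Letter α → Prop}
  {c : α → Letter α}

lemma TailGood.matches {w : V} {δ : ℤˣ} {d : Tail α} (h : TailGood hd sg r c w δ d) :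
    Matches hd sg w δ (d.map c) := by
  intro a ha
  rw [Tail.get?_map] at ha
  obtain ⟨x, hx, rfl⟩ := Option.map_eq_some_iff.1 ha
  exact h.1 x hx

lemma tailGood_nil (w : V) (δ : ℤˣ) : TailGood hd sg r c w δ (.fin []) := Tail.good_nil _ _

lemma tailGood_iff {w : V} {δ : ℤˣ} {d : Tail α} :
    TailGood hd sg r c w δ d ↔ Matches hd sg w δ (d.map c) ∧ (d.map c).Chain r := by
  rw [Tail.chain_map]
  refine ⟨fun h => ⟨h.matches, h.2⟩, fun h => ⟨fun x hx => h.1 _ ?_, h.2⟩⟩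
  rw [Tail.get?_map, hx]
  rfl

variable {l l' : List (Letter α)} {v v' w w' : V} {ε ε' δ δ' : ℤˣ} {b b' d d' : Tail α}

/-- The outer letters of `l` carry the heads and signs recorded in `HasEnds`, so the junction axiom
turns adjacency at both ends into the matching conditions on the tails. The two extra hypotheses
concern the degenerate cases in which no letter is available at a junction to detect the condition.
-/
lemma related_glue_iff (P : Polarised hd sg r c) (hl : IsCoreList hd sg r c l v ε w δ)
    (h1 : l = [] → Matches hd sg w δ (d.map c))
    (h2 : l = [] → d = .fin [] → Matches hd sg v (-ε) (b.map c)) :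
    Related r (glue v ε (b.map c) (.app l (d.map c))) ↔
      TailGood hd sg r c v (-ε) b ∧ TailGood hd sg r c w δ d := by
  rw [related_glue P.flip_iff, Tail.chain_app, tailGood_iff, tailGood_iff]
  have key : ∀ a z, hd (c z) = v ∧ sg (c z) = ε →
      (r (c a).flip (c z) ↔ hd (c a) = v ∧ sg (c a) = -ε) := by
    rintro a z ⟨e1, e2⟩
    rw [P.junction, e1, e2]
    refine and_congr_right fun _ => ⟨fun h => by rw [h, neg_neg], fun h => by rw [h, neg_neg]⟩
  -- The last letter of `l` is the inverse of some `c y` with head `w` and sign `-δ`, so the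
  -- junction axiom asks for head `w` and sign `δ`.
  have hjr : l ≠ [] → ((∀ a b, l.getLast? = some a → (d.map c).get? 0 = some b → r a b) ↔
      Matches hd sg w δ (d.map c)) := by
    intro hne
    have e := List.getLast?_eq_some_getLast hne
    obtain ⟨y, hy⟩ := hl.last_eq _ e
    obtain ⟨e1, e2⟩ := hl.last _ e
    rw [hy, Letter.flip_flip] at e1 e2
    refine ⟨fun h a ha => ?_, fun h a z ha hz => ?_⟩
    · rw [Tail.get?_map] at ha
      obtain ⟨x, hx, rfl⟩ := Option.map_eq_some_iff.1 ha
      have := h _ (c x) e (by rw [Tail.get?_map, hx]; rfl)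
      rw [hy, P.junction, e1, e2, neg_neg] at this
      exact ⟨this.1.symm, this.2⟩
    · obtain rfl := Option.some_injective _ (e.symm.trans ha)
      obtain ⟨h3, h4⟩ := h z hz
      rw [Tail.get?_map] at hz
      obtain ⟨x, hx, rfl⟩ := Option.map_eq_some_iff.1 hz
      rw [hy, P.junction, e1, e2, neg_neg]
      exact ⟨h3.symm, h4⟩
  have hjl : (l ≠ [] ∨ d ≠ .fin []) → Matches hd sg v ε (.app l (d.map c)) →
      ((∀ a z, (b.map c).get? 0 = some a → (Tail.app l (d.map c)).get? 0 = some z → r a.flip z) ↔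
      Matches hd sg v (-ε) (b.map c)) := by
    intro hne hm
    have hz : ∃ z, (Tail.app l (d.map c)).get? 0 = some (c z) := by
      by_cases hl0 : l = []
      · subst hl0
        rw [Tail.app_nil]
        obtain ⟨z, hz⟩ := Tail.exists_get?_zero (hne.resolve_left (fun h => h rfl))
        exact ⟨z, by rw [Tail.get?_map, hz]; rfl⟩
      · obtain ⟨z, hz⟩ := hl.head_eq _ (List.head?_eq_some_head hl0)
        exact ⟨z, by rw [Tail.get?_zero_app_of_ne_nil hl0, ← List.head?_eq_getElem?, ← hz,
          List.head?_eq_some_head hl0]⟩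
    obtain ⟨z, hz⟩ := hz
    refine ⟨fun h a ha => ?_, fun h a z' ha hz' => ?_⟩
    · have h3 := h a (c z) ha hz
      rw [Tail.get?_map] at ha
      obtain ⟨x, hx, rfl⟩ := Option.map_eq_some_iff.1 ha
      exact (key x z (hm _ hz)).1 h3
    · obtain rfl := Option.some_injective _ (hz.symm.trans hz')
      have h3 := h a ha
      rw [Tail.get?_map] at ha
      obtain ⟨x, hx, rfl⟩ := Option.map_eq_some_iff.1 ha
      exact (key x z (hm _ hz)).2 h3
  have hmr : ∀ {p q : Prop}, Matches hd sg w δ (d.map c) → (p ↔ q) →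
      ((d.map c).Chain r ∧ p ↔ (d.map c).Chain r ∧ q) := fun _ h => and_congr_right fun _ => h
  constructor
  · rintro ⟨hb, ⟨hlc, hd', hj⟩, hj'⟩
    have hm : Matches hd sg w δ (d.map c) := by
      by_cases hl0 : l = []
      · exact h1 hl0
      · exact (hjr hl0).1 hj
    refine ⟨⟨?_, hb⟩, hm, hd'⟩
    by_cases h0 : l = [] ∧ d = .fin []
    · exact h2 h0.1 h0.2
    · exact (hjl (by tauto) (hl.matches_app fun _ => hm)).1 hj'
  · rintro ⟨⟨hmb, hb⟩, hm, hd'⟩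
    refine ⟨hb, ⟨hl.chain, hd', ?_⟩, ?_⟩
    · by_cases hl0 : l = []
      · subst hl0
        intro a b h
        simp at h
      · exact (hjr hl0).2 hm
    · by_cases h0 : l = [] ∧ d = .fin []
      · intro a z ha hz
        rw [h0.1, h0.2] at hz
        simp at hz
      · exact (hjl (by tauto) (hl.matches_app fun _ => hm)).2 hmb

lemma related_ofTail_iff (P : Polarised hd sg r c) (hl : IsCoreList hd sg r c l v ε w δ)
    (h1 : l = [] → Matches hd sg w δ (d.map c)) :
    Related r (ofTail v ε (.app l (d.map c))) ↔ TailGood hd sg r c w δ d := by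
  have h := related_glue_iff (b := .fin []) P hl h1 (fun _ _ a ha => by simp at ha)
  rw [Tail.map_fin, List.map_nil, glue_nil] at h
  rw [h]
  exact and_iff_right (tailGood_nil _ _)

lemma isCoreList_nil : IsCoreList hd sg r c [] v ε v ε where
  nil _ := ⟨rfl, rfl⟩
  head := by simp
  last := by simp
  chain := by simp
  head_eq := by simp
  last_eq := by simp

lemma related_ofTail_map (P : Polarised hd sg r c) (h1 : Matches hd sg w δ (d.map c)) :
    Related r (ofTail w δ (d.map c)) ↔ TailGood hd sg r c w δ d := by
  have := related_ofTail_iff (d := d) P (isCoreList_nil (v := w) (ε := δ)) (fun _ => h1)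
  rwa [Tail.app_nil] at this

/-- The decompositions `B⁻¹(AD)` with prescribed `A`, in terms of tails. -/
lemma decomp_iff (P : Polarised hd sg r c) (hl : IsCoreList hd sg r c l v ε w δ)
    {B C D : Seqn V (Letter α)} (hB : Related r B) (hD : Related r D) (hC : Related r C)
    (hBc : ∀ i a, B.letter i = some a → ∃ x, a = c x)
    (hDc : ∀ i a, D.letter i = some a → ∃ x, a = c x) :
    (∃ E, Comp hd sg (ofTail v ε (.fin l)) D E ∧ Related r E ∧ Comp hd sg B.inv E C) ↔
      ∃ b d : Tail α, TailGood hd sg r c v (-ε) b ∧ TailGood hd sg r c w δ d ∧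
        B = ofTail v (-ε) (b.map c) ∧ D = ofTail w δ (d.map c) ∧
        C = glue v ε (b.map c) (.app l (d.map c)) := by
  have hmap : ∀ {x : V} {η : ℤˣ} {t : Tail (Letter α)},
      (∀ i a, (ofTail x η t).letter i = some a → ∃ x, a = c x) → ∃ d : Tail α, t = d.map c := by
    intro x η t h
    refine exists_map_eq fun n a ha => h (n + 1) a ?_
    rw [letter_ofTail, if_pos (by omega), ← ha]
    congr 1; omega
  constructor
  · rintro ⟨E, h1, -, h2⟩
    obtain ⟨t, rfl, rfl, ht⟩ := (comp_ofTail hl.toHasEnds hD.1).1 h1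
    obtain ⟨d, rfl⟩ := hmap hDc
    obtain ⟨u, rfl, rfl, hu⟩ := (comp_inv_ofTail (hl.matches_app ht) hB.1).1 h2
    obtain ⟨b, rfl⟩ := hmap hBc
    have h3 := (related_glue_iff P hl ht (fun e1 e2 => hu (by simp [e1, e2]))).1 hC
    exact ⟨b, d, h3.1, h3.2, rfl, rfl, rfl⟩
  · rintro ⟨b, d, hb, hd', rfl, rfl, rfl⟩
    refine ⟨ofTail v ε (.app l (d.map c)), (comp_ofTail hl.toHasEnds hD.1).2
      ⟨_, rfl, rfl, fun _ => hd'.matches⟩, ?_, ?_⟩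
    · exact (related_ofTail_iff P hl fun _ => hd'.matches).2 hd'
    · exact (comp_inv_ofTail (hl.matches_app fun _ => hd'.matches) hB.1).2
        ⟨_, rfl, rfl, fun _ => hb.matches⟩

/-- The boundaries can be seen in the letters. All letters of `B⁻¹` are inverses of letters of class
`c`, whereas `AD` starts with a letter of class `c`; and all letters of `D` are of class `c`,
whereas a non-trivial `A` ends with the inverse of such a letter. -/
lemma glue_app_injective (P : Polarised hd sg r c) (hl : IsCoreList hd sg r c l v ε w δ)
    (hl' : IsCoreList hd sg r c l' v' ε' w' δ') (hb : TailGood hd sg r c v (-ε) b)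
    (hd₀ : TailGood hd sg r c w δ d) (hb' : TailGood hd sg r c v' (-ε') b')
    (hd' : TailGood hd sg r c w' δ' d')
    (h : glue v ε (b.map c) (.app l (d.map c)) = glue v' ε' (b'.map c) (.app l' (d'.map c))) :
    l = l' ∧ b = b' ∧ d = d' ∧ (l = [] → v = v' ∧ ε = ε') := by
  have hmap : ∀ {t : Tail α} (n a), (t.map c).get? n = some a → ∃ x, a = c x := by
    intro t n a ha
    rw [Tail.get?_map] at ha
    obtain ⟨x, -, rfl⟩ := Option.map_eq_some_iff.1 ha
    exact ⟨x, rfl⟩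
  have hhead : ∀ {l : List (Letter α)} {v w : V} {ε δ : ℤˣ} {d : Tail α},
      IsCoreList hd sg r c l v ε w δ → ∀ a, (Tail.app l (d.map c)).get? 0 = some a →
        ¬ ∃ x, a = (c x).flip := by
    rintro l v w ε δ d hl _ ha ⟨x, rfl⟩
    have : ∃ y, (c x).flip = c y := by
      by_cases hl0 : l = []
      · subst hl0
        rw [Tail.app_nil] at ha
        exact hmap _ _ ha
      · rw [Tail.get?_zero_app_of_ne_nil hl0, ← List.head?_eq_getElem?] at ha
        exact hl.head_eq _ ha
    obtain ⟨y, hy⟩ := this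
    exact P.flip_ne x y hy
  have hflip : ∀ {t : Tail α} (n a), (t.map c).get? n = some a → ∃ x, a.flip = (c x).flip := by
    intro t n a ha
    obtain ⟨x, rfl⟩ := hmap n a ha
    exact ⟨x, rfl⟩
  obtain ⟨e1, e2⟩ := glue_injective (p := fun a => ∃ x, a = (c x).flip) hflip hflip
    (hhead hl) (hhead hl') h
  have hlast : ∀ {l : List (Letter α)} {v w : V} {ε δ : ℤˣ}, IsCoreList hd sg r c l v ε w δ →
      ∀ a, l.getLast? = some a → ¬ ∃ x, a = c x := by
    rintro l v w ε δ hl _ ha ⟨x, rfl⟩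
    obtain ⟨y, hy⟩ := hl.last_eq _ ha
    exact P.flip_ne y x hy.symm
  obtain ⟨e3, e4⟩ := app_injective (p := fun a => ∃ x, a = c x) (hlast hl) (hlast hl') hmap hmap e2
  obtain rfl := Tail.map_injective P.inj e1
  obtain rfl := Tail.map_injective P.inj e4
  subst e3
  refine ⟨rfl, rfl, rfl, fun hl0 => ?_⟩
  subst hl0
  obtain ⟨rfl, rfl⟩ := hl.nil rfl
  obtain ⟨rfl, rfl⟩ := hl'.nil rfl
  -- For an empty core, its head and sign are read off from the first letter of a tail, or from the
  -- trivial sequence if both tails are empty.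
  by_cases hd0 : d = .fin []
  · by_cases hb0 : b = .fin []
    · subst hd0 hb0
      exact glue_nil_inj h
    · obtain ⟨x, hx⟩ := Tail.exists_get?_zero hb0
      have h1 := hb.1 x hx
      have h2 := hb'.1 x hx
      exact ⟨h1.1.symm.trans h2.1, neg_injective (h1.2.symm.trans h2.2)⟩
  · obtain ⟨x, hx⟩ := Tail.exists_get?_zero hd0
    have h1 := hd₀.1 x hx
    have h2 := hd'.1 x hx
    exact ⟨h1.1.symm.trans h2.1, h1.2.symm.trans h2.2⟩

lemma comp_singleton_ofTail {t : Tail (Letter α)} (a : Letter α) (G : Seqn V (Letter α)) :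
    Comp hd sg (ofTail v ε t) (.fin [a]) G ↔ ∃ m, t = .fin m ∧ G = ofTail v ε (.fin (m ++ [a])) ∧
      (m = [] → hd a = v ∧ sg a = ε) := by
  constructor
  · intro h
    rcases t with m | s
    · refine ⟨m, rfl, ?_⟩
      by_cases hm : m = []
      · subst hm
        obtain ⟨d, h1, h2, h3⟩ := (comp_ofTail (l := []) (isCoreList_nil (r := fun _ _ => True)
          (c := Letter.dir)).toHasEnds (by simp)).1 h
        have h4 : d = .fin [a] := (ofTail_injective (w := v) (δ := ε) (t' := .fin [a]) h1.symm)
        subst h4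
        exact ⟨h2, fun _ => h3 rfl a (by simp)⟩
      · rw [ofTail_fin_of_ne_nil _ _ hm] at h
        rw [ofTail_fin_of_ne_nil _ _ (by simp)]
        cases h
        exact ⟨rfl, fun h => absurd h hm⟩
    · cases h
  · rintro ⟨m, rfl, rfl, h⟩
    by_cases hm : m = []
    · subst hm
      obtain ⟨h1, h2⟩ := h rfl
      refine Comp.triv_left _ _ _ ?_
      simp [start, h1, h2]
    · rw [ofTail_fin_of_ne_nil _ _ hm, ofTail_fin_of_ne_nil _ _ (by simp)]
      exact Comp.fin_fin _ _

lemma matches_concat {x : α} {k : List α} (h : TailGood hd sg r c w δ (.fin k))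
    (h0 : k = [] → hd (c x) = w ∧ sg (c x) = δ) :
    Matches hd sg w δ ((Tail.fin (k ++ [x])).map c) := by
  intro a ha
  rcases k with _ | ⟨y, k⟩
  · simp at ha; subst ha
    exact h0 rfl
  · exact h.matches a (by simpa using ha)

/-- Extension on the right by a letter of the class `c`. -/
lemma extend_right_iff (P : Polarised hd sg r c) (hl : IsCoreList hd sg r c l v ε w δ)
    (hd₀ : TailGood hd sg r c w δ d) (x : α) :
    (∃ G, Comp hd sg (ofTail v ε (.app l (d.map c))) (.fin [c x]) G ∧ Related r G) ↔
      ∃ k, d = .fin k ∧ TailGood hd sg r c w δ (.fin (k ++ [x])) := by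
  have e : ∀ k : List α, ofTail v ε (.fin (l ++ k.map c ++ [c x])) =
      ofTail v ε (.app l ((Tail.fin (k ++ [x])).map c)) := fun k => by simp
  constructor
  · rintro ⟨G, h1, h2⟩
    obtain ⟨m, hm, rfl, h3⟩ := (comp_singleton_ofTail _ _).1 h1
    rcases d with k | s
    · obtain rfl : l ++ k.map c = m := by simpa using hm
      rw [e, related_ofTail_iff P hl] at h2
      · exact ⟨k, rfl, h2⟩
      · rintro rfl
        obtain ⟨rfl, rfl⟩ := hl.nil rfl
        exact matches_concat hd₀ fun h => h3 (by simp [h])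
    · simp [Tail.app] at hm
  · rintro ⟨k, rfl, hk⟩
    refine ⟨_, (comp_singleton_ofTail _ _).2 ⟨l ++ k.map c, rfl, rfl, fun h => ?_⟩, ?_⟩
    · obtain ⟨rfl, h'⟩ := List.append_eq_nil_iff.1 h
      obtain ⟨rfl, rfl⟩ := hl.nil rfl
      obtain rfl : k = [] := by simpa using h'
      exact hk.1 x (by simp)
    · rw [e, related_ofTail_iff P hl fun _ => hk.matches]
      exact hk

/-- Extension on the left by the inverse of a letter of the class `c`. -/
lemma extend_left_iff (P : Polarised hd sg r c) (hl : IsCoreList hd sg r c l v ε w δ)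
    (hb : TailGood hd sg r c v (-ε) b) (hd₀ : TailGood hd sg r c w δ d) (x : α) :
    (∃ G, Comp hd sg (.fin [(c x).flip]) (glue v ε (b.map c) (.app l (d.map c))) G ∧
        Related r G) ↔
      ∃ k, b = .fin k ∧ TailGood hd sg r c v (-ε) (.fin (k ++ [x])) := by
  have hm := hl.matches_app (t := d.map c) fun _ => hd₀.matches
  have e : ∀ k : List α, Tail.fin (k.map c ++ [(c x).flip.flip]) =
      (Tail.fin (k ++ [x])).map c := fun k => by simp [Letter.flip_flip]
  constructor
  · rintro ⟨G, h1, h2⟩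
    obtain ⟨m, hk, rfl, h3⟩ := (comp_singleton_glue _ hm _).1 h1
    rcases b with k | s
    · obtain rfl : k.map c = m := by simpa using hk
      rw [e, related_glue_iff P hl (fun _ => hd₀.matches)] at h2
      · exact ⟨k, rfl, h2.1⟩
      · rintro rfl rfl
        exact matches_concat hb fun h => by simpa [Letter.flip_flip] using h3 (by simp) (by simp [h])
    · simp at hk
  · rintro ⟨k, rfl, hk⟩
    refine ⟨_, (comp_singleton_glue _ hm _).2 ⟨k.map c, rfl, rfl, fun _ h => ?_⟩, ?_⟩
    · obtain rfl : k = [] := by simpa using h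
      simpa [Letter.flip_flip] using hk.1 x (by simp)
    · rw [e, related_glue_iff P hl (fun _ => hd₀.matches) fun _ _ => hk.matches]
      exact ⟨hk, hd₀⟩

end

end Seqn

open Seqn

/-! ### Words and generalised words in normal form -/

section WordBasics

variable {V A : Type*} [Fintype V] {R : Type*} [CommRing R] {Q : BoundQuiver V A}

/-- The pairs of consecutive letters allowed in a word. -/
def WAdj (R : Type*) [CommRing R] (Q : BoundQuiver V A) : Letter A → Letter A → Prop
  | .dir x, .dir y => Follows R Q x y
  | .inv y, .inv x => Follows R Q x y
  | .dir x, .inv y => Q.tl x = Q.tl y ∧ x ≠ y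
  | .inv x, .dir y => Q.hd x = Q.hd y ∧ x ≠ y

lemma wAdj_flip (a b : Letter A) : WAdj R Q a b ↔ WAdj R Q b.flip a.flip := by
  rcases a with x | x <;> rcases b with y | y <;> simp only [WAdj, Letter.flip, eq_comm, ne_eq]

lemma gAdj_flip (a b : Letter (GPath R Q)) : GAdj a b ↔ GAdj b.flip a.flip := by
  rcases a with x | x <;> rcases b with y | y <;> simp only [GAdj, Letter.flip, eq_comm, ne_eq]

lemma isGenWord_iff {C : Seqn V (Letter (GPath R Q))} : IsGenWord C ↔ Related GAdj C :=
  ⟨fun h => ⟨h.1, h.2⟩, fun h => ⟨h.1, h.2⟩⟩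

/-- The condition on all paths that occur in a word is local, because a path avoids the ideal as
soon as all its pairs of consecutive arrows do. -/
lemma isWord_iff [Nontrivial R] {C : Seqn V (Letter A)} :
    IsWord R Q C ↔ Related (WAdj R Q) C := by
  constructor
  · intro h
    refine ⟨h.ne_nil, fun i a b ha hb => ?_⟩
    obtain ⟨h1, h2⟩ := h.adj i a b ha hb
    rcases a with x | x <;> rcases b with y | y
    · refine ⟨h1, h.mem [x, y] ⟨by simp, List.isChain_pair.2 h1⟩ (Or.inl ⟨i, fun k hk => ?_⟩)⟩
      simp only [dirList, List.map_cons, List.map_nil, List.length_cons, List.length_nil] at hk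
      interval_cases k
      · simpa [dirList] using ha
      · simpa [dirList] using hb
    · exact ⟨h1, fun e => h2 (by rw [e]; rfl)⟩
    · exact ⟨h1, fun e => h2 (by rw [e]; rfl)⟩
    · refine ⟨h1.symm, h.mem [y, x] ⟨by simp, List.isChain_pair.2 h1.symm⟩
        (Or.inr ⟨i, fun k hk => ?_⟩)⟩
      simp only [invList, List.length_map, List.length_reverse, List.length_cons,
        List.length_nil] at hk
      interval_cases k
      · simpa [invList] using ha
      · simpa [invList] using hb
  · intro h
    refine ⟨h.1, fun i a b ha hb => ?_, fun p hp hocc => ?_⟩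
    · have := h.2 i a b ha hb
      rcases a with x | x <;> rcases b with y | y
      · exact ⟨this.1, by simp [Letter.flip]⟩
      · exact ⟨this.1, by simpa [Letter.flip] using this.2⟩
      · exact ⟨this.1, by simpa [Letter.flip] using this.2⟩
      · exact ⟨this.1.symm, by simp [Letter.flip]⟩
    · refine pathElt_notMem_relIdeal p hp ?_
      rw [List.isChain_iff_getElem]
      intro j hj
      rcases hocc with ⟨i, hi⟩ | ⟨i, hi⟩
      · have h1 := hi j (by simp [dirList]; omega)
        have h2 := hi (j + 1) (by simp [dirList]; omega)
        simp only [dirList, List.getElem_map, Nat.cast_add, Nat.cast_one, ← add_assoc] at h1 h2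
        exact (h.2 _ _ _ h1 h2).2
      · have h1 := hi (p.length - 1 - (j + 1)) (by simp [invList]; omega)
        have h2 := hi (p.length - 1 - (j + 1) + 1) (by simp [invList]; omega)
        simp only [invList, List.getElem_map, Nat.cast_add, Nat.cast_one, ← add_assoc,
          List.getElem_reverse] at h1 h2
        have h3 := (h.2 _ _ _ h1 h2).2
        have e1 : ∀ (k : ℕ) (hk : k < p.length) (j : ℕ) (hj : j < p.length), k = j → p[k] = p[j] :=
          fun k _ j _ e => by subst e; rfl
        rwa [e1 (p.length - 1 - (p.length - 1 - (j + 1) + 1)) (by omega) j (by omega) (by omega),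
          e1 (p.length - 1 - (p.length - 1 - (j + 1))) (by omega) (j + 1) hj (by omega)] at h3

/-- Letters with equal heads and signs form an exceptional pair only if one of them is direct and
the other inverse. Two distinct inverse letters with the same head thus have opposite signs. -/
lemma IsSign.ne_iff {s : Letter A → ℤˣ} (hs : IsSign R Q s) {x y : A} (h : Q.tl x = Q.tl y) :
    x ≠ y ↔ s (.inv y) = -s (.inv x) := by
  constructor
  · intro hne
    rw [← Int.units_ne_iff_eq_neg]
    intro e
    obtain ⟨_, _, h1 | h1, -⟩ := hs (.inv y) (.inv x) (by simpa using hne.symm) h.symm e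
    · cases h1.2
    · cases h1.1
  · rintro h rfl
    rw [← Int.units_ne_iff_eq_neg] at h
    exact h rfl

lemma IsSign.eq_of_eq {s : Letter A → ℤˣ} (hs : IsSign R Q s) {x y : A} (h : Q.tl x = Q.tl y)
    (h' : s (.inv x) = s (.inv y)) : x = y := by
  by_contra hne
  have := (hs.ne_iff h).1 hne
  rw [← Int.units_ne_iff_eq_neg] at this
  exact this h'.symm

lemma word_polarised {s : Letter A → ℤˣ} (hs : IsSign R Q s) :
    Polarised Q.lhead s (WAdj R Q) Letter.inv where
  flip_iff := wAdj_flip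
  junction x y := by
    change (Q.tl x = Q.tl y ∧ x ≠ y) ↔ Q.tl x = Q.tl y ∧ _
    exact and_congr_right fun h => hs.ne_iff h
  inj x y h := by cases h; rfl
  flip_ne x y h := by cases h

/-- The sign of `⟨γ⟩` is that of the inverse of its first arrow, so the sign criterion for inverse
letters of words serves here as well. The class that occurs in the tails is now that of the direct
letters. -/
lemma gen_polarised {s : Letter A → ℤˣ} (hs : IsSign R Q s) :
    Polarised (ghead (R := R) (Q := Q)) (gsign s) GAdj Letter.dir where
  flip_iff := gAdj_flip
  junction x y := by
    change (x.tl = y.tl ∧ x.first ≠ y.first) ↔ x.tl = y.tl ∧ _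
    exact and_congr_right fun h => hs.ne_iff h
  inj x y h := by cases h; rfl
  flip_ne x y h := by cases h

/-- Admissible tails of words. -/
abbrev WTail (R : Type*) [CommRing R] (Q : BoundQuiver V A) (s : Letter A → ℤˣ) (w : V) (δ : ℤˣ)
    (d : Tail A) : Prop := TailGood Q.lhead s (WAdj R Q) Letter.inv w δ d

/-- Admissible tails of generalised words. -/
abbrev GTail (s : Letter A → ℤˣ) (w : V) (δ : ℤˣ) (t : Tail (GPath R Q)) : Prop :=
  TailGood ghead (gsign s) GAdj Letter.dir w δ t

/-! ### The core of a string word and of a string resolution -/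

lemma GPath.dirList_head? (γ : GPath R Q) : (dirList γ.1).head? = some (.dir γ.last) := by
  simp [dirList, GPath.last, List.head?_eq_some_head γ.ne_nil]

lemma GPath.dirList_getLast? (γ : GPath R Q) : (dirList γ.1).getLast? = some (.dir γ.first) := by
  simp [dirList, GPath.first, List.getLast?_eq_some_getLast γ.ne_nil]

lemma GPath.invList_head? (γ : GPath R Q) : (invList γ.1).head? = some (.inv γ.first) := by
  simp [invList, GPath.first, List.getLast?_eq_some_getLast γ.ne_nil]

lemma GPath.invList_getLast? (γ : GPath R Q) : (invList γ.1).getLast? = some (.inv γ.last) := by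
  simp [invList, GPath.last, List.head?_eq_some_head γ.ne_nil]

lemma invList_isChain {p : List A} : (invList p).IsChain (WAdj R Q) ↔ p.IsChain (Follows R Q) := by
  rw [invList, List.isChain_map, List.isChain_reverse]
  rfl

lemma dirList_isChain {p : List A} : (dirList p).IsChain (WAdj R Q) ↔ p.IsChain (Follows R Q) := by
  rw [dirList, List.isChain_map]
  rfl

lemma altList_cons (p : GPath R Q × GPath R Q) (ps : List (GPath R Q × GPath R Q)) :
    altList (p :: ps) = invList p.1.1 ++ (dirList p.2.1 ++ altList ps) := by
  simp [altList]

lemma galtList_cons (p : GPath R Q × GPath R Q) (ps : List (GPath R Q × GPath R Q)) :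
    galtList (p :: ps) = .dir p.1 :: .inv p.2 :: galtList ps := by
  simp [galtList]

lemma invList_ne_nil (γ : GPath R Q) : invList γ.1 ≠ [] := by
  simpa [invList] using γ.ne_nil

lemma dirList_ne_nil (γ : GPath R Q) : dirList γ.1 ≠ [] := by
  simpa [dirList] using γ.ne_nil

lemma altList_head? (p : GPath R Q × GPath R Q) (ps : List (GPath R Q × GPath R Q)) :
    (altList (p :: ps)).head? = some (.inv p.1.first) := by
  rw [altList_cons, List.head?_append, GPath.invList_head?]
  rfl

lemma altList_getLast? (p : GPath R Q × GPath R Q) (ps : List (GPath R Q × GPath R Q)) :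
    (altList (p :: ps)).getLast? =
      some (.dir ((p :: ps).getLast (List.cons_ne_nil _ _)).2.first) := by
  induction ps generalizing p with
  | nil =>
    rw [altList_cons, List.getLast?_append, List.getLast?_append, GPath.dirList_getLast?]
    rfl
  | cons q ps ih =>
    rw [altList_cons, List.getLast?_append, List.getLast?_append, ih]
    rfl

lemma galtList_getLast? (p : GPath R Q × GPath R Q) (ps : List (GPath R Q × GPath R Q)) :
    (galtList (p :: ps)).getLast? =
      some (.inv ((p :: ps).getLast (List.cons_ne_nil _ _)).2) := by
  induction ps generalizing p with
  | nil => rfl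
  | cons q ps ih =>
    have := ih q
    rw [galtList_cons, List.getLast?_cons_cons]
    rw [galtList_cons] at this ⊢
    rw [List.getLast?_cons_cons, this]
    rfl

/-- Inside the blocks `γ_i⁻¹` and `σ_i` the adjacency conditions hold because the paths lie in `P`.
The conditions where blocks meet involve only last or only first arrows, and they coincide with
those for generalised letters. -/
lemma altList_isChain [Nontrivial R] (ps : List (GPath R Q × GPath R Q)) :
    (altList ps).IsChain (WAdj R Q) ↔ (galtList ps).IsChain GAdj := by
  induction ps with
  | nil => simp [altList, galtList]
  | cons p ps ih =>
    rw [altList_cons, galtList_cons, List.isChain_append, List.isChain_append, ih,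
      List.head?_append, GPath.invList_getLast?, GPath.dirList_getLast?, GPath.dirList_head?,
      invList_isChain, dirList_isChain, List.isChain_cons_cons]
    have e1 : WAdj R Q (.inv p.1.last) (.dir p.2.last) ↔ GAdj (.dir p.1) (.inv p.2) := Iff.rfl
    have e2 : (∀ x ∈ some (Letter.dir p.2.first), ∀ y ∈ (altList ps).head?, WAdj R Q x y) ∧
        (galtList ps).IsChain GAdj ↔ (Letter.inv p.2 :: galtList ps).IsChain GAdj := by
      rcases ps with _ | ⟨q, ps⟩
      · simp [altList, galtList]
      · rw [altList_head?, galtList_cons, List.isChain_cons_cons (a := Letter.inv p.2)]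
        simp only [Option.mem_def, Option.some.injEq, forall_eq']
        exact Iff.rfl
    rw [← e1, ← e2]
    have h1 := p.1.isChain
    have h2 := p.2.isChain
    simp only [Option.mem_def, Option.some.injEq, forall_eq', Option.some_or]
    tauto

lemma append_inj_of_head {α : Type*} {p : α → Prop} {l l' t t' : List α} (hl : ∀ a ∈ l, p a)
    (hl' : ∀ a ∈ l', p a) (ht : ∀ a, t.head? = some a → ¬ p a)
    (ht' : ∀ a, t'.head? = some a → ¬ p a) (h : l ++ t = l' ++ t') : l = l' ∧ t = t' := by
  induction l generalizing l' with
  | nil =>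
    cases l' with
    | nil => exact ⟨rfl, h⟩
    | cons a l' => exact absurd (hl' a (by simp)) (ht a (by simp at h; simp [h]))
  | cons a l ih =>
    cases l' with
    | nil => exact absurd (hl a (by simp)) (ht' a (by simp at h; simp [← h]))
    | cons a' l' =>
      simp only [List.cons_append, List.cons.injEq] at h
      obtain ⟨rfl, h⟩ := h
      obtain ⟨e, h⟩ := ih (fun a ha => hl a (by simp [ha])) (fun a ha => hl' a (by simp [ha])) h
      exact ⟨by rw [e], h⟩

lemma dirList_injective : Function.Injective (dirList (A := A)) :=
  List.map_injective_iff.2 fun x y h => by cases h; rfl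

lemma invList_injective : Function.Injective (invList (A := A)) := fun p q h =>
  List.reverse_injective (List.map_injective_iff.2 (fun x y h => by cases h; rfl) h)

/-- The paths can be recovered from the word: the blocks are its maximal runs of inverse and of
direct letters. -/
lemma altList_injective : Function.Injective (altList (R := R) (Q := Q)) := by
  intro ps
  induction ps with
  | nil =>
    rintro (_ | ⟨q, qs⟩) h
    · rfl
    · have := congrArg List.head? h
      rw [altList_head?] at this
      cases this
  | cons p ps ih =>
    rintro (_ | ⟨q, qs⟩) h
    · have := congrArg List.head? h
      rw [altList_head?] at this
      cases this
    · rw [altList_cons, altList_cons] at h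
      obtain ⟨h1, h2⟩ := append_inj_of_head (p := fun a => ∃ x, a = Letter.inv x)
        (by rintro a ha; simp only [invList, List.mem_map] at ha; exact ha.imp fun _ h => h.2.symm)
        (by rintro a ha; simp only [invList, List.mem_map] at ha; exact ha.imp fun _ h => h.2.symm)
        (by
          rw [List.head?_append, GPath.dirList_head?]
          rintro a ha ⟨x, rfl⟩
          cases ha)
        (by
          rw [List.head?_append, GPath.dirList_head?]
          rintro a ha ⟨x, rfl⟩
          cases ha) h
      have hhead : ∀ (ps : List (GPath R Q × GPath R Q)) (a : Letter A),
          (altList ps).head? = some a → ¬ ∃ x, a = Letter.dir x := by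
        rintro (_ | ⟨r, rs⟩) a ha ⟨x, rfl⟩
        · cases ha
        · rw [altList_head?] at ha
          cases ha
      obtain ⟨h3, h4⟩ := append_inj_of_head (p := fun a => ∃ x, a = Letter.dir x)
        (by rintro a ha; simp only [dirList, List.mem_map] at ha; exact ha.imp fun _ h => h.2.symm)
        (by rintro a ha; simp only [dirList, List.mem_map] at ha; exact ha.imp fun _ h => h.2.symm)
        (hhead _) (hhead _) h2
      rw [ih h4, Prod.ext (Subtype.ext (invList_injective h1)) (Subtype.ext (dirList_injective h3))]

lemma galtList_injective : Function.Injective (galtList (R := R) (Q := Q)) := by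
  intro ps
  induction ps with
  | nil =>
    rintro (_ | ⟨q, qs⟩) h
    · rfl
    · rw [galtList_cons] at h
      cases h
  | cons p ps ih =>
    rintro (_ | ⟨q, qs⟩) h
    · rw [galtList_cons] at h
      cases h
    · rw [galtList_cons, galtList_cons] at h
      simp only [List.cons.injEq, Letter.dir.injEq, Letter.inv.injEq] at h
      rw [ih h.2.2, Prod.ext h.1 h.2.1]

/-- The core `A` of a decomposition `B⁻¹(AD)`: it is trivial, or given by a non-empty list of pairs
of paths. -/
inductive Core (R : Type*) [CommRing R] (Q : BoundQuiver V A) where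
  | triv (v : V) (ε : ℤˣ) : Core R Q
  | alt (p : GPath R Q × GPath R Q) (ps : List (GPath R Q × GPath R Q)) : Core R Q

namespace Core

def pairs : Core R Q → List (GPath R Q × GPath R Q)
  | triv _ _ => []
  | alt p ps => p :: ps

/-- The head of the core. -/
def v₀ : Core R Q → V
  | triv v _ => v
  | alt p _ => p.1.tl

/-- The sign of the core. -/
def ε₀ (s : Letter A → ℤˣ) : Core R Q → ℤˣ
  | triv _ ε => ε
  | alt p _ => s (.inv p.1.first)

/-- The head of the sequences which continue the core. -/
def v₁ : Core R Q → V
  | triv v _ => v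
  | alt p ps => ((p :: ps).getLast (List.cons_ne_nil _ _)).2.tl

/-- The sign of the sequences which continue the core. -/
def ε₁ (s : Letter A → ℤˣ) : Core R Q → ℤˣ
  | triv _ ε => ε
  | alt p ps => -s (.inv ((p :: ps).getLast (List.cons_ne_nil _ _)).2.first)

/-- The letters of the core, as a generalised word, are compatible. -/
def Valid (κ : Core R Q) : Prop := (galtList κ.pairs).IsChain GAdj

/-- The word `A`. -/
def wordSeq (s : Letter A → ℤˣ) (κ : Core R Q) : Seqn V (Letter A) :=
  ofTail κ.v₀ (κ.ε₀ s) (.fin (altList κ.pairs))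

/-- The generalised word `𝒜`. -/
def genSeq (s : Letter A → ℤˣ) (κ : Core R Q) : Seqn V (Letter (GPath R Q)) :=
  ofTail κ.v₀ (κ.ε₀ s) (.fin (galtList κ.pairs))

/-- The word `B⁻¹(AD)`. -/
def word (s : Letter A → ℤˣ) (κ : Core R Q) (b d : Tail A) : Seqn V (Letter A) :=
  glue κ.v₀ (κ.ε₀ s) (b.map .inv) (.app (altList κ.pairs) (d.map .inv))

/-- The generalised word `ℬ⁻¹(𝒜𝒟)`. -/
def genWord (s : Letter A → ℤˣ) (κ : Core R Q) (b d : Tail (GPath R Q)) :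
    Seqn V (Letter (GPath R Q)) :=
  glue κ.v₀ (κ.ε₀ s) (b.map .dir) (.app (galtList κ.pairs) (d.map .dir))

lemma isCoreList_word [Nontrivial R] (s : Letter A → ℤˣ) {κ : Core R Q} (hκ : κ.Valid) :
    IsCoreList Q.lhead s (WAdj R Q) Letter.inv (altList κ.pairs) κ.v₀ (κ.ε₀ s) κ.v₁ (κ.ε₁ s) := by
  have hch := (altList_isChain _).2 hκ
  rcases κ with ⟨v, ε⟩ | ⟨p, ps⟩
  · exact isCoreList_nil
  · simp only [pairs] at hch ⊢
    refine ⟨⟨fun h => ?_, fun a ha => ?_, fun a ha => ?_⟩, hch, fun a ha => ?_, fun a ha => ?_⟩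
    · have := altList_head? p ps
      rw [h] at this
      cases this
    · rw [altList_head?] at ha; cases ha
      exact ⟨rfl, rfl⟩
    · rw [altList_getLast?] at ha; cases ha
      exact ⟨rfl, by simp [ε₁, Letter.flip]⟩
    · rw [altList_head?] at ha; cases ha
      exact ⟨_, rfl⟩
    · rw [altList_getLast?] at ha; cases ha
      exact ⟨_, rfl⟩

/-- The ends carry the same vertices and signs as for the word `A`, since `⟨γ⟩` has the head and the
sign of the letter inverse to the first arrow of `γ`. For this reason the tails of words and of
generalised words are subject to the same data `v₀`, `ε₀`, `v₁`, `ε₁`. -/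
lemma isCoreList_gen (s : Letter A → ℤˣ) {κ : Core R Q} (hκ : κ.Valid) :
    IsCoreList ghead (gsign s) GAdj Letter.dir (galtList κ.pairs) κ.v₀ (κ.ε₀ s) κ.v₁ (κ.ε₁ s) := by
  rcases κ with ⟨v, ε⟩ | ⟨p, ps⟩
  · exact isCoreList_nil
  · simp only [pairs, Valid] at hκ ⊢
    refine ⟨⟨fun h => ?_, fun a ha => ?_, fun a ha => ?_⟩, hκ, fun a ha => ?_, fun a ha => ?_⟩
    · rw [galtList_cons] at h
      cases h
    · rw [galtList_cons] at ha; cases ha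
      exact ⟨rfl, rfl⟩
    · rw [galtList_getLast?] at ha; cases ha
      exact ⟨rfl, by simp [ε₁, Letter.flip, gsign]⟩
    · rw [galtList_cons] at ha; cases ha
      exact ⟨_, rfl⟩
    · rw [galtList_getLast?] at ha; cases ha
      exact ⟨_, rfl⟩

lemma eq_of_pairs {κ κ' : Core R Q} (s : Letter A → ℤˣ) (h : κ.pairs = κ'.pairs)
    (h' : κ.pairs = [] → κ.v₀ = κ'.v₀ ∧ κ.ε₀ s = κ'.ε₀ s) : κ = κ' := by
  rcases κ with ⟨v, ε⟩ | ⟨p, ps⟩ <;> rcases κ' with ⟨v', ε'⟩ | ⟨p', ps'⟩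
  · obtain ⟨h1, h2⟩ := h' rfl
    simp only [v₀, ε₀] at h1 h2
    rw [h1, h2]
  · cases h
  · cases h
  · cases h
    rfl

lemma altList_pairs_eq_nil {κ : Core R Q} : altList κ.pairs = [] ↔ κ.pairs = [] := by
  constructor
  · intro h
    exact altList_injective (h.trans (by simp [altList]))
  · intro h
    simp [h, altList]

lemma galtList_pairs_eq_nil {κ : Core R Q} : galtList κ.pairs = [] ↔ κ.pairs = [] := by
  constructor
  · intro h
    exact galtList_injective (h.trans (by simp [galtList]))
  · intro h
    simp [h, galtList]

lemma word_injective [Nontrivial R] {s : Letter A → ℤˣ} (hs : IsSign R Q s) {κ κ' : Core R Q}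
    (hκ : κ.Valid) (hκ' : κ'.Valid) {b d b' d' : Tail A}
    (hb : WTail R Q s κ.v₀ (-κ.ε₀ s) b) (hd : WTail R Q s κ.v₁ (κ.ε₁ s) d)
    (hb' : WTail R Q s κ'.v₀ (-κ'.ε₀ s) b') (hd' : WTail R Q s κ'.v₁ (κ'.ε₁ s) d')
    (h : κ.word s b d = κ'.word s b' d') : κ = κ' ∧ b = b' ∧ d = d' := by
  obtain ⟨h1, h2, h3, h4⟩ := glue_app_injective (word_polarised hs) (isCoreList_word s hκ)
    (isCoreList_word s hκ') hb hd hb' hd' h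
  exact ⟨eq_of_pairs s (altList_injective h1) fun h => h4 (altList_pairs_eq_nil.2 h), h2, h3⟩

lemma genWord_injective {s : Letter A → ℤˣ} (hs : IsSign R Q s) {κ κ' : Core R Q}
    (hκ : κ.Valid) (hκ' : κ'.Valid) {b d b' d' : Tail (GPath R Q)}
    (hb : GTail s κ.v₀ (-κ.ε₀ s) b) (hd : GTail s κ.v₁ (κ.ε₁ s) d)
    (hb' : GTail s κ'.v₀ (-κ'.ε₀ s) b') (hd' : GTail s κ'.v₁ (κ'.ε₁ s) d')
    (h : κ.genWord s b d = κ'.genWord s b' d') : κ = κ' ∧ b = b' ∧ d = d' := by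
  obtain ⟨h1, h2, h3, h4⟩ := glue_app_injective (gen_polarised hs) (isCoreList_gen s hκ)
    (isCoreList_gen s hκ') hb hd hb' hd' h
  exact ⟨eq_of_pairs s (galtList_injective h1) fun h => h4 (galtList_pairs_eq_nil.2 h), h2, h3⟩

lemma wordSeq_alt (s : Letter A → ℤˣ) (p : GPath R Q × GPath R Q) (ps) :
    (alt p ps).wordSeq s = .fin (altList (p :: ps)) :=
  ofTail_fin_of_ne_nil _ _ fun h => by
    simpa [pairs] using altList_pairs_eq_nil.1 h

lemma genSeq_alt (s : Letter A → ℤˣ) (p : GPath R Q × GPath R Q) (ps) :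
    (alt p ps).genSeq s = .fin (galtList (p :: ps)) :=
  ofTail_fin_of_ne_nil _ _ fun h => by
    simpa [pairs] using galtList_pairs_eq_nil.1 h

/-- Passing between `A` and `𝒜` does not change the core; only the tails have to be translated. -/
lemma isAltMatch_iff {s : Letter A → ℤˣ} {A' : Seqn V (Letter A)}
    {A'' : Seqn V (Letter (GPath R Q))} :
    IsAltMatch A' A'' ↔ ∃ κ : Core R Q, A' = κ.wordSeq s ∧ A'' = κ.genSeq s := by
  constructor
  · rintro (⟨v, ε, rfl, rfl⟩ | ⟨ps, hps, rfl, rfl⟩)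
    · exact ⟨.triv v ε, rfl, rfl⟩
    · obtain ⟨p, ps, rfl⟩ := List.exists_cons_of_ne_nil hps
      exact ⟨.alt p ps, (wordSeq_alt s p ps).symm, (genSeq_alt s p ps).symm⟩
  · rintro ⟨⟨v, ε⟩ | ⟨p, ps⟩, rfl, rfl⟩
    · exact Or.inl ⟨v, ε, rfl, rfl⟩
    · exact Or.inr ⟨p :: ps, by simp, wordSeq_alt s p ps, genSeq_alt s p ps⟩

lemma wordSeq_injective {s : Letter A → ℤˣ} {κ κ' : Core R Q}
    (h : κ.wordSeq s = κ'.wordSeq s) : κ = κ' := by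
  have h1 := ofTail_injective h
  simp only [Tail.fin.injEq] at h1
  refine eq_of_pairs s (altList_injective h1) fun h2 => ?_
  rw [wordSeq, wordSeq, ← h1, h2] at h
  exact ofTail_nil_inj h

lemma genSeq_injective {s : Letter A → ℤˣ} {κ κ' : Core R Q}
    (h : κ.genSeq s = κ'.genSeq s) : κ = κ' := by
  have h1 := ofTail_injective h
  simp only [Tail.fin.injEq] at h1
  refine eq_of_pairs s (galtList_injective h1) fun h2 => ?_
  rw [genSeq, genSeq, ← h1, h2] at h
  exact ofTail_nil_inj h

lemma isWord_wordSeq [Nontrivial R] {s : Letter A → ℤˣ} {κ : Core R Q} :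
    IsWord R Q (κ.wordSeq s) ↔ κ.Valid := by
  rw [isWord_iff, wordSeq, related_ofTail, Tail.chain_fin, altList_isChain]
  rfl

lemma isGenWord_genSeq {s : Letter A → ℤˣ} {κ : Core R Q} :
    IsGenWord (κ.genSeq s) ↔ κ.Valid := by
  rw [isGenWord_iff, genSeq, related_ofTail, Tail.chain_fin]
  rfl

/-- The decompositions of a word. -/
lemma isDecomp_iff [Nontrivial R] {s : Letter A → ℤˣ} (hs : IsSign R Q s)
    {B A' D C : Seqn V (Letter A)} (hC : IsWord R Q C) :
    IsDecomp R Q s C B A' D ↔ ∃ (κ : Core R Q) (b d : Tail A), κ.Valid ∧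
      WTail R Q s κ.v₀ (-κ.ε₀ s) b ∧ WTail R Q s κ.v₁ (κ.ε₁ s) d ∧
      B = ofTail κ.v₀ (-κ.ε₀ s) (b.map .inv) ∧ A' = κ.wordSeq s ∧
      D = ofTail κ.v₁ (κ.ε₁ s) (d.map .inv) ∧ C = κ.word s b d := by
  constructor
  · intro h
    have hA : ∃ κ : Core R Q, A' = κ.wordSeq s := by
      rcases h.alt with ⟨v, ε, e⟩ | ⟨ps, hps, e⟩
      · exact ⟨.triv v ε, e⟩
      · obtain ⟨p, ps, rfl⟩ := List.exists_cons_of_ne_nil hps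
        exact ⟨.alt p ps, e.trans (wordSeq_alt s p ps).symm⟩
    obtain ⟨κ, rfl⟩ := hA
    have hκ := isWord_wordSeq.1 h.word_A
    obtain ⟨E, h1, h2, h3⟩ := h.comp
    obtain ⟨b, d, hb, hd, h4, h5, h6⟩ := (decomp_iff (word_polarised hs) (isCoreList_word s hκ)
      (isWord_iff.1 h.word_B) (isWord_iff.1 h.word_D) (isWord_iff.1 hC) h.inverse_B h.inverse_D).1
      ⟨E, h1, isWord_iff.1 h2, h3⟩
    exact ⟨κ, b, d, hκ, hb, hd, h4, rfl, h5, h6⟩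
  · rintro ⟨κ, b, d, hκ, hb, hd, rfl, rfl, rfl, rfl⟩
    have hmap : ∀ {v : V} {ε : ℤˣ} {t : Tail A} (i a),
        (ofTail v ε (t.map Letter.inv)).letter i = some a → ∃ x, a = Letter.inv x := by
      intro v ε t i a ha
      rw [letter_ofTail, Tail.get?_map] at ha
      split_ifs at ha
      obtain ⟨x, -, rfl⟩ := Option.map_eq_some_iff.1 ha
      exact ⟨x, rfl⟩
    have hB : IsWord R Q (ofTail κ.v₀ (-κ.ε₀ s) (b.map .inv)) :=
      isWord_iff.2 ((related_ofTail_map (word_polarised hs) hb.matches).2 hb)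
    have hD : IsWord R Q (ofTail κ.v₁ (κ.ε₁ s) (d.map .inv)) :=
      isWord_iff.2 ((related_ofTail_map (word_polarised hs) hd.matches).2 hd)
    obtain ⟨E, h1, h2, h3⟩ := (decomp_iff (word_polarised hs) (isCoreList_word s hκ)
      (isWord_iff.1 hB) (isWord_iff.1 hD) (isWord_iff.1 hC) hmap hmap).2
      ⟨b, d, hb, hd, rfl, rfl, rfl⟩
    refine ⟨hB, isWord_wordSeq.2 hκ, hD, ?_, hmap, hmap, E, h1, isWord_iff.2 h2, h3⟩
    rcases κ with ⟨v, ε⟩ | ⟨p, ps⟩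
    · exact Or.inl ⟨v, ε, rfl⟩
    · exact Or.inr ⟨p :: ps, by simp, wordSeq_alt s p ps⟩

lemma isWord_word [Nontrivial R] {s : Letter A → ℤˣ} (hs : IsSign R Q s) {κ : Core R Q}
    (hκ : κ.Valid) {b d : Tail A} (hb : WTail R Q s κ.v₀ (-κ.ε₀ s) b)
    (hd : WTail R Q s κ.v₁ (κ.ε₁ s) d) : IsWord R Q (κ.word s b d) :=
  isWord_iff.2 ((related_glue_iff (word_polarised hs) (isCoreList_word s hκ)
    (fun _ => hd.matches) (fun _ _ => hb.matches)).2 ⟨hb, hd⟩)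

lemma isGenWord_genWord {s : Letter A → ℤˣ} (hs : IsSign R Q s) {κ : Core R Q}
    (hκ : κ.Valid) {b d : Tail (GPath R Q)} (hb : GTail s κ.v₀ (-κ.ε₀ s) b)
    (hd : GTail s κ.v₁ (κ.ε₁ s) d) : IsGenWord (κ.genWord s b d) :=
  isGenWord_iff.2 ((related_glue_iff (gen_polarised hs) (isCoreList_gen s hκ)
    (fun _ => hd.matches) (fun _ _ => hb.matches)).2 ⟨hb, hd⟩)

/-- This makes a string word the same thing as a valid core with two admissible tails, the form in
which string words are treated from now on. -/
lemma isStringWord_iff [Nontrivial R] {s : Letter A → ℤˣ} (hs : IsSign R Q s)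
    {C : Seqn V (Letter A)} :
    IsStringWord R Q s C ↔ ∃ (κ : Core R Q) (b d : Tail A), κ.Valid ∧
      WTail R Q s κ.v₀ (-κ.ε₀ s) b ∧ WTail R Q s κ.v₁ (κ.ε₁ s) d ∧ C = κ.word s b d := by
  constructor
  · rintro ⟨hC, B, A', D, h⟩
    obtain ⟨κ, b, d, hκ, hb, hd, -, -, -, e⟩ := (isDecomp_iff hs hC).1 h
    exact ⟨κ, b, d, hκ, hb, hd, e⟩
  · rintro ⟨κ, b, d, hκ, hb, hd, rfl⟩
    have hC := isWord_word hs hκ hb hd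
    exact ⟨hC, _, _, _, (isDecomp_iff hs hC).2 ⟨κ, b, d, hκ, hb, hd, rfl, rfl, rfl, rfl⟩⟩

/-- Uniqueness of the decomposition. It removes the quantifiers over decompositions from the
definitions of `R_C` and of the relations of `M(C)`. -/
lemma isDecomp_word [Nontrivial R] {s : Letter A → ℤˣ} (hs : IsSign R Q s) {κ : Core R Q}
    (hκ : κ.Valid) {b d : Tail A} (hb : WTail R Q s κ.v₀ (-κ.ε₀ s) b)
    (hd : WTail R Q s κ.v₁ (κ.ε₁ s) d) {B A' D : Seqn V (Letter A)} :
    IsDecomp R Q s (κ.word s b d) B A' D ↔ B = ofTail κ.v₀ (-κ.ε₀ s) (b.map .inv) ∧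
      A' = κ.wordSeq s ∧ D = ofTail κ.v₁ (κ.ε₁ s) (d.map .inv) := by
  rw [isDecomp_iff hs (isWord_word hs hκ hb hd)]
  constructor
  · rintro ⟨κ', b', d', hκ', hb', hd', rfl, rfl, rfl, e⟩
    obtain ⟨rfl, rfl, rfl⟩ := word_injective hs hκ hκ' hb hd hb' hd' e
    exact ⟨rfl, rfl, rfl⟩
  · rintro ⟨rfl, rfl, rfl⟩
    exact ⟨κ, b, d, hκ, hb, hd, rfl, rfl, rfl, rfl⟩

end Core

end WordBasics

open Seqn

/-! ### The correspondence of tails -/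

section TailBijection

variable {V A : Type*} [Fintype V] {R : Type*} [CommRing R] {Q : BoundQuiver V A}

lemma GPath.IsArrow.eq {σ : GPath R Q} (h : σ.IsArrow) : σ.1 = [σ.first] := by
  obtain ⟨a, ha⟩ := h
  simp [GPath.first, ha]

/-- In a generalised word, `⟨γ⟩` may be followed by the arrow `⟨σ⟩`. -/
def ArrStep (γ σ : GPath R Q) : Prop := GAdj (.dir γ) (.dir σ) ∧ σ.IsArrow

/-- The tails `⟨β⟩⟨a₁⟩⟨a₂⟩⋯` with arrows `aᵢ` which cannot be extended. -/
def IsArrowChain (β : GPath R Q) (t : Tail (GPath R Q)) : Prop :=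
  Tail.Good (· = β) ArrStep t ∧ Tail.IsMax (· = β) ArrStep t

/-- The tails that occur in string resolutions. -/
def ResTail (s : Letter A → ℤˣ) (w : V) (δ : ℤˣ) (t : Tail (GPath R Q)) : Prop :=
  t = .fin [] ∨ ∃ β : GPath R Q, β.tl = w ∧ s (.inv β.first) = δ ∧ IsArrowChain β t

/-- The tail `d` of a word cannot be extended. -/
def WTailMax (R : Type*) [CommRing R] (Q : BoundQuiver V A) (s : Letter A → ℤˣ) (w : V) (δ : ℤˣ)
    (d : Tail A) : Prop :=
  ¬ ∃ k x, d = .fin k ∧ WTail R Q s w δ (.fin (k ++ [x]))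

/-- The tail `t` of a string resolution corresponds to the tail `d` of a word. -/
def TailRes (s : Letter A → ℤˣ) (w : V) (δ : ℤˣ) (d : Tail A) (t : Tail (GPath R Q)) : Prop :=
  (WTailMax R Q s w δ d ∧ t = .fin []) ∨
    ∃ (k : List A) (x : A) (β : GPath R Q), d = .fin k ∧ β.1 = x :: k.reverse ∧
      WTail R Q s w δ (.fin (k ++ [x])) ∧ IsArrowChain β t

/-- The path `σ` is the arrow that stops the last arrow of `γ`, and gentleness allows at most one.
-/
lemma arrStep_unique {Λ : Type*} [Ring Λ] [Algebra R Λ] {ϑ : PathAlgebra R Q →ₐ[R] Λ}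
    (hϑ : IsCompleteGentle ϑ) (γ σ σ' : GPath R Q) (h : ArrStep γ σ) (h' : ArrStep γ σ') :
    σ = σ' := by
  refine Subtype.ext ?_
  rw [h.2.eq, h'.2.eq]
  congr 1
  exact Set.encard_le_one_iff.1 (hϑ.stop_left γ.last) _ _ ⟨h.1.1.symm, h.1.2⟩ ⟨h'.1.1.symm, h'.1.2⟩

lemma existsUnique_isArrowChain {Λ : Type*} [Ring Λ] [Algebra R Λ] {ϑ : PathAlgebra R Q →ₐ[R] Λ}
    (hϑ : IsCompleteGentle ϑ) (β : GPath R Q) : ∃! t, IsArrowChain β t :=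
  Tail.existsUnique_isMax (fun _ _ hx hy => hx.trans hy.symm) (arrStep_unique hϑ)

/-- The head and the sign leave one choice at most for the first letter, by the sign axiom; each
further letter is determined because an arrow has at most one continuation inside `P`. -/
lemma existsUnique_wTailMax {Λ : Type*} [Ring Λ] [Algebra R Λ] {ϑ : PathAlgebra R Q →ₐ[R] Λ}
    (hϑ : IsCompleteGentle ϑ) {s : Letter A → ℤˣ} (hs : IsSign R Q s) (w : V) (δ : ℤˣ) :
    ∃! d, WTail R Q s w δ d ∧ WTailMax R Q s w δ d :=
  Tail.existsUnique_isMax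
    (fun _ _ hx hy => hs.eq_of_eq (hx.1.trans hy.1.symm) (hx.2.trans hy.2.symm))
    (fun a _ _ hx hy => Set.encard_le_one_iff.1 (hϑ.cont_left a) _ _ hx hy)

lemma IsArrowChain.get?_zero {β : GPath R Q} {t : Tail (GPath R Q)} (h : IsArrowChain β t) :
    t.get? 0 = some β := by
  rcases h0 : t.get? 0 with _ | γ
  · exact absurd rfl (h.2.not_of_zero h0 β)
  · rw [h.1.1 γ h0]

lemma IsArrowChain.ne_nil {β : GPath R Q} {t : Tail (GPath R Q)} (h : IsArrowChain β t) :
    t ≠ .fin [] := by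
  rintro rfl
  have := h.get?_zero
  simp at this

/-- The prolonged tail is the inverse of the path `β`, so consecutive letters are compatible in any
case and only the head and the sign of the first letter are left to check. -/
lemma wTail_concat_iff {s : Letter A → ℤˣ} {w : V} {δ : ℤˣ} {k : List A} {x : A}
    {β : GPath R Q} [Nontrivial R] (hβ : β.1 = x :: k.reverse) :
    WTail R Q s w δ (.fin (k ++ [x])) ↔ β.tl = w ∧ s (.inv β.first) = δ := by
  have e : k ++ [x] = β.1.reverse := by rw [hβ]; simp
  have h0 : (k ++ [x])[0]? = some β.first := by
    rw [e, ← List.head?_eq_getElem?, List.head?_reverse, List.getLast?_eq_some_getLast β.ne_nil]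
    rfl
  constructor
  · intro h
    exact h.1 _ (by rw [Tail.get?_fin, h0])
  · intro h
    refine ⟨fun a ha => ?_, ?_⟩
    · rw [Tail.get?_fin, h0] at ha
      cases ha
      exact h
    · rw [Tail.chain_fin, e, List.isChain_reverse]
      exact β.isChain

lemma exists_gPath_of_wTail [Nontrivial R] {s : Letter A → ℤˣ} {w : V} {δ : ℤˣ} {k : List A}
    {x : A} (h : WTail R Q s w δ (.fin (k ++ [x]))) : ∃ β : GPath R Q, β.1 = x :: k.reverse := by
  refine ⟨GPath.mk (x :: k.reverse) (by simp) ?_, rfl⟩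
  have h2 := Tail.chain_fin.1 h.2
  rw [show x :: k.reverse = (k ++ [x]).reverse by simp, List.isChain_reverse]
  exact h2

lemma wTail_of_concat {s : Letter A → ℤˣ} {w : V} {δ : ℤˣ} {k : List A} {x : A}
    (h : WTail R Q s w δ (.fin (k ++ [x]))) : WTail R Q s w δ (.fin k) := by
  refine ⟨fun a ha => h.1 a ?_, ?_⟩
  · rw [Tail.get?_fin] at ha ⊢
    obtain ⟨h0, e⟩ := List.getElem?_eq_some_iff.1 ha
    rw [List.getElem?_append_left h0, ha]
  · have h2 := Tail.chain_fin.1 h.2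
    rw [Tail.chain_fin]
    exact (List.isChain_append.1 h2).1

variable {Λ : Type*} [Ring Λ] [Algebra R Λ] {ϑ : PathAlgebra R Q →ₐ[R] Λ}

lemma wTail_extension_unique (hϑ : IsCompleteGentle ϑ) {s : Letter A → ℤˣ} (hs : IsSign R Q s)
    {w : V} {δ : ℤˣ} {k : List A} {x y : A} (hx : WTail R Q s w δ (.fin (k ++ [x])))
    (hy : WTail R Q s w δ (.fin (k ++ [y]))) : x = y := by
  rcases List.eq_nil_or_concat k with rfl | ⟨k, z, rfl⟩
  · have h1 := hx.1 x (by simp)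
    have h2 := hy.1 y (by simp)
    exact hs.eq_of_eq (h1.1.trans h2.1.symm) (h1.2.trans h2.2.symm)
  · have h1 := hx.2 k.length z x (by simp) (by simp)
    have h2 := hy.2 k.length z y (by simp) (by simp)
    exact Set.encard_le_one_iff.1 (hϑ.cont_left z) _ _ h1 h2

/-- If the tail can be prolonged, the arrow that prolongs it is unique. It determines the path `β`,
and `β` starts exactly one maximal chain of arrow steps. A tail that cannot be prolonged leaves only
the trivial tail. -/
lemma existsUnique_tailRes [Nontrivial R] (hϑ : IsCompleteGentle ϑ) {s : Letter A → ℤˣ}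
    (hs : IsSign R Q s) {w : V} {δ : ℤˣ} (d : Tail A) :
    ∃! t : Tail (GPath R Q), TailRes s w δ d t := by
  by_cases h : WTailMax R Q s w δ d
  · refine ⟨.fin [], Or.inl ⟨h, rfl⟩, ?_⟩
    rintro t (⟨-, rfl⟩ | ⟨k, x, β, rfl, -, hk, -⟩)
    · rfl
    · exact absurd ⟨k, x, rfl, hk⟩ h
  · obtain ⟨k, x, rfl, hk⟩ := not_not.1 h
    obtain ⟨β, hβ⟩ := exists_gPath_of_wTail hk
    obtain ⟨t, ht, hu⟩ := existsUnique_isArrowChain hϑ β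
    refine ⟨t, Or.inr ⟨k, x, β, rfl, hβ, hk, ht⟩, ?_⟩
    rintro t' (⟨h', -⟩ | ⟨k', x', β', e, hβ', hk', ht'⟩)
    · exact absurd h' h
    · cases e
      obtain rfl := wTail_extension_unique hϑ hs hk hk'
      obtain rfl : β = β' := Subtype.ext (hβ.trans hβ'.symm)
      exact hu t' ht'

lemma TailRes.resTail [Nontrivial R] {s : Letter A → ℤˣ} {w : V} {δ : ℤˣ} {d : Tail A}
    {t : Tail (GPath R Q)} (h : TailRes s w δ d t) : ResTail s w δ t := by
  rcases h with ⟨-, rfl⟩ | ⟨k, x, β, rfl, hβ, hk, ht⟩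
  · exact Or.inl rfl
  · obtain ⟨h1, h2⟩ := (wTail_concat_iff hβ).1 hk
    exact Or.inr ⟨β, h1, h2, ht⟩

/-- The reverse passage. A non-trivial tail determines its first path `β`, and removing the last
arrow of `β` leaves the tail of the word; a trivial tail stands for the unique maximal inverse
continuation. -/
lemma existsUnique_wTail [Nontrivial R] (hϑ : IsCompleteGentle ϑ) {s : Letter A → ℤˣ}
    (hs : IsSign R Q s) {w : V} {δ : ℤˣ} {t : Tail (GPath R Q)} (ht : ResTail s w δ t) :
    ∃! d : Tail A, WTail R Q s w δ d ∧ TailRes s w δ d t := by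
  rcases ht with rfl | ⟨β, h1, h2, h3⟩
  · obtain ⟨d, hd, hu⟩ := existsUnique_wTailMax hϑ hs w δ
    refine ⟨d, ⟨hd.1, Or.inl ⟨hd.2, rfl⟩⟩, ?_⟩
    rintro d' ⟨h, ⟨h', -⟩ | ⟨k, x, β, rfl, hβ, hk, ht⟩⟩
    · exact hu d' ⟨h, h'⟩
    · exact absurd rfl ht.ne_nil
  · obtain ⟨x, p, hp⟩ := List.exists_cons_of_ne_nil β.ne_nil
    have hβ : β.1 = x :: p.reverse.reverse := by rw [hp, List.reverse_reverse]
    have hk := (wTail_concat_iff (s := s) hβ).2 ⟨h1, h2⟩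
    refine ⟨.fin p.reverse, ⟨wTail_of_concat hk, Or.inr ⟨_, x, β, rfl, hβ, hk, h3⟩⟩, ?_⟩
    rintro d' ⟨h, ⟨h', rfl⟩ | ⟨k, x', β', rfl, hβ', hk', ht⟩⟩
    · exact absurd rfl h3.ne_nil
    · have : β = β' := Option.some_injective _ (h3.get?_zero.symm.trans ht.get?_zero)
      subst this
      rw [hβ] at hβ'
      simp only [List.reverse_reverse, List.cons.injEq] at hβ'
      rw [hβ'.2, List.reverse_reverse]

lemma chain_arrStep_iff {t : Tail (GPath R Q)} :
    t.Chain ArrStep ↔ t.Chain (fun γ σ => GAdj (.dir γ) (.dir σ)) ∧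
      ∀ n a, t.get? (n + 1) = some a → a.IsArrow := by
  constructor
  · refine fun h => ⟨h.imp fun _ _ h => h.1, fun n a ha => ?_⟩
    rcases hb : t.get? n with _ | b
    · rw [Tail.get?_succ_eq_none hb] at ha
      cases ha
    · exact (h n b a hb ha).2
  · exact fun h n a b ha hb => ⟨h.1 n a b ha hb, h.2 n b hb⟩

lemma IsArrowChain.gTail {s : Letter A → ℤˣ} {w : V} {δ : ℤˣ} {β : GPath R Q}
    {t : Tail (GPath R Q)} (h : IsArrowChain β t) (h1 : β.tl = w) (h2 : s (.inv β.first) = δ) :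
    GTail s w δ t := by
  refine ⟨fun a ha => ?_, (chain_arrStep_iff.1 h.1.2).1⟩
  obtain rfl := h.1.1 a ha
  exact ⟨h1, h2⟩

lemma ResTail.gTail {s : Letter A → ℤˣ} {w : V} {δ : ℤˣ} {t : Tail (GPath R Q)}
    (h : ResTail s w δ t) : GTail s w δ t := by
  rcases h with rfl | ⟨β, h1, h2, h3⟩
  · exact tailGood_nil _ _
  · exact h3.gTail h1 h2

/-- The condition on the parts `ℬ` and `𝒟` of a string resolution. -/
lemma tail_cond_iff {s : Letter A → ℤˣ} (hs : IsSign R Q s) {w : V} {δ : ℤˣ}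
    {t : Tail (GPath R Q)} (ht : GTail s w δ t) :
    (¬ (ofTail w δ (t.map .dir)).IsTriv → (ofTail w δ (t.map .dir)).IsDirect ∧
      (∀ n : ℤ, 1 < n → ∀ l, (ofTail w δ (t.map .dir)).letter n = some l →
        ∃ a : GPath R Q, a.IsArrow ∧ l = .dir a) ∧ ¬ ExtendsRight s (ofTail w δ (t.map .dir))) ↔
      ResTail s w δ t := by
  have hext : ExtendsRight s (ofTail w δ (t.map .dir)) ↔ ∃ a : GPath R Q, a.IsArrow ∧
      ∃ k, t = .fin k ∧ GTail s w δ (.fin (k ++ [a])) := by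
    refine exists_congr fun a => and_congr_right fun _ => ?_
    have := extend_right_iff (gen_polarised hs) (isCoreList_nil (v := w) (ε := δ)) ht a
    rw [Tail.app_nil] at this
    rw [← this]
    exact exists_congr fun G => and_congr_right fun _ => isGenWord_iff
  rw [isTriv_ofTail, Tail.map_eq_nil, hext]
  constructor
  · intro h
    by_cases h0 : t = .fin []
    · exact Or.inl h0
    · obtain ⟨-, h2, h3⟩ := h h0
      obtain ⟨β, hβ⟩ := Tail.exists_get?_zero h0
      obtain ⟨h4, h5⟩ := ht.1 β hβ
      refine Or.inr ⟨β, h4, h5, ⟨fun a ha => ?_, chain_arrStep_iff.2 ⟨ht.2, fun n a ha => ?_⟩⟩, ?_⟩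
      · exact Option.some_injective _ (ha.symm.trans hβ)
      -- Entry `n + 1` of the tail is the letter with index `n + 2`, to which the requirement on all
      -- letters behind the first applies.
      · obtain ⟨b, hb, e⟩ := h2 (n + 2) (by omega) (.dir a) (by
          rw [letter_ofTail, if_pos (by omega), Tail.get?_map,
            show ((n : ℤ) + 2 - 1).toNat = n + 1 by omega, ha]
          rfl)
        cases e
        exact hb
      · rintro ⟨k, x, rfl, hk⟩
        have hk0 : k ≠ [] := by rintro rfl; exact h0 rfl
        obtain ⟨h6, h7⟩ := chain_arrStep_iff.1 hk.2
        -- Since `k` is not empty, `x` is not the first entry of the prolonged chain and is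
        -- therefore an arrow.
        refine h3 ⟨x, h7 (k.length - 1) x ?_, k, rfl, fun a ha => ?_, h6⟩
        · have := List.length_pos_of_ne_nil hk0
          rw [Nat.sub_add_cancel this]
          simp
        · obtain rfl : a = β := hk.1 a ha
          exact ⟨h4, h5⟩
  · rintro (rfl | ⟨β, h1, h2, h3⟩) h0
    · exact absurd rfl h0
    · obtain ⟨h4, h5⟩ := chain_arrStep_iff.1 h3.1.2
      refine ⟨fun i a ha => ?_, fun i hi a ha => ?_, ?_⟩
      · rw [letter_ofTail, Tail.get?_map] at ha
        split_ifs at ha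
        obtain ⟨x, -, rfl⟩ := Option.map_eq_some_iff.1 ha
        exact ⟨x, rfl⟩
      · rw [letter_ofTail, if_pos (by omega), Tail.get?_map] at ha
        obtain ⟨x, hx, rfl⟩ := Option.map_eq_some_iff.1 ha
        refine ⟨x, h5 (i - 2).toNat x ?_, rfl⟩
        rw [← hx]
        congr 1; omega
      · rintro ⟨a, ha, k, rfl, hk⟩
        have hk0 : k ≠ [] := by rintro rfl; exact h0 rfl
        refine h3.2 ⟨k, a, rfl, fun c hc => h3.1.1 c ?_, fun n c c' hc hc' => ⟨hk.2 n c c' hc hc', ?_⟩⟩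
        · rw [← hc, Tail.get?_fin, Tail.get?_fin,
            List.getElem?_append_left (List.length_pos_of_ne_nil hk0)]
        · by_cases hn : n + 1 < k.length
          · refine h5 n c' ?_
            rw [Tail.get?_fin, List.getElem?_append_left hn] at hc'
            exact hc'
          · rw [Tail.get?_fin, List.getElem?_append_right (by omega)] at hc'
            obtain ⟨h6, h7⟩ := List.getElem?_eq_some_iff.1 hc'
            simp at h7
            rw [← h7]; exact ha

namespace Core

/-- The decompositions of a string resolution. -/
lemma isGenDecomp_iff {s : Letter A → ℤˣ} (hs : IsSign R Q s)
    {B A' D C : Seqn V (Letter (GPath R Q))} (hC : IsGenWord C) :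
    IsGenDecomp s C B A' D ↔ ∃ (κ : Core R Q) (b d : Tail (GPath R Q)), κ.Valid ∧
      ResTail s κ.v₀ (-κ.ε₀ s) b ∧ ResTail s κ.v₁ (κ.ε₁ s) d ∧
      B = ofTail κ.v₀ (-κ.ε₀ s) (b.map .dir) ∧ A' = κ.genSeq s ∧
      D = ofTail κ.v₁ (κ.ε₁ s) (d.map .dir) ∧ C = κ.genWord s b d := by
  constructor
  · intro h
    have hA : ∃ κ : Core R Q, A' = κ.genSeq s := by
      rcases h.alt with ⟨v, ε, e⟩ | ⟨ps, hps, e⟩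
      · exact ⟨.triv v ε, e⟩
      · obtain ⟨p, ps, rfl⟩ := List.exists_cons_of_ne_nil hps
        exact ⟨.alt p ps, e.trans (genSeq_alt s p ps).symm⟩
    obtain ⟨κ, rfl⟩ := hA
    have hκ := isGenWord_genSeq.1 h.word_A
    obtain ⟨E, h1, h2, h3⟩ := h.comp
    -- Directness is demanded of non-trivial parts only, but a trivial part has no letters that
    -- could violate it.
    have hdir : ∀ X : Seqn V (Letter (GPath R Q)), (¬ X.IsTriv → X.IsDirect) → X.IsDirect := by
      intro X hX
      by_cases h0 : X.IsTriv
      · obtain ⟨v, ε, rfl⟩ := h0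
        intro i a ha
        simp [letter] at ha
      · exact hX h0
    obtain ⟨b, d, hb, hd, rfl, rfl, h6⟩ := (decomp_iff (gen_polarised hs) (isCoreList_gen s hκ)
      (isGenWord_iff.1 h.word_B) (isGenWord_iff.1 h.word_D) (isGenWord_iff.1 hC)
      (hdir _ fun h0 => (h.cond_B h0).1) (hdir _ fun h0 => (h.cond_D h0).1)).1
      ⟨E, h1, isGenWord_iff.1 h2, h3⟩
    exact ⟨κ, b, d, hκ, (tail_cond_iff hs hb).1 h.cond_B, (tail_cond_iff hs hd).1 h.cond_D,
      rfl, rfl, rfl, h6⟩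
  · rintro ⟨κ, b, d, hκ, hb, hd, rfl, rfl, rfl, rfl⟩
    have hmap : ∀ {v : V} {ε : ℤˣ} {t : Tail (GPath R Q)} (i a),
        (ofTail v ε (t.map Letter.dir)).letter i = some a → ∃ x, a = Letter.dir x := by
      intro v ε t i a ha
      rw [letter_ofTail, Tail.get?_map] at ha
      split_ifs at ha
      obtain ⟨x, -, rfl⟩ := Option.map_eq_some_iff.1 ha
      exact ⟨x, rfl⟩
    have hB : IsGenWord (ofTail κ.v₀ (-κ.ε₀ s) (b.map .dir)) :=
      isGenWord_iff.2 ((related_ofTail_map (gen_polarised hs) hb.gTail.matches).2 hb.gTail)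
    have hD : IsGenWord (ofTail κ.v₁ (κ.ε₁ s) (d.map .dir)) :=
      isGenWord_iff.2 ((related_ofTail_map (gen_polarised hs) hd.gTail.matches).2 hd.gTail)
    obtain ⟨E, h1, h2, h3⟩ := (decomp_iff (gen_polarised hs) (isCoreList_gen s hκ)
      (isGenWord_iff.1 hB) (isGenWord_iff.1 hD) (isGenWord_iff.1 hC) hmap hmap).2
      ⟨b, d, hb.gTail, hd.gTail, rfl, rfl, rfl⟩
    refine ⟨hB, isGenWord_genSeq.2 hκ, hD, ?_, (tail_cond_iff hs hb.gTail).2 hb,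
      (tail_cond_iff hs hd.gTail).2 hd, E, h1, isGenWord_iff.2 h2, h3⟩
    rcases κ with ⟨v, ε⟩ | ⟨p, ps⟩
    · exact Or.inl ⟨v, ε, rfl⟩
    · exact Or.inr ⟨p :: ps, by simp, genSeq_alt s p ps⟩

lemma isStringRes_iff {s : Letter A → ℤˣ} (hs : IsSign R Q s)
    {C : Seqn V (Letter (GPath R Q))} :
    IsStringRes s C ↔ ∃ (κ : Core R Q) (b d : Tail (GPath R Q)), κ.Valid ∧
      ResTail s κ.v₀ (-κ.ε₀ s) b ∧ ResTail s κ.v₁ (κ.ε₁ s) d ∧ C = κ.genWord s b d := by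
  constructor
  · rintro ⟨hC, B, A', D, h⟩
    obtain ⟨κ, b, d, hκ, hb, hd, -, -, -, e⟩ := (isGenDecomp_iff hs hC).1 h
    exact ⟨κ, b, d, hκ, hb, hd, e⟩
  · rintro ⟨κ, b, d, hκ, hb, hd, rfl⟩
    have hC := isGenWord_genWord hs hκ hb.gTail hd.gTail
    exact ⟨hC, _, _, _, (isGenDecomp_iff hs hC).2 ⟨κ, b, d, hκ, hb, hd, rfl, rfl, rfl, rfl⟩⟩

lemma isGenDecomp_genWord {s : Letter A → ℤˣ} (hs : IsSign R Q s) {κ : Core R Q}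
    (hκ : κ.Valid) {b d : Tail (GPath R Q)} (hb : ResTail s κ.v₀ (-κ.ε₀ s) b)
    (hd : ResTail s κ.v₁ (κ.ε₁ s) d) {B A' D : Seqn V (Letter (GPath R Q))} :
    IsGenDecomp s (κ.genWord s b d) B A' D ↔ B = ofTail κ.v₀ (-κ.ε₀ s) (b.map .dir) ∧
      A' = κ.genSeq s ∧ D = ofTail κ.v₁ (κ.ε₁ s) (d.map .dir) := by
  rw [isGenDecomp_iff hs (isGenWord_genWord hs hκ hb.gTail hd.gTail)]
  constructor
  · rintro ⟨κ', b', d', hκ', hb', hd', rfl, rfl, rfl, e⟩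
    obtain ⟨rfl, rfl, rfl⟩ := genWord_injective hs hκ hκ' hb.gTail hd.gTail hb'.gTail hd'.gTail e
    exact ⟨rfl, rfl, rfl⟩
  · rintro ⟨rfl, rfl, rfl⟩
    exact ⟨κ, b, d, hκ, hb, hd, rfl, rfl, rfl, rfl⟩

end Core

/-- Caps in terms of tails. -/
lemma isCap_iff [Nontrivial R] {s : Letter A → ℤˣ} (hs : IsSign R Q s) {w : V} {δ : ℤˣ}
    {d : Tail A} (hd : WTail R Q s w δ d) {β : GPath R Q} :
    IsCap R Q s (ofTail w δ (d.map .inv)) β ↔ ∃ k x, d = .fin k ∧ β.1 = x :: k.reverse ∧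
      WTail R Q s w δ (.fin (k ++ [x])) := by
  have hext := fun x => extend_right_iff (word_polarised hs) (isCoreList_nil (v := w) (ε := δ)) hd x
  simp only [Tail.app_nil] at hext
  constructor
  · rintro ⟨x, p, hβ, hp, W, hW, hW'⟩
    obtain ⟨k, rfl, hk⟩ := (hext x).1 ⟨W, hW, isWord_iff.1 hW'⟩
    refine ⟨k, x, rfl, ?_, hk⟩
    rw [hβ]
    congr 1
    rcases hp with ⟨rfl, h⟩ | ⟨hp, h⟩
    · rw [isTriv_ofTail] at h
      have : k = [] := by simpa using h
      simp [this]
    · rw [← ofTail_fin_of_ne_nil w δ (by simpa [invList] using hp)] at h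
      have h' := ofTail_injective h
      simp only [Tail.map_fin, invList, Tail.fin.injEq] at h'
      rw [List.map_injective_iff.2 (fun x y h => by cases h; rfl) h', List.reverse_reverse]
  · rintro ⟨k, x, rfl, hβ, hk⟩
    obtain ⟨W, hW, hW'⟩ := (hext x).2 ⟨k, rfl, hk⟩
    refine ⟨x, k.reverse, hβ, ?_, W, hW, isWord_iff.2 hW'⟩
    by_cases h0 : k = []
    · exact Or.inl ⟨by simp [h0], isTriv_ofTail.2 (by simp [h0])⟩
    · refine Or.inr ⟨by simpa using h0, ?_⟩
      rw [Tail.map_fin, ofTail_fin_of_ne_nil _ _ (by simpa using h0)]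
      simp [invList]

lemma exists_isCap_iff [Nontrivial R] {s : Letter A → ℤˣ} (hs : IsSign R Q s) {w : V} {δ : ℤˣ}
    {d : Tail A} (hd : WTail R Q s w δ d) :
    (∃ β, IsCap R Q s (ofTail w δ (d.map .inv)) β) ↔ ¬ WTailMax R Q s w δ d := by
  rw [WTailMax, not_not]
  constructor
  · rintro ⟨β, h⟩
    obtain ⟨k, x, e, -, hk⟩ := (isCap_iff hs hd).1 h
    exact ⟨k, x, e, hk⟩
  · rintro ⟨k, x, e, hk⟩
    obtain ⟨β, hβ⟩ := exists_gPath_of_wTail hk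
    exact ⟨β, (isCap_iff hs hd).2 ⟨k, x, e, hβ, hk⟩⟩

end TailBijection

/-! ### Prolonging glued sequences on either side -/

namespace Seqn

section Extensions

variable {V α : Type*} {hd : Letter α → V} {sg : Letter α → ℤˣ}
  {r : Letter α → Letter α → Prop} {c : α → Letter α} {l : List (Letter α)} {v w : V} {ε δ : ℤˣ}

/-- Composition of a finite sequence with a sequence on the right. -/
lemma exists_comp_ofTail_iff (hd : Letter α → V) (sg : Letter α → ℤˣ) (l : List (Letter α)) (v : V)
    (ε : ℤˣ) : ∃ w δ, (l = [] → w = v ∧ δ = ε) ∧ ∀ D E : Seqn V (Letter α), D ≠ .fin [] →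
      (Comp hd sg (ofTail v ε (.fin l)) D E ↔ ∃ d : Tail (Letter α), D = ofTail w δ d ∧
        E = ofTail v ε (.app l d) ∧ (l = [] → Matches hd sg w δ d)) := by
  by_cases hl : l = []
  · subst hl
    exact ⟨v, ε, fun _ => ⟨rfl, rfl⟩, fun D E hD => comp_ofTail ⟨by simp, by simp, by simp⟩ hD⟩
  · refine ⟨hd (l.getLast hl).flip, -sg (l.getLast hl).flip, fun h => absurd h hl, fun D E hD => ?_⟩
    have h : HasEnds hd sg l (hd (l.head hl)) (sg (l.head hl)) (hd (l.getLast hl).flip)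
        (-sg (l.getLast hl).flip) := by
      refine ⟨fun h => absurd h hl, fun a ha => ?_, fun a ha => ?_⟩
      · rw [List.head?_eq_some_head hl] at ha; cases ha; exact ⟨rfl, rfl⟩
      · rw [List.getLast?_eq_some_getLast hl] at ha; cases ha; exact ⟨rfl, by simp⟩
    have h0 := comp_ofTail h (E := E) hD
    rw [ofTail_congr (w := v) (δ := ε) (by simpa using hl)] at h0
    rw [h0]
    refine exists_congr fun d => and_congr_right fun _ => and_congr_left fun _ => ?_
    rw [ofTail_congr (w := v) (δ := ε) (Tail.app_ne_nil hl d)]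

/-- The right-hand part of a sequence of letters with admissible left-hand part. -/
lemma related_glue_right_iff (P : Polarised hd sg r c) (hl : IsCoreList hd sg r c l v ε w δ)
    {b d : Tail α} (hb : TailGood hd sg r c v (-ε) b)
    (h : l = [] → b = .fin [] → Matches hd sg w δ (d.map c)) :
    Related r (glue v ε (b.map c) (.app l (d.map c))) ↔ TailGood hd sg r c w δ d := by
  by_cases hm : l = [] → Matches hd sg w δ (d.map c)
  · rw [related_glue_iff P hl hm fun _ _ => hb.matches, and_iff_right hb]
  · rw [Classical.not_imp] at hm
    obtain ⟨rfl, hm⟩ := hm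
    refine ⟨fun h1 => absurd ?_ hm, fun h1 => absurd h1.matches hm⟩
    have hb0 : b ≠ .fin [] := fun h0 => hm (h rfl h0)
    obtain ⟨x, hx⟩ := Tail.exists_get?_zero hb0
    obtain ⟨h2, h3⟩ := hb.1 x hx
    obtain ⟨rfl, rfl⟩ := hl.nil rfl
    rw [related_glue P.flip_iff, Tail.app_nil] at h1
    intro a ha
    rw [Tail.get?_map] at ha
    obtain ⟨y, hy, rfl⟩ := Option.map_eq_some_iff.1 ha
    have := (P.junction x y).1 (h1.2.2 (c x) (c y) (by simp [hx]) (by simp [hy]))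
    exact ⟨this.1.symm.trans h2, by rw [this.2, h3, neg_neg]⟩

lemma glue_fin_eq_ofTail (v : V) (ε : ℤˣ) (b : List α) (l : List (Letter α)) (k : List α)
    (t : Tail α) (c : α → Letter α) :
    glue v ε ((Tail.fin b).map c) (.app l ((Tail.app k t).map c)) =
      ofTail v ε (.app ((b.map c).reverse.map Letter.flip ++ (l ++ k.map c)) (t.map c)) := by
  simp [glue, Tail.map_app, Tail.app_app]

lemma glue_fin_fin_eq_ofTail (v : V) (ε : ℤˣ) (b : List α) (l : List (Letter α)) (k : List α)
    (c : α → Letter α) :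
    glue v ε ((Tail.fin b).map c) (.app l ((Tail.fin k).map c)) =
      ofTail v ε (.fin ((b.map c).reverse.map Letter.flip ++ (l ++ k.map c))) := by
  simp [glue]

/-- Continuation on the right by letters of the class `c`. -/
lemma continue_right_iff (P : Polarised hd sg r c) (hl : IsCoreList hd sg r c l v ε w δ)
    {b k : List α} (hb : TailGood hd sg r c v (-ε) (.fin b)) (hk : TailGood hd sg r c w δ (.fin k))
    {p : Letter α → Prop} (hp : ∀ a, p a → ∃ x, a = c x) (F : Seqn V (Letter α)) :
    (∃ D, Related r D ∧ (∀ i a, D.letter i = some a → p a) ∧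
      Comp hd sg (glue v ε ((Tail.fin b).map c) (.app l ((Tail.fin k).map c))) D F ∧ Related r F) ↔
      ∃ t : Tail α, (∀ n x, t.get? n = some x → p (c x)) ∧
        TailGood hd sg r c w δ (.app k t) ∧
        F = glue v ε ((Tail.fin b).map c) (.app l ((Tail.app k t).map c)) := by
  obtain ⟨w', δ', h0, hcomp⟩ := exists_comp_ofTail_iff hd sg
    ((b.map c).reverse.map Letter.flip ++ (l ++ k.map c)) v ε
  rw [glue_fin_fin_eq_ofTail]
  constructor
  · rintro ⟨D, hD, hDp, h1, h2⟩
    obtain ⟨t, rfl, rfl, ht⟩ := (hcomp _ _ hD.1).1 h1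
    have htp : ∀ n a, t.get? n = some a → p a := fun n a ha => hDp (n + 1) a (by
      rw [letter_ofTail, if_pos (by omega), ← ha]
      congr 1; omega)
    obtain ⟨t, rfl⟩ := exists_map_eq fun n a ha => hp a (htp n a ha)
    rw [← glue_fin_eq_ofTail, related_glue_right_iff P hl hb] at h2
    · exact ⟨t, fun n x hx => htp n _ (by simp [hx]), h2, (glue_fin_eq_ofTail ..).symm⟩
    · rintro rfl hb0
      obtain ⟨rfl, rfl⟩ := hl.nil rfl
      obtain rfl : b = [] := by simpa using hb0
      by_cases hk0 : k = []
      · subst hk0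
        obtain ⟨rfl, rfl⟩ := h0 (by simp)
        simpa using ht (by simp)
      · intro a ha
        refine hk.matches a ?_
        rw [Tail.map_app, Tail.get?_zero_app_of_ne_nil (by simpa using hk0)] at ha
        simpa using ha
  · rintro ⟨t, ht, h1, rfl⟩
    refine ⟨ofTail w' δ' (t.map c), ?_, fun i a ha => ?_, (hcomp _ _ (ofTail_ne_fin_nil _ _ _)).2
      ⟨_, rfl, glue_fin_eq_ofTail .., fun h => ?_⟩,
      (related_glue_right_iff P hl hb fun _ _ => h1.matches).2 h1⟩
    · rw [related_ofTail, Tail.chain_map]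
      exact (Tail.chain_app.1 h1.2).2.1
    · rw [letter_ofTail, Tail.get?_map] at ha
      split_ifs at ha
      obtain ⟨x, hx, rfl⟩ := Option.map_eq_some_iff.1 ha
      exact ht _ x hx
    · simp only [List.append_eq_nil_iff, List.map_eq_nil_iff, List.reverse_eq_nil_iff] at h
      obtain ⟨rfl, rfl, rfl⟩ := h
      obtain ⟨rfl, rfl⟩ := h0 (by simp)
      obtain ⟨rfl, rfl⟩ := hl.nil rfl
      simpa using h1.matches

/-- Extension of a sequence with finite left-hand part by one letter on the right. -/
lemma extend_glue_right_iff (P : Polarised hd sg r c) (hl : IsCoreList hd sg r c l v ε w δ)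
    {b : List α} {d : Tail α} (hb : TailGood hd sg r c v (-ε) (.fin b))
    (hd₀ : TailGood hd sg r c w δ d) (x : α) :
    (∃ G, Comp hd sg (glue v ε ((Tail.fin b).map c) (.app l (d.map c))) (.fin [c x]) G ∧
      Related r G) ↔ ∃ k, d = .fin k ∧ TailGood hd sg r c w δ (.fin (k ++ [x])) := by
  have e : ∀ k : List α, ofTail v ε (.fin ((b.map c).reverse.map Letter.flip ++ (l ++ k.map c) ++
      [c x])) = glue v ε ((Tail.fin b).map c) (.app l ((Tail.fin (k ++ [x])).map c)) := fun k => by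
    rw [glue_fin_fin_eq_ofTail]; simp
  rcases d with k | t
  · rw [glue_fin_fin_eq_ofTail]
    constructor
    · rintro ⟨G, h1, h2⟩
      obtain ⟨m, hm, rfl, h3⟩ := (comp_singleton_ofTail _ _).1 h1
      obtain rfl := Tail.fin.inj hm
      rw [e, related_glue_right_iff P hl hb] at h2
      · exact ⟨k, rfl, h2⟩
      · rintro rfl hb0
        obtain ⟨rfl, rfl⟩ := hl.nil rfl
        obtain rfl : b = [] := by simpa using hb0
        exact matches_concat hd₀ fun h => h3 (by simp [h])
    · rintro ⟨k', hk', hk⟩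
      obtain rfl := Tail.fin.inj hk'
      refine ⟨_, (comp_singleton_ofTail _ _).2 ⟨_, rfl, rfl, fun h => ?_⟩, ?_⟩
      · simp only [List.append_eq_nil_iff, List.map_eq_nil_iff, List.reverse_eq_nil_iff] at h
        obtain ⟨rfl, rfl, rfl⟩ := h
        obtain ⟨rfl, rfl⟩ := hl.nil rfl
        exact hk.1 x (by simp)
      · rw [e]
        exact (related_glue_right_iff P hl hb fun _ _ => hk.matches).2 hk
  · refine ⟨?_, by rintro ⟨k, hk, -⟩; cases hk⟩
    rintro ⟨G, h1, -⟩
    have h2 : glue v ε ((Tail.fin b).map c) (.app l ((Tail.inf t).map c)) =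
        ofTail v ε (.app ((b.map c).reverse.map Letter.flip) (.app l ((Tail.inf t).map c))) := rfl
    rw [h2] at h1
    obtain ⟨m, hm, -⟩ := (comp_singleton_ofTail _ _).1 h1
    simp [Tail.app] at hm

/-- Continuation on the left by inverses of letters of the class `c`. -/
lemma continue_left_iff (P : Polarised hd sg r c) (hl : IsCoreList hd sg r c l v ε w δ)
    {d : Tail α} (hd₀ : TailGood hd sg r c w δ d)
    {p : Letter α → Prop} (hp : ∀ a, p a → ∃ x, a = c x) (F : Seqn V (Letter α)) :
    (∃ B, Related r B ∧ (∀ i a, B.letter i = some a → p a) ∧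
      Comp hd sg B.inv (ofTail v ε (.app l (d.map c))) F ∧ Related r F) ↔
      ∃ t : Tail α, (∀ n x, t.get? n = some x → p (c x)) ∧ TailGood hd sg r c v (-ε) t ∧
        F = glue v ε (t.map c) (.app l (d.map c)) := by
  have hm := hl.matches_app (t := d.map c) fun _ => hd₀.matches
  constructor
  · rintro ⟨B, hB, hBp, h1, h2⟩
    obtain ⟨t, rfl, rfl, ht⟩ := (comp_inv_ofTail hm hB.1).1 h1
    have htp : ∀ n a, t.get? n = some a → p a := fun n a ha => hBp (n + 1) a (by
      rw [letter_ofTail, if_pos (by omega), ← ha]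
      congr 1; omega)
    obtain ⟨t, rfl⟩ := exists_map_eq fun n a ha => hp a (htp n a ha)
    rw [related_glue_iff P hl (fun _ => hd₀.matches)] at h2
    · exact ⟨t, fun n x hx => htp n _ (by simp [hx]), h2.1, rfl⟩
    · rintro rfl rfl
      exact ht (by simp)
  · rintro ⟨t, ht, h1, rfl⟩
    refine ⟨ofTail v (-ε) (t.map c), ?_, fun i a ha => ?_, (comp_inv_ofTail hm
      (ofTail_ne_fin_nil _ _ _)).2 ⟨_, rfl, rfl, fun _ => h1.matches⟩,
      (related_glue_iff P hl (fun _ => hd₀.matches) fun _ _ => h1.matches).2 ⟨h1, hd₀⟩⟩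
    · exact (related_ofTail_map P h1.matches).2 h1
    · rw [letter_ofTail, Tail.get?_map] at ha
      split_ifs at ha
      obtain ⟨x, hx, rfl⟩ := Option.map_eq_some_iff.1 ha
      exact ht _ x hx

/-- Both sides contain the same pairs of neighbours; the pair formed by `a` and the first letter of
`b` is merely read in the opposite direction. -/
lemma related_glue_shift (h : ∀ a b, r a b ↔ r b.flip a.flip) {v' : V} {ε' : ℤˣ} (a : Letter α)
    (b e : Tail (Letter α)) : Related r (glue v ε b (.app [a.flip] e)) ↔
      Related r (glue v' ε' (.app [a] b) e) := by
  rw [related_glue h, related_glue h, Tail.chain_app, Tail.chain_app]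
  simp only [List.isChain_singleton, List.getLast?_singleton, Option.some.injEq, true_and,
    Tail.get?_zero_app_of_ne_nil (List.cons_ne_nil _ _), List.getElem?_cons_zero]
  have h1 : (∀ x y, a = x → b.get? 0 = some y → r x y) ↔
      ∀ y z, b.get? 0 = some y → a.flip = z → r y.flip z := by
    constructor
    · rintro h1 y _ hy rfl
      exact (h _ _).1 (h1 a y rfl hy)
    · rintro h1 _ y rfl hy
      exact (h _ _).2 (h1 y _ hy rfl)
  rw [h1]
  constructor
  · rintro ⟨h2, ⟨h3, h4⟩, h5⟩
    exact ⟨⟨h2, h5⟩, h3, fun x y hx hy => h4 _ y (by rw [hx]) hy⟩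
  · rintro ⟨⟨h2, h5⟩, h3, h4⟩
    refine ⟨h2, ⟨h3, ?_⟩, h5⟩
    rintro _ y rfl hy
    exact h4 a y rfl hy

/-- Continuation on the left of `(c x)⁻¹AD`. -/
lemma continue_cons_left_iff (P : Polarised hd sg r c) (hl : IsCoreList hd sg r c l v ε w δ)
    {d : Tail α} (hd₀ : TailGood hd sg r c w δ d) {x : α} (hx : TailGood hd sg r c v (-ε) (.fin [x]))
    {p : Letter α → Prop} (hp : ∀ a, p a → ∃ x, a = c x) (F : Seqn V (Letter α)) :
    (∃ B, Related r B ∧ (∀ i a, B.letter i = some a → p a) ∧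
      Comp hd sg B.inv (glue v ε (.fin [c x]) (.app l (d.map c))) F ∧ Related r F) ↔
      ∃ t : Tail α, (∀ n x, t.get? n = some x → p (c x)) ∧
        TailGood hd sg r c v (-ε) (.app [x] t) ∧
        F = glue v ε (t.map c) (.app [(c x).flip] (.app l (d.map c))) := by
  -- A letter is present, so the labels may be replaced by the head and sign of `(c x)⁻¹`. This
  -- brings the sequence into the form that `comp_inv_ofTail` requires.
  have e : glue v ε (.fin [c x]) (.app l (d.map c)) = ofTail (hd (c x).flip) (sg (c x).flip)
      (.app [(c x).flip] (.app l (d.map c))) := ofTail_congr (Tail.app_ne_nil (by simp) _)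
  have hm : Matches hd sg (hd (c x).flip) (sg (c x).flip)
      (.app [(c x).flip] (.app l (d.map c))) := by
    intro a ha
    rw [Tail.get?_zero_app_of_ne_nil (by simp)] at ha
    cases ha
    exact ⟨rfl, rfl⟩
  have hglue : ∀ (v : V) (ε : ℤˣ) (b : Tail (Letter α)),
      glue (hd (c x).flip) (sg (c x).flip) b (.app [(c x).flip] (.app l (d.map c))) =
        glue v ε b (.app [(c x).flip] (.app l (d.map c))) := by
    intro v ε b
    rcases b with b | b
    · exact ofTail_congr fun h => Tail.app_ne_nil (by simp) _ (Tail.app_eq_nil.1 h).2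
    · generalize Tail.app [(c x).flip] (Tail.app l (d.map c)) = u
      cases u <;> rfl
  -- Handing the junction letter back to the left turns `x` into the first entry of the left tail,
  -- to which the criterion for glued sequences applies.
  have hrel : ∀ t : Tail α, Related r (glue v ε (t.map c) (.app [(c x).flip] (.app l (d.map c)))) ↔
      TailGood hd sg r c v (-ε) (.app [x] t) := by
    intro t
    rw [related_glue_shift P.flip_iff (v' := v) (ε' := ε)]
    have h1 : Tail.app [c x] (t.map c) = (Tail.app [x] t).map c := by rw [Tail.map_app]; rfl
    rw [h1, related_glue_iff P hl (fun _ => hd₀.matches), and_iff_left hd₀]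
    intro _ _ a ha
    rw [Tail.map_app, Tail.get?_zero_app_of_ne_nil (by simp)] at ha
    exact hx.matches a (by simpa using ha)
  rw [e]
  constructor
  · rintro ⟨B, hB, hBp, h1, h2⟩
    obtain ⟨t, rfl, rfl, ht⟩ := (comp_inv_ofTail hm hB.1).1 h1
    have htp : ∀ n a, t.get? n = some a → p a := fun n a ha => hBp (n + 1) a (by
      rw [letter_ofTail, if_pos (by omega), ← ha]
      congr 1; omega)
    obtain ⟨t, rfl⟩ := exists_map_eq fun n a ha => hp a (htp n a ha)
    rw [hglue v ε] at h2
    exact ⟨t, fun n x hx => htp n _ (by simp [hx]), (hrel t).1 h2, hglue v ε _⟩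
  · rintro ⟨t, ht, h1, rfl⟩
    refine ⟨ofTail (hd (c x).flip) (-sg (c x).flip) (t.map c), ?_, fun i a ha => ?_,
      (comp_inv_ofTail hm (ofTail_ne_fin_nil _ _ _)).2 ⟨_, rfl, (hglue v ε _).symm,
        fun h => absurd h (Tail.app_ne_nil (by simp) _)⟩, (hrel t).2 h1⟩
    · rw [related_ofTail, Tail.chain_map]
      exact (Tail.chain_app.1 h1.2).2.1
    · rw [letter_ofTail, Tail.get?_map] at ha
      split_ifs at ha
      obtain ⟨x, hx, rfl⟩ := Option.map_eq_some_iff.1 ha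
      exact ht _ x hx

/-- Extension of `B⁻¹(c x)⁻¹AD` by one letter on the left. -/
lemma extend_cons_left_iff (P : Polarised hd sg r c) (hl : IsCoreList hd sg r c l v ε w δ)
    {d t : Tail α} (hd₀ : TailGood hd sg r c w δ d) {x : α}
    (ht : TailGood hd sg r c v (-ε) (.app [x] t)) (y : α) :
    (∃ G, Comp hd sg (.fin [(c y).flip])
        (glue v ε (t.map c) (.app [(c x).flip] (.app l (d.map c)))) G ∧ Related r G) ↔
      ∃ k, t = .fin k ∧ TailGood hd sg r c v (-ε) (.fin (x :: k ++ [y])) := by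
  have hmv : ∀ v' ε', glue v ε (t.map c) (.app [(c x).flip] (.app l (d.map c))) =
      glue v' ε' (t.map c) (.app [(c x).flip] (.app l (d.map c))) := by
    intro v' ε'
    generalize t.map c = b
    rcases b with b | b
    · exact ofTail_congr fun h => Tail.app_ne_nil (by simp) _ (Tail.app_eq_nil.1 h).2
    · generalize Tail.app [(c x).flip] (Tail.app l (d.map c)) = u
      cases u <;> rfl
  have hm : Matches hd sg (hd (c x).flip) (sg (c x).flip)
      (.app [(c x).flip] (.app l (d.map c))) := by
    intro a ha
    rw [Tail.get?_zero_app_of_ne_nil (by simp)] at ha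
    cases ha
    exact ⟨rfl, rfl⟩
  have hrel : ∀ (v' : V) (ε' : ℤˣ) (k : List α), Related r (glue v' ε'
        (.fin (k.map c ++ [(c y).flip.flip])) (.app [(c x).flip] (.app l (d.map c)))) ↔
      TailGood hd sg r c v (-ε) (.fin (x :: k ++ [y])) := by
    intro v' ε' k
    rw [related_glue_shift P.flip_iff (v' := v) (ε' := ε), Letter.flip_flip]
    have h1 : Tail.app [c x] (.fin (k.map c ++ [c y])) = (Tail.fin (x :: k ++ [y])).map c := by
      simp
    rw [h1, related_glue_iff P hl (fun _ => hd₀.matches), and_iff_left hd₀]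
    intro _ _ a ha
    refine ht.matches a ?_
    rw [Tail.map_app, Tail.get?_zero_app_of_ne_nil (by simp)]
    simpa using ha
  rw [hmv]
  constructor
  · rintro ⟨G, h1, h2⟩
    obtain ⟨m, hk, rfl, -⟩ := (comp_singleton_glue _ hm _).1 h1
    rcases t with k | s
    · obtain rfl : k.map c = m := by simpa using hk
      exact ⟨k, rfl, (hrel _ _ k).1 h2⟩
    · simp at hk
  · rintro ⟨k, rfl, hk⟩
    exact ⟨_, (comp_singleton_glue _ hm _).2 ⟨k.map c, rfl, rfl,
      fun h => absurd h (Tail.app_ne_nil (by simp) _)⟩, (hrel _ _ k).2 hk⟩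

/-- Only `ℤ`-sequences are moved by a shift, and a finite right part excludes them. Hence no shift
is needed in `R_C` when only the left cap exists. -/
lemma shift_glue_fin (b : Tail (Letter α)) (e : List (Letter α)) (n : ℤ) :
    (glue v ε b (.fin e)).shift n = glue v ε b (.fin e) := by
  rcases b with b | b
  · simp only [glue, Tail.app_fin]
    generalize b.reverse.map Letter.flip ++ e = u
    cases u <;> rfl
  · rfl

end Extensions

end Seqn

open Seqn

/-! ### The resolution of a string word in normal form -/

section ResolutionWords

variable {V A : Type*} [Fintype V] {R : Type*} [CommRing R] {Q : BoundQuiver V A}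

/-- Maximal continuations by arrows. -/
lemma isArrowChain_app_iff {s : Letter A → ℤˣ} {w : V} {δ : ℤˣ} {β : GPath R Q}
    (hβ : GTail s w δ (.fin [β])) {t : Tail (GPath R Q)} :
    ((∀ n x, t.get? n = some x → x.IsArrow) ∧ GTail s w δ (.app [β] t) ∧
      ¬ ∃ a : GPath R Q, a.IsArrow ∧ ∃ k, t = .fin k ∧ GTail s w δ (.fin (β :: k ++ [a]))) ↔
      IsArrowChain β (.app [β] t) := by
  have h0 : ∀ n, (Tail.app [β] t).get? (n + 1) = t.get? n := fun n => by
    rw [Tail.get?_app, if_neg (by simp)]; simp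
  constructor
  · rintro ⟨h1, h2, h3⟩
    refine ⟨⟨fun a ha => ?_, chain_arrStep_iff.2 ⟨h2.2, fun n a ha => h1 n a (h0 n ▸ ha)⟩⟩, ?_⟩
    · rw [Tail.get?_zero_app_of_ne_nil (by simp)] at ha
      exact (Option.some_injective _ ha).symm
    · rintro ⟨k, x, hk, hx⟩
      rcases t with k' | k'
      · obtain rfl : β :: k' = k := by simpa using hk
        obtain ⟨h4, h5⟩ := chain_arrStep_iff.1 hx.2
        refine h3 ⟨x, h5 k'.length x (by simp), k', rfl, fun a ha => ?_, h4⟩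
        obtain rfl : β = a := by simpa using ha
        exact hβ.1 _ (by simp)
      · simp [Tail.app] at hk
  · intro h
    obtain ⟨h1, h2⟩ := hβ.1 β (by simp)
    obtain ⟨h4, h5⟩ := chain_arrStep_iff.1 h.1.2
    refine ⟨fun n x hx => h5 n x (h0 n ▸ hx), h.gTail h1 h2, ?_⟩
    rintro ⟨a, ha, k, rfl, hk⟩
    refine h.2 ⟨β :: k, a, rfl, fun b hb => by simpa using hb.symm,
      chain_arrStep_iff.2 ⟨hk.2, fun n b hb => ?_⟩⟩
    by_cases hn : n < k.length
    · refine h5 n b ?_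
      simpa [List.getElem?_append_left hn] using hb
    · rw [Tail.get?_fin, List.getElem?_append_right (by simp; omega)] at hb
      obtain ⟨h6, h7⟩ := List.getElem?_eq_some_iff.1 hb
      simp at h7
      exact h7 ▸ ha

namespace Core

/-- The words `E(↗)`, for a core continued on the right by `⟨β⟩`. -/
lemma isUpRight_iff {s : Letter A → ℤˣ} (hs : IsSign R Q s) {κ : Core R Q} (hκ : κ.Valid)
    {b : List (GPath R Q)} {δ : GPath R Q} (hb : GTail s κ.v₀ (-κ.ε₀ s) (.fin b))
    (hδ : GTail s κ.v₁ (κ.ε₁ s) (.fin [δ])) (F : Seqn V (Letter (GPath R Q))) :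
    IsUpRight s (κ.genWord s (.fin b) (.fin [δ])) F ↔
      ∃ u, IsArrowChain δ u ∧ F = κ.genWord s (.fin b) u := by
  have P := gen_polarised hs
  have hl := isCoreList_gen s hκ
  have h1 := continue_right_iff P hl hb hδ
    (p := fun l => ∃ a : GPath R Q, a.IsArrow ∧ l = .dir a) (fun _ ⟨x, _, h⟩ => ⟨x, h⟩) F
  have h2 : ∀ u, GTail s κ.v₁ (κ.ε₁ s) u → (ExtendsRight s (κ.genWord s (.fin b) u) ↔
      ∃ a : GPath R Q, a.IsArrow ∧ ∃ k, u = .fin k ∧ GTail s κ.v₁ (κ.ε₁ s) (.fin (k ++ [a]))) :=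
    fun u hu => exists_congr fun a => and_congr_right fun _ => by
      rw [← extend_glue_right_iff P hl hb hu a]
      exact exists_congr fun G => and_congr_right fun _ => isGenWord_iff
  have h3 : ∀ t : Tail (GPath R Q), (∃ a : GPath R Q, a.IsArrow ∧ ∃ k, Tail.app [δ] t = .fin k ∧
      GTail s κ.v₁ (κ.ε₁ s) (.fin (k ++ [a]))) ↔ ∃ a : GPath R Q, a.IsArrow ∧ ∃ k, t = .fin k ∧
      GTail s κ.v₁ (κ.ε₁ s) (.fin (δ :: k ++ [a])) := by
    intro t
    refine exists_congr fun a => and_congr_right fun _ => ?_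
    constructor
    · rintro ⟨k, hk, h⟩
      rcases t with k' | k'
      · obtain rfl : δ :: k' = k := by simpa using hk
        exact ⟨k', rfl, h⟩
      · simp [Tail.app] at hk
    · rintro ⟨k, rfl, h⟩
      exact ⟨_, rfl, h⟩
  constructor
  · rintro ⟨N, hN, hNp, hc, hF, hE⟩
    obtain ⟨t, ht, ht', rfl⟩ := h1.1 ⟨N, isGenWord_iff.1 hN, hNp, hc, isGenWord_iff.1 hF⟩
    refine ⟨.app [δ] t, (isArrowChain_app_iff hδ).1 ⟨fun n x hx => ?_, ht', ?_⟩, rfl⟩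
    · obtain ⟨a, ha, e⟩ := ht n x hx
      cases e; exact ha
    · rw [← h3, ← h2 _ ht']
      exact hE
  · rintro ⟨u, hu, rfl⟩
    obtain ⟨t, rfl⟩ := Tail.exists_eq_app_singleton hu.get?_zero
    obtain ⟨h4, h5, h6⟩ := (isArrowChain_app_iff hδ).2 hu
    obtain ⟨N, hN, hNp, hc, hF⟩ := h1.2 ⟨t, fun n x hx => ⟨x, h4 n x hx, rfl⟩, h5, rfl⟩
    refine ⟨N, isGenWord_iff.2 hN, hNp, hc, isGenWord_iff.2 hF, ?_⟩
    rw [← h3, ← h2 _ h5] at h6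
    exact h6

/-- The words `E(↖)[1]`, for a core continued on the left by `⟨β⟩⁻¹`. -/
lemma isUpLeft_iff {s : Letter A → ℤˣ} (hs : IsSign R Q s) {κ : Core R Q} (hκ : κ.Valid)
    {β : GPath R Q} {d : Tail (GPath R Q)} (hβ : GTail s κ.v₀ (-κ.ε₀ s) (.fin [β]))
    (hd : GTail s κ.v₁ (κ.ε₁ s) d) (F : Seqn V (Letter (GPath R Q))) :
    (∃ F', IsUpLeft s (κ.genWord s (.fin [β]) d) F' ∧ F = F'.shift 1) ↔
      ∃ u, IsArrowChain β u ∧ F = κ.genWord s u d := by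
  have P := gen_polarised hs
  have hl := isCoreList_gen s hκ
  have h1 := fun F => continue_cons_left_iff P hl hd hβ
    (p := fun l => ∃ a : GPath R Q, a.IsArrow ∧ l = .dir a) (fun _ ⟨x, _, h⟩ => ⟨x, h⟩) F
  have h2 : ∀ t, GTail s κ.v₀ (-κ.ε₀ s) (.app [β] t) →
      (ExtendsLeft s (glue κ.v₀ (κ.ε₀ s) (t.map .dir)
        (.app [(Letter.dir β).flip] (.app (galtList κ.pairs) (d.map .dir)))) ↔
      ∃ a : GPath R Q, a.IsArrow ∧ ∃ k, t = .fin k ∧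
        GTail s κ.v₀ (-κ.ε₀ s) (.fin (β :: k ++ [a]))) :=
    fun t ht => exists_congr fun a => and_congr_right fun _ => by
      rw [← extend_cons_left_iff P hl hd ht a]
      exact exists_congr fun G => and_congr_right fun _ => isGenWord_iff
  -- Composing with `L⁻¹` places the origin in front of `⟨β⟩⁻¹`; the shift by `1` moves it back to
  -- the start of the core.
  have hsh : ∀ t : Tail (GPath R Q), (glue κ.v₀ (κ.ε₀ s) (t.map .dir)
      (.app [(Letter.dir β).flip] (.app (galtList κ.pairs) (d.map .dir)))).shift 1 =
      κ.genWord s (.app [β] t) d := by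
    intro t
    rw [shift_glue _ κ.v₀ _ (κ.ε₀ s), genWord, Tail.map_app]
    rfl
  constructor
  · rintro ⟨F', ⟨N, hN, hNp, hc, hF, hE⟩, rfl⟩
    obtain ⟨t, ht, ht', rfl⟩ := (h1 F').1 ⟨N, isGenWord_iff.1 hN, hNp, hc, isGenWord_iff.1 hF⟩
    refine ⟨.app [β] t, (isArrowChain_app_iff hβ).1 ⟨fun n x hx => ?_, ht', ?_⟩, hsh t⟩
    · obtain ⟨a, ha, e⟩ := ht n x hx
      cases e; exact ha
    · rw [← h2 _ ht']
      exact hE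
  · rintro ⟨u, hu, rfl⟩
    obtain ⟨t, rfl⟩ := Tail.exists_eq_app_singleton hu.get?_zero
    obtain ⟨h4, h5, h6⟩ := (isArrowChain_app_iff hβ).2 hu
    obtain ⟨N, hN, hNp, hc, hF⟩ := (h1 _).2 ⟨t, fun n x hx => ⟨x, h4 n x hx, rfl⟩, h5, rfl⟩
    refine ⟨_, ⟨N, isGenWord_iff.2 hN, hNp, hc, isGenWord_iff.2 hF, ?_⟩, (hsh t).symm⟩
    rw [← h2 _ h5] at h6
    exact h6

lemma genSeq_eq_genWord (s : Letter A → ℤˣ) (κ : Core R Q) :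
    κ.genSeq s = κ.genWord s (.fin []) (.fin []) := by
  simp [genSeq, genWord, glue_nil]

lemma wordSeq_eq_word (s : Letter A → ℤˣ) (κ : Core R Q) :
    κ.wordSeq s = κ.word s (.fin []) (.fin []) := by
  simp [wordSeq, word, glue_nil]

lemma comp_genSeq_iff {s : Letter A → ℤˣ} {κ : Core R Q} (hκ : κ.Valid) {δ : GPath R Q}
    (hδ : GTail s κ.v₁ (κ.ε₁ s) (.fin [δ])) (X : Seqn V (Letter (GPath R Q))) :
    Comp ghead (gsign s) (κ.genSeq s) (.fin [.dir δ]) X ↔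
      X = κ.genWord s (.fin []) (.fin [δ]) := by
  have e : κ.genWord s (.fin []) (.fin [δ]) =
      ofTail κ.v₀ (κ.ε₀ s) (.fin (galtList κ.pairs ++ [.dir δ])) := by
    simp [genWord, glue_nil]
  rw [genSeq, comp_singleton_ofTail, e]
  constructor
  · rintro ⟨m, hm, rfl, -⟩
    rw [Tail.fin.inj hm]
  · rintro rfl
    refine ⟨_, rfl, rfl, fun h => ?_⟩
    obtain ⟨h1, h2⟩ := (isCoreList_gen s hκ).nil h
    rw [h1, h2]
    exact hδ.1 δ (by simp)

lemma comp_genWord_iff {s : Letter A → ℤˣ} {κ : Core R Q} (hκ : κ.Valid) {β : GPath R Q}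
    (hβ : GTail s κ.v₀ (-κ.ε₀ s) (.fin [β])) {d : Tail (GPath R Q)}
    (hd : GTail s κ.v₁ (κ.ε₁ s) d) (X : Seqn V (Letter (GPath R Q))) :
    Comp ghead (gsign s) (.fin [.inv β]) (κ.genWord s (.fin []) d) X ↔
      X = κ.genWord s (.fin [β]) d := by
  have hm := (isCoreList_gen s hκ).matches_app (t := d.map .dir) fun _ => hd.matches
  rw [genWord, Tail.map_fin, List.map_nil, comp_singleton_glue _ hm]
  constructor
  · rintro ⟨k, hk, rfl, -⟩
    rw [← Tail.fin.inj hk]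
    rfl
  · rintro rfl
    exact ⟨[], rfl, rfl, fun _ _ => hβ.1 β (by simp)⟩

variable {Λ : Type*} [Ring Λ] [Algebra R Λ] {ϑ : PathAlgebra R Q →ₐ[R] Λ}

/-- A cap exhibits the prolonging arrow, which rules out the maximal case; uniqueness of this arrow
then identifies the path that starts the chain. -/
lemma tailRes_iff_of_isCap [Nontrivial R] (hϑ : IsCompleteGentle ϑ)
    {s : Letter A → ℤˣ} (hs : IsSign R Q s) {w : V} {δ : ℤˣ}
    {d : Tail A} (hd : WTail R Q s w δ d) {β : GPath R Q}
    (hβ : IsCap R Q s (ofTail w δ (d.map .inv)) β) (t : Tail (GPath R Q)) :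
    (TailRes s w δ d t ↔ IsArrowChain β t) ∧ GTail s w δ (.fin [β]) := by
  obtain ⟨k, x, rfl, hk, hx⟩ := (isCap_iff hs hd).1 hβ
  refine ⟨⟨?_, fun h => Or.inr ⟨k, x, β, rfl, hk, hx, h⟩⟩, fun a ha => ?_, by
    rw [Tail.chain_fin]; simp⟩
  · rintro (⟨h, -⟩ | ⟨k', x', β', e, hβ', hx', h⟩)
    · exact absurd ⟨k, x, rfl, hx⟩ h
    · obtain rfl := Tail.fin.inj e
      obtain rfl := wTail_extension_unique hϑ hs hx hx'
      rwa [Subtype.ext (hk.trans hβ'.symm)]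
  · obtain rfl : β = a := by simpa using ha
    exact (wTail_concat_iff hk).1 hx

lemma tailRes_iff_of_not_isCap [Nontrivial R] {s : Letter A → ℤˣ} (hs : IsSign R Q s)
    {w : V} {δ : ℤˣ} {d : Tail A} (hd : WTail R Q s w δ d)
    (h : ¬ ∃ β, IsCap R Q s (ofTail w δ (d.map .inv)) β) (t : Tail (GPath R Q)) :
    TailRes s w δ d t ↔ t = .fin [] := by
  rw [exists_isCap_iff hs hd, not_not] at h
  refine ⟨?_, fun h' => Or.inl ⟨h, h'⟩⟩
  rintro (⟨-, h'⟩ | ⟨k, x, β, e, -, hk, -⟩)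
  · exact h'
  · exact absurd ⟨k, x, e, hk⟩ h

/-- The resolution of a string word. -/
lemma isResolutionWord_iff [Nontrivial R] (hϑ : IsCompleteGentle ϑ) {s : Letter A → ℤˣ}
    (hs : IsSign R Q s) {κ : Core R Q} (hκ : κ.Valid) {b d : Tail A}
    (hb : WTail R Q s κ.v₀ (-κ.ε₀ s) b) (hd : WTail R Q s κ.v₁ (κ.ε₁ s) d)
    (F : Seqn V (Letter (GPath R Q))) :
    IsResolutionWord s (κ.word s b d) F ↔ ∃ t u, TailRes s κ.v₀ (-κ.ε₀ s) b t ∧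
      TailRes s κ.v₁ (κ.ε₁ s) d u ∧ F = κ.genWord s t u := by
  have hA : ∀ A'', IsAltMatch (κ.wordSeq s) A'' ↔ A'' = κ.genSeq s := by
    intro A''
    rw [isAltMatch_iff (s := s)]
    constructor
    · rintro ⟨κ', h1, rfl⟩
      rw [wordSeq_injective h1]
    · rintro rfl
      exact ⟨κ, rfl, rfl⟩
  -- The decomposition and the generalised core are unique, so the four cases of the definition
  -- depend only on the existence of the two caps.
  have h0 : IsResolutionWord s (κ.word s b d) F ↔
    ((∃ β δ, IsCap R Q s (ofTail κ.v₀ (-κ.ε₀ s) (b.map .inv)) β ∧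
        IsCap R Q s (ofTail κ.v₁ (κ.ε₁ s) (d.map .inv)) δ ∧
        ∃ X E F', Seqn.Comp ghead (gsign s) (κ.genSeq s) (.fin [.dir δ]) X ∧
          Seqn.Comp ghead (gsign s) (.fin [.inv β]) X E ∧ IsUpBoth s E F' ∧ F = F'.shift 1) ∨
      ((¬ ∃ β, IsCap R Q s (ofTail κ.v₀ (-κ.ε₀ s) (b.map .inv)) β) ∧
        ∃ δ, IsCap R Q s (ofTail κ.v₁ (κ.ε₁ s) (d.map .inv)) δ ∧
        ∃ E, Seqn.Comp ghead (gsign s) (κ.genSeq s) (.fin [.dir δ]) E ∧ IsUpRight s E F) ∨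
      ((¬ ∃ δ, IsCap R Q s (ofTail κ.v₁ (κ.ε₁ s) (d.map .inv)) δ) ∧
        ∃ β, IsCap R Q s (ofTail κ.v₀ (-κ.ε₀ s) (b.map .inv)) β ∧
        ∃ E, Seqn.Comp ghead (gsign s) (.fin [.inv β]) (κ.genSeq s) E ∧ IsUpLeft s E F) ∨
      ((¬ ∃ β, IsCap R Q s (ofTail κ.v₀ (-κ.ε₀ s) (b.map .inv)) β) ∧
        (¬ ∃ δ, IsCap R Q s (ofTail κ.v₁ (κ.ε₁ s) (d.map .inv)) δ) ∧ F = κ.genSeq s)) := by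
    constructor
    · rintro ⟨B, A', D, hD, A'', hA', h⟩
      obtain ⟨rfl, rfl, rfl⟩ := (isDecomp_word hs hκ hb hd).1 hD
      obtain rfl := (hA _).1 hA'
      exact h
    · intro h
      exact ⟨_, _, _, (isDecomp_word hs hκ hb hd).2 ⟨rfl, rfl, rfl⟩, _, (hA _).2 rfl, h⟩
  have hnil : ∀ {w δ}, GTail (R := R) (Q := Q) s w δ (.fin []) := fun {w δ} => tailGood_nil w δ
  rw [h0]
  by_cases h1 : ∃ β, IsCap R Q s (ofTail κ.v₀ (-κ.ε₀ s) (b.map .inv)) β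
  · obtain ⟨β, hβ⟩ := h1
    have hβ' := tailRes_iff_of_isCap hϑ hs hb hβ
    -- The cap is unique because it is the first entry of the corresponding chain.
    have hβu : ∀ β', IsCap R Q s (ofTail κ.v₀ (-κ.ε₀ s) (b.map .inv)) β' → β' = β := by
      intro β' h
      obtain ⟨t, ht, -⟩ := existsUnique_isArrowChain hϑ β'
      have := ((hβ' t).1.1 (((tailRes_iff_of_isCap hϑ hs hb h) t).1.2 ht)).get?_zero
      exact Option.some_injective _ (ht.get?_zero.symm.trans this)
    by_cases h2 : ∃ δ, IsCap R Q s (ofTail κ.v₁ (κ.ε₁ s) (d.map .inv)) δ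
    · obtain ⟨δ, hδ⟩ := h2
      have hδ' := tailRes_iff_of_isCap hϑ hs hd hδ
      have hδu : ∀ δ', IsCap R Q s (ofTail κ.v₁ (κ.ε₁ s) (d.map .inv)) δ' → δ' = δ := by
        intro β' h
        obtain ⟨t, ht, -⟩ := existsUnique_isArrowChain hϑ β'
        have := ((hδ' t).1.1 (((tailRes_iff_of_isCap hϑ hs hd h) t).1.2 ht)).get?_zero
        exact Option.some_injective _ (ht.get?_zero.symm.trans this)
      have hβ1 := (hβ' (.fin [])).2
      have hδ1 := (hδ' (.fin [])).2
      simp only [(hβ' _).1, (hδ' _).1]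
      constructor
      · rintro (⟨β', δ', e1, e2, X, E, F', hX, hE, ⟨Y, hY, hF'⟩, rfl⟩ | ⟨h, -⟩ | ⟨h, -⟩ | ⟨h, -⟩)
        · obtain rfl := hβu _ e1
          obtain rfl := hδu _ e2
          obtain rfl := (comp_genSeq_iff hκ hδ1 X).1 hX
          obtain rfl := (comp_genWord_iff hκ hβ1 hδ1 E).1 hE
          obtain ⟨u, hu, rfl⟩ := (isUpRight_iff hs hκ hβ1 hδ1 Y).1 hY
          obtain ⟨t, ht, e⟩ := (isUpLeft_iff hs hκ hβ1
            (((hδ' u).1.2 hu).resTail.gTail) _).1 ⟨F', hF', rfl⟩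
          exact ⟨t, u, ht, hu, e⟩
        · exact absurd ⟨β, hβ⟩ h
        · exact absurd ⟨δ, hδ⟩ h
        · exact absurd ⟨β, hβ⟩ h
      · rintro ⟨t, u, ht, hu, e⟩
        obtain ⟨F', hF', e'⟩ := (isUpLeft_iff hs hκ hβ1
          (((hδ' u).1.2 hu).resTail.gTail) F).2 ⟨t, ht, e⟩
        exact Or.inl ⟨β, δ, hβ, hδ, _, _, F', (comp_genSeq_iff hκ hδ1 _).2 rfl,
          (comp_genWord_iff hκ hβ1 hδ1 _).2 rfl,
          ⟨_, (isUpRight_iff hs hκ hβ1 hδ1 _).2 ⟨u, hu, rfl⟩, hF'⟩, e'⟩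
    · have hδ' := tailRes_iff_of_not_isCap hs hd h2
      have hβ1 := (hβ' (.fin [])).2
      -- The right part is finite here, so the shift in `isUpLeft_iff` has no effect and agrees with
      -- the unshifted definition in this case.
      have hsh : ∀ F', IsUpLeft s (κ.genWord s (.fin [β]) (.fin [])) F' → F'.shift 1 = F' := by
        rintro F' ⟨N, hN, hNp, hc, hF, -⟩
        obtain ⟨t, -, -, rfl⟩ := (continue_cons_left_iff (gen_polarised hs) (isCoreList_gen s hκ)
          hnil hβ1 (p := fun l => ∃ a : GPath R Q, a.IsArrow ∧ l = .dir a)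
          (fun _ ⟨x, _, h⟩ => ⟨x, h⟩) F').1 ⟨N, isGenWord_iff.1 hN, hNp, hc, isGenWord_iff.1 hF⟩
        exact shift_glue_fin _ _ _
      simp only [(hβ' _).1, hδ']
      constructor
      · rintro (⟨_, δ, _, e, _⟩ | ⟨h, -⟩ | ⟨-, β', e1, E, hE, hF⟩ | ⟨h, -⟩)
        · exact absurd ⟨δ, e⟩ h2
        · exact absurd ⟨β, hβ⟩ h
        · obtain rfl := hβu _ e1
          rw [genSeq_eq_genWord] at hE
          obtain rfl := (comp_genWord_iff hκ hβ1 hnil E).1 hE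
          obtain ⟨t, ht, e⟩ := (isUpLeft_iff hs hκ hβ1 hnil F).1 ⟨F, hF, (hsh F hF).symm⟩
          exact ⟨t, _, ht, rfl, e⟩
        · exact absurd ⟨β, hβ⟩ h
      · rintro ⟨t, _, ht, rfl, e⟩
        obtain ⟨F', hF', e'⟩ := (isUpLeft_iff hs hκ hβ1 hnil F).2 ⟨t, ht, e⟩
        rw [hsh F' hF'] at e'
        subst e'
        refine Or.inr (Or.inr (Or.inl ⟨h2, β, hβ, _, ?_, hF'⟩))
        rw [genSeq_eq_genWord]
        exact (comp_genWord_iff hκ hβ1 hnil _).2 rfl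
  · have hβ' := tailRes_iff_of_not_isCap hs hb h1
    by_cases h2 : ∃ δ, IsCap R Q s (ofTail κ.v₁ (κ.ε₁ s) (d.map .inv)) δ
    · obtain ⟨δ, hδ⟩ := h2
      have hδ' := tailRes_iff_of_isCap hϑ hs hd hδ
      have hδ1 := (hδ' (.fin [])).2
      simp only [(hδ' _).1, hβ']
      constructor
      · rintro (⟨β, _, e, _⟩ | ⟨-, δ', e1, E, hE, hF⟩ | ⟨h, -⟩ | ⟨-, h, -⟩)
        · exact absurd ⟨β, e⟩ h1
        · have := (tailRes_iff_of_isCap hϑ hs hd e1 (.fin [])).2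
          obtain rfl := (comp_genSeq_iff hκ this E).1 hE
          obtain ⟨u, hu, rfl⟩ := (isUpRight_iff hs hκ hnil this F).1 hF
          exact ⟨_, u, rfl, (hδ' u).1.1 ((tailRes_iff_of_isCap hϑ hs hd e1 u).1.2 hu), rfl⟩
        · exact absurd ⟨δ, hδ⟩ h
        · exact absurd ⟨δ, hδ⟩ h
      · rintro ⟨_, u, rfl, hu, rfl⟩
        exact Or.inr (Or.inl ⟨h1, δ, hδ, _, (comp_genSeq_iff hκ hδ1 _).2 rfl,
          (isUpRight_iff hs hκ hnil hδ1 _).2 ⟨u, hu, rfl⟩⟩)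
    · have hδ' := tailRes_iff_of_not_isCap hs hd h2
      simp only [hδ', hβ']
      constructor
      · rintro (⟨β, _, e, _⟩ | ⟨-, δ, e, _⟩ | ⟨-, β, e, _⟩ | ⟨-, -, rfl⟩)
        · exact absurd ⟨β, e⟩ h1
        · exact absurd ⟨δ, e⟩ h2
        · exact absurd ⟨β, e⟩ h1
        · exact ⟨_, _, rfl, rfl, genSeq_eq_genWord s κ⟩
      · rintro ⟨_, _, rfl, rfl, rfl⟩
        exact Or.inr (Or.inr (Or.inr ⟨h1, h2, (genSeq_eq_genWord s κ).symm⟩))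

end Core

end ResolutionWords

open Seqn

/-! ### The homology word of a string resolution in normal form -/

section HomologyWords

variable {V A : Type*} [Fintype V] {R : Type*} [CommRing R] {Q : BoundQuiver V A}

namespace Core

/-- The words `E(↘)`, for a core continued on the left by a finite tail. -/
lemma isDownRight_iff [Nontrivial R] {s : Letter A → ℤˣ} (hs : IsSign R Q s) {κ : Core R Q}
    (hκ : κ.Valid) {b : List A} (hb : WTail R Q s κ.v₀ (-κ.ε₀ s) (.fin b))
    (C : Seqn V (Letter A)) :
    IsDownRight R Q s (κ.word s (.fin b) (.fin [])) C ↔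
      ∃ d, WTail R Q s κ.v₁ (κ.ε₁ s) d ∧ WTailMax R Q s κ.v₁ (κ.ε₁ s) d ∧
        C = κ.word s (.fin b) d := by
  have P := word_polarised hs
  have hl := isCoreList_word s hκ
  have h1 := continue_right_iff P hl hb (tailGood_nil κ.v₁ (κ.ε₁ s))
    (p := fun l => ∃ a : A, l = .inv a) (fun _ h => h) C
  simp only [Tail.app_nil] at h1
  have h2 : ∀ d, WTail R Q s κ.v₁ (κ.ε₁ s) d → ((∃ (x : A) (G : _),
      Comp Q.lhead s (κ.word s (.fin b) d) (.fin [.inv x]) G ∧ IsWord R Q G) ↔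
        ¬ WTailMax R Q s κ.v₁ (κ.ε₁ s) d) := by
    intro d hd
    rw [WTailMax, not_not, exists_comm (α := List A)]
    refine exists_congr fun x => ?_
    rw [← extend_glue_right_iff P hl hb hd x]
    exact exists_congr fun G => and_congr_right fun _ => isWord_iff
  constructor
  · rintro ⟨D, hD, hDi, hc, hC, hm⟩
    obtain ⟨t, -, ht, rfl⟩ := h1.1 ⟨D, isWord_iff.1 hD, hDi, hc, isWord_iff.1 hC⟩
    exact ⟨t, ht, not_not.1 fun h => hm ((h2 t ht).2 h), rfl⟩
  · rintro ⟨d, hd, hm, rfl⟩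
    obtain ⟨D, hD, hDi, hc, hC⟩ := h1.2 ⟨d, fun _ x _ => ⟨x, rfl⟩, hd, rfl⟩
    exact ⟨D, isWord_iff.2 hD, hDi, hc, isWord_iff.2 hC, fun h => (h2 d hd).1 h hm⟩

/-- The words `E(↙)`, for a core continued on the right. -/
lemma isDownLeft_iff [Nontrivial R] {s : Letter A → ℤˣ} (hs : IsSign R Q s) {κ : Core R Q}
    (hκ : κ.Valid) {d : Tail A} (hd : WTail R Q s κ.v₁ (κ.ε₁ s) d) (C : Seqn V (Letter A)) :
    IsDownLeft R Q s (κ.word s (.fin []) d) C ↔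
      ∃ b, WTail R Q s κ.v₀ (-κ.ε₀ s) b ∧ WTailMax R Q s κ.v₀ (-κ.ε₀ s) b ∧
        C = κ.word s b d := by
  have P := word_polarised hs
  have hl := isCoreList_word s hκ
  have h1 := continue_left_iff P hl hd (p := fun l => ∃ a : A, l = .inv a) (fun _ h => h) C
  have e : κ.word s (.fin []) d =
      ofTail κ.v₀ (κ.ε₀ s) (.app (altList κ.pairs) (d.map .inv)) := by
    simp [word, glue_nil]
  have h2 : ∀ b, WTail R Q s κ.v₀ (-κ.ε₀ s) b → ((∃ (x : A) (G : _),
      Comp Q.lhead s (.fin [.dir x]) (κ.word s b d) G ∧ IsWord R Q G) ↔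
        ¬ WTailMax R Q s κ.v₀ (-κ.ε₀ s) b) := by
    intro b hb
    rw [WTailMax, not_not, exists_comm (α := List A)]
    refine exists_congr fun x => ?_
    rw [← extend_left_iff P hl hb hd x]
    exact exists_congr fun G => and_congr_right fun _ => isWord_iff
  rw [IsDownLeft, e]
  constructor
  · rintro ⟨B, hB, hBi, hc, hC, hm⟩
    obtain ⟨t, -, ht, rfl⟩ := h1.1 ⟨B, isWord_iff.1 hB, hBi, hc, isWord_iff.1 hC⟩
    exact ⟨t, ht, not_not.1 fun h => hm ((h2 t ht).2 h), rfl⟩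
  · rintro ⟨b, hb, hm, rfl⟩
    obtain ⟨B, hB, hBi, hc, hC⟩ := h1.2 ⟨b, fun _ x _ => ⟨x, rfl⟩, hb, rfl⟩
    exact ⟨B, isWord_iff.2 hB, hBi, hc, isWord_iff.2 hC, fun h => (h2 b hb).1 h hm⟩

lemma isMulInv_iff [Nontrivial R] {s : Letter A → ℤˣ} {κ : Core R Q}
    (hκ : κ.Valid) {μ : List A} (hμ : WTail R Q s κ.v₁ (κ.ε₁ s) (.fin μ.reverse))
    (X : Seqn V (Letter A)) :
    IsMulInv Q s (κ.wordSeq s) μ X ↔ X = κ.word s (.fin []) (.fin μ.reverse) := by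
  by_cases h0 : μ = []
  · subst h0
    simp [IsMulInv, wordSeq_eq_word]
  · have e : (Seqn.fin (invList μ) : Seqn V (Letter A)) =
        ofTail κ.v₁ (κ.ε₁ s) (.fin (invList μ)) :=
      (ofTail_fin_of_ne_nil _ _ (by simpa [invList] using h0)).symm
    simp only [IsMulInv, h0, false_and, false_or, ne_eq, not_false_eq_true, true_and]
    rw [e, wordSeq, comp_ofTail (isCoreList_word s hκ).toHasEnds (ofTail_ne_fin_nil _ _ _)]
    have e2 : κ.word s (.fin []) (.fin μ.reverse) =
        ofTail κ.v₀ (κ.ε₀ s) (.app (altList κ.pairs) (.fin (invList μ))) := by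
      simp [word, glue_nil, invList]
    rw [e2]
    constructor
    · rintro ⟨d, h1, rfl, -⟩
      rw [ofTail_injective h1]
    · rintro rfl
      exact ⟨_, rfl, rfl, fun _ => hμ.matches⟩

lemma isMulLeft_iff [Nontrivial R] {s : Letter A → ℤˣ} {κ : Core R Q}
    (hκ : κ.Valid) {σ : List A} (hσ : WTail R Q s κ.v₀ (-κ.ε₀ s) (.fin σ.reverse))
    {d : Tail A} (hd : WTail R Q s κ.v₁ (κ.ε₁ s) d) (X : Seqn V (Letter A)) :
    IsMulLeft Q s σ (κ.word s (.fin []) d) X ↔ X = κ.word s (.fin σ.reverse) d := by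
  by_cases h0 : σ = []
  · subst h0
    simp [IsMulLeft]
  · have hne : invList σ ≠ [] := by simpa [invList] using h0
    have e : (Seqn.fin (dirList σ) : Seqn V (Letter A)) = (Seqn.fin (invList σ)).inv := by
      simp only [Seqn.inv, invList, dirList, List.map_reverse, List.reverse_reverse, List.map_map]
      rfl
    have e2 : κ.word s (.fin []) d =
        ofTail κ.v₀ (κ.ε₀ s) (.app (altList κ.pairs) (d.map .inv)) := by
      simp [word, glue_nil]
    simp only [IsMulLeft, h0, false_and, false_or, ne_eq, not_false_eq_true, true_and]
    rw [e, e2, comp_inv_ofTail ((isCoreList_word s hκ).matches_app fun _ => hd.matches)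
      (by simpa using hne)]
    constructor
    · rintro ⟨b, h1, rfl, -⟩
      rw [← ofTail_fin_of_ne_nil κ.v₀ (-κ.ε₀ s) hne] at h1
      rw [← ofTail_injective h1]
      rfl
    · rintro rfl
      exact ⟨.fin (invList σ), (ofTail_fin_of_ne_nil _ _ hne).symm, rfl, fun _ => hσ.matches⟩

end Core

lemma startsWith_ofTail_iff {w : V} {δ : ℤˣ} {t : Tail (GPath R Q)} {β : GPath R Q} {x : A}
    {p : List A} (h : t.get? 0 = some β) (hβ : β.1 = x :: p) (μ : List A) :
    StartsWith (ofTail w δ (t.map .dir)) μ ↔ μ = p := by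
  have h1 : (ofTail w δ (t.map .dir)).letter 1 = some (.dir β) := by
    rw [letter_ofTail, if_pos le_rfl, Tail.get?_map]
    simp [h]
  constructor
  · rintro ⟨γ, d, h2, h3⟩
    rw [h1] at h2
    cases h2
    rw [hβ] at h3
    exact (List.cons.inj h3).2.symm
  · rintro rfl
    exact ⟨β, x, h1, hβ⟩

lemma tailRes_nil_iff {s : Letter A → ℤˣ} {w : V} {δ : ℤˣ} {d : Tail A} :
    TailRes (R := R) (Q := Q) s w δ d (.fin []) ↔ WTailMax R Q s w δ d := by
  constructor
  · rintro (⟨h, -⟩ | ⟨k, x, β, -, -, -, h⟩)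
    · exact h
    · exact absurd rfl h.ne_nil
  · exact fun h => Or.inl ⟨h, rfl⟩

/-- A chain records `β` as its first entry, and the tail belonging to `β = xp` is `p⁻¹`. This is
what links the factor `σ` of `⟨bσ⟩` in the definition of `H` to tails of words. -/
lemma wTail_tailRes_iff [Nontrivial R] {s : Letter A → ℤˣ} {w : V} {δ : ℤˣ} {d : Tail A}
    {t : Tail (GPath R Q)} {β : GPath R Q} {x : A} {p : List A} (hβ : β.1 = x :: p)
    (h1 : β.tl = w) (h2 : s (.inv β.first) = δ) (ht : IsArrowChain β t) :
    (WTail R Q s w δ d ∧ TailRes s w δ d t) ↔ d = .fin p.reverse := by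
  have hβ' : β.1 = x :: p.reverse.reverse := by rw [hβ, List.reverse_reverse]
  have hk := (wTail_concat_iff (s := s) hβ').2 ⟨h1, h2⟩
  constructor
  · rintro ⟨-, ⟨-, rfl⟩ | ⟨k, y, γ, rfl, hγ, -, h⟩⟩
    · exact absurd rfl ht.ne_nil
    · obtain rfl : β = γ := Option.some_injective _ (ht.get?_zero.symm.trans h.get?_zero)
      rw [hβ] at hγ
      rw [(List.cons.inj hγ).2, List.reverse_reverse]
  · rintro rfl
    exact ⟨wTail_of_concat hk, Or.inr ⟨_, x, β, rfl, hβ', hk, ht⟩⟩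

namespace Core

/-- The homology word of a string resolution. -/
lemma isHomologyWord_iff [Nontrivial R] {s : Letter A → ℤˣ} (hs : IsSign R Q s) {κ : Core R Q}
    (hκ : κ.Valid) {t u : Tail (GPath R Q)} (ht : ResTail s κ.v₀ (-κ.ε₀ s) t)
    (hu : ResTail s κ.v₁ (κ.ε₁ s) u) (C : Seqn V (Letter A)) :
    IsHomologyWord s (κ.genWord s t u) C ↔ ∃ b d,
      (WTail R Q s κ.v₀ (-κ.ε₀ s) b ∧ TailRes s κ.v₀ (-κ.ε₀ s) b t) ∧
      (WTail R Q s κ.v₁ (κ.ε₁ s) d ∧ TailRes s κ.v₁ (κ.ε₁ s) d u) ∧ C = κ.word s b d := by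
  have hA : ∀ A', IsAltMatch A' (κ.genSeq s) ↔ A' = κ.wordSeq s := by
    intro A'
    rw [isAltMatch_iff (s := s)]
    constructor
    · rintro ⟨κ', rfl, h1⟩
      rw [genSeq_injective h1]
    · rintro rfl
      exact ⟨κ, rfl, rfl⟩
  have h0 : IsHomologyWord s (κ.genWord s t u) C ↔
      ((t = .fin [] ∧ u = .fin [] ∧ IsDownBoth R Q s (κ.wordSeq s) C) ∨
      (t = .fin [] ∧ ∃ μ, StartsWith (ofTail κ.v₁ (κ.ε₁ s) (u.map .dir)) μ ∧
        ∃ X, IsMulInv Q s (κ.wordSeq s) μ X ∧ IsDownLeft R Q s X C) ∨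
      (u = .fin [] ∧ ∃ σ, StartsWith (ofTail κ.v₀ (-κ.ε₀ s) (t.map .dir)) σ ∧
        ∃ X, IsMulLeft Q s σ (κ.wordSeq s) X ∧ IsDownRight R Q s X C) ∨
      (∃ σ μ, StartsWith (ofTail κ.v₀ (-κ.ε₀ s) (t.map .dir)) σ ∧
        StartsWith (ofTail κ.v₁ (κ.ε₁ s) (u.map .dir)) μ ∧
        ∃ X, IsMulInv Q s (κ.wordSeq s) μ X ∧ IsMulLeft Q s σ X C)) := by
    constructor
    · rintro ⟨B, A'', D, hD, A', hA', h⟩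
      obtain ⟨rfl, rfl, rfl⟩ := (isGenDecomp_genWord hs hκ ht hu).1 hD
      obtain rfl := (hA _).1 hA'
      simpa only [isTriv_ofTail, Tail.map_eq_nil] using h
    · intro h
      refine ⟨_, _, _, (isGenDecomp_genWord hs hκ ht hu).2 ⟨rfl, rfl, rfl⟩, _, (hA _).2 rfl, ?_⟩
      simpa only [isTriv_ofTail, Tail.map_eq_nil] using h
  have hnil : ∀ {w δ}, WTail R Q s w δ (.fin []) := fun {w δ} => tailGood_nil w δ
  have hnot : ∀ w δ μ, ¬ StartsWith (R := R) (Q := Q) (ofTail w δ ((Tail.fin []).map .dir)) μ := by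
    rintro w δ μ ⟨γ, d, h, -⟩
    simp [letter_ofTail] at h
  rw [h0]
  -- The four cases of the definition: a trivial part contributes the maximal inverse continuation,
  -- a non-trivial part contributes its first path without the last arrow.
  rcases ht with rfl | ⟨β, hβ1, hβ2, hβ3⟩ <;> rcases hu with rfl | ⟨γ, hγ1, hγ2, hγ3⟩
  · simp only [hnot, tailRes_nil_iff, false_and, exists_false, and_false, or_false, true_and]
    constructor
    · rintro ⟨X, hX, hC⟩
      rw [wordSeq_eq_word] at hX
      obtain ⟨d, hd, hd', rfl⟩ := (isDownRight_iff hs hκ hnil X).1 hX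
      obtain ⟨b, hb, hb', rfl⟩ := (isDownLeft_iff hs hκ hd C).1 hC
      exact ⟨b, d, ⟨hb, hb'⟩, ⟨hd, hd'⟩, rfl⟩
    · rintro ⟨b, d, ⟨hb, hb'⟩, ⟨hd, hd'⟩, rfl⟩
      refine ⟨κ.word s (.fin []) d, ?_, (isDownLeft_iff hs hκ hd _).2 ⟨b, hb, hb', rfl⟩⟩
      rw [wordSeq_eq_word]
      exact (isDownRight_iff hs hκ hnil _).2 ⟨d, hd, hd', rfl⟩
  · obtain ⟨x, p, hp⟩ := List.exists_cons_of_ne_nil γ.ne_nil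
    have hu' := fun d => wTail_tailRes_iff (d := d) hp hγ1 hγ2 hγ3
    obtain ⟨hw, -⟩ := (hu' _).2 rfl
    simp only [hnot, tailRes_nil_iff, hu', startsWith_ofTail_iff hγ3.get?_zero hp, hγ3.ne_nil,
      false_and, and_false, exists_false, false_or, or_false, true_and, exists_eq_left,
      isMulInv_iff hκ hw, isDownLeft_iff hs hκ hw, and_assoc]
    exact exists_congr fun b => ⟨fun ⟨h1, h2, h3⟩ => ⟨_, h1, h2, rfl, h3⟩,
      fun ⟨_, h1, h2, e, h3⟩ => ⟨h1, h2, e ▸ h3⟩⟩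
  · obtain ⟨x, p, hp⟩ := List.exists_cons_of_ne_nil β.ne_nil
    have hu' := fun d => wTail_tailRes_iff (d := d) hp hβ1 hβ2 hβ3
    obtain ⟨hw, -⟩ := (hu' _).2 rfl
    rw [wordSeq_eq_word]
    simp only [hnot, tailRes_nil_iff, hu', startsWith_ofTail_iff hβ3.get?_zero hp, hβ3.ne_nil,
      false_and, and_false, exists_false, false_or, or_false, true_and, exists_eq_left,
      isMulLeft_iff hκ hw hnil, isDownRight_iff hs hκ hw, and_assoc]
    constructor
    · rintro ⟨d, hd, hd', rfl⟩
      exact ⟨_, d, rfl, hd, hd', rfl⟩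
    · rintro ⟨_, d, rfl, hd, hd', rfl⟩
      exact ⟨d, hd, hd', rfl⟩
  · obtain ⟨x, p, hp⟩ := List.exists_cons_of_ne_nil β.ne_nil
    obtain ⟨y, q, hq⟩ := List.exists_cons_of_ne_nil γ.ne_nil
    have hu' := fun d => wTail_tailRes_iff (d := d) hp hβ1 hβ2 hβ3
    have hv' := fun d => wTail_tailRes_iff (d := d) hq hγ1 hγ2 hγ3
    obtain ⟨hw, -⟩ := (hu' _).2 rfl
    obtain ⟨hw', -⟩ := (hv' _).2 rfl
    simp only [hu', hv', startsWith_ofTail_iff hβ3.get?_zero hp, hβ3.ne_nil,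
      startsWith_ofTail_iff hγ3.get?_zero hq, hγ3.ne_nil,
      false_and, false_or]
    constructor
    · rintro ⟨_, _, rfl, rfl, X, h1, h2⟩
      obtain rfl := (isMulInv_iff hκ hw' X).1 h1
      exact ⟨_, _, rfl, rfl, (isMulLeft_iff hκ hw hw' C).1 h2⟩
    · rintro ⟨_, _, rfl, rfl, h⟩
      exact ⟨_, _, rfl, rfl, _, (isMulInv_iff hκ hw' _).2 rfl, (isMulLeft_iff hκ hw hw' C).2 h⟩

end Core

end HomologyWords

/-! ### The mutually inverse bijections -/

section Bijections

variable {V A : Type*} [Fintype V] {R : Type*} [CommRing R] [Nontrivial R] {Q : BoundQuiver V A}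
  {Λ : Type*} [Ring Λ] [Algebra R Λ] {ϑ : PathAlgebra R Q →ₐ[R] Λ}

lemma existsUnique_resolutionWord (hϑ : IsCompleteGentle ϑ) {s : Letter A → ℤˣ}
    (hs : IsSign R Q s) {C : Seqn V (Letter A)} (hC : IsStringWord R Q s C) :
    ∃! F : Seqn V (Letter (GPath R Q)), IsResolutionWord s C F := by
  obtain ⟨κ, b, d, hκ, hb, hd, rfl⟩ := (Core.isStringWord_iff hs).1 hC
  obtain ⟨t, ht, htu⟩ := existsUnique_tailRes hϑ hs (w := κ.v₀) (δ := -κ.ε₀ s) b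
  obtain ⟨u, hu, huu⟩ := existsUnique_tailRes hϑ hs (w := κ.v₁) (δ := κ.ε₁ s) d
  refine ⟨κ.genWord s t u, (Core.isResolutionWord_iff hϑ hs hκ hb hd _).2 ⟨t, u, ht, hu, rfl⟩, ?_⟩
  intro F hF
  obtain ⟨t', u', ht', hu', rfl⟩ := (Core.isResolutionWord_iff hϑ hs hκ hb hd _).1 hF
  rw [htu t' ht', huu u' hu']

lemma existsUnique_homologyWord (hϑ : IsCompleteGentle ϑ) {s : Letter A → ℤˣ}
    (hs : IsSign R Q s) {F : Seqn V (Letter (GPath R Q))} (hF : IsStringRes s F) :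
    ∃! C : Seqn V (Letter A), IsHomologyWord s F C := by
  obtain ⟨κ, t, u, hκ, ht, hu, rfl⟩ := (Core.isStringRes_iff hs).1 hF
  obtain ⟨b, hb, hbu⟩ := existsUnique_wTail hϑ hs ht
  obtain ⟨d, hd, hdu⟩ := existsUnique_wTail hϑ hs hu
  refine ⟨κ.word s b d, (Core.isHomologyWord_iff hs hκ ht hu _).2 ⟨b, d, hb, hd, rfl⟩, ?_⟩
  intro C hC
  obtain ⟨b', d', hb', hd', rfl⟩ := (Core.isHomologyWord_iff hs hκ ht hu _).1 hC
  rw [hbu b' hb', hdu d' hd']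

/-- The map is a choice made by `Classical.epsilon`; unique existence makes it interchangeable with
the relation that defines it. -/
lemma resolutionWord_eq_iff (hϑ : IsCompleteGentle ϑ) {s : Letter A → ℤˣ}
    (hs : IsSign R Q s) {C : Seqn V (Letter A)} (hC : IsStringWord R Q s C)
    {F : Seqn V (Letter (GPath R Q))} : F = resolutionWord R Q s C ↔ IsResolutionWord s C F := by
  have h := existsUnique_resolutionWord hϑ hs hC
  have h1 : IsResolutionWord s C (resolutionWord R Q s C) := Classical.epsilon_spec h.exists
  exact ⟨fun e => e ▸ h1, fun e => h.unique e h1⟩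

lemma homologyWord_eq_iff (hϑ : IsCompleteGentle ϑ) {s : Letter A → ℤˣ}
    (hs : IsSign R Q s) {F : Seqn V (Letter (GPath R Q))} (hF : IsStringRes s F)
    {C : Seqn V (Letter A)} : C = homologyWord s F ↔ IsHomologyWord s F C := by
  have h := existsUnique_homologyWord hϑ hs hF
  have h1 : IsHomologyWord s F (homologyWord s F) := Classical.epsilon_spec h.exists
  exact ⟨fun e => e ▸ h1, fun e => h.unique e h1⟩

/-- A string word and its resolution, in terms of a core and of corresponding tails. -/
lemma exists_core_of_isResolutionWord (hϑ : IsCompleteGentle ϑ) {s : Letter A → ℤˣ}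
    (hs : IsSign R Q s) {C : Seqn V (Letter A)} (hC : IsStringWord R Q s C)
    {F : Seqn V (Letter (GPath R Q))} (h : IsResolutionWord s C F) :
    ∃ (κ : Core R Q) (b d : Tail A) (t u : Tail (GPath R Q)), κ.Valid ∧
      WTail R Q s κ.v₀ (-κ.ε₀ s) b ∧ WTail R Q s κ.v₁ (κ.ε₁ s) d ∧
      TailRes s κ.v₀ (-κ.ε₀ s) b t ∧ TailRes s κ.v₁ (κ.ε₁ s) d u ∧
      C = κ.word s b d ∧ F = κ.genWord s t u := by
  obtain ⟨κ, b, d, hκ, hb, hd, rfl⟩ := (Core.isStringWord_iff hs).1 hC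
  obtain ⟨t, u, ht, hu, rfl⟩ := (Core.isResolutionWord_iff hϑ hs hκ hb hd _).1 h
  exact ⟨κ, b, d, t, u, hκ, hb, hd, ht, hu, rfl, rfl⟩

/-- The two constructions are inverse to each other. -/
lemma isResolutionWord_iff_isHomologyWord (hϑ : IsCompleteGentle ϑ) {s : Letter A → ℤˣ}
    (hs : IsSign R Q s) {C : Seqn V (Letter A)} {F : Seqn V (Letter (GPath R Q))} :
    (IsStringWord R Q s C ∧ IsResolutionWord s C F) ↔ (IsStringRes s F ∧ IsHomologyWord s F C) := by
  constructor
  · rintro ⟨hC, h⟩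
    obtain ⟨κ, b, d, t, u, hκ, hb, hd, ht, hu, rfl, rfl⟩ :=
      exists_core_of_isResolutionWord hϑ hs hC h
    exact ⟨(Core.isStringRes_iff hs).2 ⟨κ, t, u, hκ, ht.resTail, hu.resTail, rfl⟩,
      (Core.isHomologyWord_iff hs hκ ht.resTail hu.resTail _).2 ⟨b, d, ⟨hb, ht⟩, ⟨hd, hu⟩, rfl⟩⟩
  · rintro ⟨hF, h⟩
    obtain ⟨κ, t, u, hκ, ht, hu, rfl⟩ := (Core.isStringRes_iff hs).1 hF
    obtain ⟨b, d, ⟨hb, hb'⟩, ⟨hd, hd'⟩, rfl⟩ := (Core.isHomologyWord_iff hs hκ ht hu _).1 h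
    exact ⟨(Core.isStringWord_iff hs).2 ⟨κ, b, d, hκ, hb, hd, rfl⟩,
      (Core.isResolutionWord_iff hϑ hs hκ hb hd _).2 ⟨t, u, hb', hd', rfl⟩⟩

lemma mapsTo_resolutionWord (hϑ : IsCompleteGentle ϑ) {s : Letter A → ℤˣ} (hs : IsSign R Q s) :
    Set.MapsTo (resolutionWord R Q s) {C | IsStringWord R Q s C} {F | IsStringRes s F} :=
  fun _ hC => ((isResolutionWord_iff_isHomologyWord hϑ hs).1
    ⟨hC, (resolutionWord_eq_iff hϑ hs hC).1 rfl⟩).1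

lemma mapsTo_homologyWord (hϑ : IsCompleteGentle ϑ) {s : Letter A → ℤˣ} (hs : IsSign R Q s) :
    Set.MapsTo (homologyWord s) {F : Seqn V (Letter (GPath R Q)) | IsStringRes s F}
      {C | IsStringWord R Q s C} :=
  fun _ hF => ((isResolutionWord_iff_isHomologyWord hϑ hs).2
    ⟨hF, (homologyWord_eq_iff hϑ hs hF).1 rfl⟩).1

lemma invOn_homologyWord (hϑ : IsCompleteGentle ϑ) {s : Letter A → ℤˣ} (hs : IsSign R Q s) :
    Set.InvOn (homologyWord s) (resolutionWord R Q s) {C | IsStringWord R Q s C}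
      {F | IsStringRes s F} := by
  constructor
  · intro C hC
    have h := (isResolutionWord_iff_isHomologyWord hϑ hs).1
      ⟨hC, (resolutionWord_eq_iff hϑ hs hC).1 rfl⟩
    exact ((homologyWord_eq_iff hϑ hs h.1).2 h.2).symm
  · intro F hF
    have h := (isResolutionWord_iff_isHomologyWord hϑ hs).2
      ⟨hF, (homologyWord_eq_iff hϑ hs hF).1 rfl⟩
    exact ((resolutionWord_eq_iff hϑ hs h.1).2 h.2).symm

end Bijections

/-! ### Truncations, and the interval of a decomposition -/

namespace Seqn

section Parts

variable {V α : Type*} {hd : Letter α → V} {sg : Letter α → ℤˣ}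

lemma letter_endTriv (C : Seqn V (Letter α)) (i : ℤ) : (endTriv hd sg C).letter i = none := by
  unfold endTriv
  rcases C.inv.start hd sg with _ | ⟨v, ε⟩ <;> simp [letter]

lemma idx_endTriv (C : Seqn V (Letter α)) : (endTriv hd sg C).idx = {0} := by
  unfold endTriv
  rcases C.inv.start hd sg with _ | ⟨v, ε⟩ <;> simp [idx]

lemma letter_gt (C : Seqn V (Letter α)) {a : ℤ} (ha : a ∈ C.idx) (i : ℤ) :
    (C.gt hd sg a).letter i = if 1 ≤ i then C.letter (a + i) else none := by
  cases C with
  | triv v ε => simp [gt, letter]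
  | fin l =>
    simp only [idx, Set.mem_Icc] at ha
    simp only [gt]
    split_ifs with h1 _ h2
    · rw [letter_endTriv]
      simp only [letter]
      rw [if_pos (by omega), eq_comm, List.getElem?_eq_none_iff]
      omega
    · rw [letter_endTriv]
    · simp only [letter]
      rw [if_pos h2, if_pos (by omega), List.getElem?_drop]
      congr 1; omega
    · simp only [letter]
      rw [if_neg h2]
  | right t =>
    simp only [idx, Set.mem_Ici] at ha
    simp only [gt, letter]
    split_ifs with h1 h2
    · rw [Stream'.get_drop]
      congr 2; omega
    · omega
    · rfl
  | left t =>
    simp only [idx, Set.mem_Iic] at ha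
    simp only [gt]
    split_ifs with h1 h2 h2
    · rw [letter_endTriv]
      simp only [letter]
      rw [if_neg (by omega)]
    · rw [letter_endTriv]
    · simp only [letter]
      rw [if_pos h2]
      split_ifs with h3
      · rw [List.getElem?_reverse (by simp; omega), Stream'.length_take,
          Stream'.getElem?_take (by omega)]
        congr 2; omega
      · rw [List.getElem?_eq_none_iff]
        simp; omega
    · simp only [letter]
      rw [if_neg h2]
  | bi f =>
    simp only [gt, letter]
    split_ifs with h1
    · change some (f (a + 1 + ((i - 1).toNat : ℤ))) = _
      congr 2; omega
    · rfl

lemma idx_gt (C : Seqn V (Letter α)) {a : ℤ} (ha : a ∈ C.idx) (j : ℤ) :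
    j ∈ (C.gt hd sg a).idx ↔ 0 ≤ j ∧ a + j ∈ C.idx := by
  cases C with
  | triv v ε =>
    simp only [idx, Set.mem_singleton_iff] at ha
    simp only [gt, idx, Set.mem_singleton_iff]
    omega
  | fin l =>
    simp only [idx, Set.mem_Icc] at ha
    simp only [gt]
    split_ifs with h1
    · rw [idx_endTriv]
      simp only [idx, Set.mem_singleton_iff, Set.mem_Icc]
      omega
    · simp only [idx, Set.mem_Icc, List.length_drop]
      omega
  | right t =>
    simp only [idx, Set.mem_Ici] at ha
    simp only [gt, idx, Set.mem_Ici]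
    omega
  | left t =>
    simp only [idx, Set.mem_Iic] at ha
    simp only [gt]
    split_ifs with h1
    · rw [idx_endTriv]
      simp only [idx, Set.mem_singleton_iff, Set.mem_Iic]
      omega
    · simp only [idx, Set.mem_Iic, Set.mem_Icc, List.length_reverse, Stream'.length_take]
      omega
  | bi f => simp [gt, idx]

lemma letter_le_inv (C : Seqn V (Letter α)) {a : ℤ} (ha : a ∈ C.idx) (i : ℤ) :
    (C.le hd sg a).inv.letter i =
      if 1 ≤ i then (C.letter (a + 1 - i)).map Letter.flip else none := by
  cases C with
  | triv v ε => simp [le, gt, letter, inv]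
  | fin l =>
    simp only [idx, Set.mem_Icc] at ha
    simp only [le, inv_inv]
    rw [letter_gt _ (by simp [inv, idx]; omega)]
    by_cases hi : 1 ≤ i
    swap
    · rw [if_neg hi, if_neg hi]
    rw [if_pos hi, if_pos hi]
    simp only [inv, letter]
    rw [if_pos (by omega)]
    split_ifs with h
    · rw [List.getElem?_map, List.getElem?_reverse (by omega)]
      congr 2; omega
    · rw [List.getElem?_map, List.getElem?_eq_none (by simp; omega)]
  | right t =>
    simp only [idx, Set.mem_Ici] at ha
    simp only [le, inv_inv]
    rw [letter_gt _ (by simp [inv, idx]; omega)]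
    by_cases hi : 1 ≤ i
    swap
    · rw [if_neg hi, if_neg hi]
    rw [if_pos hi, if_pos hi]
    simp only [inv, letter]
    split_ifs with h h' h'
    · rw [Stream'.get_map, Option.map_some]
      congr 3; omega
    · omega
    · omega
    · rfl
  | left t =>
    simp only [idx, Set.mem_Iic] at ha
    simp only [le, inv_inv]
    rw [letter_gt _ (by simp [inv, idx]; omega)]
    by_cases hi : 1 ≤ i
    swap
    · rw [if_neg hi, if_neg hi]
    rw [if_pos hi, if_pos hi]
    simp only [inv, letter]
    split_ifs with h h' h'
    · rw [Stream'.get_map, Option.map_some]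
      congr 3; omega
    · omega
    · omega
    · rfl
  | bi f =>
    simp only [le, inv_inv]
    rw [letter_gt _ (by simp [inv, idx])]
    by_cases hi : 1 ≤ i
    swap
    · rw [if_neg hi, if_neg hi]
    rw [if_pos hi, if_pos hi]
    simp only [inv, letter, Option.map_some]
    congr 3; omega

lemma inv_glue (v : V) (ε : ℤˣ) (B E : Tail (Letter α)) :
    (glue v ε B E).inv = glue v (-ε) E B := by
  have h1 : ∀ (v : V) (ε : ℤˣ) (l : List (Letter α)),
      (ofTail v ε (.fin l)).inv = ofTail v (-ε) (.fin (l.reverse.map Letter.flip)) := by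
    intro v ε l
    by_cases hl : l = []
    · subst hl; rfl
    · rw [ofTail_fin_of_ne_nil _ _ hl, ofTail_fin_of_ne_nil _ _ (by simpa using hl)]
      rfl
  have h2 : ∀ l : List (Letter α), (l.map Letter.flip).map Letter.flip = l := fun l => by
    rw [List.map_map]
    exact (List.map_congr_left fun a _ => Letter.flip_flip a).trans (List.map_id l)
  have h3 : ∀ s : Stream' (Letter α), (s.map Letter.flip).map Letter.flip = s := fun s =>
    Stream'.ext fun n => by simp [Stream'.get_map, Letter.flip_flip]
  rcases B with b | b <;> rcases E with e | e
  · simp only [glue, Tail.app_fin, h1, List.reverse_append, List.map_append, List.map_reverse,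
      List.reverse_reverse, h2]
  · simp only [glue, Tail.app, ofTail, inv, Stream'.map_append_stream, List.map_reverse,
      h2]
  · simp only [glue, Tail.app, ofTail, inv, Stream'.map_append_stream, List.map_reverse, h3]
  · simp only [glue, inv, Seqn.bi.injEq]
    funext i
    by_cases h : i ≤ 0
    · rw [if_neg (by omega), if_pos h, Stream'.get_map]
      congr 2; omega
    · rw [if_pos (by omega), if_neg h, Stream'.get_map, Letter.flip_flip]
      congr 1; omega

lemma gt_ofTail_app {v w : V} {ε δ : ℤˣ} {m : List (Letter α)} {t : Tail (Letter α)}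
    (h : t = .fin [] → endTriv hd sg (ofTail v ε (.fin m)) = .triv w δ) :
    (ofTail v ε (.app m t)).gt hd sg m.length = ofTail w δ t := by
  rcases t with (_ | ⟨x, t⟩) | t
  · have h0 := h rfl
    by_cases hm : m = []
    · subst hm
      simpa [ofTail, gt, endTriv, inv, start] using h0
    · rw [Tail.app_fin, List.append_nil, ofTail_fin_of_ne_nil _ _ hm]
      rw [ofTail_fin_of_ne_nil _ _ hm] at h0
      simp only [gt]
      rw [if_pos le_rfl, h0]
      rfl
  · rw [Tail.app_fin, ofTail_fin_of_ne_nil _ _ (by simp), ofTail_fin_of_ne_nil _ _ (by simp)]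
    simp only [gt]
    rw [if_neg (by simp)]
    simp
  · change (Seqn.right _).gt hd sg _ = Seqn.right t
    simp only [gt, Int.toNat_natCast]
    rw [Stream'.drop_append_stream]

lemma gt_glue_app {v w : V} {ε δ : ℤˣ} {B t : Tail (Letter α)} {m : List (Letter α)}
    (h : t = .fin [] → endTriv hd sg (glue v ε B (.fin m)) = .triv w δ) :
    (glue v ε B (.app m t)).gt hd sg (origin B (.app m t) + m.length) = ofTail w δ t := by
  rcases B with b | b
  · simp only [glue, origin_fin, Tail.app_app]
    have := gt_ofTail_app (hd := hd) (sg := sg) (v := v) (ε := ε) (w := w) (δ := δ) (t := t)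
      (m := b.reverse.map Letter.flip ++ m) h
    rw [← this]
    congr 1
    simp
  · rcases t with (_ | ⟨x, t⟩) | t
    · change _ = Seqn.triv w δ
      rw [Tail.app_fin, List.append_nil, origin_inf_fin, ← h rfl]
      simp only [glue, gt]
      rw [if_pos (by omega)]
    · rw [Tail.app_fin, origin_inf_fin, ofTail_fin_of_ne_nil _ _ (by simp)]
      simp only [glue, gt]
      rw [if_neg (by simp; omega)]
      congr 1
      rw [List.reverse_eq_iff]
      simp only [List.reverse_append, Stream'.append_append_stream]
      rw [show (-(-((m ++ x :: t).length : ℤ) + (m.length : ℤ))).toNat = (x :: t).reverse.length by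
        simp only [List.length_append, List.length_reverse, List.length_cons]; omega]
      refine List.ext_getElem? fun n => ?_
      by_cases hn : n < (x :: t).reverse.length
      · rw [Stream'.getElem?_take hn, List.getElem?_eq_getElem hn, Stream'.get_append_left _ _ _ hn]
      · rw [List.getElem?_eq_none (by simpa using hn), List.getElem?_eq_none (by simpa using hn)]
    · change (Seqn.bi _).gt hd sg _ = Seqn.right t
      refine congrArg Seqn.right (Stream'.ext fun n => ?_)
      change (if _ then _ else _) = t.get n
      rw [Tail.app, origin_inf_inf, if_neg (by omega),
        show (0 + (m.length : ℤ) + 1 + (n : ℤ) - 1).toNat = m.length + n by omega,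
        ← Stream'.get_drop, Stream'.drop_append_stream]

/-- A truncation `C_{≤i}` is computed by truncating the inverse on the other side. Inversion
interchanges the two tails (`inv_glue`), so the claim is the case of an empty list in `gt_glue_app`.
-/
lemma le_glue_inv {v : V} {ε : ℤˣ} {B E : Tail (Letter α)} (hE : Matches hd sg v ε E) :
    ((glue v ε B E).le hd sg (origin B E)).inv = ofTail v (-ε) B := by
  have h0 : B = .fin [] → endTriv hd sg (glue v (-ε) E (.fin [])) = .triv v (-ε) := by
    rintro -
    rw [← inv_ofTail_neg_eq_glue, neg_neg, endTriv, inv_inv, start_ofTail hE]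
  have h1 := gt_glue_app (hd := hd) (sg := sg) (m := []) h0
  rw [Tail.app_nil, ← inv_glue] at h1
  rw [← h1]
  -- For a finite list `le` measures the position from the right-hand end, otherwise it negates it.
  -- Both give the origin of the inverse sequence.
  have key : (∃ l, l ≠ [] ∧ glue v ε B E = .fin l ∧ (l.length : ℤ) - origin B E = origin E B) ∨
      ((∀ l, glue v ε B E ≠ .fin l) ∧ -origin B E = origin E B) := by
    rcases B with b | b <;> rcases E with e | e
    · by_cases hn : b.reverse.map Letter.flip ++ e = []
      · refine Or.inr ⟨fun l => ?_, ?_⟩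
        · simp only [glue, Tail.app_fin, hn]
          intro h; cases h
        · simp only [List.append_eq_nil_iff, List.map_eq_nil_iff, List.reverse_eq_nil_iff] at hn
          simp [hn.1, hn.2, origin]
      · refine Or.inl ⟨_, hn, ofTail_fin_of_ne_nil _ _ hn, ?_⟩
        simp [origin]
    · refine Or.inr ⟨fun l h => ?_, rfl⟩
      cases h
    · refine Or.inr ⟨fun l h => ?_, by simp [origin]⟩
      cases h
    · refine Or.inr ⟨fun l h => ?_, by simp [origin]⟩
      cases h
  rcases key with ⟨l, -, h2, h3⟩ | ⟨h2, h3⟩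
  · rw [h2]
    simp only [le, inv_inv, h3, List.length_nil, Nat.cast_zero, add_zero]
  · rw [← h3]
    generalize glue v ε B E = C at h2
    cases C with
    | fin l => exact absurd rfl (h2 l)
    | _ => simp only [le, inv_inv, List.length_nil, Nat.cast_zero, add_zero]

lemma endTriv_glue {l : List (Letter α)} {v w : V} {ε δ : ℤˣ} (h : HasEnds hd sg l v ε w δ)
    {B : Tail (Letter α)} (hB : Matches hd sg v (-ε) B) :
    endTriv hd sg (glue v ε B (.fin l)) = .triv w δ := by
  have h1 : (glue v (-ε) (.fin l) B).start hd sg = some (w, -δ) := by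
    by_cases hl : l = []
    · subst hl
      obtain ⟨rfl, rfl⟩ := h.nil rfl
      rw [glue_nil]
      exact start_ofTail hB
    · have e : glue v (-ε) (.fin l) B = ofTail w (-δ) (.app (l.reverse.map Letter.flip) B) :=
        ofTail_congr (Tail.app_ne_nil (by simpa using hl) _)
      rw [e]
      refine start_ofTail fun a ha => ?_
      rw [Tail.get?_zero_app_of_ne_nil (by simpa using hl), ← List.head?_eq_getElem?,
        List.head?_map, List.head?_reverse] at ha
      obtain ⟨x, hx, rfl⟩ := Option.map_eq_some_iff.1 ha
      exact h.last x hx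
  rw [endTriv, inv_glue, h1]
  simp

/-- The positions at which the parts of `B⁻¹(AD)` begin and end. -/
lemma interval_iff {r : Letter α → Letter α → Prop} {c : α → Letter α} (P : Polarised hd sg r c)
    {l : List (Letter α)} {v w : V} {ε δ : ℤˣ} (hl : IsCoreList hd sg r c l v ε w δ)
    {b d : Tail α} (hb : TailGood hd sg r c v (-ε) b) (hd₀ : TailGood hd sg r c w δ d)
    {C : Seqn V (Letter α)} (hC : C = glue v ε (b.map c) (.app l (d.map c))) {o : ℤ}
    (ho : o = origin (b.map c) (.app l (d.map c))) (i j : ℤ) :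
    (i ∈ C.idx ∧ j ∈ C.idx ∧ i ≤ j ∧ ofTail v (-ε) (b.map c) = (C.le hd sg i).inv ∧
      ofTail v ε (.fin l) = (C.gt hd sg i).le hd sg (j - i) ∧
      ofTail w δ (d.map c) = C.gt hd sg j) ↔ i = o ∧ j = o + l.length := by
  have hm := hl.matches_app (t := d.map c) fun _ => hd₀.matches
  have hidx : ∀ k, k ∈ C.idx ↔ k = o ∨
      (o < k ∧ (Tail.app l (d.map c)).get? (k - o - 1).toNat ≠ none) ∨
      (k < o ∧ (b.map c).get? (o - k - 1).toNat ≠ none) := fun k => by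
    rw [hC, ho]; exact idx_glue _ _ _ _ _
  have hlet : ∀ k, C.letter k = if o < k then (Tail.app l (d.map c)).get? (k - o - 1).toNat
      else ((b.map c).get? (o - k).toNat).map Letter.flip := fun k => by
    rw [hC, ho]; exact letter_glue _ _ _ _ _
  constructor
  · rintro ⟨hi, hj, hij, h1, h2, h3⟩
    -- Otherwise the first letter of `AD`, which is of class `c`, would occur inverted in `B`, all
    -- of whose letters are of class `c`.
    have hio : i ≤ o := by
      by_contra hlt
      have h4 : C.letter (o + 1) ≠ none := by
        rcases (hidx i).1 hi with h | h | h
        · omega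
        · rw [hlet, if_pos (by omega)]
          exact fun h' => h.2 (Tail.get?_eq_none_of_le h' (by omega))
        · omega
      obtain ⟨x, hx⟩ := Option.ne_none_iff_exists'.1 h4
      have h5 : ∃ y, x = c y := by
        rw [hlet, if_pos (by omega), show (o + 1 - o - 1).toNat = 0 by omega] at hx
        by_cases hl0 : l = []
        · subst hl0
          rw [Tail.app_nil, Tail.get?_map] at hx
          obtain ⟨y, -, e⟩ := Option.map_eq_some_iff.1 hx
          exact ⟨y, e.symm⟩
        · rw [Tail.get?_zero_app_of_ne_nil hl0, ← List.head?_eq_getElem?] at hx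
          exact hl.head_eq x hx
      obtain ⟨y, rfl⟩ := h5
      have h6 := congrArg (fun C => C.letter (i - o)) h1
      simp only [letter_ofTail, letter_le_inv C hi] at h6
      rw [if_pos (by omega), if_pos (by omega), show i + 1 - (i - o) = o + 1 by ring, hx,
        Tail.get?_map] at h6
      obtain ⟨z, -, e⟩ := Option.map_eq_some_iff.1 h6
      exact P.flip_ne y z e.symm
    -- Otherwise the letter at `o + l.length` would lie in `D`. It is the inverse of a letter of
    -- class `c`: the last letter of `A`, or of `B⁻¹` if `A` is trivial.
    have hjo : o + l.length ≤ j := by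
      by_contra hlt
      have h4 : ∃ y, C.letter (o + l.length) = some (c y).flip := by
        by_cases hl0 : l = []
        · subst hl0
          have h5 : (b.map c).get? (o - j - 1).toNat ≠ none := by
            rcases (hidx j).1 hj with h | h | h
            · simp at hlt; omega
            · simp at hlt; omega
            · exact h.2
          have h6 : (b.map c).get? 0 ≠ none := fun h' =>
            h5 (Tail.get?_eq_none_of_le h' (by omega))
          rw [Tail.get?_map] at h6
          obtain ⟨x, hx⟩ := Option.ne_none_iff_exists'.1 h6
          obtain ⟨y, hy, rfl⟩ := Option.map_eq_some_iff.1 hx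
          refine ⟨y, ?_⟩
          rw [hlet, if_neg (by simp)]
          simp [hy]
        · have hpos := List.length_pos_of_ne_nil hl0
          obtain ⟨y, hy⟩ := hl.last_eq _ (List.getLast?_eq_some_getLast hl0)
          refine ⟨y, ?_⟩
          rw [hlet, if_pos (by omega), Tail.get?_app, if_pos (by omega), ← hy,
            ← List.getLast?_eq_some_getLast hl0, List.getLast?_eq_getElem?]
          congr 1; omega
      obtain ⟨y, hy⟩ := h4
      have h6 := congrArg (fun C => C.letter (o + l.length - j)) h3
      simp only [letter_ofTail, letter_gt C hj] at h6
      rw [if_pos (by omega), if_pos (by omega), add_sub_cancel, hy, Tail.get?_map] at h6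
      obtain ⟨z, -, e⟩ := Option.map_eq_some_iff.1 h6
      exact P.flip_ne y z e.symm
    -- The middle part has exactly `l.length` letters, so the truncation between `i` and `j` cannot
    -- be longer. With the two preceding bounds this determines both positions.
    have hlen : j - i ≤ l.length := by
      by_contra hlt
      have h4 : C.letter (i + 1) ≠ none := by
        rw [hlet]
        split_ifs with h
        · obtain rfl : i = o := by omega
          rcases (hidx j).1 hj with h | h | h
          · omega
          · exact fun h' => h.2 (Tail.get?_eq_none_of_le h' (by omega))
          · omega
        · rcases (hidx i).1 hi with h | h | h
          · omega
          · omega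
          · rw [show o - (i + 1) = o - i - 1 by ring]
            simpa using h.2
      have h5 := congrArg (fun C => C.inv.letter (j - i)) h2
      have h6 : j - i ∈ (C.gt hd sg i).idx := by
        rw [idx_gt C hi]
        exact ⟨by omega, by rwa [add_sub_cancel]⟩
      simp only [letter_le_inv _ h6] at h5
      rw [if_pos (by omega), letter_gt C hi, if_pos (by omega),
        show i + (j - i + 1 - (j - i)) = i + 1 by ring] at h5
      have h7 : (ofTail v ε (.fin l)).inv = glue v (-ε) (.fin l) (.fin []) := by
        rw [← inv_ofTail_neg_eq_glue, neg_neg]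
      rw [h7, letter_glue, origin_fin, if_pos (by omega)] at h5
      simp only [Tail.get?_fin, List.getElem?_nil] at h5
      obtain ⟨x, hx⟩ := Option.ne_none_iff_exists'.1 h4
      rw [hx] at h5
      cases h5
    omega
  · rintro ⟨rfl, rfl⟩
    have hgt : C.gt hd sg i = ofTail v ε (.app l (d.map c)) := by
      have := gt_glue_app (hd := hd) (sg := sg) (v := v) (ε := ε) (w := v) (δ := ε)
        (B := b.map c) (t := .app l (d.map c)) (m := []) (fun _ =>
          endTriv_glue ⟨fun _ => ⟨rfl, rfl⟩, by simp, by simp⟩ hb.matches)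
      rw [Tail.app_nil] at this
      rw [hC, ho, ← this]
      simp
    refine ⟨(hidx _).2 (Or.inl rfl), ?_, by omega, ?_, ?_, ?_⟩
    · rw [hidx]
      by_cases hl0 : l = []
      · simp [hl0]
      · have hpos := List.length_pos_of_ne_nil hl0
        refine Or.inr (Or.inl ⟨by omega, ?_⟩)
        rw [Tail.get?_app, if_pos (by omega), ne_eq, List.getElem?_eq_none_iff]
        omega
    · rw [hC, ho, le_glue_inv hm]
    · rw [hgt, add_sub_cancel_left]
      have hrr : ∀ l : List (Letter α), (l.reverse.map Letter.flip).reverse.map Letter.flip = l := by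
        intro l
        rw [← List.map_reverse, List.reverse_reverse, List.map_map]
        exact (List.map_congr_left fun a _ => Letter.flip_flip a).trans (List.map_id l)
      have h4 : ∀ t, ofTail v ε (.app l t) = glue w δ (.fin (l.reverse.map Letter.flip)) t := by
        intro t
        rw [glue, hrr]
        by_cases hl0 : l = []
        · subst hl0
          obtain ⟨rfl, rfl⟩ := hl.nil rfl
          rfl
        · exact ofTail_congr (Tail.app_ne_nil hl0 t)
      have h5 := le_glue_inv (hd := hd) (sg := sg) (v := w) (ε := δ)
        (B := .fin (l.reverse.map Letter.flip)) hd₀.matches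
      rw [← h4, inv_eq_iff, inv_ofTail_neg_eq_glue, ← h4, origin_fin] at h5
      simpa using h5.symm
    · rw [hC, ho]
      exact (gt_glue_app fun _ => endTriv_glue hl.toHasEnds hb.matches).symm

end Parts

end Seqn

open Seqn

/-! ### Heights and letters of a string resolution -/

section Heights

variable {V A : Type*} [Fintype V] {R : Type*} [CommRing R] {Q : BoundQuiver V A}

lemma height_add_one (C : Seqn V (Letter (GPath R Q))) (i : ℤ) :
    height C (i + 1) = height C i + letterHeight (C.letter (i + 1)) := by
  -- The height is defined by different sums on the two sides of `0`; the step from `-1` to `0` is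
  -- the one that passes from one formula to the other.
  rcases lt_trichotomy i (-1) with h | rfl | h
  · have e : Finset.Ioc i 0 = insert (i + 1) (Finset.Ioc (i + 1) 0) := by
      ext j; simp only [Finset.mem_Ioc, Finset.mem_insert]; omega
    rw [height, height, if_neg (by omega), if_neg (by omega), e, Finset.sum_insert (by simp)]
    ring
  · have e : Finset.Ioc (-1 : ℤ) 0 = {0} := by
      ext j; simp only [Finset.mem_Ioc, Finset.mem_singleton]; omega
    simp [height, e]
  · have e : Finset.Ioc 0 (i + 1) = insert (i + 1) (Finset.Ioc 0 i) := by
      ext j; simp only [Finset.mem_Ioc, Finset.mem_insert]; omega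
    rw [height, height, if_pos (by omega), if_pos (by omega), e, Finset.sum_insert (by simp)]
    ring

lemma galtList_getElem?_even (ps : List (GPath R Q × GPath R Q)) (k : ℕ) :
    (galtList ps)[2 * k]? = ps[k]?.map fun p => Letter.dir p.1 := by
  induction ps generalizing k with
  | nil => simp [galtList]
  | cons p ps ih =>
    rw [galtList_cons]
    rcases k with _ | k
    · rfl
    · rw [show 2 * (k + 1) = 2 * k + 1 + 1 by ring]
      simpa using ih k

lemma galtList_getElem?_odd (ps : List (GPath R Q × GPath R Q)) (k : ℕ) :
    (galtList ps)[2 * k + 1]? = ps[k]?.map fun p => Letter.inv p.2 := by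
  induction ps generalizing k with
  | nil => simp [galtList]
  | cons p ps ih =>
    rw [galtList_cons]
    rcases k with _ | k
    · rfl
    · rw [show 2 * (k + 1) + 1 = 2 * k + 1 + 1 + 1 by ring]
      simpa using ih k

lemma length_galtList (ps : List (GPath R Q × GPath R Q)) :
    (galtList ps).length = 2 * ps.length := by
  induction ps with
  | nil => rfl
  | cons p ps ih =>
    rw [galtList_cons]
    simp only [List.length_cons, ih]
    ring

namespace Core

/-- The position at which the core starts in `ℬ⁻¹(𝒜𝒟)`. -/
def genOrigin (κ : Core R Q) (t u : Tail (GPath R Q)) : ℤ :=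
  origin (t.map Letter.dir) (.app (galtList κ.pairs) (u.map Letter.dir))

variable (s : Letter A → ℤˣ) (κ : Core R Q) (t u : Tail (GPath R Q))

lemma letter_genWord_left (j : ℕ) :
    (κ.genWord s t u).letter (κ.genOrigin t u - j) = (t.get? j).map .inv := by
  rw [genWord, letter_glue, ← genOrigin, if_neg (by omega), Tail.get?_map, Option.map_map,
    show (κ.genOrigin t u - (κ.genOrigin t u - j)).toNat = j by omega]
  rfl

lemma letter_genWord_right (j : ℕ) :
    (κ.genWord s t u).letter (κ.genOrigin t u + 2 * κ.pairs.length + 1 + j) =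
      (u.get? j).map .dir := by
  rw [genWord, letter_glue, ← genOrigin, if_pos (by omega), Tail.get?_app, length_galtList,
    if_neg (by omega), Tail.get?_map]
  congr 2; omega

lemma letter_genWord_odd {k : ℕ} (hk : k < κ.pairs.length) :
    (κ.genWord s t u).letter (κ.genOrigin t u + 2 * k + 1) = some (.dir κ.pairs[k].1) := by
  rw [genWord, letter_glue, ← genOrigin, if_pos (by omega), Tail.get?_app, length_galtList,
    if_pos (by omega),
    show (κ.genOrigin t u + 2 * k + 1 - κ.genOrigin t u - 1).toNat = 2 * k by omega,
    galtList_getElem?_even, List.getElem?_eq_getElem hk]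
  rfl

lemma letter_genWord_even {k : ℕ} (hk : k < κ.pairs.length) :
    (κ.genWord s t u).letter (κ.genOrigin t u + 2 * k + 2) = some (.inv κ.pairs[k].2) := by
  rw [genWord, letter_glue, ← genOrigin, if_pos (by omega), Tail.get?_app, length_galtList,
    if_pos (by omega),
    show (κ.genOrigin t u + 2 * k + 2 - κ.genOrigin t u - 1).toNat = 2 * k + 1 by omega,
    galtList_getElem?_odd, List.getElem?_eq_getElem hk]
  rfl

/-- The positions of `ℬ⁻¹(𝒜𝒟)`. -/
lemma mem_idx_genWord {i : ℤ} (hi : i ∈ (κ.genWord s t u).idx) :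
    (∃ k : ℕ, k ≤ κ.pairs.length ∧ i = κ.genOrigin t u + 2 * k) ∨
    (∃ k : ℕ, k < κ.pairs.length ∧ i = κ.genOrigin t u + 2 * k + 1) ∨
    (∃ j : ℕ, u.get? j ≠ none ∧ i = κ.genOrigin t u + 2 * κ.pairs.length + 1 + j) ∨
    (∃ j : ℕ, t.get? j ≠ none ∧ i = κ.genOrigin t u - 1 - j) := by
  rw [genWord, idx_glue, ← genOrigin] at hi
  rcases hi with rfl | ⟨h1, h2⟩ | ⟨h1, h2⟩
  · exact Or.inl ⟨0, Nat.zero_le _, by simp⟩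
  · obtain ⟨m, hm⟩ := Int.eq_ofNat_of_zero_le (a := i - κ.genOrigin t u - 1) (by omega)
    by_cases h3 : m < 2 * κ.pairs.length
    · rcases Nat.even_or_odd' m with ⟨k, rfl | rfl⟩
      · exact Or.inr (Or.inl ⟨k, by omega, by omega⟩)
      · exact Or.inl ⟨k + 1, by omega, by push_cast at hm ⊢; omega⟩
    · refine Or.inr (Or.inr (Or.inl ⟨m - 2 * κ.pairs.length, ?_, by omega⟩))
      rw [Tail.get?_app, length_galtList, if_neg (by omega), hm, Tail.get?_map] at h2
      simpa using h2
  · refine Or.inr (Or.inr (Or.inr ⟨(κ.genOrigin t u - i - 1).toNat, ?_, by omega⟩))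
    rw [Tail.get?_map] at h2
    simpa using h2

/-- Each letter `⟨γ⟩` of the core lowers the height by one and the following `⟨σ⟩⁻¹` restores it. -/
lemma height_genWord_even {k : ℕ} (hk : k ≤ κ.pairs.length) :
    height (κ.genWord s t u) (κ.genOrigin t u + 2 * k) =
      height (κ.genWord s t u) (κ.genOrigin t u) := by
  induction k with
  | zero => simp
  | succ k ih =>
    have h1 := height_add_one (κ.genWord s t u) (κ.genOrigin t u + 2 * k + 1)
    have h2 := height_add_one (κ.genWord s t u) (κ.genOrigin t u + 2 * k)
    rw [letter_genWord_odd s κ t u (by omega), ih (by omega)] at h2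
    rw [h2, add_assoc _ (1 : ℤ) 1, show (1 : ℤ) + 1 = 2 by rfl,
      letter_genWord_even s κ t u (by omega)] at h1
    push_cast
    rw [mul_add, mul_one, ← add_assoc, h1]
    simp [letterHeight]

lemma height_genWord_odd {k : ℕ} (hk : k < κ.pairs.length) :
    height (κ.genWord s t u) (κ.genOrigin t u + 2 * k + 1) =
      height (κ.genWord s t u) (κ.genOrigin t u) - 1 := by
  rw [height_add_one, letter_genWord_odd s κ t u hk, height_genWord_even s κ t u hk.le]
  rfl

/-- The letters of `𝒟` are direct, so each of them lowers the height. On the left the letters of `ℬ`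
occur inverted but are passed in the opposite direction, so the height decreases away from the core
on both sides. -/
lemma height_genWord_right {j : ℕ} (hj : u.get? j ≠ none) :
    height (κ.genWord s t u) (κ.genOrigin t u + 2 * κ.pairs.length + 1 + j) =
      height (κ.genWord s t u) (κ.genOrigin t u) - 1 - j := by
  induction j with
  | zero =>
    obtain ⟨x, hx⟩ := Option.ne_none_iff_exists'.1 hj
    have h := letter_genWord_right s κ t u 0
    rw [hx] at h
    simp only [Nat.cast_zero, add_zero] at h ⊢
    rw [height_add_one, h, height_genWord_even s κ t u le_rfl]
    simp only [letterHeight, Option.map_some]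
    ring
  | succ j ih =>
    obtain ⟨x, hx⟩ := Option.ne_none_iff_exists'.1 hj
    have h := letter_genWord_right s κ t u (j + 1)
    rw [hx] at h
    push_cast at h ⊢
    rw [← add_assoc] at h ⊢
    rw [height_add_one, h, ih fun h' => hj (Tail.get?_succ_eq_none h')]
    simp only [letterHeight, Option.map_some]
    ring

lemma height_genWord_left {j : ℕ} (hj : t.get? j ≠ none) :
    height (κ.genWord s t u) (κ.genOrigin t u - 1 - j) =
      height (κ.genWord s t u) (κ.genOrigin t u) - 1 - j := by
  induction j with
  | zero =>
    obtain ⟨x, hx⟩ := Option.ne_none_iff_exists'.1 hj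
    have h := letter_genWord_left s κ t u 0
    have h1 := height_add_one (κ.genWord s t u) (κ.genOrigin t u - 1)
    rw [hx] at h
    simp only [Nat.cast_zero, sub_zero] at h ⊢
    rw [sub_add_cancel, h] at h1
    rw [h1]
    simp [letterHeight]
  | succ j ih =>
    obtain ⟨x, hx⟩ := Option.ne_none_iff_exists'.1 hj
    have h := letter_genWord_left s κ t u (j + 1)
    have h1 := height_add_one (κ.genWord s t u) (κ.genOrigin t u - 1 - (j + 1 : ℕ))
    rw [hx] at h
    rw [show κ.genOrigin t u - 1 - ((j + 1 : ℕ) : ℤ) + 1 = κ.genOrigin t u - (j + 1 : ℕ) by ring,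
      h, show κ.genOrigin t u - ((j + 1 : ℕ) : ℤ) = κ.genOrigin t u - 1 - j by push_cast; ring,
      ih fun h' => hj (Tail.get?_succ_eq_none h')] at h1
    simp only [letterHeight, Option.map_some] at h1
    push_cast at h1 ⊢
    linarith

lemma height_genWord_le {i : ℤ} (hi : i ∈ (κ.genWord s t u).idx) :
    height (κ.genWord s t u) i ≤ height (κ.genWord s t u) (κ.genOrigin t u) := by
  rcases mem_idx_genWord s κ t u hi with ⟨k, hk, rfl⟩ | ⟨k, hk, rfl⟩ | ⟨j, hj, rfl⟩ | ⟨j, hj, rfl⟩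
  · rw [height_genWord_even s κ t u hk]
  · rw [height_genWord_odd s κ t u hk]; omega
  · rw [height_genWord_right s κ t u hj]; omega
  · rw [height_genWord_left s κ t u hj]; omega

lemma height_genWord_eq {i : ℤ} (hi : i ∈ (κ.genWord s t u).idx)
    (h : height (κ.genWord s t u) i = height (κ.genWord s t u) (κ.genOrigin t u)) :
    ∃ k : ℕ, k ≤ κ.pairs.length ∧ i = κ.genOrigin t u + 2 * k := by
  rcases mem_idx_genWord s κ t u hi with ⟨k, hk, rfl⟩ | ⟨k, hk, rfl⟩ | ⟨j, hj, rfl⟩ | ⟨j, hj, rfl⟩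
  · exact ⟨k, hk, rfl⟩
  · rw [height_genWord_odd s κ t u hk] at h; omega
  · rw [height_genWord_right s κ t u hj] at h; omega
  · rw [height_genWord_left s κ t u hj] at h; omega

lemma mem_idx_genWord_even {k : ℕ} (hk : k ≤ κ.pairs.length) :
    κ.genOrigin t u + 2 * k ∈ (κ.genWord s t u).idx := by
  rw [genWord, idx_glue, ← genOrigin]
  rcases Nat.eq_zero_or_pos k with rfl | h
  · simp
  · refine Or.inr (Or.inl ⟨by omega, ?_⟩)
    rw [Tail.get?_app, length_galtList, if_pos (by omega), ne_eq, List.getElem?_eq_none_iff,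
      length_galtList]
    omega

variable {s t u}

lemma isArrowChain_of_resTail {w : V} {δ : ℤˣ} (ht : ResTail s w δ t) {j : ℕ} {η : GPath R Q}
    (hη : t.get? j = some η) :
    (∀ σ, t.get? (j + 1) = some σ → ArrStep η σ) ∧
      (t.get? (j + 1) = none → ∀ σ, ¬ ArrStep η σ) := by
  rcases ht with rfl | ⟨β, -, -, h⟩
  · simp at hη
  · exact ⟨fun σ hσ => h.1.2 j η σ hη hσ, fun h' σ => h.2.not_of_succ h.1 hη h' σ⟩

/-- The neighbourhood of a position of less than maximal height. -/
lemma letters_of_height_lt (ht : ResTail s κ.v₀ (-κ.ε₀ s) t)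
    (hu : ResTail s κ.v₁ (κ.ε₁ s) u) {i : ℤ} (hi : i ∈ (κ.genWord s t u).idx)
    (h : height (κ.genWord s t u) i < height (κ.genWord s t u) (κ.genOrigin t u)) :
    (∃ γ σ : GPath R Q, (κ.genWord s t u).letter i = some (.dir γ) ∧
      (κ.genWord s t u).letter (i + 1) = some (.inv σ)) ∨
    (∃ η : GPath R Q, (κ.genWord s t u).letter i = some (.dir η) ∧
      (∀ μ, (κ.genWord s t u).letter (i + 1 + 1) ≠ some (.inv μ)) ∧
      ∀ σ, ArrStep η σ → ∃ σ', ArrStep η σ' ∧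
        (κ.genWord s t u).letter (i + 1) = some (.dir σ')) ∨
    (∃ η : GPath R Q, (κ.genWord s t u).letter (i + 1) = some (.inv η) ∧
      (∀ μ, (κ.genWord s t u).letter (i - 1) ≠ some (.dir μ)) ∧
      ∀ σ, ArrStep η σ → ∃ σ', ArrStep η σ' ∧ (κ.genWord s t u).letter i = some (.inv σ')) := by
  rcases mem_idx_genWord s κ t u hi with ⟨k, hk, rfl⟩ | ⟨k, hk, rfl⟩ | ⟨j, hj, rfl⟩ | ⟨j, hj, rfl⟩
  · rw [height_genWord_even s κ t u hk] at h
    omega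
  · exact Or.inl ⟨_, _, letter_genWord_odd s κ t u hk, by
      rw [add_assoc]; exact letter_genWord_even s κ t u hk⟩
  · obtain ⟨η, hη⟩ := Option.ne_none_iff_exists'.1 hj
    have h1 := letter_genWord_right s κ t u (j + 1)
    have h2 := letter_genWord_right s κ t u (j + 1 + 1)
    push_cast at h1 h2
    simp only [← add_assoc] at h1 h2
    refine Or.inr (Or.inl ⟨η, by rw [letter_genWord_right, hη]; rfl, fun μ hμ => ?_,
      fun σ hσ => ?_⟩)
    · rw [h2] at hμ
      obtain ⟨x, -, e⟩ := Option.map_eq_some_iff.1 hμ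
      cases e
    · obtain ⟨h3, h4⟩ := isArrowChain_of_resTail hu hη
      -- Maximality of the chain enters here: the tail stops only where no arrow annihilates `η`
      -- from the left.
      rcases h5 : u.get? (j + 1) with _ | σ'
      · exact absurd hσ (h4 h5 σ)
      · exact ⟨σ', h3 σ' h5, by rw [h1, h5]; rfl⟩
  · obtain ⟨η, hη⟩ := Option.ne_none_iff_exists'.1 hj
    have h0 := letter_genWord_left s κ t u j
    have h1 := letter_genWord_left s κ t u (j + 1)
    have h2 := letter_genWord_left s κ t u (j + 1 + 1)
    rw [show κ.genOrigin t u - ((j + 1 : ℕ) : ℤ) = κ.genOrigin t u - 1 - j by push_cast; ring] at h1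
    rw [show κ.genOrigin t u - ((j + 1 + 1 : ℕ) : ℤ) = κ.genOrigin t u - 1 - j - 1 by
      push_cast; ring] at h2
    refine Or.inr (Or.inr ⟨η, ?_, fun μ hμ => ?_, fun σ hσ => ?_⟩)
    · rw [show κ.genOrigin t u - 1 - (j : ℤ) + 1 = κ.genOrigin t u - j by ring, h0, hη]
      rfl
    · rw [h2] at hμ
      obtain ⟨x, -, e⟩ := Option.map_eq_some_iff.1 hμ
      cases e
    · obtain ⟨h3, h4⟩ := isArrowChain_of_resTail ht hη
      rcases h5 : t.get? (j + 1) with _ | σ'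
      · exact absurd hσ (h4 h5 σ)
      · exact ⟨σ', h3 σ' h5, by rw [h1, h5]; rfl⟩

/-- The interval of a string resolution. -/
lemma isInterval_genWord (hs : IsSign R Q s) (hκ : κ.Valid) (ht : ResTail s κ.v₀ (-κ.ε₀ s) t)
    (hu : ResTail s κ.v₁ (κ.ε₁ s) u) (i j : ℤ) :
    IsInterval s (κ.genWord s t u) i j ↔
      i = κ.genOrigin t u ∧ j = κ.genOrigin t u + 2 * κ.pairs.length := by
  have h := interval_iff (gen_polarised hs) (isCoreList_gen s hκ) ht.gTail hu.gTail
    (C := κ.genWord s t u) rfl (o := κ.genOrigin t u) rfl i j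
  rw [length_galtList] at h
  push_cast at h
  rw [← h]
  constructor
  · rintro ⟨B, A', D, hD, h1, h2, h3, h4, h5, h6⟩
    obtain ⟨rfl, rfl, rfl⟩ := (isGenDecomp_genWord hs hκ ht hu).1 hD
    exact ⟨h1, h2, h3, h4, h5, h6⟩
  · rintro ⟨h1, h2, h3, h4, h5, h6⟩
    exact ⟨_, _, _, (isGenDecomp_genWord hs hκ ht hu).2 ⟨rfl, rfl, rfl⟩, h1, h2, h3, h4, h5, h6⟩

end Core

end Heights

/-! ### Cycles and boundaries in string complexes -/

section Complex

open DirectSum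

variable {V A : Type*} [Fintype V] {R : Type*} [CommRing R] {Q : BoundQuiver V A}
  {Λ : Type*} [Ring Λ] [Algebra R Λ] {ϑ : PathAlgebra R Q →ₐ[R] Λ}
  {C : Seqn V (Letter (GPath R Q))}

lemma Seqn.mem_idx_of_letter {α : Type*} {C : Seqn V (Letter α)} {i : ℤ} {l : Letter α}
    (h : C.letter i = some l) : i - 1 ∈ C.idx ∧ i ∈ C.idx := by
  cases C with
  | triv v ε => simp [Seqn.letter] at h
  | fin k =>
    simp only [Seqn.letter] at h
    split_ifs at h with h1
    obtain ⟨h2, -⟩ := List.getElem?_eq_some_iff.1 h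
    simp only [Seqn.idx, Set.mem_Icc]
    omega
  | right t =>
    simp only [Seqn.letter] at h
    split_ifs at h with h1
    simp only [Seqn.idx, Set.mem_Ici]
    omega
  | left t =>
    simp only [Seqn.letter] at h
    split_ifs at h with h1
    simp only [Seqn.idx, Set.mem_Iic]
    omega
  | bi f => simp [Seqn.idx]

variable (ϑ) in
/-- The element `a g_{C,i}` in degree `n`. -/
noncomputable def pSingle (C : Seqn V (Letter (GPath R Q))) (n i : ℤ)
    (h : i ∈ C.idx ∧ height C i = n) (a : projMod ϑ (C.vtx ghead i)) : StringP ϑ C n :=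
  DirectSum.lof Λ {i : ℤ // i ∈ C.idx ∧ height C i = n}
    (fun i => projMod ϑ (C.vtx ghead i.1)) ⟨i, h⟩ a

variable (ϑ) in
open Classical in
/-- The coefficient of `g_{C,i}` in degree `n`. -/
noncomputable def pCoord (C : Seqn V (Letter (GPath R Q))) (n i : ℤ) : StringP ϑ C n →ₗ[Λ] Λ :=
  if h : i ∈ C.idx ∧ height C i = n then
    (Submodule.subtype _).comp (DirectSum.component Λ {i : ℤ // i ∈ C.idx ∧ height C i = n}
      (fun i => projMod ϑ (C.vtx ghead i.1)) ⟨i, h⟩)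
  else 0

lemma pGen_eq {n i : ℤ} (h : i ∈ C.idx ∧ height C i = n) :
    pGen ϑ C n i = pSingle ϑ C n i h ⟨idemp ϑ (C.vtx ghead i),
      Submodule.mem_span_singleton_self _⟩ := by
  rw [pGen, dif_pos h]
  rfl

lemma smul_pSingle {n i : ℤ} (h : i ∈ C.idx ∧ height C i = n) (c : Λ)
    (a : projMod ϑ (C.vtx ghead i)) : c • pSingle ϑ C n i h a = pSingle ϑ C n i h (c • a) :=
  (map_smul _ c a).symm

lemma pDiff_pSingle {n i : ℤ} (h : i ∈ C.idx ∧ height C i = n)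
    (a : projMod ϑ (C.vtx ghead i)) :
    pDiff ϑ C n (pSingle ϑ C n i h a) = (a : Λ) • (pMinus ϑ C n i + pPlus ϑ C n i) := by
  rw [pDiff, pSingle]
  erw [DirectSum.toModule_lof]
  simp

lemma pCoord_pSingle {n i : ℤ} (h : i ∈ C.idx ∧ height C i = n)
    (a : projMod ϑ (C.vtx ghead i)) (j : ℤ) :
    pCoord ϑ C n j (pSingle ϑ C n i h a) = if i = j then (a : Λ) else 0 := by
  by_cases hj : j ∈ C.idx ∧ height C j = n
  · rw [pCoord, dif_pos hj, pSingle]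
    split_ifs with e
    · subst e
      rw [LinearMap.comp_apply, DirectSum.component.lof_self]
      rfl
    · rw [LinearMap.comp_apply, DirectSum.component.of, dif_neg (by simpa using e)]
      rfl
  · rw [pCoord, dif_neg hj, if_neg]
    · rfl
    · rintro rfl
      exact hj h

lemma pCoord_pGen {n j : ℤ} (h : j ∈ C.idx ∧ height C j = n) (i : ℤ) :
    pCoord ϑ C n j (pGen ϑ C n i) = if i = j then idemp ϑ (C.vtx ghead j) else 0 := by
  by_cases hi : i ∈ C.idx ∧ height C i = n
  · rw [pGen_eq hi, pCoord_pSingle]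
    by_cases e : i = j
    · subst e; rw [if_pos rfl]
    · rw [if_neg e, if_neg e]
  · rw [pGen, dif_neg hi, map_zero, if_neg]
    rintro rfl
    exact hi h

lemma pCoord_mem (n i : ℤ) (z : StringP ϑ C n) : pCoord ϑ C n i z ∈ projMod ϑ (C.vtx ghead i) := by
  rw [pCoord]
  split_ifs with h
  · rw [LinearMap.comp_apply]
    exact Subtype.property _
  · exact zero_mem _

/-- An element of a direct sum is the sum of its components. The exactness proof can therefore
produce a preimage for each component separately. -/
lemma sum_pSingle {n : ℤ} (S : Submodule Λ (StringP ϑ C n)) (z : StringP ϑ C n)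
    (h : ∀ i (hi : i ∈ C.idx ∧ height C i = n),
      pSingle ϑ C n i hi ⟨pCoord ϑ C n i z, pCoord_mem n i z⟩ ∈ S) : z ∈ S := by
  have : ∀ (i : {i : ℤ // i ∈ C.idx ∧ height C i = n}) (x : projMod ϑ (C.vtx ghead i.1)),
    Decidable (x ≠ 0) := fun _ _ => Classical.dec _
  rw [← DirectSum.sum_support_of z]
  refine Submodule.sum_mem _ fun i _ => ?_
  have h1 := h i.1 i.2
  have e : (⟨pCoord ϑ C n i.1 z, pCoord_mem n i.1 z⟩ : projMod ϑ (C.vtx ghead i.1)) = z i := by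
    refine Subtype.ext ?_
    change pCoord ϑ C n i.1 z = (z i : Λ)
    rw [pCoord, dif_pos i.2]
    rfl
  rw [e] at h1
  exact h1

/-- The contribution of `g_{C,j-1}` to the coefficient of `g_{C,j}`. -/
noncomputable def plusPart (C : Seqn V (Letter (GPath R Q))) (n j : ℤ) (z : StringP ϑ C n) : Λ :=
  match C.letter j with
  | some (.inv μ) => pCoord ϑ C n (j - 1) z * pathVal ϑ μ.1
  | _ => 0

/-- The contribution of `g_{C,j+1}` to the coefficient of `g_{C,j}`. -/
noncomputable def minusPart (C : Seqn V (Letter (GPath R Q))) (n j : ℤ) (z : StringP ϑ C n) : Λ :=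
  match C.letter (j + 1) with
  | some (.dir η) => pCoord ϑ C n (j + 1) z * pathVal ϑ η.1
  | _ => 0

lemma plusPart_add (n j : ℤ) (z z' : StringP ϑ C n) :
    plusPart C n j (z + z') = plusPart C n j z + plusPart C n j z' := by
  unfold plusPart
  split <;> simp [add_mul]

lemma minusPart_add (n j : ℤ) (z z' : StringP ϑ C n) :
    minusPart C n j (z + z') = minusPart C n j z + minusPart C n j z' := by
  unfold minusPart
  split <;> simp [add_mul]

lemma plusPart_zero (n j : ℤ) : plusPart C n j (0 : StringP ϑ C n) = 0 := by
  unfold plusPart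
  split <;> simp

lemma minusPart_zero (n j : ℤ) : minusPart C n j (0 : StringP ϑ C n) = 0 := by
  unfold minusPart
  split <;> simp

lemma pCoord_pPlus {n j : ℤ} (hj : j ∈ C.idx ∧ height C j = n + 1) {i : ℤ}
    (hi : i ∈ C.idx ∧ height C i = n) (a : projMod ϑ (C.vtx ghead i)) :
    (a : Λ) * pCoord ϑ C (n + 1) j (pPlus ϑ C n i) = plusPart C n j (pSingle ϑ C n i hi a) := by
  unfold pPlus plusPart
  by_cases h : i + 1 = j
  · subst h
    rcases hl : C.letter (i + 1) with _ | μ | μ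
    · simp
    · simp
    · simp only [map_smul, smul_eq_mul, pCoord_pGen hj, pCoord_pSingle, add_sub_cancel_right,
        if_true]
      rw [vtx_of_letter C _ _ hl]
      exact congrArg _ (pathVal_mul_idemp μ)
  · have e1 : ∀ μ : GPath R Q, pCoord ϑ C (n + 1) j (pathVal ϑ μ.1 • pGen ϑ C (n + 1) (i + 1)) = 0 := by
      intro μ
      rw [map_smul, pCoord_pGen hj, if_neg h, smul_zero]
    have e2 : pCoord ϑ C n (j - 1) (pSingle ϑ C n i hi a) = 0 := by
      rw [pCoord_pSingle, if_neg (by omega)]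
    rw [e2]
    rcases C.letter (i + 1) with _ | μ | μ <;> rcases C.letter j with _ | η | η <;> simp [e1]

lemma pCoord_pMinus (hC : IsGenWord C) {n j : ℤ} (hj : j ∈ C.idx ∧ height C j = n + 1) {i : ℤ}
    (hi : i ∈ C.idx ∧ height C i = n) (a : projMod ϑ (C.vtx ghead i)) :
    (a : Λ) * pCoord ϑ C (n + 1) j (pMinus ϑ C n i) = minusPart C n j (pSingle ϑ C n i hi a) := by
  unfold pMinus minusPart
  by_cases h : i - 1 = j
  · obtain rfl : i = j + 1 := by omega
    rcases hl : C.letter (j + 1) with _ | μ | μ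
    · simp
    · simp only [map_smul, smul_eq_mul, pCoord_pGen hj, pCoord_pSingle, add_sub_cancel_right,
        if_true]
      rw [vtx_of_letter_succ C hC _ _ hl]
      exact congrArg _ (pathVal_mul_idemp μ)
    · simp
  · have e1 : ∀ μ : GPath R Q, pCoord ϑ C (n + 1) j (pathVal ϑ μ.1 • pGen ϑ C (n + 1) (i - 1)) = 0 := by
      intro μ
      rw [map_smul, pCoord_pGen hj, if_neg h, smul_zero]
    have e2 : pCoord ϑ C n (j + 1) (pSingle ϑ C n i hi a) = 0 := by
      rw [pCoord_pSingle, if_neg (by omega)]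
    rw [e2]
    rcases C.letter i with _ | μ | μ <;> rcases C.letter (j + 1) with _ | η | η <;> simp [e1]

/-- The coefficients of the differential. -/
lemma pCoord_pDiff (hC : IsGenWord C) {n j : ℤ} (hj : j ∈ C.idx ∧ height C j = n + 1)
    (z : StringP ϑ C n) :
    pCoord ϑ C (n + 1) j (pDiff ϑ C n z) = minusPart C n j z + plusPart C n j z := by
  induction z using DirectSum.induction_on with
  | zero => rw [map_zero, map_zero, plusPart_zero, minusPart_zero, add_zero]
  | of i a =>
    have h := pDiff_pSingle i.2 a
    have e : DirectSum.of (fun i : {i : ℤ // i ∈ C.idx ∧ height C i = n} =>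
      projMod ϑ (C.vtx ghead i.1)) i a = pSingle ϑ C n i.1 i.2 a := rfl
    rw [e, h, map_smul, map_add, smul_add, ← pCoord_pPlus hj, ← pCoord_pMinus hC hj]
    rfl
  | add x y hx hy => rw [map_add, map_add, hx, hy, plusPart_add, minusPart_add]; abel

section Kernel

variable [IsNoetherianRing R] [IsLocalRing R]

/-- The coefficients of a cycle are annihilated by the adjacent paths. -/
lemma pCoord_mul_inv_eq_zero (hϑ : IsCompleteGentle ϑ) (hC : IsGenWord C) {n i : ℤ}
    (hi : height C i = n) {z : StringP ϑ C n} (hz : pDiff ϑ C n z = 0) {μ : GPath R Q}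
    (hμ : C.letter (i + 1) = some (.inv μ)) : pCoord ϑ C n i z * pathVal ϑ μ.1 = 0 := by
  have hj : i + 1 ∈ C.idx ∧ height C (i + 1) = n + 1 := by
    refine ⟨(Seqn.mem_idx_of_letter hμ).2, ?_⟩
    rw [height_add_one, hμ, hi]
    rfl
  have h := pCoord_pDiff hC hj z
  have e : plusPart C n (i + 1) z = pCoord ϑ C n i z * pathVal ϑ μ.1 := by
    simp only [plusPart, hμ, add_sub_cancel_right]
  rw [hz, map_zero, e] at h
  -- A second summand in the coefficient of `g_{i+1}` arises only if a direct letter follows. Then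
  -- the first arrows of the two paths differ and the summands lie in left ideals that meet in zero,
  -- so each of them vanishes.
  rcases hl : C.letter (i + 1 + 1) with _ | η | η
  · simpa [minusPart, hl] using h.symm
  · have hadj : μ.tl = η.tl ∧ μ.first ≠ η.first := hC.adj _ _ _ hμ hl
    simp only [minusPart, hl] at h
    exact (mul_pathVal_eq_zero_of_add hϑ η μ hadj.2.symm _ _ h.symm).2
  · simpa [minusPart, hl] using h.symm

lemma pCoord_mul_dir_eq_zero (hϑ : IsCompleteGentle ϑ) (hC : IsGenWord C) {n i : ℤ}
    (hi : height C i = n) {z : StringP ϑ C n} (hz : pDiff ϑ C n z = 0) {η : GPath R Q}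
    (hη : C.letter i = some (.dir η)) : pCoord ϑ C n i z * pathVal ϑ η.1 = 0 := by
  obtain ⟨j, rfl⟩ : ∃ j, i = j + 1 := ⟨i - 1, by ring⟩
  have hj : j ∈ C.idx ∧ height C j = n + 1 := by
    refine ⟨by simpa using (Seqn.mem_idx_of_letter hη).1, ?_⟩
    rw [height_add_one, hη] at hi
    simp only [letterHeight] at hi
    omega
  have h := pCoord_pDiff hC hj z
  have e : minusPart C n j z = pCoord ϑ C n (j + 1) z * pathVal ϑ η.1 := by
    simp only [minusPart, hη]
  rw [hz, map_zero, e] at h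
  rcases hl : C.letter j with _ | μ | μ
  · simpa [plusPart, hl] using h.symm
  · simpa [plusPart, hl] using h.symm
  · have hadj : μ.tl = η.tl ∧ μ.first ≠ η.first := hC.adj _ _ _ hl hη
    simp only [plusPart, hl] at h
    exact (mul_pathVal_eq_zero_of_add hϑ η μ hadj.2.symm _ _ h.symm).1

/-- The arrow that generates the annihilator of `η` is itself a path by which `⟨η⟩` may be
continued. This links annihilators to the chains of arrow steps in the tails. -/
lemma exists_eq_mul_of_mul_pathVal_eq_zero (hϑ : IsCompleteGentle ϑ) (η : GPath R Q) {a : Λ}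
    (ha : a ∈ projMod ϑ (some η.hd)) (h : a * pathVal ϑ η.1 = 0) :
    a = 0 ∨ ∃ σ c, ArrStep η σ ∧ c ∈ projMod ϑ (some σ.hd) ∧ a = c * pathVal ϑ σ.1 := by
  rcases annihilator_path hϑ η a ha h with h0 | ⟨y, c, h1, h2, h3, h4⟩
  · exact Or.inl h0
  · refine Or.inr ⟨GPath.mk [y] (by simp) (by simp), c, ⟨⟨h1.symm, h2⟩, y, rfl⟩, h3, ?_⟩
    rw [h4]
    congr 1
    exact (pathVal_singleton y).symm

/-- Exactness in a degree in which all positions look as in the interior or in the tails of a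
string resolution. -/
lemma mem_range_pDiff (hϑ : IsCompleteGentle ϑ) (hC : IsGenWord C) {n : ℤ}
    (hloc : ∀ i ∈ C.idx, height C i = n + 1 →
      (∃ γ σ : GPath R Q, C.letter i = some (.dir γ) ∧ C.letter (i + 1) = some (.inv σ)) ∨
      (∃ η : GPath R Q, C.letter i = some (.dir η) ∧
        (∀ μ, C.letter (i + 1 + 1) ≠ some (.inv μ)) ∧
        ∀ σ, ArrStep η σ → ∃ σ', ArrStep η σ' ∧ C.letter (i + 1) = some (.dir σ')) ∨
      (∃ η : GPath R Q, C.letter (i + 1) = some (.inv η) ∧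
        (∀ μ, C.letter (i - 1) ≠ some (.dir μ)) ∧
        ∀ σ, ArrStep η σ → ∃ σ', ArrStep η σ' ∧ C.letter i = some (.inv σ')))
    {z : StringP ϑ C (n + 1)} (hz : pDiff ϑ C (n + 1) z = 0) :
    z ∈ LinearMap.range (pDiff ϑ C n) := by
  refine sum_pSingle _ z fun i hi => ?_
  have hmem := pCoord_mem (n + 1) i z
  have hzero : ∀ h : pCoord ϑ C (n + 1) i z = 0,
      pSingle ϑ C (n + 1) i hi ⟨pCoord ϑ C (n + 1) i z, hmem⟩ ∈ LinearMap.range (pDiff ϑ C n) := by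
    intro h
    have : (⟨pCoord ϑ C (n + 1) i z, hmem⟩ : projMod ϑ (C.vtx ghead i)) = 0 := Subtype.ext h
    rw [this, pSingle, map_zero]
    exact zero_mem _
  have hlift : ∀ (σ : GPath R Q) (c : Λ), C.vtx ghead i = some σ.tl →
      pCoord ϑ C (n + 1) i z = c * pathVal ϑ σ.1 →
      pSingle ϑ C (n + 1) i hi ⟨pCoord ϑ C (n + 1) i z, hmem⟩ =
        c • pathVal ϑ σ.1 • pGen ϑ C (n + 1) i := by
    intro σ c hv hc
    rw [pGen_eq hi, smul_pSingle, smul_pSingle]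
    congr 1
    refine Subtype.ext ?_
    simp only [hc, SetLike.mk_smul_mk, smul_eq_mul]
    rw [hv, pathVal_mul_idemp]
  rcases hloc i hi.1 hi.2 with ⟨γ, σ, h1, h2⟩ | ⟨η, h1, h2, h3⟩ | ⟨η, h1, h2, h3⟩
  -- At a local minimum of the height the coefficient annihilates two paths with different last
  -- arrows.
  · have hadj : γ.hd = σ.hd ∧ γ.last ≠ σ.last := hC.adj _ _ _ h1 h2
    refine hzero (eq_zero_of_annihilates_two hϑ γ σ hadj.1 hadj.2 _ ?_
      (pCoord_mul_dir_eq_zero hϑ hC hi.2 hz h1) (pCoord_mul_inv_eq_zero hϑ hC hi.2 hz h2))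
    rw [vtx_of_letter C _ _ h1] at hmem
    exact hmem
  -- In the right tail the coefficient is `c σ`, where `⟨σ⟩` is the next letter. It is hit by `c
  -- g_{i+1}`, because `g_{i+1}^- = σ g_i` and `g_{i+1}^+ = 0`.
  · have hv := vtx_of_letter C _ _ h1
    have hmem' := hmem
    rw [hv] at hmem'
    rcases exists_eq_mul_of_mul_pathVal_eq_zero hϑ η hmem'
      (pCoord_mul_dir_eq_zero hϑ hC hi.2 hz h1) with h0 | ⟨σ, c, hσ, hc, e⟩
    · exact hzero h0
    · obtain ⟨σ', hσ', hl⟩ := h3 σ hσ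
      obtain rfl := arrStep_unique hϑ η σ σ' hσ hσ'
      have hj : i + 1 ∈ C.idx ∧ height C (i + 1) = n := by
        refine ⟨(Seqn.mem_idx_of_letter hl).2, ?_⟩
        rw [height_add_one, hl, hi.2]
        simp [letterHeight]
      have hv' : C.vtx ghead (i + 1) = some σ.hd := vtx_of_letter C _ _ hl
      refine ⟨pSingle ϑ C n (i + 1) hj ⟨c, by rw [hv']; exact hc⟩, ?_⟩
      rw [pDiff_pSingle, hlift σ c (vtx_of_letter_succ C hC _ _ hl) e]
      have e1 : pMinus ϑ C n (i + 1) = pathVal ϑ σ.1 • pGen ϑ C (n + 1) i := by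
        simp only [pMinus, hl, add_sub_cancel_right]
      have e2 : pPlus ϑ C n (i + 1) = 0 := by
        rcases hl' : C.letter (i + 1 + 1) with _ | μ | μ
        · simp [pPlus, hl']
        · simp [pPlus, hl']
        · exact absurd hl' (h2 μ)
      rw [e1, e2, add_zero]
  -- The mirror image in the left tail, with preimage `c g_{i-1}`.
  · have hv := vtx_of_letter_succ C hC _ _ h1
    have hmem' := hmem
    rw [hv] at hmem'
    rcases exists_eq_mul_of_mul_pathVal_eq_zero hϑ η hmem'
      (pCoord_mul_inv_eq_zero hϑ hC hi.2 hz h1) with h0 | ⟨σ, c, hσ, hc, e⟩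
    · exact hzero h0
    · obtain ⟨σ', hσ', hl⟩ := h3 σ hσ
      obtain rfl := arrStep_unique hϑ η σ σ' hσ hσ'
      have hl' : C.letter (i - 1 + 1) = some (.inv σ) := by rw [sub_add_cancel, hl]
      have hj : i - 1 ∈ C.idx ∧ height C (i - 1) = n := by
        refine ⟨(Seqn.mem_idx_of_letter hl).1, ?_⟩
        have := height_add_one C (i - 1)
        rw [hl', sub_add_cancel, hi.2] at this
        simp only [letterHeight] at this
        omega
      have hv' : C.vtx ghead (i - 1) = some σ.hd := vtx_of_letter_succ C hC _ _ hl'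
      refine ⟨pSingle ϑ C n (i - 1) hj ⟨c, by rw [hv']; exact hc⟩, ?_⟩
      rw [pDiff_pSingle, hlift σ c (vtx_of_letter C _ _ hl) e]
      have e1 : pPlus ϑ C n (i - 1) = pathVal ϑ σ.1 • pGen ϑ C (n + 1) i := by
        simp only [pPlus, sub_add_cancel, hl]
      have e2 : pMinus ϑ C n (i - 1) = 0 := by
        rcases hl2 : C.letter (i - 1) with _ | μ | μ
        · simp [pMinus, hl2]
        · exact absurd hl2 (h2 μ)
        · simp [pMinus, hl2]
      rw [e1, e2, zero_add]

end Kernel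

end Complex

open Seqn

lemma Seqn.vtx_glue_origin {V α : Type*} {hd : Letter α → V} {sg : Letter α → ℤˣ} {v : V} {ε : ℤˣ}
    {B E : Tail (Letter α)} (hB : Matches hd sg v (-ε) B) (hE : Matches hd sg v ε E) :
    (glue v ε B E).vtx hd (origin B E) = some v := by
  have h1 := letter_glue v ε B E (origin B E)
  have h2 := letter_glue v ε B E (origin B E + 1)
  rw [if_neg (by omega), sub_self] at h1
  rw [if_pos (by omega), add_sub_cancel_left, sub_self] at h2
  by_cases hn : B = .fin [] ∧ E = .fin []
  · obtain ⟨rfl, rfl⟩ := hn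
    rfl
  · have h3 : ∀ w δ, glue v ε B E ≠ .triv w δ := by
      intro w δ e
      refine hn ⟨?_, ?_⟩
      · refine Tail.eq_nil_of_get?_zero ?_
        rw [e] at h1
        simpa [letter] using h1
      · refine Tail.eq_nil_of_get?_zero ?_
        rw [e] at h2
        simpa [letter] using h2.symm
    have h4 : (glue v ε B E).vtx hd (origin B E) =
        match (glue v ε B E).letter (origin B E) with
        | some l => some (hd l.flip)
        | none => ((glue v ε B E).letter (origin B E + 1)).map hd := by
      generalize glue v ε B E = C at h3
      cases C with
      | triv w δ => exact absurd rfl (h3 w δ)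
      | _ => rfl
    rw [h4, h1, h2]
    rcases hB0 : B.get? 0 with _ | a
    · rcases hE0 : E.get? 0 with _ | c
      · exact absurd ⟨Tail.eq_nil_of_get?_zero hB0, Tail.eq_nil_of_get?_zero hE0⟩ hn
      · simp [hB0, hE0, (hE c hE0).1]
    · simp [hB0, Letter.flip_flip, (hB a hB0).1]

/-! ### The peaks of a string word -/

section Peaks

variable {V A : Type*} [Fintype V] {R : Type*} [CommRing R] {Q : BoundQuiver V A}

/-- The position `m` in the list `l` is neither preceded by an inverse nor followed by a direct
letter. -/
def IsListPeak {α : Type*} (l : List (Letter α)) (m : ℕ) : Prop :=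
  m ≤ l.length ∧ (∀ x, 1 ≤ m → l[m - 1]? ≠ some (.inv x)) ∧ ∀ x, l[m]? ≠ some (.dir x)

lemma invList_getElem? (γ : GPath R Q) {m : ℕ} (h : m < (invList γ.1).length) :
    ∃ x, (invList γ.1)[m]? = some (.inv x) := by
  have h' : m < γ.1.reverse.length := by simpa [invList] using h
  exact ⟨γ.1.reverse[m], by rw [invList, List.getElem?_map, List.getElem?_eq_getElem h']; rfl⟩

lemma dirList_getElem? (γ : GPath R Q) {m : ℕ} (h : m < (dirList γ.1).length) :
    ∃ x, (dirList γ.1)[m]? = some (.dir x) := by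
  have h' : m < γ.1.length := by simpa [dirList] using h
  exact ⟨γ.1[m], by rw [dirList, List.getElem?_map, List.getElem?_eq_getElem h']; rfl⟩

/-- A position strictly inside `γ⁻¹σ`, or where the two blocks meet, follows an inverse letter or
precedes a direct one. So apart from the start, only positions from the end of this block onwards
can be peaks. -/
lemma isListPeak_altList_cons (p : GPath R Q × GPath R Q) (ps : List (GPath R Q × GPath R Q))
    (m : ℕ) : IsListPeak (altList (p :: ps)) m ↔ m = 0 ∨
      ∃ m', m = (invList p.1.1).length + (dirList p.2.1).length + m' ∧
        IsListPeak (altList ps) m' := by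
  rw [altList_cons]
  have hγ := List.length_pos_of_ne_nil (invList_ne_nil p.1)
  have hσ := List.length_pos_of_ne_nil (dirList_ne_nil p.2)
  have h1 : ∀ m < (invList p.1.1).length, ∃ x,
      (invList p.1.1 ++ (dirList p.2.1 ++ altList ps))[m]? = some (.inv x) := by
    intro m hm
    rw [List.getElem?_append_left hm]
    exact invList_getElem? p.1 hm
  have h2 : ∀ m, (invList p.1.1).length ≤ m →
      m < (invList p.1.1).length + (dirList p.2.1).length → ∃ x,
      (invList p.1.1 ++ (dirList p.2.1 ++ altList ps))[m]? = some (.dir x) := by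
    intro m hm hm'
    rw [List.getElem?_append_right hm, List.getElem?_append_left (by omega)]
    exact dirList_getElem? p.2 (by omega)
  have h3 : ∀ m, (invList p.1.1 ++ (dirList p.2.1 ++ altList ps))[(invList p.1.1).length +
      (dirList p.2.1).length + m]? = (altList ps)[m]? := by
    intro m
    rw [List.getElem?_append_right (by omega), List.getElem?_append_right (by omega)]
    congr 1; omega
  constructor
  · rintro ⟨h4, h5, h6⟩
    by_cases hm0 : m = 0
    · exact Or.inl hm0
    by_cases hm1 : m ≤ (invList p.1.1).length
    · obtain ⟨x, hx⟩ := h1 (m - 1) (by omega)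
      exact absurd hx (h5 x (by omega))
    by_cases hm2 : m < (invList p.1.1).length + (dirList p.2.1).length
    · obtain ⟨x, hx⟩ := h2 m (by omega) hm2
      exact absurd hx (h6 x)
    obtain ⟨m', rfl⟩ := Nat.exists_eq_add_of_le (not_lt.1 hm2)
    refine Or.inr ⟨m', rfl, ?_, fun x hx => ?_, fun x => ?_⟩
    · simp only [List.length_append] at h4
      omega
    · rw [← h3, ← Nat.add_sub_assoc hx]
      exact h5 x (by omega)
    · rw [← h3]
      exact h6 x
  · rintro (rfl | ⟨m', rfl, h4, h5, h6⟩)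
    · refine ⟨Nat.zero_le _, fun x hx => by omega, fun x hx => ?_⟩
      obtain ⟨y, hy⟩ := h1 0 hγ
      rw [hx] at hy
      cases hy
    · refine ⟨by simp only [List.length_append]; omega, fun x _ => ?_, fun x => by rw [h3]; exact h6 x⟩
      by_cases hm : m' = 0
      · subst hm
        obtain ⟨y, hy⟩ := h2 ((invList p.1.1).length + (dirList p.2.1).length - 1) (by omega)
          (by omega)
        rw [add_zero, hy]
        simp
      · rw [Nat.add_sub_assoc (by omega), h3]
        exact h5 x (by omega)

lemma isListPeak_altList_iff (ps : List (GPath R Q × GPath R Q)) (m : ℕ) :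
    IsListPeak (altList ps) m ↔ ∃ k ≤ ps.length, m = (altList (ps.take k)).length := by
  induction ps generalizing m with
  | nil =>
    constructor
    · rintro ⟨h, -, -⟩
      exact ⟨0, le_rfl, by simpa [altList] using h⟩
    · rintro ⟨k, -, rfl⟩
      simp [IsListPeak, altList]
  | cons p ps ih =>
    rw [isListPeak_altList_cons]
    simp only [ih]
    constructor
    · rintro (rfl | ⟨m', rfl, k, hk, rfl⟩)
      · exact ⟨0, Nat.zero_le _, by simp [altList]⟩
      · refine ⟨k + 1, by simpa using hk, ?_⟩
        rw [List.take_succ_cons, altList_cons]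
        simp only [List.length_append]
        omega
    · rintro ⟨k, hk, rfl⟩
      rcases k with _ | k
      · exact Or.inl (by simp [altList])
      · refine Or.inr ⟨_, ?_, k, by simpa using hk, rfl⟩
        rw [List.take_succ_cons, altList_cons]
        simp only [List.length_append]
        omega

namespace Core

/-- The position of the `k`-th peak of `B⁻¹(AD)`. -/
def peakPos (κ : Core R Q) (b d : Tail A) (k : ℕ) : ℤ :=
  origin (b.map Letter.inv) (.app (altList κ.pairs) (d.map Letter.inv)) +
    (altList (κ.pairs.take k)).length

variable (s : Letter A → ℤˣ) (κ : Core R Q) (b d : Tail A)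

/-- A position in the interior of `B⁻¹` is followed by a direct letter and one in the interior of
`D` is preceded by an inverse letter. Only the positions of `A`, including both ends, can be peaks,
and there the neighbouring tails impose no further condition. -/
lemma isPeak_word_iff (i : ℤ) :
    (κ.word s b d).IsPeak i ↔ ∃ k ≤ κ.pairs.length, i = κ.peakPos b d k := by
  set o := origin (b.map Letter.inv) (.app (altList κ.pairs) (d.map Letter.inv)) with ho
  have hidx : ∀ k, k ∈ (κ.word s b d).idx ↔ k = o ∨
      (o < k ∧ (Tail.app (altList κ.pairs) (d.map .inv)).get? (k - o - 1).toNat ≠ none) ∨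
      (k < o ∧ (b.map Letter.inv).get? (o - k - 1).toNat ≠ none) := fun k => idx_glue _ _ _ _ _
  have hlet : ∀ k, (κ.word s b d).letter k = if o < k then
      (Tail.app (altList κ.pairs) (d.map .inv)).get? (k - o - 1).toNat
      else ((b.map Letter.inv).get? (o - k).toNat).map Letter.flip := fun k =>
    letter_glue _ _ _ _ _
  have key : (κ.word s b d).IsPeak i ↔ ∃ m : ℕ, i = o + m ∧ IsListPeak (altList κ.pairs) m := by
    constructor
    · rintro ⟨h1, h2, h3⟩
      have hio : o ≤ i := by
        by_contra hlt
        rcases (hidx i).1 h1 with h | h | h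
        · omega
        · omega
        · have h4 : (κ.word s b d).letter (i + 1) ≠ none := by
            rw [hlet, if_neg (by omega), show o - (i + 1) = o - i - 1 by ring]
            simpa using h.2
          obtain ⟨x, hx⟩ := Option.ne_none_iff_exists'.1 h4
          rcases h3 with ⟨y, hy⟩ | h3
          · rw [hlet, if_neg (by omega), Tail.get?_map, Option.map_map] at hy
            obtain ⟨z, -, e⟩ := Option.map_eq_some_iff.1 hy
            cases e
          · exact h3 (mem_idx_of_letter hx).2
      obtain ⟨m, hm⟩ := Int.eq_ofNat_of_zero_le (sub_nonneg.2 hio)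
      obtain rfl : i = o + m := by omega
      have hm' : m ≤ (altList κ.pairs).length := by
        by_contra hlt
        have h4 := hlet (o + m)
        rw [if_pos (by omega), Tail.get?_app, if_neg (by omega), Tail.get?_map] at h4
        rcases h2 with ⟨y, hy⟩ | h2
        · rw [hy] at h4
          obtain ⟨z, -, e⟩ := Option.map_eq_some_iff.1 h4.symm
          cases e
        · rcases (hidx _).1 h1 with h | h | h
          · omega
          · refine h2 ((hidx _).2 ?_)
            by_cases h5 : m = 1
            · subst h5
              exact Or.inl (by push_cast; ring)
            · refine Or.inr (Or.inl ⟨by omega, fun h6 => h.2 (Tail.get?_eq_none_of_le h6 ?_)⟩)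
              omega
          · omega
      refine ⟨m, rfl, hm', fun x hx hx' => ?_, fun x hx => ?_⟩
      · have h4 := hlet (o + m)
        have hlt : m - 1 < (altList κ.pairs).length := by omega
        rw [if_pos (by omega), Tail.get?_app, show (o + (m : ℤ) - o - 1).toNat = m - 1 by omega,
          if_pos hlt, hx'] at h4
        rcases h2 with ⟨y, hy⟩ | h2
        · rw [hy] at h4
          cases h4
        · exact h2 (mem_idx_of_letter h4).1
      · have h4 := hlet (o + m + 1)
        have hlt := (List.getElem?_eq_some_iff.1 hx).1
        rw [if_pos (by omega), Tail.get?_app, show (o + (m : ℤ) + 1 - o - 1).toNat = m by omega,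
          if_pos hlt, hx] at h4
        rcases h3 with ⟨y, hy⟩ | h3
        · rw [hy] at h4
          cases h4
        · exact h3 (mem_idx_of_letter h4).2
    · rintro ⟨m, rfl, h1, h2, h3⟩
      refine ⟨?_, ?_, ?_⟩
      · rw [hidx]
        by_cases hm : m = 0
        · subst hm; simp
        · refine Or.inr (Or.inl ⟨by omega, ?_⟩)
          rw [Tail.get?_app, if_pos (by omega), ne_eq, List.getElem?_eq_none_iff]
          omega
      · by_cases hm : m = 0
        · subst hm
          by_cases hb : (b.map Letter.inv).get? 0 = none
          · right
            rw [hidx]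
            rintro (h | h | h)
            · omega
            · omega
            · refine h.2 ?_
              rw [← hb]
              congr 1; omega
          · left
            obtain ⟨x, hx⟩ := Option.ne_none_iff_exists'.1 hb
            rw [Tail.get?_map] at hx
            obtain ⟨y, hy, -⟩ := Option.map_eq_some_iff.1 hx
            refine ⟨y, ?_⟩
            rw [hlet, if_neg (by omega), Tail.get?_map]
            simp [hy, Letter.flip]
        · left
          have hlt : m - 1 < (altList κ.pairs).length := by omega
          have h4 := hlet (o + m)
          rw [if_pos (by omega), Tail.get?_app, show (o + (m : ℤ) - o - 1).toNat = m - 1 by omega,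
            if_pos hlt, List.getElem?_eq_getElem hlt] at h4
          have h5 := h2
          rw [List.getElem?_eq_getElem hlt] at h5
          rw [h4]
          rcases hx : (altList κ.pairs)[m - 1] with x | x
          · exact ⟨x, rfl⟩
          · exact absurd (by rw [hx]) (h5 x (by omega))
      · have h4 := hlet (o + m + 1)
        rw [if_pos (by omega), Tail.get?_app,
          show (o + (m : ℤ) + 1 - o - 1).toNat = m by omega] at h4
        by_cases hlt : m < (altList κ.pairs).length
        · left
          rw [if_pos hlt, List.getElem?_eq_getElem hlt] at h4
          rw [List.getElem?_eq_getElem hlt] at h3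
          rw [h4]
          rcases hx : (altList κ.pairs)[m] with x | x
          · exact absurd (by rw [hx]) (h3 x)
          · exact ⟨x, rfl⟩
        · rw [if_neg hlt, Tail.get?_map] at h4
          rcases h5 : d.get? (m - (altList κ.pairs).length) with _ | x
          · right
            rw [hidx]
            rintro (h | h | h)
            · omega
            · refine h.2 ?_
              rw [Tail.get?_app, show (o + (m : ℤ) + 1 - o - 1).toNat = m by omega, if_neg hlt,
                Tail.get?_map, h5]
              rfl
            · omega
          · left
            exact ⟨x, by rw [h4, h5]; rfl⟩
  rw [key]
  simp only [isListPeak_altList_iff]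
  constructor
  · rintro ⟨m, rfl, k, hk, rfl⟩
    exact ⟨k, hk, rfl⟩
  · rintro ⟨k, hk, rfl⟩
    exact ⟨_, rfl, k, hk, rfl⟩

lemma altList_append (ps qs : List (GPath R Q × GPath R Q)) :
    altList (ps ++ qs) = altList ps ++ altList qs := by
  simp [altList]

lemma altList_take_succ {k : ℕ} (hk : k < κ.pairs.length) :
    altList (κ.pairs.take (k + 1)) = altList (κ.pairs.take k) ++
      (invList κ.pairs[k].1.1 ++ dirList κ.pairs[k].2.1) := by
  rw [List.take_add_one, List.getElem?_eq_getElem hk, altList_append]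
  simp [altList]

lemma peakPos_lt {j k : ℕ} (hjk : j < k) (hk : k ≤ κ.pairs.length) :
    κ.peakPos b d j < κ.peakPos b d k := by
  induction k, hjk using Nat.le_induction with
  | base =>
    have h := List.length_pos_of_ne_nil (invList_ne_nil κ.pairs[j].1)
    rw [peakPos, peakPos, altList_take_succ κ (by omega)]
    simp only [List.length_append]
    omega
  | succ k hjk ih =>
    refine (ih (by omega)).trans ?_
    have h := List.length_pos_of_ne_nil (invList_ne_nil κ.pairs[k].1)
    rw [peakPos, peakPos, altList_take_succ κ (by omega)]
    simp only [List.length_append]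
    omega

lemma peaks_word : (κ.word s b d).peaks =
    (Finset.range (κ.pairs.length + 1)).image (κ.peakPos b d) := by
  have e : {i : ℤ | (κ.word s b d).IsPeak i} =
      ((Finset.range (κ.pairs.length + 1)).image (κ.peakPos b d) : Set ℤ) := by
    ext i
    simp only [Set.mem_ofPred_eq, isPeak_word_iff, Finset.coe_image, Set.mem_image,
      Finset.coe_range, Set.mem_Iio]
    exact ⟨fun ⟨k, hk, h⟩ => ⟨k, by omega, h.symm⟩, fun ⟨k, hk, h⟩ => ⟨k, by omega, h.symm⟩⟩
  have hf : {i : ℤ | (κ.word s b d).IsPeak i}.Finite := e ▸ Finset.finite_toSet _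
  rw [Seqn.peaks, dif_pos hf]
  ext i
  rw [Set.Finite.mem_toFinset, e]
  exact Finset.mem_coe

lemma card_peaks_word : (κ.word s b d).peaks.card = κ.pairs.length + 1 := by
  rw [peaks_word, Finset.card_image_of_injOn, Finset.card_range]
  intro j hj k hk h
  simp only [Finset.coe_range, Set.mem_Iio] at hj hk
  rcases lt_trichotomy j k with h' | h' | h'
  · exact absurd h (peakPos_lt κ b d h' (by omega)).ne
  · exact h'
  · exact absurd h (peakPos_lt κ b d h' (by omega)).ne'

/-- A finite set has only one increasing enumeration, and `peakPos` is strictly increasing. -/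
lemma peak_word (i : Fin (κ.word s b d).peaks.card) :
    (κ.word s b d).peak i = κ.peakPos b d i := by
  have hc := card_peaks_word s κ b d
  have h := Finset.orderEmbOfFin_unique (s := (κ.word s b d).peaks) rfl
    (f := fun i => κ.peakPos b d i) (fun i => ?_) (fun i j hij => ?_)
  · rw [Seqn.peak, ← h]
  · exact (Finset.ext_iff.1 (peaks_word s κ b d) _).2
      (Finset.mem_image_of_mem _ (Finset.mem_range.2 (by have := i.2; omega)))
  · exact peakPos_lt κ b d hij (by have := j.2; omega)

/-- The vertices at the peaks of a string word agree with those at the positions of maximal height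
of its resolution. -/
lemma vtx_peakPos [Nontrivial R] {s : Letter A → ℤˣ} {κ : Core R Q} (hκ : κ.Valid) {b d : Tail A}
    {t u : Tail (GPath R Q)} (hb : WTail R Q s κ.v₀ (-κ.ε₀ s) b)
    (hd : WTail R Q s κ.v₁ (κ.ε₁ s) d) (ht : GTail s κ.v₀ (-κ.ε₀ s) t)
    (hu : GTail s κ.v₁ (κ.ε₁ s) u) {k : ℕ} (hk : k ≤ κ.pairs.length) :
    (κ.word s b d).vtx Q.lhead (κ.peakPos b d k) =
      (κ.genWord s t u).vtx ghead (κ.genOrigin t u + 2 * k) := by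
  rcases k with _ | k
  · have h1 := vtx_glue_origin hb.matches
      ((isCoreList_word s hκ).matches_app (t := d.map .inv) fun _ => hd.matches)
    have h2 := vtx_glue_origin ht.matches
      ((isCoreList_gen s hκ).matches_app (t := u.map .dir) fun _ => hu.matches)
    have e : κ.peakPos b d 0 = origin (b.map Letter.inv)
        (.app (altList κ.pairs) (d.map Letter.inv)) := by
      simp [peakPos, altList]
    rw [e, Nat.cast_zero, mul_zero, add_zero]
    exact h1.trans h2.symm
  -- Behind the first peak, both vertices are the tail of the path `σ` in the preceding pair.
  · have hk' : k < κ.pairs.length := by omega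
    have h2 := letter_genWord_even s κ t u hk'
    push_cast
    rw [mul_add, mul_one, ← add_assoc, vtx_of_letter _ _ _ h2]
    set L := altList (κ.pairs.take (k + 1)) with hL
    have hlast : L.getLast? = some (.dir κ.pairs[k].2.first) := by
      rw [hL, altList_take_succ κ hk', List.getLast?_append, List.getLast?_append,
        GPath.dirList_getLast?]
      rfl
    have hpos : 0 < L.length := List.length_pos_of_ne_nil fun h => by
      rw [h] at hlast
      cases hlast
    have e : altList κ.pairs = L ++ altList (κ.pairs.drop (k + 1)) := by
      rw [hL, ← altList_append, List.take_append_drop]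
    have h1 : (κ.word s b d).letter (κ.peakPos b d (k + 1)) = some (.dir κ.pairs[k].2.first) := by
      rw [word, letter_glue, peakPos, ← hL, if_pos (by omega), Tail.get?_app,
        add_sub_cancel_left, show ((L.length : ℤ) - 1).toNat = L.length - 1 by omega, if_pos, e,
        List.getElem?_append_left (by omega), ← List.getLast?_eq_getElem?, hlast]
      rw [e, List.length_append]
      omega
    have h3 : ∀ (C : Seqn V (Letter A)) (i : ℤ) (l : Letter A), C.letter i = some l →
        C.vtx Q.lhead i = some (Q.lhead l.flip) := by
      intro C i l h
      cases C <;> simp_all [Seqn.vtx, Seqn.letter]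
    rw [h3 _ _ _ h1]
    rfl

end Core

end Peaks

/-! ### Projective resolutions from string complexes -/

section Resolutions

open DirectSum

variable {V A : Type*} [Fintype V] {R : Type*} [CommRing R] {Q : BoundQuiver V A}
  {Λ : Type*} [Ring Λ] [Algebra R Λ] {ϑ : PathAlgebra R Q →ₐ[R] Λ}
  {C : Seqn V (Letter (GPath R Q))}

/-- Right multiplication by `e` is a retraction of `Λ` onto `Λe`. -/
lemma projective_span_idempotent {e : Λ} (he : e * e = e) :
    Module.Projective Λ (Submodule.span Λ {e}) := by
  refine Module.Projective.of_split (M := Λ) (Submodule.subtype _)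
    ((LinearMap.toSpanSingleton Λ Λ e).codRestrict _ fun a =>
      Submodule.smul_mem _ a (Submodule.mem_span_singleton_self e)) ?_
  refine LinearMap.ext fun x => Subtype.ext ?_
  obtain ⟨a, ha⟩ := Submodule.mem_span_singleton.1 x.2
  change (x : Λ) * e = x
  rw [← ha, smul_eq_mul, mul_assoc, he]

lemma projective_projMod (v : Option V) : Module.Projective Λ (projMod ϑ v) := by
  refine projective_span_idempotent ?_
  rcases v with _ | v
  · exact mul_zero _
  · exact idemp_mul_idemp v

lemma stringComplex_d (hϑ : IsCompleteGentle ϑ) (hC : IsGenWord C) (n : ℤ) :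
    (stringComplex hϑ C hC).d n (n + 1) = ModuleCat.ofHom (pDiff ϑ C n) :=
  CochainComplex.of_d (X := fun n => ModuleCat.of Λ (StringP ϑ C n))
    (fun n => ModuleCat.ofHom (pDiff ϑ C n)) n

instance projective_stringComplex (hϑ : IsCompleteGentle ϑ) (hC : IsGenWord C) (n : ℤ) :
    Module.Projective Λ ((stringComplex hϑ C hC).X n) := by
  have := fun i : {i : ℤ // i ∈ C.idx ∧ height C i = n} =>
    projective_projMod (ϑ := ϑ) (C.vtx ghead i.1)
  change Module.Projective Λ (StringP ϑ C n)
  infer_instance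

lemma subsingleton_stringP {n : ℤ} (h : ∀ i ∈ C.idx, height C i ≠ n) :
    Subsingleton (StringP ϑ C n) := by
  have : IsEmpty {i : ℤ // i ∈ C.idx ∧ height C i = n} := ⟨fun i => h i.1 i.2.1 i.2.2⟩
  exact ⟨fun x y => DFinsupp.ext fun i => isEmptyElim i⟩

lemma isZero_stringComplex (hϑ : IsCompleteGentle ϑ) (hC : IsGenWord C) {n : ℤ}
    (h : ∀ i ∈ C.idx, height C i ≠ n) : Limits.IsZero ((stringComplex hϑ C hC).X n) := by
  have : Subsingleton ((stringComplex hϑ C hC).X n) := subsingleton_stringP h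
  exact ModuleCat.isZero_of_subsingleton _

lemma isZero_homology_stringComplex (hϑ : IsCompleteGentle ϑ) (hC : IsGenWord C) {n : ℤ}
    (h : ∀ z, pDiff ϑ C (n + 1) z = 0 → z ∈ LinearMap.range (pDiff ϑ C n)) :
    Limits.IsZero ((stringComplex hϑ C hC).homology (n + 1)) := by
  rw [← HomologicalComplex.exactAt_iff_isZero_homology,
    HomologicalComplex.exactAt_iff' _ n (n + 1) (n + 1 + 1) (by simp) (by simp),
    ShortComplex.moduleCat_exact_iff]
  intro z hz
  change (stringComplex hϑ C hC).d (n + 1) (n + 1 + 1) z = 0 at hz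
  change ∃ x, (stringComplex hϑ C hC).d n (n + 1) x = z
  rw [stringComplex_d] at hz ⊢
  exact h z hz

/-- The homology in the largest degree is a cokernel. -/
noncomputable def topHomologyIso (hϑ : IsCompleteGentle ϑ) (hC : IsGenWord C) {n : ℤ}
    (h : ∀ i ∈ C.idx, height C i ≤ n + 1) :
    (stringComplex hϑ C hC).homology (n + 1) ≅
      ModuleCat.of Λ (StringP ϑ C (n + 1) ⧸ LinearMap.range (pDiff ϑ C n)) := by
  -- The term in the next degree is zero, so the outgoing differential vanishes and the homology can
  -- be computed as the cokernel of the incoming one.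
  refine ShortComplex.homologyMapIso
    ((stringComplex hϑ C hC).isoSc' n (n + 1) (n + 1 + 1) (by simp) (by simp)) ≪≫
    (ShortComplex.HomologyData.ofIsColimitCokernelCofork _ ?_ _
      (ModuleCat.cokernelIsColimit _)).left.homologyIso ≪≫
    (Submodule.quotEquivOfEq _ _ ?_).toModuleIso
  · exact (isZero_stringComplex hϑ hC fun i hi e => by have := h i hi; omega).eq_of_tgt _ _
  · change LinearMap.range ((stringComplex hϑ C hC).d n (n + 1)).hom = _
    rw [stringComplex_d]
    rfl

/-- A string complex which is exact below its largest degree `n + 1` is, up to a shift, a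
projective resolution of its homology in that degree. -/
lemma isResolutionOf_stringComplex (hϑ : IsCompleteGentle ϑ) (hC : IsGenWord C) {n : ℤ}
    (h : ∀ i ∈ C.idx, height C i ≤ n + 1)
    (hex : ∀ m < n, ∀ z, pDiff ϑ C (m + 1) z = 0 → z ∈ LinearMap.range (pDiff ϑ C m))
    {M : ModuleCat Λ}
    (e : (StringP ϑ C (n + 1) ⧸ LinearMap.range (pDiff ϑ C n)) ≃ₗ[Λ] M) :
    IsResolutionOf ((shiftFunctor (CochainComplex (ModuleCat Λ) ℤ) (n + 1)).obj
      (stringComplex hϑ C hC)) M := by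
  have hiso : ∀ m m', n + 1 + m = m' →
      Nonempty (((shiftFunctor (CochainComplex (ModuleCat Λ) ℤ) (n + 1)).obj
        (stringComplex hϑ C hC)).homology m ≅ (stringComplex hϑ C hC).homology m') :=
    fun m m' hm => ⟨(CochainComplex.ShiftSequence.shiftIso (ModuleCat Λ) (n + 1) m m' hm).app
      (stringComplex hϑ C hC)⟩
  refine ⟨⟨fun m => projective_stringComplex hϑ hC (m + (n + 1)), fun m hm =>
    isZero_stringComplex hϑ hC (n := m + (n + 1)) fun i hi e => by have := h i hi; omega,
    fun m hm => ?_⟩, ?_⟩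
  · obtain ⟨f⟩ := hiso m (n + m + 1) (by ring)
    refine Limits.IsZero.of_iso ?_ f
    rcases lt_or_gt_of_ne hm with h' | h'
    · exact isZero_homology_stringComplex hϑ hC (hex _ (by omega))
    -- Above the largest height the complex itself is zero.
    · refine isZero_homology_stringComplex hϑ hC fun z _ => ?_
      have : Subsingleton (StringP ϑ C (n + m + 1)) :=
        subsingleton_stringP fun i hi e => by have := h i hi; omega
      rw [Subsingleton.elim z 0]
      exact zero_mem _
  · obtain ⟨f⟩ := hiso 0 (n + 1) (by ring)
    exact ⟨f ≪≫ topHomologyIso hϑ hC h ≪≫ e.toModuleIso⟩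

lemma pDiff_pGen (hC : IsGenWord C) {n i : ℤ} (h : i ∈ C.idx ∧ height C i = n) :
    pDiff ϑ C n (pGen ϑ C n i) = pMinus ϑ C n i + pPlus ϑ C n i := by
  rw [pGen_eq h, pDiff_pSingle, smul_add]
  congr 1
  · rcases hl : C.letter i with _ | η | η
    · simp [pMinus, hl]
    · have : C.vtx ghead i = some η.hd := vtx_of_letter C _ _ hl
      simp only [pMinus, hl, this, smul_smul]
      rw [GPath.hd, GPath.last, idemp_mul_pathVal]
    · simp [pMinus, hl]
  · rcases hl : C.letter (i + 1) with _ | η | η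
    · simp [pPlus, hl]
    · simp [pPlus, hl]
    · have : C.vtx ghead i = some η.hd := vtx_of_letter_succ C hC _ _ hl
      simp only [pPlus, hl, this, smul_smul]
      rw [GPath.hd, GPath.last, idemp_mul_pathVal]

lemma range_pDiff (hC : IsGenWord C) (n : ℤ) :
    LinearMap.range (pDiff ϑ C n) = Submodule.span Λ
      {z | ∃ i, (i ∈ C.idx ∧ height C i = n) ∧ z = pMinus ϑ C n i + pPlus ϑ C n i} := by
  refine le_antisymm ?_ (Submodule.span_le.2 ?_)
  · rintro _ ⟨z, rfl⟩
    induction z using DirectSum.induction_on with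
    | zero => rw [map_zero]; exact zero_mem _
    | of i a =>
      have h := pDiff_pSingle i.2 a
      exact h ▸ Submodule.smul_mem _ _ (Submodule.subset_span ⟨i.1, i.2, rfl⟩)
    | add x y hx hy => rw [map_add]; exact add_mem hx hy
  · rintro _ ⟨i, h, rfl⟩
    exact ⟨_, pDiff_pGen hC h⟩

/-- Reindexing a direct sum of left ideals, with signs. -/
lemma exists_signed_reindex {ι κ : Type*} [DecidableEq ι] [DecidableEq κ] (e : ι ≃ κ)
    (N : ι → Submodule Λ Λ) (P : κ → Submodule Λ Λ) (h : ∀ i, N i = P (e i)) (ε : ι → ℤˣ) :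
    ∃ φ : (⨁ i, N i) ≃ₗ[Λ] ⨁ k, P k, ∀ i x, φ (DirectSum.lof Λ ι (fun i => N i) i x) =
      (ε i : ℤ) • DirectSum.lof Λ κ (fun k => P k) (e i) ⟨x, h i ▸ x.2⟩ := by
  have hN : ∀ i j (hij : i = j) (x : Λ) (hx : x ∈ N i),
      DirectSum.lof Λ ι (fun i => N i) i ⟨x, hx⟩ =
        DirectSum.lof Λ ι (fun i => N i) j ⟨x, hij ▸ hx⟩ := by
    rintro i _ rfl x hx; rfl
  have hP : ∀ i j (hij : i = j) (x : Λ) (hx : x ∈ P i),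
      DirectSum.lof Λ κ (fun k => P k) i ⟨x, hx⟩ =
        DirectSum.lof Λ κ (fun k => P k) j ⟨x, hij ▸ hx⟩ := by
    rintro i _ rfl x hx; rfl
  have h' : ∀ k, P k = N (e.symm k) := fun k => by rw [h, e.apply_symm_apply]
  have hε : ∀ i, (ε i : ℤ) * (ε i : ℤ) = 1 := fun i => by
    rw [← Units.val_mul, Int.units_mul_self, Units.val_one]
  let f : (⨁ i, N i) →ₗ[Λ] ⨁ k, P k := DirectSum.toModule Λ ι _ fun i =>
    (ε i : ℤ) • (DirectSum.lof Λ κ (fun k => P k) (e i)).comp (Submodule.inclusion (h i).le)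
  let g : (⨁ k, P k) →ₗ[Λ] ⨁ i, N i := DirectSum.toModule Λ κ _ fun k =>
    (ε (e.symm k) : ℤ) • (DirectSum.lof Λ ι (fun i => N i) (e.symm k)).comp
      (Submodule.inclusion (h' k).le)
  have hf : ∀ i x, f (DirectSum.lof Λ ι (fun i => N i) i x) =
      (ε i : ℤ) • DirectSum.lof Λ κ (fun k => P k) (e i) ⟨x, h i ▸ x.2⟩ :=
    fun i x => DirectSum.toModule_lof _ _ _
  have hg : ∀ k x, g (DirectSum.lof Λ κ (fun k => P k) k x) =
      (ε (e.symm k) : ℤ) • DirectSum.lof Λ ι (fun i => N i) (e.symm k) ⟨x, h' k ▸ x.2⟩ :=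
    fun k x => DirectSum.toModule_lof _ _ _
  refine ⟨LinearEquiv.ofLinearMap f g ?_ ?_, hf⟩
  · refine DirectSum.linearMap_ext Λ fun k => LinearMap.ext fun x => ?_
    simp only [LinearMap.comp_apply, LinearMap.id_apply]
    rw [hg, map_zsmul, hf, smul_smul, hε, one_smul, hP _ _ (e.apply_symm_apply k)]
  · refine DirectSum.linearMap_ext Λ fun i => LinearMap.ext fun x => ?_
    simp only [LinearMap.comp_apply, LinearMap.id_apply]
    have h1 : ε (e.symm (e i)) = ε i := by rw [e.symm_apply_apply]
    rw [hf, map_zsmul, hg, smul_smul, hN _ _ (e.symm_apply_apply i), h1, hε, one_smul]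

end Resolutions

open Seqn

/-! ### The top homology is the string module -/

section ZerothHomology

open DirectSum

variable {V A : Type*} [Fintype V] {R : Type*} [CommRing R] {Q : BoundQuiver V A}
  {Λ : Type*} [Ring Λ] [Algebra R Λ] {ϑ : PathAlgebra R Q →ₐ[R] Λ}

/-- The first path of the tail of a resolution is the cap of the corresponding tail. -/
lemma TailRes.get?_zero_iff [Nontrivial R] (hϑ : IsCompleteGentle ϑ) {s : Letter A → ℤˣ}
    (hs : IsSign R Q s) {w : V} {δ : ℤˣ} {d : Tail A} (hd : WTail R Q s w δ d)
    {t : Tail (GPath R Q)} (ht : TailRes s w δ d t) (β : GPath R Q) :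
    IsCap R Q s (ofTail w δ (d.map .inv)) β ↔ t.get? 0 = some β := by
  constructor
  · intro h
    exact ((Core.tailRes_iff_of_isCap hϑ hs hd h t).1.1 ht).get?_zero
  · intro h
    rcases ht with ⟨-, rfl⟩ | ⟨k, x, β', rfl, h1, h2, h3⟩
    · simp at h
    · obtain rfl : β' = β := Option.some.inj (h3.get?_zero.symm.trans h)
      exact (isCap_iff hs hd).2 ⟨k, x, rfl, h1, h2⟩

namespace Core

lemma wordSeq_eq_fin_iff {s : Letter A → ℤˣ} {κ : Core R Q}
    {ps : List (GPath R Q × GPath R Q)} :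
    κ.wordSeq s = .fin (altList ps) ↔ κ.pairs ≠ [] ∧ ps = κ.pairs := by
  rcases κ with ⟨v, ε⟩ | ⟨p, qs⟩
  · have : (Core.triv v ε : Core R Q).wordSeq s = .triv v ε := rfl
    simp [this, pairs]
  · rw [wordSeq_alt]
    simp only [Seqn.fin.injEq, pairs, ne_eq, reduceCtorEq, not_false_eq_true, true_and]
    exact ⟨fun h => (altList_injective h).symm, fun h => by rw [h]⟩

section Coker

variable {s : Letter A → ℤˣ} {κ : Core R Q} {b d : Tail A} {t u : Tail (GPath R Q)}

/-- The relations of the string module are the boundaries in the string complex. -/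
lemma exists_equiv_map_eq_range [Nontrivial R] (hϑ : IsCompleteGentle ϑ) (hs : IsSign R Q s)
    (hκ : κ.Valid) (hb : WTail R Q s κ.v₀ (-κ.ε₀ s) b) (hd : WTail R Q s κ.v₁ (κ.ε₁ s) d)
    (ht : TailRes s κ.v₀ (-κ.ε₀ s) b t) (hu : TailRes s κ.v₁ (κ.ε₁ s) d u) {n : ℤ}
    (hn : height (κ.genWord s t u) (κ.genOrigin t u) = n + 1) :
    ∃ φ : StringN ϑ (κ.word s b d) ≃ₗ[Λ] StringP ϑ (κ.genWord s t u) (n + 1),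
      (stringLMinus ϑ s (κ.word s b d) ⊔ stringLZero ϑ s (κ.word s b d) ⊔
        stringLPlus ϑ s (κ.word s b d)).map (φ : StringN ϑ (κ.word s b d) →ₗ[Λ] _) =
        LinearMap.range (pDiff ϑ (κ.genWord s t u) n) := by
  have hC : IsGenWord (κ.genWord s t u) := isGenWord_genWord hs hκ ht.resTail.gTail hu.resTail.gTail
  have hc := card_peaks_word s κ b d
  have hgen : ∀ k ≤ κ.pairs.length, κ.genOrigin t u + 2 * (k : ℤ) ∈ (κ.genWord s t u).idx ∧
      height (κ.genWord s t u) (κ.genOrigin t u + 2 * (k : ℤ)) = n + 1 :=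
    fun k hk => ⟨mem_idx_genWord_even s κ t u hk, by rw [height_genWord_even s κ t u hk, hn]⟩
  have hlt : ∀ i : Fin (κ.word s b d).peaks.card, i.val ≤ κ.pairs.length := fun i => by
    have := i.2; omega
  -- The `k`-th peak of the word corresponds to the position `2k` behind the start of the core;
  -- these are all the positions of maximal height.
  let e : Fin (κ.word s b d).peaks.card ≃
      {i : ℤ // i ∈ (κ.genWord s t u).idx ∧ height (κ.genWord s t u) i = n + 1} :=
    Equiv.ofBijective (fun k => ⟨_, hgen k.val (hlt k)⟩) (by
      constructor
      · intro i j h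
        have := congrArg Subtype.val h
        exact Fin.ext (by simp only at this; omega)
      · rintro ⟨i, hi, h⟩
        obtain ⟨k, hk, rfl⟩ := height_genWord_eq s κ t u hi (h.trans hn.symm)
        exact ⟨⟨k, by omega⟩, rfl⟩)
  have hv : ∀ i : Fin (κ.word s b d).peaks.card,
      (κ.word s b d).vtx Q.lhead ((κ.word s b d).peak i) =
        (κ.genWord s t u).vtx ghead (e i).1 := fun i => by
    rw [peak_word]
    exact vtx_peakPos hκ hb hd ht.resTail.gTail hu.resTail.gTail (hlt i)
  -- The module is defined by differences `γ g_i - σ g_{i+1}`, the differential by sums. The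
  -- alternating signs `(-1)^i` convert one into the other, up to a unit.
  obtain ⟨φ, hφ⟩ := exists_signed_reindex e
    (fun i => projMod ϑ ((κ.word s b d).vtx Q.lhead ((κ.word s b d).peak i)))
    (fun i => projMod ϑ ((κ.genWord s t u).vtx ghead i.1)) (fun i => by rw [hv])
    (fun i => (-1) ^ i.val)
  have hφg : ∀ i, φ (stringGen ϑ (κ.word s b d) i) = (((-1) ^ i.val : ℤˣ) : ℤ) •
      pGen ϑ (κ.genWord s t u) (n + 1) (κ.genOrigin t u + 2 * (i.val : ℤ)) := fun i => by
    rw [stringGen, hφ, pGen_eq (hgen i.val (hlt i)), pSingle]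
    congr 2
    exact Subtype.ext (congrArg (idemp ϑ) (hv i))
  have hsq : ∀ k : ℕ, (((-1) ^ k : ℤˣ) : ℤ) * (((-1) ^ k : ℤˣ) : ℤ) = 1 := fun k => by
    rw [← Units.val_mul, Int.units_mul_self, Units.val_one]
  have hsucc : ∀ k : ℕ, (((-1) ^ (k + 1) : ℤˣ) : ℤ) = -(((-1) ^ k : ℤˣ) : ℤ) := fun k => by
    rw [pow_succ]; simp
  have hφs : ∀ (γ : Λ) (i : Fin (κ.word s b d).peaks.card), φ (γ • stringGen ϑ (κ.word s b d) i) =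
      (((-1) ^ i.val : ℤˣ) : ℤ) • γ •
        pGen ϑ (κ.genWord s t u) (n + 1) (κ.genOrigin t u + 2 * (i.val : ℤ)) := fun γ i => by
    rw [map_smul, hφg, smul_comm]
  have hφd : ∀ (γ σ : Λ) (i j : Fin (κ.word s b d).peaks.card), j.val = i.val + 1 →
      φ (γ • stringGen ϑ (κ.word s b d) i - σ • stringGen ϑ (κ.word s b d) j) =
      (((-1) ^ i.val : ℤˣ) : ℤ) •
        (γ • pGen ϑ (κ.genWord s t u) (n + 1) (κ.genOrigin t u + 2 * (i.val : ℤ)) +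
          σ • pGen ϑ (κ.genWord s t u) (n + 1) (κ.genOrigin t u + 2 * (j.val : ℤ))) := by
    intro γ σ i j hij
    rw [map_sub, hφs, hφs, show (((-1) ^ j.val : ℤˣ) : ℤ) = -(((-1) ^ i.val : ℤˣ) : ℤ) by
      rw [hij, hsucc], neg_smul, sub_neg_eq_add, smul_add]
  have hleft : ∀ β : GPath R Q, t.get? 0 = some β →
      (κ.genOrigin t u - 1 ∈ (κ.genWord s t u).idx ∧
        height (κ.genWord s t u) (κ.genOrigin t u - 1) = n) ∧
      pMinus ϑ (κ.genWord s t u) n (κ.genOrigin t u - 1) +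
        pPlus ϑ (κ.genWord s t u) n (κ.genOrigin t u - 1) = pathVal ϑ β.1 •
          pGen ϑ (κ.genWord s t u) (n + 1) (κ.genOrigin t u) := by
    intro β hβ
    have h0 := letter_genWord_left s κ t u 0
    have h1 := letter_genWord_left s κ t u 1
    have h2 := height_genWord_left s κ t u (j := 0) (by simp [hβ])
    rw [hβ] at h0
    simp only [Nat.cast_zero, Nat.cast_one, sub_zero, Option.map_some] at h0 h1 h2
    refine ⟨⟨(mem_idx_of_letter h0).1, by omega⟩, ?_⟩
    have h3 : pMinus ϑ (κ.genWord s t u) n (κ.genOrigin t u - 1) = 0 := by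
      rw [pMinus, h1]
      rcases t.get? 1 with _ | x <;> simp
    rw [h3, zero_add, pPlus, sub_add_cancel, h0]
  have hright : ∀ δ : GPath R Q, u.get? 0 = some δ →
      (κ.genOrigin t u + 2 * κ.pairs.length + 1 ∈ (κ.genWord s t u).idx ∧
        height (κ.genWord s t u) (κ.genOrigin t u + 2 * κ.pairs.length + 1) = n) ∧
      pMinus ϑ (κ.genWord s t u) n (κ.genOrigin t u + 2 * κ.pairs.length + 1) +
        pPlus ϑ (κ.genWord s t u) n (κ.genOrigin t u + 2 * κ.pairs.length + 1) =
        pathVal ϑ δ.1 • pGen ϑ (κ.genWord s t u) (n + 1)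
          (κ.genOrigin t u + 2 * (κ.pairs.length : ℤ)) := by
    intro δ hδ
    have h0 := letter_genWord_right s κ t u 0
    have h1 := letter_genWord_right s κ t u 1
    have h2 := height_genWord_right s κ t u (j := 0) (by simp [hδ])
    rw [hδ] at h0
    simp only [Nat.cast_zero, Nat.cast_one, add_zero, sub_zero, Option.map_some] at h0 h1 h2
    refine ⟨⟨(mem_idx_of_letter h0).2, by omega⟩, ?_⟩
    have h3 : pPlus ϑ (κ.genWord s t u) n (κ.genOrigin t u + 2 * κ.pairs.length + 1) = 0 := by
      rw [pPlus, h1]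
      rcases u.get? 1 with _ | x <;> simp
    rw [h3, add_zero, pMinus, h0, add_sub_cancel_right]
  have hmid : ∀ (k : ℕ) (hk : k < κ.pairs.length),
      (κ.genOrigin t u + 2 * k + 1 ∈ (κ.genWord s t u).idx ∧
        height (κ.genWord s t u) (κ.genOrigin t u + 2 * k + 1) = n) ∧
      pMinus ϑ (κ.genWord s t u) n (κ.genOrigin t u + 2 * k + 1) +
        pPlus ϑ (κ.genWord s t u) n (κ.genOrigin t u + 2 * k + 1) =
        pathVal ϑ κ.pairs[k].1.1 • pGen ϑ (κ.genWord s t u) (n + 1)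
          (κ.genOrigin t u + 2 * (k : ℤ)) +
        pathVal ϑ κ.pairs[k].2.1 • pGen ϑ (κ.genWord s t u) (n + 1)
          (κ.genOrigin t u + 2 * ((k + 1 : ℕ) : ℤ)) := by
    intro k hk
    have h0 := letter_genWord_odd s κ t u hk
    have h1 := letter_genWord_even s κ t u hk
    have h2 := height_genWord_odd s κ t u hk
    refine ⟨⟨(mem_idx_of_letter h0).2, by omega⟩, ?_⟩
    rw [pMinus, pPlus, h0, add_assoc (κ.genOrigin t u + 2 * (k : ℤ)), one_add_one_eq_two, h1,
      show κ.genOrigin t u + 2 * (k : ℤ) + 1 - 1 = κ.genOrigin t u + 2 * (k : ℤ) by ring,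
      show κ.genOrigin t u + 2 * (k : ℤ) + 2 = κ.genOrigin t u + 2 * ((k + 1 : ℕ) : ℤ) by
        push_cast; ring]
  have hdec := fun B A' D => isDecomp_word hs hκ hb hd (B := B) (A' := A') (D := D)
  have hcapB := fun β => ht.get?_zero_iff hϑ hs hb β
  have hcapD := fun β => hu.get?_zero_iff hϑ hs hd β
  have hmem : ∀ i, i ∈ (κ.genWord s t u).idx ∧ height (κ.genWord s t u) i = n →
      pMinus ϑ (κ.genWord s t u) n i + pPlus ϑ (κ.genWord s t u) n i ∈
        LinearMap.range (pDiff ϑ (κ.genWord s t u) n) :=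
    fun i hi => ⟨_, pDiff_pGen hC hi⟩
  refine ⟨φ, le_antisymm (Submodule.map_le_iff_le_comap.2 (sup_le (sup_le ?_ ?_) ?_)) ?_⟩
  · refine Submodule.span_le.2 ?_
    rintro _ ⟨B, A', D, hD, β, hβ, i, hi, rfl⟩
    obtain ⟨rfl, rfl, rfl⟩ := (hdec B A' D).1 hD
    obtain ⟨h1, h2⟩ := hleft β ((hcapB β).1 hβ)
    have h3 := hmem _ h1
    change φ _ ∈ LinearMap.range (pDiff ϑ (κ.genWord s t u) n)
    rw [hφs, hi, Nat.cast_zero, mul_zero, add_zero, ← h2]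
    exact zsmul_mem h3 _
  · refine Submodule.span_le.2 ?_
    rintro _ ⟨B, A', D, hD, ps, hps, i, j, hij, γ, σ, hγ, rfl⟩
    obtain ⟨rfl, rfl, rfl⟩ := (hdec B A' D).1 hD
    obtain ⟨-, rfl⟩ := wordSeq_eq_fin_iff.1 hps
    obtain ⟨hi, he⟩ := List.getElem?_eq_some_iff.1 hγ
    obtain ⟨h1, h2⟩ := hmid i.val hi
    have h3 := hmem _ h1
    change φ _ ∈ LinearMap.range (pDiff ϑ (κ.genWord s t u) n)
    rw [h2, he] at h3
    rw [hφd _ _ _ _ hij, hij]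
    exact zsmul_mem h3 _
  · refine Submodule.span_le.2 ?_
    rintro _ ⟨B, A', D, hD, β, hβ, i, hi, rfl⟩
    obtain ⟨rfl, rfl, rfl⟩ := (hdec B A' D).1 hD
    obtain ⟨h1, h2⟩ := hright β ((hcapD β).1 hβ)
    have h3 := hmem _ h1
    change φ _ ∈ LinearMap.range (pDiff ϑ (κ.genWord s t u) n)
    rw [hφs, show i.val = κ.pairs.length by omega, ← h2]
    exact zsmul_mem h3 _
  -- Conversely, the positions in degree `n` are the odd positions of the core and the positions
  -- next to the core on either side, so the generating boundaries correspond to `L_0`, `L_+` and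
  -- `L_-`.
  · rw [range_pDiff hC]
    refine Submodule.span_le.2 ?_
    rintro _ ⟨i, ⟨hi, hh⟩, rfl⟩
    rcases mem_idx_genWord s κ t u hi with ⟨k, hk, rfl⟩ | ⟨k, hk, rfl⟩ | ⟨j, hj, rfl⟩ | ⟨j, hj, rfl⟩
    · rw [height_genWord_even s κ t u hk] at hh
      omega
    · have hi' : k < (κ.word s b d).peaks.card := by omega
      have hj' : k + 1 < (κ.word s b d).peaks.card := by omega
      have hm : pathVal ϑ κ.pairs[k].1.1 • stringGen ϑ (κ.word s b d) ⟨k, hi'⟩ -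
          pathVal ϑ κ.pairs[k].2.1 • stringGen ϑ (κ.word s b d) ⟨k + 1, hj'⟩ ∈
          stringLZero ϑ s (κ.word s b d) := Submodule.subset_span
        ⟨_, _, _, (hdec _ _ _).2 ⟨rfl, rfl, rfl⟩, κ.pairs,
          wordSeq_eq_fin_iff.2 ⟨fun h => by simp [h] at hk, rfl⟩,
          ⟨k, hi'⟩, ⟨k + 1, hj'⟩, rfl, _, _, List.getElem?_eq_getElem hk, rfl⟩
      refine ⟨_, zsmul_mem (Submodule.mem_sup_left (Submodule.mem_sup_right hm))
        (((-1) ^ k : ℤˣ) : ℤ), ?_⟩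
      change φ _ = _
      rw [map_zsmul, hφd _ _ _ _ rfl, smul_smul, hsq, one_smul, (hmid k hk).2]
    · obtain ⟨δ, hδ⟩ := Option.ne_none_iff_exists'.1 hj
      rw [height_genWord_right s κ t u hj] at hh
      -- One step below the maximal height, only the first position of the tail is possible.
      obtain rfl : j = 0 := by omega
      have hi' : κ.pairs.length < (κ.word s b d).peaks.card := by omega
      have hm : pathVal ϑ δ.1 • stringGen ϑ (κ.word s b d) ⟨κ.pairs.length, hi'⟩ ∈
          stringLPlus ϑ s (κ.word s b d) := Submodule.subset_span
        ⟨_, _, _, (hdec _ _ _).2 ⟨rfl, rfl, rfl⟩, δ, (hcapD δ).2 hδ, ⟨κ.pairs.length, hi'⟩,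
          by simp [hc], rfl⟩
      refine ⟨_, zsmul_mem (Submodule.mem_sup_right hm) (((-1) ^ κ.pairs.length : ℤˣ) : ℤ), ?_⟩
      change φ _ = _
      rw [map_zsmul, hφs, smul_smul, hsq, one_smul, Nat.cast_zero, add_zero, (hright δ hδ).2]
    · obtain ⟨β, hβ⟩ := Option.ne_none_iff_exists'.1 hj
      rw [height_genWord_left s κ t u hj] at hh
      obtain rfl : j = 0 := by omega
      have hi' : 0 < (κ.word s b d).peaks.card := by omega
      refine ⟨pathVal ϑ β.1 • stringGen ϑ (κ.word s b d) ⟨0, hi'⟩,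
        Submodule.mem_sup_left (Submodule.mem_sup_left (Submodule.subset_span
          ⟨_, _, _, (hdec _ _ _).2 ⟨rfl, rfl, rfl⟩, β, (hcapB β).2 hβ, ⟨0, hi'⟩, rfl, rfl⟩)), ?_⟩
      change φ _ = _
      rw [hφs, Nat.cast_zero, sub_zero, (hleft β hβ).2]
      simp

end Coker

end Core

end ZerothHomology

open Seqn

/-! ### The bijections and the resolution combined -/

section Main

variable {V A : Type*} [Fintype V] {R : Type*} [CommRing R] [IsNoetherianRing R] [IsLocalRing R]
  {Q : BoundQuiver V A} {Λ : Type*} [Ring Λ] [Algebra R Λ] {ϑ : PathAlgebra R Q →ₐ[R] Λ}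

/-- The shifted string complex of the resolution of a string word resolves the string module. -/
lemma Core.isResolutionOf_genWord (hϑ : IsCompleteGentle ϑ) {s : Letter A → ℤˣ}
    (hs : IsSign R Q s) {κ : Core R Q} (hκ : κ.Valid) {b d : Tail A} {t u : Tail (GPath R Q)}
    (hb : WTail R Q s κ.v₀ (-κ.ε₀ s) b) (hd : WTail R Q s κ.v₁ (κ.ε₁ s) d)
    (ht : TailRes s κ.v₀ (-κ.ε₀ s) b t) (hu : TailRes s κ.v₁ (κ.ε₁ s) d u)
    (hC : IsGenWord (κ.genWord s t u)) :
    IsResolutionOf ((shiftFunctor (CochainComplex (ModuleCat Λ) ℤ)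
      (height (κ.genWord s t u) (κ.genOrigin t u))).obj (stringComplex hϑ (κ.genWord s t u) hC))
      (ModuleCat.of Λ (StringModule ϑ s (κ.word s b d))) := by
  obtain ⟨n, hn⟩ : ∃ n, height (κ.genWord s t u) (κ.genOrigin t u) = n + 1 :=
    ⟨_, (sub_add_cancel _ 1).symm⟩
  obtain ⟨φ, hφ⟩ := exists_equiv_map_eq_range (ϑ := ϑ) hϑ hs hκ hb hd ht hu hn
  rw [hn]
  refine isResolutionOf_stringComplex hϑ hC
    -- All positions in a degree below `n + 1` have less than maximal height, so their
    -- neighbourhoods are of the three kinds for which exactness is known.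
    (fun i hi => (height_genWord_le s κ t u hi).trans_eq hn) (fun m hm z hz => ?_)
    (Submodule.Quotient.equiv _ _ φ hφ).symm
  exact mem_range_pDiff hϑ hC (fun i hi h => letters_of_height_lt κ ht.resTail hu.resTail hi
    (by omega)) hz

end Main

theorem corollary5p9 {R : Type*} [CommRing R] [IsNoetherianRing R] [IsLocalRing R]
    [IsAdicComplete (IsLocalRing.maximalIdeal R) R]
    {V A : Type*} [Fintype V] [Finite A] (Q : BoundQuiver V A)
    {Λ : Type*} [Ring Λ] [Algebra R Λ] (ϑ : PathAlgebra R Q →ₐ[R] Λ) (hϑ : IsCompleteGentle ϑ)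
    (s : Letter A → ℤˣ) (hs : IsSign R Q s) :
    -- the words `R_C` and `H(Cres)` are well defined
    (∀ C : Seqn V (Letter A), IsStringWord R Q s C →
      ∃! Cres : Seqn V (Letter (GPath R Q)), IsResolutionWord s C Cres) ∧
    (∀ Cres : Seqn V (Letter (GPath R Q)), IsStringRes s Cres →
      ∃! C : Seqn V (Letter A), IsHomologyWord s Cres C) ∧
    -- mutually inverse bijections
    Set.BijOn (resolutionWord R Q s) {C | IsStringWord R Q s C} {Cres | IsStringRes s Cres} ∧
    Set.BijOn (homologyWord s) {Cres : Seqn V (Letter (GPath R Q)) | IsStringRes s Cres}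
      {C | IsStringWord R Q s C} ∧
    Set.InvOn (homologyWord s) (resolutionWord R Q s) {C | IsStringWord R Q s C}
      {Cres | IsStringRes s Cres} ∧
    -- the string complex of `Cres = R_C`, shifted by `ℋ(ι(±))`, is a resolution of `M(C)`
    ∀ (C : Seqn V (Letter A)) (Cres : Seqn V (Letter (GPath R Q))),
      IsStringWord R Q s C → ∀ hres : IsStringRes s Cres, Cres = resolutionWord R Q s C →
        (∃! ι : ℤ × ℤ, IsInterval s Cres ι.1 ι.2) ∧
        ∀ a b : ℤ, IsInterval s Cres a b → height Cres a = height Cres b ∧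
          IsResolutionOf
            ((shiftFunctor (CochainComplex (ModuleCat Λ) ℤ) (height Cres a)).obj
              (stringComplex hϑ Cres hres.1))
            (ModuleCat.of Λ (StringModule ϑ s C)) := by
  refine ⟨fun C hC => existsUnique_resolutionWord hϑ hs hC,
    fun F hF => existsUnique_homologyWord hϑ hs hF,
    (invOn_homologyWord hϑ hs).symm.symm.bijOn (mapsTo_resolutionWord hϑ hs)
      (mapsTo_homologyWord hϑ hs),
    (invOn_homologyWord hϑ hs).symm.bijOn (mapsTo_homologyWord hϑ hs)
      (mapsTo_resolutionWord hϑ hs),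
    invOn_homologyWord hϑ hs, fun C F hC hF e => ?_⟩
  -- The word and its resolution share one core and have corresponding tails; the interval is the
  -- extent of this core, at whose two ends the heights agree.
  obtain ⟨κ, b, d, t, u, hκ, hb, hd, ht, hu, rfl, rfl⟩ :=
    exists_core_of_isResolutionWord hϑ hs hC ((resolutionWord_eq_iff hϑ hs hC).1 e)
  have hI := Core.isInterval_genWord κ hs hκ ht.resTail hu.resTail
  refine ⟨⟨(_, _), (hI _ _).2 ⟨rfl, rfl⟩, fun ι hι => ?_⟩, fun i j hij => ?_⟩
  · obtain ⟨h1, h2⟩ := (hI _ _).1 hι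
    exact Prod.ext h1 h2
  · obtain ⟨rfl, rfl⟩ := (hI _ _).1 hij
    exact ⟨(Core.height_genWord_even s κ t u le_rfl).symm,
      Core.isResolutionOf_genWord hϑ hs hκ hb hd ht hu hF.1⟩
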